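/- **Algebra.** For a commutative $\mathbb C$-algebra $\mathcal O$ with a derivation $\partial$ (mainly $\mathcal O=\mathcal O_{\mathbb C}$, the holomorphic functions on $\mathbb C$, with $\partial=\partial_z$), let $\mathfrak a_{\mathcal N=6}$ be the super vector space with even part the elements $(V,S,\tilde S,U)$, $V,U\in\mathcal O$, $S,\tilde S\in\mathcal O\otimes\mathfrak{sl}(2)$, and odd part the pairs $(\Gamma,\Sigma)$ of $2\times2$ matrices $\Gamma^{\alpha\dot\alpha},\Sigma_{\alpha\dot\alpha}$ over $\mathcal O$. Write $\Gamma^\vee_{\alpha\dot\alpha}=\epsilon_{\alpha\beta}\epsilon_{\dot\alpha\dot\beta}\Gamma^{\beta\dot\beta}$ and $M_0$ for the traceless part of a matrix. The bracket of even elements is that of $\mathrm{Vect}\ltimes\mathcal O\otimes(\mathfrak{sl}(2)\oplus\mathfrak{sl}(2)\oplus\mathfrak{gl}(1))$ (with $V$ standing for $V\partial_z$), and $$[V,\Gamma]=V\partial\Gamma-\tfrac12(\partial V)\Gamma,\quad [V,\Sigma]=V\partial\Sigma+\tfrac12(\partial V)\Sigma,\quad [S+\tilde S,\Sigma]=-S^T\Sigma-\Sigma\tilde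 S,\quad [U,\Sigma]=0,$$ $$[S,\Gamma]=S\Gamma-\tfrac12(\partial S)^T\Gamma^\vee,\qquad[\tilde S,\Gamma]=\Gamma\tilde S^T+\tfrac12\Gamma^\vee\partial\tilde S,\qquad[U,\Gamma]=-(\partial U)\Gamma^\vee,$$ (where $S\Gamma$ and $\Gamma\tilde S^T$ are of type $\Gamma$, and the terms with derivatives of $S,\tilde S,U$ are of type $\Sigma$); on odd elements $[\Sigma,\Sigma']=0$, $$[\Sigma,\Gamma]=(\Gamma\Sigma^T)_0-(\Gamma^T\Sigma)_0+\tfrac12\mathrm{Tr}(\Sigma\Gamma^T),$$ $$[\Gamma,\Gamma']=\mathrm{Tr}(\Gamma'^T\Gamma^\vee)\,\partial_z+\tfrac12(\Gamma\,\partial\Gamma'^{\vee T}+\Gamma'\,\partial\Gamma^{\vee T})_0+\tfrac12(\Gamma^T\partial\Gamma'^{\vee}+\Gamma'^T\partial\Gamma^{\vee})_0,$$ the terms being of types $S,\tilde S,U$ and $V,S,\tilde S$ respectively. **Theory.** Let $\mathfrak g$ be a finite-dimensional complex Lie algebra with an invariant nondegenerate symmetric bilinear form $\mathrm{Tr}$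 with matrix $K_{ab}$, $k\neq0$ a level, and $R$ a finite-dimensional representation with matrices $(\rho_a)^s{}_t$ that satisfies the anti-Jordan-triple fundamental identity $$K^{ab}\big((\rho_a)^s{}_t(\rho_b)^u{}_v+(\rho_a)^s{}_v(\rho_b)^u{}_t\big)=0 .$$ The holomorphic-topological (HT) twist of the generalized Gaiotto–Witten theory with hypermultiplets and twisted hypermultiplets both in $R\oplus R^*=T^*R$ is the classical BV theory on $\mathbb C_z\times\mathbb R_t$ with superfields (elements of $C^\infty(\mathbb C\times\mathbb R)[dt,d\bar z]$, with auxiliary Grassmann parameters, tensored with powers of $dz$) $\mathbf A$ (odd, in $\mathfrak g$), $\mathbf B$ (even, in $\mathfrak g^*$), $\mathbf X^\alpha$, $\mathbf Y^{\dot\alpha}$ (even, in $R$, $R^*$; $\alpha,\dot\alpha\in\{1,2\}$, with values $1$ and $2$ for hypermultiplets and twisted hypermultiplets), and $\mathbf\Psi_{\mathbf X,\alpha}$, $\mathbf\Psi_{\mathbf Y,\dot\alpha}$ (odd, in $R^*$, $R$). The BV pairing pairs $\mathbf A$ with $\mathbf B$, $\mathbf X$ with $\mathbf\Psi_{\mathbf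 X}$ and $\mathbf Y$ with $\mathbf\Psi_{\mathbf Y}$; with $d'=dt\,\partial_t+d\bar z\,\partial_{\bar z}$, $\partial=dz\,\partial_z$ and $\nu_a^{\alpha\dot\alpha}=\mathbf Y^{\dot\alpha}\rho_a\mathbf X^\alpha$ the action is $$S=\int \mathbf B F'(\mathbf A)+\tfrac{k}{4\pi}\mathrm{Tr}(\mathbf A\partial\mathbf A)+\mathbf\Psi_{\mathbf X}d'_{\mathbf A}\mathbf X+\mathbf\Psi_{\mathbf Y}d'_{\mathbf A}\mathbf Y+\tfrac{2\pi}{k}\mathrm{Tr}(\nu^{11}\nu^{22}),$$ and $Q=\{-,S\}_{BV}$. Put $\partial_{\mathbf B}=\partial-\tfrac{2\pi}k\mathbf B$ and consider, for holomorphic coefficients $V,S,\tilde S,U,\Gamma,\Sigma$, the currents ($\mathbf\Psi\mathbf Z$ denoting the sum over $\mathbf Z=\mathbf X^\alpha,\mathbf Y^{\dot\alpha}$) $$\widehat{\mathbf T}_V=V\big(\tfrac34\mathbf\Psi\partial_{\mathbf B}\mathbf Z-\tfrac14\mathbf Z\partial_{\mathbf B}\mathbf\Psi\big),\quad \mathbf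 J_S=S^\alpha{}_\beta\mathbf\Psi_{\mathbf X,\alpha}\mathbf X^\beta,\quad \tilde{\mathbf J}_{\tilde S}=\tilde S^{\dot\alpha}{}_{\dot\beta}\mathbf\Psi_{\mathbf Y,\dot\alpha}\mathbf Y^{\dot\beta},\quad \mathbf L_U=U(\mathbf\Psi_{\mathbf X,\alpha}\mathbf X^\alpha-\mathbf\Psi_{\mathbf Y,\dot\alpha}\mathbf Y^{\dot\alpha}),$$ $$\mathbf\Theta_\Gamma=\Gamma^{\alpha\dot\alpha}\mathbf\Psi_{\mathbf X,\alpha}\mathbf\Psi_{\mathbf Y,\dot\alpha}-\tfrac12\Gamma^\vee_{\alpha\dot\alpha}(\mathbf X^\alpha\partial_{\mathbf B}\mathbf Y^{\dot\alpha}-\mathbf Y^{\dot\alpha}\partial_{\mathbf B}\mathbf X^\alpha),\qquad \mathbf\Xi_\Sigma=\Sigma_{\alpha\dot\alpha}\mathbf Y^{\dot\alpha}\mathbf X^\alpha .$$ **Proposition.** 1. $\mathfrak a_{\mathcal N=6}$ (over $\mathcal O_{\mathbb C}$) is a Lie superalgebra. Its even part is $\mathrm{Vect}(\mathbb C)\ltimes\mathcal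 O_{\mathbb C}\otimes(\mathfrak{so}(4)\oplus\mathfrak{gl}(1))$, and its odd part is, as a module over the even part, an extension $$0\to K_{\mathbb C}^{1/2}\otimes(\mathbb C^2_+\otimes\mathbb C^2_-)^*_0\to(\mathfrak a_{\mathcal N=6})^-\to K_{\mathbb C}^{-1/2}\otimes(\mathbb C^2_+\otimes\mathbb C^2_-)_0\to0$$ (subscript: $\mathfrak{gl}(1)$-weight) in which the subspace $K_{\mathbb C}^{1/2}\otimes(\cdots)^*$ brackets trivially with itself. 2. $Q$ squares to zero, is the Hamiltonian vector field of $S$, and the HT twist admits an action of $\mathfrak a_{\mathcal N=6}$: each of the currents $\mathbf J$ above is conserved, $Q\mathbf J=d'\mathbf J$, its Hamiltonian vector field commutes with $Q$, and the Hamiltonian vector fields of $\widehat{\mathbf T}_V$, $\mathbf J_S$, $\tilde{\mathbf J}_{\tilde S}$, $\mathbf L_U$, $\mathbf\Theta_{i\Gamma}$, $\mathbf\Xi_{i\Sigma}$ satisfy exactly the bracket relations of $\mathfrak a_{\mathcal N=6}$. The action of $V\in\mathrm{Vect}(\mathbb C)$ differs by a $Q$-exact term (the commutator of $Q$ with the transformation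 $\mathbf A\mapsto\tfrac{2\pi}kV\mathbf B$) from the Lie derivative along $V\partial_z$, where $\mathbf A$, $\mathbf B$, $\mathbf X$ and $\mathbf Y$, $\mathbf\Psi$ are sections of $K^0$, $K^1$, $K^{1/4}$, $K^{3/4}$. 3. $\mathfrak a_{\mathcal N=6}$ is the positive part of the (big) $\mathcal N=4$ superconformal algebra $K_4'$. Here $K_4'$ is the derived algebra of the Lie conformal superalgebra $K_4=\mathbb C[\partial]\otimes\Lambda(\xi_1,\dots,\xi_4)$ with $$[f_\lambda g]=(\tfrac{|f|}2-1)\partial(fg)+\tfrac12(-1)^{|f|}\sum_i(\partial_if)(\partial_ig)+\lambda(\tfrac{|f|+|g|}2-2)fg,$$ and its positive part is $K_4'\otimes\mathcal O/(\partial a\otimes f+a\otimes\partial f)$ with bracket $[a_f,b_g]=\sum_j\big(a_{(j)}b\big)_{(\partial^jf/j!)\,g}$; this holds both for $\mathcal O=\mathbb C[z]$ (the Fourier modes $a_{z^n}$, $n\ge0$) and, in the analytic version, for $\mathcal O=\mathcal O_{\mathbb C}$. -/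

import Mathlib

open scoped TensorProduct ContDiff
open Polynomial (X C)

noncomputable section

namespace HTTwist

/-! ## Lie superalgebras, given by their even and odd parts -/

/-- The three components of a super bracket on `L₀ ⊕ ΠL₁`
(`[odd, even]` is minus `[even, odd]`). -/
structure SuperBracket (L₀ L₁ : Type*) where
  /-- even-even -/
  ee : L₀ → L₀ → L₀
  /-- even-odd -/
  eo : L₀ → L₁ → L₁
  /-- odd-odd -/
  oo : L₁ → L₁ → L₀

/-- The bracket of arbitrary elements. -/
def SuperBracket.br {L₀ L₁ : Type*} [AddCommGroup L₀] [AddCommGroup L₁]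
    (β : SuperBracket L₀ L₁) (x y : L₀ × L₁) : L₀ × L₁ :=
  (β.ee x.1 y.1 + β.oo x.2 y.2, β.eo x.1 y.2 - β.eo y.1 x.2)

/-- The axioms of a complex Lie superalgebra: bilinearity, super skew-symmetry and the four
parity components of the super Jacobi identity. -/
structure IsLieSuperalgebra {L₀ L₁ : Type*} [AddCommGroup L₀] [AddCommGroup L₁]
    [Module ℂ L₀] [Module ℂ L₁] (β : SuperBracket L₀ L₁) : Prop where
  ee_linear : ∀ x, IsLinearMap ℂ (β.ee x)
  eo_linear_right : ∀ x, IsLinearMap ℂ (β.eo x)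
  eo_linear_left : ∀ u, IsLinearMap ℂ (fun x => β.eo x u)
  oo_linear : ∀ u, IsLinearMap ℂ (β.oo u)
  ee_skew : ∀ x y, β.ee x y = -β.ee y x
  oo_symm : ∀ u v, β.oo u v = β.oo v u
  jacobi_eee : ∀ x y z, β.ee x (β.ee y z) = β.ee (β.ee x y) z + β.ee y (β.ee x z)
  jacobi_eeo : ∀ x y u, β.eo x (β.eo y u) = β.eo (β.ee x y) u + β.eo y (β.eo x u)
  jacobi_eoo : ∀ x u v, β.ee x (β.oo u v) = β.oo (β.eo x u) v + β.oo u (β.eo x v)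
  jacobi_ooo : ∀ u v w, β.eo (β.oo u v) w + β.eo (β.oo v w) u + β.eo (β.oo w u) v = 0

/-! ## The Lie superalgebra `𝔞_{𝒩=6}` over a commutative differential algebra of functions -/

/-- Two by two matrices. -/
abbrev M2 (O : Type*) := Matrix (Fin 2) (Fin 2) O

/-- `Γ^∨_{αβ} = ε_{αγ} ε_{βδ} Γ^{γδ}`. -/
def vee {O : Type*} [Ring O] (G : M2 O) : M2 O :=
  !![G 1 1, -G 1 0; -G 0 1, G 0 0]

section Algebra

variable {O : Type*} [CommRing O] [Algebra ℂ O]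

/-- `O ⊗ 𝔰𝔩(2)`: traceless matrices of functions. -/
abbrev SL2 (O : Type*) [CommRing O] [Algebra ℂ O] : Submodule ℂ (M2 O) :=
  LinearMap.ker (Matrix.traceLinearMap (Fin 2) ℂ O)

/-- The traceless part `M₀ = M - ½ tr(M)` of a matrix. -/
def traceless (M : M2 O) : SL2 O :=
  ⟨M - (2⁻¹ : ℂ) • (M.trace • (1 : M2 O)), by
    rw [LinearMap.mem_ker, Matrix.traceLinearMap_apply, Matrix.trace_sub, Matrix.trace_smul,
      Matrix.trace_smul, Matrix.trace_one, Fintype.card_fin, smul_eq_mul]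
    have h : (2⁻¹ : ℂ) • (M.trace * ((2 : ℕ) : O)) = M.trace := by
      have : M.trace * ((2 : ℕ) : O) = (2 : ℂ) • M.trace := by
        rw [Nat.cast_ofNat, mul_comm, two_mul, two_smul]
      rw [this, smul_smul, inv_mul_cancel₀ two_ne_zero, one_smul]
    rw [h, sub_self]⟩

/-- The even part `Vect ⊕ O ⊗ (𝔰𝔩(2)₊ ⊕ 𝔰𝔩(2)₋ ⊕ 𝔤𝔩(1))`; an element is written `(V, S, S̃, U)`,
with `V` standing for the vector field `V ∂_z`. -/
abbrev AEven (O : Type*) [CommRing O] [Algebra ℂ O] := O × SL2 O × SL2 O × O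

/-- The odd part; an element is a pair `(Γ, Σ)` of a `K^{-1/2}`-valued matrix `Γ^{αα̇}` and a
`K^{1/2}`-valued matrix `Σ_{αα̇}` (`K` is trivialised by `dz`). -/
abbrev AOdd (O : Type*) := M2 O × M2 O

/-- Sections of `K^w` with values in a tensor product of representations: the Lie derivative
along `V ∂_z`. -/
def lieDer (D : Derivation ℂ O O) (w : ℂ) (V : O) (M : M2 O) : M2 O :=
  V • M.map D + w • (D V • M)

/-- The natural action of the even part on `K^{-1/2} ⊗ (ℂ²₊ ⊗ ℂ²₋)₀`. -/
def actVec (D : Derivation ℂ O O) (x : AEven O) (G : M2 O) : M2 O :=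
  lieDer D (-2⁻¹) x.1 G + (x.2.1 : M2 O) * G + G * (x.2.2.1 : M2 O).transpose

/-- The natural action of the even part on `K^{1/2} ⊗ (ℂ²₊ ⊗ ℂ²₋)^*₀`. -/
def actCovec (D : Derivation ℂ O O) (x : AEven O) (Sg : M2 O) : M2 O :=
  lieDer D 2⁻¹ x.1 Sg - (x.2.1 : M2 O).transpose * Sg - Sg * (x.2.2.1 : M2 O)

/-- The super bracket of `𝔞_{𝒩=6}`. -/
def aN6 (D : Derivation ℂ O O) : SuperBracket (AEven O) (AOdd O) where
  ee x y :=
    (x.1 * D y.1 - y.1 * D x.1,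
      traceless (x.1 • (y.2.1 : M2 O).map D - y.1 • (x.2.1 : M2 O).map D
        + ((x.2.1 : M2 O) * y.2.1 - (y.2.1 : M2 O) * x.2.1)),
      traceless (x.1 • (y.2.2.1 : M2 O).map D - y.1 • (x.2.2.1 : M2 O).map D
        + ((x.2.2.1 : M2 O) * y.2.2.1 - (y.2.2.1 : M2 O) * x.2.2.1)),
      x.1 * D y.2.2.2 - y.1 * D x.2.2.2)
  eo x u :=
    (actVec D x u.1,
      actCovec D x u.2
        - (2⁻¹ : ℂ) • (((x.2.1 : M2 O).map D).transpose * vee u.1)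
        + (2⁻¹ : ℂ) • (vee u.1 * (x.2.2.1 : M2 O).map D)
        - D x.2.2.2 • vee u.1)
  oo u v :=
    ((v.1.transpose * vee u.1).trace,
      traceless ((2⁻¹ : ℂ) • (u.1 * ((vee v.1).map D).transpose
          + v.1 * ((vee u.1).map D).transpose)
        + (u.1 * v.2.transpose + v.1 * u.2.transpose)),
      traceless ((2⁻¹ : ℂ) • (u.1.transpose * (vee v.1).map D
          + v.1.transpose * (vee u.1).map D)
        - (u.1.transpose * v.2 + v.1.transpose * u.2)),
      (2⁻¹ : ℂ) • ((u.1 * v.2.transpose).trace + (v.1 * u.2.transpose).trace))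

/-- The even part is the semidirect sum of `Vect` and `O ⊗ (𝔰𝔬(4) ⊕ 𝔤𝔩(1))`, on which `Vect` acts
by differentiating coefficients. -/
def EvenPartIsVectSO4GL1 (D : Derivation ℂ O O) : Prop :=
  ∃ e : AEven O ≃ₗ[ℂ] O × LieAlgebra.Orthogonal.so (Fin 4) O × O,
    (∀ x, (e x).1 = x.1 ∧ (e x).2.2 = x.2.2.2) ∧
    ∀ x y, (e ((aN6 D).ee x y)).1 = (e x).1 * D (e y).1 - (e y).1 * D (e x).1 ∧
      ((e ((aN6 D).ee x y)).2.1 : Matrix (Fin 4) (Fin 4) O)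
        = (e x).1 • ((e y).2.1 : Matrix (Fin 4) (Fin 4) O).map D
          - (e y).1 • ((e x).2.1 : Matrix (Fin 4) (Fin 4) O).map D
          + ⁅((e x).2.1 : Matrix (Fin 4) (Fin 4) O), ((e y).2.1 : Matrix (Fin 4) (Fin 4) O)⁆ ∧
      (e ((aN6 D).ee x y)).2.2 = (e x).1 * D (e y).2.2 - (e y).1 * D (e x).2.2

/-- The odd part is, as a module over the even part, an extension
`0 → K^{1/2} ⊗ (ℂ²₊ ⊗ ℂ²₋)^*₀ → 𝔞⁻ → K^{-1/2} ⊗ (ℂ²₊ ⊗ ℂ²₋)₀ → 0`. -/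
def OddPartIsExtension (D : Derivation ℂ O O) : Prop :=
  ∃ (i : M2 O →ₗ[ℂ] AOdd O) (p : AOdd O →ₗ[ℂ] M2 O),
    Function.Injective i ∧ Function.Surjective p ∧ LinearMap.range i = LinearMap.ker p ∧
    (∀ x Sg, (aN6 D).eo x (i Sg) = i (actCovec D x Sg)) ∧
    (∀ x u, p ((aN6 D).eo x u) = actVec D x (p u)) ∧
    ∀ Sg Sg', (aN6 D).oo (i Sg) (i Sg') = 0

end Algebra

/-! ## The Lie conformal superalgebra `K'₄` and its annihilation algebra -/

/-- `K₄ = ℂ[∂] ⊗ Λ(4)`, in the basis `ξ_I` of the Grassmann algebra `Λ(4)`. -/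
abbrev K4 := Finset (Fin 4) → Polynomial ℂ

/-- The sign in `ξ_I ξ_J = ± ξ_{I ∪ J}` for disjoint `I`, `J`. -/
def grSign (I J : Finset (Fin 4)) : ℂ :=
  (-1) ^ ((I ×ˢ J).filter fun p => p.2 < p.1).card

/-- The sign in `∂ξ_I / ∂ξ_i = ± ξ_{I ∖ i}` (left derivative) for `i ∈ I`. -/
def derSign (i : Fin 4) (I : Finset (Fin 4)) : ℂ :=
  (-1) ^ (I.filter fun j => j < i).card

/-- The `ξ_K`-coefficient of
`[ξ_I λ ξ_J] = (|I|/2 - 1) ∂(ξ_I ξ_J) + ½ (-1)^{|I|} ∑ᵢ (∂ᵢξ_I)(∂ᵢξ_J) + λ ((|I|+|J|)/2 - 2) ξ_I ξ_J`,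
a polynomial in `λ` (outer variable) with coefficients polynomials in `∂` (inner variable). -/
def lamStruct (I J K : Finset (Fin 4)) : Polynomial (Polynomial ℂ) :=
  (if Disjoint I J ∧ K = I ∪ J then
    C (C (grSign I J)) * (C (C ((I.card : ℂ) / 2 - 1) * X)
      + C (C (((I.card : ℂ) + (J.card : ℂ)) / 2 - 2)) * X)
  else 0)
  + ∑ i : Fin 4, (if i ∈ I ∧ i ∈ J ∧ Disjoint (I.erase i) (J.erase i) ∧
        K = I.erase i ∪ J.erase i then
      C (C ((-1) ^ I.card / 2 * (derSign i I * derSign i J * grSign (I.erase i) (J.erase i))))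
    else 0)

/-- The `λ`-bracket of `K₄`, extended by sesquilinearity
`[p(∂)a λ q(∂)b] = p(-λ) q(∂+λ) [a λ b]`. -/
def lamBr (a b : K4) : Finset (Fin 4) → Polynomial (Polynomial ℂ) := fun K =>
  ∑ I, ∑ J, Polynomial.aeval (-X : Polynomial (Polynomial ℂ)) (a I)
    * Polynomial.aeval (C X + X : Polynomial (Polynomial ℂ)) (b J) * lamStruct I J K

/-- The coefficient of `λ^j` in `[a λ b]`, i.e. the `j`-th product `a_(j) b` divided by `j!`. -/
def lamCoeff (j : ℕ) (a b : K4) : K4 := fun K => (lamBr a b K).coeff j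

/-- `K'₄`, the derived algebra of `K₄`. -/
def K4' : Submodule ℂ K4 := Submodule.span ℂ {x | ∃ j a b, x = lamCoeff j a b}

/-- The products of `K'₄`. -/
def lamCoeff' (j : ℕ) (a b : K4') : K4' :=
  ⟨lamCoeff j a b, Submodule.subset_span ⟨j, a, b, rfl⟩⟩

/-- `β` is the Lie superalgebra of modes of `K'₄` with coefficients in the differential algebra
`(O, D)`: the quotient of `K'₄ ⊗ O` by `∂a ⊗ f + a ⊗ Df`, with bracket
`[a_f, b_g] = ∑ⱼ (a_(j) b)_{(Dʲf / j!) g}`, where `a_f` is the class of `a ⊗ f`.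
For `O = ℂ[z]` it is spanned by the Fourier modes `a_{z^n}`, `n ≥ 0`, of `K'₄`
(the annihilation algebra). -/
def IsModeAlgebraK4' {O L₀ L₁ : Type*} [CommRing O] [Algebra ℂ O] (D : Derivation ℂ O O)
    [AddCommGroup L₀] [AddCommGroup L₁] [Module ℂ L₀] [Module ℂ L₁]
    (β : SuperBracket L₀ L₁) : Prop :=
  ∃ mode : K4' ⊗[ℂ] O →ₗ[ℂ] L₀ × L₁,
    Function.Surjective mode ∧
    LinearMap.ker mode = Submodule.span ℂ
      {t | ∃ (a a' : K4') (f : O), (a' : K4) = (X : Polynomial ℂ) • (a : K4) ∧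
        t = a' ⊗ₜ[ℂ] f + a ⊗ₜ[ℂ] D f} ∧
    (∀ (a : K4') (f : O), (∀ I, Odd I.card → (a : K4) I = 0) → (mode (a ⊗ₜ f)).2 = 0) ∧
    (∀ (a : K4') (f : O), (∀ I, Even I.card → (a : K4) I = 0) → (mode (a ⊗ₜ f)).1 = 0) ∧
    ∀ (a b : K4') (f g : O),
      β.br (mode (a ⊗ₜ f)) (mode (b ⊗ₜ g)) =
        ∑ᶠ j : ℕ, mode (lamCoeff' j a b ⊗ₜ ((fun h => D h)^[j] f * g))

/-! ## Functions and forms on `ℂ × ℝ` -/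

/-- Holomorphic functions on `ℂ`. -/
def Hol : Subalgebra ℂ (ℂ → ℂ) where
  carrier := {f | Differentiable ℂ f}
  mul_mem' hf hg := Differentiable.mul hf hg
  add_mem' hf hg := Differentiable.add hf hg
  algebraMap_mem' c := differentiable_const c

/-- The derivation `∂_z` of holomorphic functions. -/
def holDer : Derivation ℂ Hol Hol :=
  Derivation.mk'
    { toFun := fun f => ⟨deriv (f : ℂ → ℂ), f.2.deriv⟩
      map_add' := fun f g => Subtype.ext (funext fun z =>
        deriv_add (f.2 z) (g.2 z))
      map_smul' := fun c f => Subtype.ext (funext fun z =>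
        deriv_const_smul c (f.2 z)) }
    (fun f g => Subtype.ext (funext fun z => by
      have h := deriv_mul (f.2 z) (g.2 z)
      change deriv ((f : ℂ → ℂ) * (g : ℂ → ℂ)) z
        = (f : ℂ → ℂ) z * deriv (g : ℂ → ℂ) z + (g : ℂ → ℂ) z * deriv (f : ℂ → ℂ) z
      rw [h]; ring))

/-- Smooth complex functions on `ℂ × ℝ`. -/
def SmoothFun : Subalgebra ℂ (ℂ × ℝ → ℂ) where
  carrier := {f | ContDiff ℝ ∞ f}
  mul_mem' {f g} hf hg := ContDiff.mul (show ContDiff ℝ ∞ f from hf) (show ContDiff ℝ ∞ g from hg)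
  add_mem' {f g} hf hg := ContDiff.add (show ContDiff ℝ ∞ f from hf) (show ContDiff ℝ ∞ g from hg)
  algebraMap_mem' c := show ContDiff ℝ ∞ (fun _ : ℂ × ℝ => c) from contDiff_const

theorem smoothFun_contDiff (f : SmoothFun) : ContDiff ℝ ∞ (f : ℂ × ℝ → ℂ) := f.2

theorem smoothFun_differentiableAt (f : SmoothFun) (p : ℂ × ℝ) :
    DifferentiableAt ℝ (f : ℂ × ℝ → ℂ) p :=
  ((smoothFun_contDiff f).differentiable (by simp)) p

/-- The derivative along a constant vector field. -/
def dirD (v : ℂ × ℝ) : SmoothFun →ₗ[ℂ] SmoothFun where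
  toFun f := ⟨fun p => fderiv ℝ (f : ℂ × ℝ → ℂ) p v,
    show ContDiff ℝ ∞ (fun p => fderiv ℝ (f : ℂ × ℝ → ℂ) p v) from
    (ContDiff.fderiv_right (m := ∞) (smoothFun_contDiff f) (by simp)).clm_apply contDiff_const⟩
  map_add' f g := Subtype.ext (funext fun p => by
    change fderiv ℝ ((f : ℂ × ℝ → ℂ) + (g : ℂ × ℝ → ℂ)) p v
      = fderiv ℝ (f : ℂ × ℝ → ℂ) p v + fderiv ℝ (g : ℂ × ℝ → ℂ) p v
    rw [fderiv_add (smoothFun_differentiableAt f p) (smoothFun_differentiableAt g p)]; rfl)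
  map_smul' c f := Subtype.ext (funext fun p => by
    change fderiv ℝ (c • (f : ℂ × ℝ → ℂ)) p v = c • fderiv ℝ (f : ℂ × ℝ → ℂ) p v
    rw [fderiv_const_smul (smoothFun_differentiableAt f p)]; rfl)

/-- `∂_z = ½ (∂_x - i ∂_y)`. -/
def derZ : SmoothFun →ₗ[ℂ] SmoothFun :=
  (2⁻¹ : ℂ) • (dirD (1, 0) - Complex.I • dirD (Complex.I, 0))

/-- `∂_{z̄} = ½ (∂_x + i ∂_y)`. -/
def derZbar : SmoothFun →ₗ[ℂ] SmoothFun :=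
  (2⁻¹ : ℂ) • (dirD (1, 0) + Complex.I • dirD (Complex.I, 0))

/-- `∂_t`. -/
def derT : SmoothFun →ₗ[ℂ] SmoothFun := dirD (0, 1)

/-- A holomorphic function of `z`, pulled back to `ℂ × ℝ`. -/
def pull (f : Hol) : SmoothFun :=
  ⟨fun p => (f : ℂ → ℂ) p.1,
    ((Differentiable.contDiff (n := ∞) f.2).restrict_scalars ℝ).comp contDiff_fst⟩

/-- The complex Grassmann algebra on `dt`, `dz̄` and `N` auxiliary odd parameters. -/
abbrev Grass (N : ℕ) := ExteriorAlgebra ℂ (Fin 2 ⊕ Fin N → ℂ)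

/-- Superfields on `ℂ × ℝ`: elements of `C^∞(ℂ × ℝ)[dt, dz̄]` with coefficients in the Grassmann
algebra of auxiliary odd parameters. The factor `dz^j` of a form in `Ω^{(j),•}` is not displayed. -/
abbrev Sup (N : ℕ) := SmoothFun ⊗[ℂ] Grass N

section Superfields

variable (N : ℕ)

/-- `dt`. -/
def dt : Grass N := ExteriorAlgebra.ι ℂ (Pi.single (Sum.inl 0) 1)

/-- `dz̄`. -/
def dzbar : Grass N := ExteriorAlgebra.ι ℂ (Pi.single (Sum.inl 1) 1)

/-- `∂ = dz ∂_z`. -/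
def del : Sup N →ₗ[ℂ] Sup N := TensorProduct.map derZ LinearMap.id

/-- `d' = dt ∂_t + dz̄ ∂_{z̄}`. -/
def dprime : Sup N →ₗ[ℂ] Sup N :=
  TensorProduct.map derT (LinearMap.mulLeft ℂ (dt N))
    + TensorProduct.map derZbar (LinearMap.mulLeft ℂ (dzbar N))

variable {N}

/-- Even elements of the Grassmann algebra. -/
def GEven (η : Grass N) : Prop := CliffordAlgebra.involute η = η

/-- Odd elements of the Grassmann algebra. -/
def GOdd (η : Grass N) : Prop := CliffordAlgebra.involute η = -η

/-- The parity involution on superfields. -/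
def parityInv : Sup N →ₗ[ℂ] Sup N :=
  TensorProduct.map LinearMap.id
    (CliffordAlgebra.involute (Q := (0 : QuadraticForm ℂ (Fin 2 ⊕ Fin N → ℂ)))).toLinearMap

/-- Superfields of even total parity. -/
def SEven (a : Sup N) : Prop := parityInv a = a

/-- Superfields of odd total parity. -/
def SOdd (a : Sup N) : Prop := parityInv a = -a

/-- A constant, as a superfield. -/
def const (η : Grass N) : Sup N := 1 ⊗ₜ η

variable (N) in
/-- Superfields of compact support. -/
def compactSup : Submodule ℂ (Sup N) :=
  Submodule.span ℂ {a | ∃ (f : SmoothFun) (η : Grass N),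
    HasCompactSupport (f : ℂ × ℝ → ℂ) ∧ a = f ⊗ₜ η}

variable (N) in
/-- Total derivatives `d'α + ∂β` with `α`, `β` of compact support. Two densities that differ by
such an element have the same integral. -/
def totalDer : Submodule ℂ (Sup N) :=
  (compactSup N).map (dprime N) ⊔ (compactSup N).map (del N)

end Superfields

/-! ## The theory -/

/-- Coordinates of a metric Lie algebra with a representation and a level: structure constants
`[e_b, e_c] = ∑ₐ f b c a eₐ`, metric `K_{ab}`, matrices `(ρ_a)^s_t` and level `k`. -/
structure GaugeData (ι m : Type*) where
  /-- structure constants -/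
  f : ι → ι → ι → ℂ
  /-- metric -/
  K : Matrix ι ι ℂ
  /-- representation matrices -/
  ρ : ι → Matrix m m ℂ
  /-- level -/
  k : ℂ

/-- The coordinates of a Lie algebra `𝔤` with bilinear form `Tr`, of a representation `R`
and of a level `k`, in bases of `𝔤` and `R`. -/
def gaugeData {𝔤 R ι m : Type*} [LieRing 𝔤] [LieAlgebra ℂ 𝔤] [AddCommGroup R] [Module ℂ R]
    [LieRingModule 𝔤 R] [LieModule ℂ 𝔤 R] [Fintype m] [DecidableEq m]
    (e : Module.Basis ι ℂ 𝔤) (r : Module.Basis m ℂ R) (Tr : LinearMap.BilinForm ℂ 𝔤) (k : ℂ) :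
    GaugeData ι m where
  f b c a := e.repr ⁅e b, e c⁆ a
  K := Matrix.of fun a b => Tr (e a) (e b)
  ρ a := LinearMap.toMatrix r r (LieModule.toEnd ℂ 𝔤 R (e a))
  k := k

/-- The components of the fields: `𝐀^a`, `𝐁_a`, `𝐗^{α s}`, `𝐘^{α̇}_s`, `𝚿_{𝐗,α,s}`, `𝚿_{𝐘,α̇}^s`.
The doublets are `𝐗^α = (𝐗, 𝐗̃)` and `𝐘^{α̇} = (𝐘, 𝐘̃)`, with `(𝐗, 𝐘)` the hypermultiplets in
`R ⊕ R^*` and `(𝐗̃, 𝐘̃)` the twisted hypermultiplets in the same representation. -/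
inductive FieldIdx (ι m : Type*)
  | A (a : ι)
  | B (a : ι)
  | X (α : Fin 2) (s : m)
  | Y (α : Fin 2) (s : m)
  | PX (α : Fin 2) (s : m)
  | PY (α : Fin 2) (s : m)

/-- Field configurations. -/
abbrev Fields (ι m : Type*) (N : ℕ) := FieldIdx ι m → Sup N

/-- The field configurations of the correct parity: `𝐀`, `𝚿` are odd and `𝐁`, `𝐗`, `𝐘` are even. -/
def IsField {ι m : Type*} {N : ℕ} (φ : Fields ι m N) : Prop :=
  (∀ a, SOdd (φ (.A a))) ∧ (∀ a, SEven (φ (.B a))) ∧ (∀ α s, SEven (φ (.X α s))) ∧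
  (∀ α s, SEven (φ (.Y α s))) ∧ (∀ α s, SOdd (φ (.PX α s))) ∧ (∀ α s, SOdd (φ (.PY α s)))

/-- `d` is the derivative at `φ` in the direction `ψ` of a map `F` polynomial along the line
`φ + sψ`: the coefficient of `s` in `F (φ + sψ)`. -/
def HasDirDeriv {E E' : Type*} [AddCommGroup E] [Module ℂ E] [AddCommGroup E'] [Module ℂ E']
    (F : E → E') (φ ψ : E) (d : E') : Prop :=
  ∃ c : ℕ →₀ E', (∀ s : ℂ, F (φ + s • ψ) = c.sum fun n v => s ^ n • v) ∧ c 1 = d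

/-- `ξ` is the value at `φ` of the commutator of the infinitesimal transformations `F` and `G`,
`DF(φ)[G φ] - DG(φ)[F φ]`; for linear transformations this is `F ∘ G - G ∘ F`. -/
def IsComm {E : Type*} [AddCommGroup E] [Module ℂ E] (F G : E → E) (φ ξ : E) : Prop :=
  ∃ a b, HasDirDeriv F φ (G φ) a ∧ HasDirDeriv G φ (F φ) b ∧ ξ = a - b

/-- Parameters `(V, S, S̃, U, Γ, Σ)` of an infinitesimal symmetry. -/
structure Params (N : ℕ) where
  /-- vector field -/
  V : Sup N
  /-- `𝔰𝔩(2)₊` -/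
  S : M2 (Sup N)
  /-- `𝔰𝔩(2)₋` -/
  St : M2 (Sup N)
  /-- `𝔤𝔩(1)` -/
  U : Sup N
  /-- `K^{-1/2}` -/
  G : M2 (Sup N)
  /-- `K^{1/2}` -/
  Sg : M2 (Sup N)

/-- The parameters `η ⊗ x` for an even element `x`. -/
def evenParams {N : ℕ} (η : Grass N) (x : AEven Hol) : Params N where
  V := pull x.1 ⊗ₜ η
  S := (x.2.1 : M2 Hol).map fun f => pull f ⊗ₜ η
  St := (x.2.2.1 : M2 Hol).map fun f => pull f ⊗ₜ η
  U := pull x.2.2.2 ⊗ₜ η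
  G := 0
  Sg := 0

/-- The parameters for `θ ⊗ u`, `u` an odd element: the odd generators of `𝔞_{𝒩=6}` are
represented by the currents `𝚯` and `𝚵` with coefficients rescaled by `i`. -/
def oddParams {N : ℕ} (θ : Grass N) (u : AOdd Hol) : Params N where
  V := 0
  S := 0
  St := 0
  U := 0
  G := u.1.map fun f => pull f ⊗ₜ (Complex.I • θ)
  Sg := u.2.map fun f => pull f ⊗ₜ (Complex.I • θ)

section Theory

variable {ι m : Type*} [Fintype ι] [DecidableEq ι] [Fintype m] {N : ℕ} (T : GaugeData ι m)

/-- The split form of the fundamental identity (anti-Jordan triple system):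
`K^{ab} ((ρ_a)^s_t (ρ_b)^u_v + (ρ_a)^s_v (ρ_b)^u_t) = 0`. -/
def FundamentalIdentity : Prop :=
  ∀ s t u v, ∑ a, ∑ b, T.K⁻¹ a b * (T.ρ a s t * T.ρ b u v + T.ρ a s v * T.ρ b u t) = 0

/-- `κ = 2π / k`. -/
def kappa : ℂ := 2 * (Real.pi : ℂ) / T.k

/-- Raising a coadjoint index with the inverse metric. -/
def raise (w : ι → Sup N) : ι → Sup N := fun a => ∑ b, T.K⁻¹ a b • w b

/-- Action of `c ∈ 𝔤` on `v ∈ R`: `c^a (ρ_a)^s_t v^t`. -/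
def act (c : ι → Sup N) (v : m → Sup N) : m → Sup N :=
  fun s => ∑ a, ∑ t, T.ρ a s t • (c a * v t)

/-- Action of `c ∈ 𝔤` on `w ∈ R^*`: `- c^a (ρ_a)^t_s w_t`. -/
def dact (c : ι → Sup N) (w : m → Sup N) : m → Sup N :=
  fun s => -∑ a, ∑ t, T.ρ a t s • (c a * w t)

/-- The components `ν_a^{αα̇} = 𝐘^{α̇} ρ_a 𝐗^α` of the moment maps. -/
def nu (φ : Fields ι m N) (α β : Fin 2) : ι → Sup N :=
  fun a => ∑ s, ∑ t, T.ρ a s t • (φ (.Y β s) * φ (.X α t))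

/-- The moment map `μ_a = 𝚿_𝐗 ρ_a 𝐗 - 𝐘 ρ_a 𝚿_𝐘` (summed over the doublets). -/
def mu (φ : Fields ι m N) : ι → Sup N :=
  fun a => ∑ α, ∑ s, ∑ t, T.ρ a s t •
    (φ (.PX α s) * φ (.X α t) - φ (.Y α s) * φ (.PY α t))

/-- The doublet partner: hypermultiplets `0`, twisted hypermultiplets `1`. -/
def partner (α : Fin 2) : Fin 2 := 1 - α

/-- The curvature `F'(𝐀) = d'𝐀 + ½[𝐀, 𝐀]`. -/
def curv (φ : Fields ι m N) (a : ι) : Sup N :=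
  dprime N (φ (.A a)) + (2⁻¹ : ℂ) • ∑ b, ∑ c, T.f b c a • (φ (.A b) * φ (.A c))

/-- `d'_𝐀` on `R`-valued superfields. -/
def dA (φ : Fields ι m N) (v : m → Sup N) (s : m) : Sup N :=
  dprime N (v s) + act T (fun a => φ (.A a)) v s

/-- `d'_𝐀` on `R^*`-valued superfields. -/
def dAdual (φ : Fields ι m N) (w : m → Sup N) (s : m) : Sup N :=
  dprime N (w s) + dact T (fun a => φ (.A a)) w s

/-- The action of the `HT` supercharge. The superpotential is that of the generalized
Gaiotto–Witten theory, `W = (2π/k) Tr(ν ν̃)`, with `ν = ν^{11}` and `ν̃ = ν^{22}` the moment maps of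
the hypermultiplets and of the twisted hypermultiplets. -/
def Q (φ : Fields ι m N) : Fields ι m N
  | .A a => curv T φ a
  | .B a => dprime N (φ (.B a)) - ∑ b, ∑ c, T.f b a c • (φ (.A b) * φ (.B c))
      - mu T φ a + (T.k / (2 * (Real.pi : ℂ))) • ∑ b, T.K a b • del N (φ (.A b))
  | .X α s => dA T φ (fun t => φ (.X α t)) s
  | .Y α s => dAdual T φ (fun t => φ (.Y α t)) s
  | .PX α s => dAdual T φ (fun t => φ (.PX α t)) s
      - kappa T • dact T (raise T (nu T φ (partner α) (partner α))) (fun t => φ (.Y α t)) s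
  | .PY α s => dA T φ (fun t => φ (.PY α t)) s
      + kappa T • act T (raise T (nu T φ (partner α) (partner α))) (fun t => φ (.X α t)) s

/-- The Lagrangian density
`𝐁 F'(𝐀) + (k/4π) Tr(𝐀 ∂𝐀) + 𝚿_𝐗 d'_𝐀 𝐗 + 𝚿_𝐘 d'_𝐀 𝐘 + (2π/k) Tr(ν ν̃)` of the action `S`. -/
def lagrangian (φ : Fields ι m N) : Sup N :=
  ∑ a, φ (.B a) * curv T φ a
  + (T.k / (4 * (Real.pi : ℂ))) • ∑ a, ∑ b, T.K a b • (φ (.A a) * del N (φ (.A b)))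
  + ∑ α, ∑ s, (φ (.PX α s) * dA T φ (fun t => φ (.X α t)) s
      + φ (.PY α s) * dAdual T φ (fun t => φ (.Y α t)) s)
  + kappa T • ∑ a, nu T φ 0 0 a * raise T (nu T φ 1 1) a

/-- The covariant derivative `∂_𝐁 = ∂ - (2π/k) 𝐁` on `R`-valued superfields. -/
def delB (φ : Fields ι m N) (v : m → Sup N) (s : m) : Sup N :=
  del N (v s) - kappa T • act T (raise T fun a => φ (.B a)) v s

/-- The covariant derivative `∂_𝐁` on `R^*`-valued superfields. -/
def delBdual (φ : Fields ι m N) (w : m → Sup N) (s : m) : Sup N :=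
  del N (w s) - kappa T • dact T (raise T fun a => φ (.B a)) w s

/-- The density `V 𝐓̂ + 𝐉_S + 𝐉̃_S̃ + 𝐋_U + 𝚯_Γ + 𝚵_Σ` of the current with the given parameters:
`𝐓̂ = ¾ 𝚿 ∂_𝐁 𝐙 - ¼ 𝐙 ∂_𝐁 𝚿` (hypermultiplets and twisted hypermultiplets),
`𝐉_S = S^α_β 𝚿_{𝐗,α} 𝐗^β`, `𝐉̃_S̃ = S̃^α̇_β̇ 𝚿_{𝐘,α̇} 𝐘^β̇`, `𝐋_U = U (𝚿_𝐗 𝐗 - 𝚿_𝐘 𝐘)`,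
`𝚯_Γ = Γ^{αα̇} 𝚿_{𝐗,α} 𝚿_{𝐘,α̇} - ½ Γ^∨_{αα̇} (𝐗^α ∂_𝐁 𝐘^α̇ - 𝐘^α̇ ∂_𝐁 𝐗^α)`,
`𝚵_Σ = Σ_{αα̇} 𝐘^α̇ 𝐗^α`. -/
def current (p : Params N) (φ : Fields ι m N) : Sup N :=
  ∑ s, (
    ∑ α, (p.V * ((3 / 4 : ℂ) • (φ (.PX α s) * delB T φ (fun t => φ (.X α t)) s
            + φ (.PY α s) * delBdual T φ (fun t => φ (.Y α t)) s)
          - (4⁻¹ : ℂ) • (φ (.X α s) * delBdual T φ (fun t => φ (.PX α t)) s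
            + φ (.Y α s) * delB T φ (fun t => φ (.PY α t)) s))
        + p.U * (φ (.PX α s) * φ (.X α s) - φ (.PY α s) * φ (.Y α s)))
    + ∑ α, ∑ β, (p.S α β * (φ (.PX α s) * φ (.X β s))
        + p.St α β * (φ (.PY α s) * φ (.Y β s))
        + p.G α β * (φ (.PX α s) * φ (.PY β s))
        - (2⁻¹ : ℂ) • (vee p.G α β *
            (φ (.X α s) * delBdual T φ (fun t => φ (.Y β t)) s
              - φ (.Y β s) * delB T φ (fun t => φ (.X α t)) s))
        + p.Sg α β * (φ (.Y β s) * φ (.X α s))))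

/-- The infinitesimal transformation of the fields generated by the current with the given
parameters. -/
def transf (p : Params N) (φ : Fields ι m N) : Fields ι m N
  | .A a => kappa T • raise T (fun b => p.V * mu T φ b
      + ∑ α, ∑ β, vee p.G α β * nu T φ α β b) a
  | .B _ => 0
  | .X α s => p.V * delB T φ (fun t => φ (.X α t)) s + (4⁻¹ : ℂ) • (del N p.V * φ (.X α s))
      + ∑ β, p.S α β * φ (.X β s) + p.U * φ (.X α s) - ∑ β, p.G α β * φ (.PY β s)
  | .Y α s => p.V * delBdual T φ (fun t => φ (.Y α t)) s + (4⁻¹ : ℂ) • (del N p.V * φ (.Y α s))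
      + ∑ β, p.St α β * φ (.Y β s) - p.U * φ (.Y α s) + ∑ β, p.G β α * φ (.PX β s)
  | .PX α s => p.V * delBdual T φ (fun t => φ (.PX α t)) s
      + (3 / 4 : ℂ) • (del N p.V * φ (.PX α s))
      - ∑ β, p.S β α * φ (.PX β s) - p.U * φ (.PX α s)
      + ∑ β, (vee p.G α β * delBdual T φ (fun t => φ (.Y β t)) s
        + (2⁻¹ : ℂ) • (del N (vee p.G α β) * φ (.Y β s)) - p.Sg α β * φ (.Y β s))
  | .PY α s => p.V * delB T φ (fun t => φ (.PY α t)) s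
      + (3 / 4 : ℂ) • (del N p.V * φ (.PY α s))
      - ∑ β, p.St β α * φ (.PY β s) + p.U * φ (.PY α s)
      - ∑ β, (vee p.G β α * delB T φ (fun t => φ (.X β t)) s
        + (2⁻¹ : ℂ) • (del N (vee p.G β α) * φ (.X β s)) + p.Sg β α * φ (.X β s))

/-- The action of `θ ⊗ Q`. -/
def thetaQ (θ : Grass N) (φ : Fields ι m N) : Fields ι m N := fun i => const θ * Q T φ i

/-- The geometric action of the vector field `V ∂_z`: the Lie derivative, with `𝐀`, `𝐁`,
`𝐗, 𝐘`, `𝚿` sections of `K^0`, `K^1`, `K^{1/4}`, `K^{3/4}`. -/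
def geometric (V : Sup N) (φ : Fields ι m N) : Fields ι m N
  | .A a => V * del N (φ (.A a))
  | .B a => V * del N (φ (.B a)) + del N V * φ (.B a)
  | .X α s => V * del N (φ (.X α s)) + (4⁻¹ : ℂ) • (del N V * φ (.X α s))
  | .Y α s => V * del N (φ (.Y α s)) + (4⁻¹ : ℂ) • (del N V * φ (.Y α s))
  | .PX α s => V * del N (φ (.PX α s)) + (3 / 4 : ℂ) • (del N V * φ (.PX α s))
  | .PY α s => V * del N (φ (.PY α s)) + (3 / 4 : ℂ) • (del N V * φ (.PY α s))

/-- The transformation `𝐀 ↦ (2π/k) V 𝐁` (index raised), all other fields being fixed. -/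
def homotopy (V : Sup N) (φ : Fields ι m N) : Fields ι m N
  | .A a => kappa T • (V * raise T (fun b => φ (.B b)) a)
  | _ => 0

/-- The density of the BV symplectic pairing, which pairs `𝐀` with `𝐁` and `𝐗`, `𝐘` with
`𝚿_𝐗`, `𝚿_𝐘`. -/
def pairing (ψ ξ : Fields ι m N) : Sup N :=
  ∑ a, (ψ (.A a) * ξ (.B a) - ψ (.B a) * ξ (.A a))
  + ∑ α, ∑ s, (ψ (.PX α s) * ξ (.X α s) - ψ (.X α s) * ξ (.PX α s)
      + ψ (.PY α s) * ξ (.Y α s) - ψ (.Y α s) * ξ (.PY α s))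

/-- `F` is the Hamiltonian vector field of the local functional with (odd) density `J`: for every
compactly supported variation `ψ` of the fields, the variation of `J` equals `pairing ψ (F φ)` up
to a total derivative. -/
def IsHamiltonian (J : Fields ι m N → Sup N) (F : Fields ι m N → Fields ι m N) : Prop :=
  ∀ φ ψ, IsField φ → IsField ψ → (∀ i, ψ i ∈ compactSup N) →
    ∃ d, HasDirDeriv J φ ψ d ∧ d - pairing ψ (F φ) ∈ totalDer N

/-- The density `J` is conserved: `Q J = d' J`. -/
def IsConserved (J : Fields ι m N → Sup N) : Prop :=
  ∀ (θ : Grass N) φ, GOdd θ → IsField φ →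
    HasDirDeriv J φ (thetaQ T θ φ) (const θ * dprime N (J φ))

/-- `F` is a symmetry of the theory generated by the conserved current with density `J`. -/
structure IsSymmetry (J : Fields ι m N → Sup N) (F : Fields ι m N → Fields ι m N) : Prop where
  maps_fields : ∀ φ, IsField φ → IsField (F φ)
  comm_Q : ∀ (θ : Grass N) φ, GOdd θ → IsField φ → IsComm (thetaQ T θ) F φ 0
  hamiltonian : IsHamiltonian J F
  conserved : IsConserved T J

/-- The symmetry `η ⊗ x`, `x` an even element. -/
def evenSym (η : Grass N) (x : AEven Hol) : Fields ι m N → Fields ι m N := transf T (evenParams η x)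

/-- The symmetry `θ ⊗ u`, `u` an odd element. -/
def oddSym (θ : Grass N) (u : AOdd Hol) : Fields ι m N → Fields ι m N := transf T (oddParams θ u)

variable (N) in
/-- `Q` squares to zero and is generated by the action `S`. -/
structure IsBVTheory : Prop where
  Q_sq : ∀ (θ θ' : Grass N) (φ : Fields ι m N), GOdd θ → GOdd θ' → IsField φ →
    IsComm (thetaQ T θ) (thetaQ T θ') φ 0
  Q_maps : ∀ (θ : Grass N) (φ : Fields ι m N), GOdd θ → IsField φ → IsField (thetaQ T θ φ)
  Q_hamiltonian : ∀ θ : Grass N, GOdd θ →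
    IsHamiltonian (fun φ : Fields ι m N => -(const θ * lagrangian T φ)) (thetaQ T θ)

variable (N) in
/-- The theory carries an action of the Lie superalgebra `𝔞_{𝒩=6}` (over holomorphic functions) by
symmetries generated by conserved currents, in which vector fields act, up to `Q`-exact
terms, by Lie derivatives. The bracket relations are those of the even part of the tensor product
of `𝔞_{𝒩=6}` with the Grassmann algebra of parameters; in particular
`[θ ⊗ u, θ' ⊗ v] = -θθ' ⊗ [u, v]` for odd `θ`, `θ'`, `u`, `v`. -/
structure CarriesActionOfAN6 : Prop where
  even_sym : ∀ (η : Grass N) x, GEven η →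
    IsSymmetry T (current T (evenParams η x)) (evenSym T η x)
  odd_sym : ∀ (θ : Grass N) u, GOdd θ →
    IsSymmetry T (current T (oddParams θ u)) (oddSym T θ u)
  even_even : ∀ (η η' : Grass N) x y φ, GEven η → GEven η' → IsField φ →
    IsComm (evenSym T η x) (evenSym T η' y) φ (evenSym T (η * η') ((aN6 holDer).ee x y) φ)
  even_odd : ∀ (η θ : Grass N) x u φ, GEven η → GOdd θ → IsField φ →
    IsComm (evenSym T η x) (oddSym T θ u) φ (oddSym T (η * θ) ((aN6 holDer).eo x u) φ)
  odd_odd : ∀ (θ θ' : Grass N) u v φ, GOdd θ → GOdd θ' → IsField φ →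
    IsComm (oddSym T θ u) (oddSym T θ' v) φ (evenSym T (-(θ * θ')) ((aN6 holDer).oo u v) φ)
  vect_homotopic : ∀ (θ θ' : Grass N) (V : Hol) φ, GOdd θ → GOdd θ' → IsField φ →
    IsComm (thetaQ T θ) (homotopy T (pull V ⊗ₜ θ')) φ
      (geometric (pull V ⊗ₜ (θ * θ')) φ - evenSym T (θ * θ') (V, 0, 0, 0) φ)

end Theory

end HTTwist

end

open HTTwist

/-!
The algebra `𝔞_{𝒩=6}` is treated over an arbitrary differential algebra `(O, D)`: the axioms of a
Lie superalgebra, the identification of the even part through `𝔰𝔩(2) ⊕ 𝔰𝔩(2) ≅ 𝔰𝔬(4)` and the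
extension structure of the odd part are polynomial identities in the components and their
derivatives.

For the positive part of `K'₄` the point is that `K'₄` is the free `ℂ[∂]`-submodule of `K₄` in which
the `ξ₁ξ₂ξ₃ξ₄`-component is divisible by `∂` (`mem_K4'_iff`). Hence its modes with coefficients in
`O` are families of sixteen functions (`ker_modeCoord`), and sesquilinearity of the `λ`-bracket
(`lamEval_sesqui`) reduces the bracket of modes to the structure constants of the Grassmann algebra
(`sum_polyOp_lamCoeff`). The identification with `𝔞_{𝒩=6}` is then explicit (`assemble`,
`br_assemble`). The argument does not depend on `(O, D)`, so that it covers both holomorphic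
functions and polynomials.

For the theory, superfields are replaced by an algebra `A` with a parity involution, an odd
differential `d` and a commuting even derivation `del` (`SuperDiff`), over a commutative algebra `E`
of even elements killed by `d`, which contains the parameters of the symmetries (`Scalars`). An odd
parameter `τ` is an odd constant, and `θ d` is an even derivation for an odd constant `θ`; this turns
the transformation `θ ⊗ Q` into an expression in ordinary covariant derivatives with the even
connection `θ 𝐀` (`gQ`), and all signs are carried by the few lemmas that move `θ` and `τ` through
products. All nonlinearities are contractions with constant tensors (`contract`), so that derivatives
of transformations are computed by the product rule (`HasDirDeriv.mul`).

* The symmetries never change `𝐁`. Their action on the matter fields is therefore by first order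
  operators in a fixed covariant derivative `∂_𝐁` (`wtr`, `xtr`), whose commutators involve no
  curvature, since only one derivative occurs. The matter fields thus carry a representation of
  `𝔞_{𝒩=6}` (`wtr_wtr`, `wtr_xtr`, `oo_X` and its variants), and the transformation of `𝐀` follows from
  the equivariance of the moment maps `μ` and `ν` (`isComm_even_even`, `isComm_even_odd`,
  `isComm_odd_odd`).
* The variation of the connection `-(2π/k) 𝐁` under `Q` is, up to a term in `μ`, the curvature of the
  pair formed by the `Q`-covariant derivative and `∂_𝐁` (`conB_gQ`). This curvature cancels the
  commutator of the two covariant derivatives (`covR_comm`), and the term in `μ` is cancelled by the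
  variation of `𝐀`. What is left of `[Q, F] = 0` is the invariance of the superpotential
  `(2π/k) Tr(ν ν̃)`, which holds because the fundamental identity makes the triple products
  `R^* × R × R → R` and `R^* × R × R^* → R^*` skew (`atri_skew`, `dtri_skew`): see `dtri_wtr` and
  `dtri_rot`, and `quartic_kinetic`, `quartic_rot` and `quartic_odd` for the currents.
* `Q` squares to zero because the curvature of two `Q`-covariant derivatives is the antisymmetrized
  variation of `𝐀` (`curv_gQ`), the Bianchi identity holds (`covG_gQ`) and `μ` varies covariantly
  (`gmu'_gQ`).
* The currents vary into the pairing with their transformations up to an explicit `∂`-exact term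
  (`ecur'_sub_gpair`, `ocur'_sub_gpair`), and the Lagrangian density up to a total derivative
  (`glag'_sub_gpair`).

Finally, the tensor product of smooth functions with a Grassmann algebra is such an `A` (`supDiff`),
with `E` the algebra of all even elements killed by `d'`, and holomorphic functions with even constant
coefficients lie in `E` (`holScal`). The extension of scalars from holomorphic functions to `E`
respects the brackets (`aN6_ee_escale_evenMap` and its variants).
-/


noncomputable section

namespace HTTwist

set_option linter.unusedSectionVars false

/-! ### The algebra in components -/

section AlgebraPart
variable {O : Type*} [CommRing O] [Algebra ℂ O]

/-- The traceless matrix with first row `a, b` and lower left entry `c`. -/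
def sl2mk (a b c : O) : SL2 O :=
  ⟨!![a, b; c, -a], by simp [LinearMap.mem_ker, Matrix.trace_fin_two]⟩

theorem exists_sl2mk (S : SL2 O) : ∃ a b c, S = sl2mk a b c := by
  refine ⟨S.1 0 0, S.1 0 1, S.1 1 0, Subtype.ext ?_⟩
  have h : (S : M2 O) 0 0 + (S : M2 O) 1 1 = 0 := by
    have := S.2
    rwa [LinearMap.mem_ker, Matrix.traceLinearMap_apply, Matrix.trace_fin_two] at this
  ext i j
  fin_cases i <;> fin_cases j <;> simp [sl2mk]
  linear_combination h

theorem sl2mk_add (a b c a' b' c' : O) :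
    sl2mk a b c + sl2mk a' b' c' = sl2mk (a + a') (b + b') (c + c') := by
  apply Subtype.ext; ext i j
  fin_cases i <;> fin_cases j <;> simp [sl2mk, add_comm]

theorem sl2mk_neg (a b c : O) : -sl2mk a b c = sl2mk (-a) (-b) (-c) := by
  apply Subtype.ext; ext i j
  fin_cases i <;> fin_cases j <;> simp [sl2mk]

theorem sl2mk_smul (r : ℂ) (a b c : O) : r • sl2mk a b c = sl2mk (r • a) (r • b) (r • c) := by
  apply Subtype.ext; ext i j
  fin_cases i <;> fin_cases j <;> simp [sl2mk]

theorem sl2mk_zero : (0 : SL2 O) = sl2mk 0 0 0 := by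
  apply Subtype.ext; ext i j
  fin_cases i <;> fin_cases j <;> simp [sl2mk]

theorem coe_sl2mk (a b c : O) : (sl2mk a b c : M2 O) = !![a, b; c, -a] := rfl

theorem sl2mk_inj {a b c a' b' c' : O} :
    sl2mk a b c = sl2mk a' b' c' ↔ a = a' ∧ b = b' ∧ c = c' := by
  constructor
  · intro h
    have h' := congrArg Subtype.val h
    exact ⟨congrFun (congrFun h' 0) 0, congrFun (congrFun h' 0) 1, congrFun (congrFun h' 1) 0⟩
  · rintro ⟨rfl, rfl, rfl⟩; rfl

theorem traceless_of (a b c d : O) :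
    traceless !![a, b; c, d] = sl2mk ((2⁻¹ : ℂ) • (a - d)) b c := by
  apply Subtype.ext; ext i j
  fin_cases i <;> fin_cases j <;>
    simp [sl2mk, traceless, Matrix.trace_fin_two, -smul_add]
  · algebra
  · algebra

variable (D : Derivation ℂ O O)

theorem exists_mat (G : M2 O) : ∃ a b c d, G = !![a, b; c, d] :=
  ⟨_, _, _, _, Matrix.eta_fin_two G⟩

theorem vee_of (a b c d : O) : vee !![a, b; c, d] = !![d, -c; -b, a] := rfl

theorem map_of (a b c d : O) : (!![a, b; c, d] : M2 O).map D = !![D a, D b; D c, D d] := by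
  ext i j; fin_cases i <;> fin_cases j <;> rfl

theorem transpose_of (a b c d : O) : (!![a, b; c, d] : M2 O).transpose = !![a, c; b, d] := by
  ext i j; fin_cases i <;> fin_cases j <;> rfl

theorem m2_add (a b c d a' b' c' d' : O) :
    !![a, b; c, d] + !![a', b'; c', d'] = !![a + a', b + b'; c + c', d + d'] := by
  ext i j; fin_cases i <;> fin_cases j <;> rfl

theorem m2_sub (a b c d a' b' c' d' : O) :
    !![a, b; c, d] - !![a', b'; c', d'] = !![a - a', b - b'; c - c', d - d'] := by
  ext i j; fin_cases i <;> fin_cases j <;> rfl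

theorem m2_smul {R : Type*} [SMul R O] (r : R) (a b c d : O) :
    r • !![a, b; c, d] = !![r • a, r • b; r • c, r • d] := by
  ext i j; fin_cases i <;> fin_cases j <;> rfl

theorem m2_inj {a b c d a' b' c' d' : O} :
    !![a, b; c, d] = !![a', b'; c', d'] ↔ a = a' ∧ b = b' ∧ c = c' ∧ d = d' := by
  constructor
  · intro h
    exact ⟨congrFun (congrFun h 0) 0, congrFun (congrFun h 0) 1, congrFun (congrFun h 1) 0,
      congrFun (congrFun h 1) 1⟩
  · rintro ⟨rfl, rfl, rfl, rfl⟩; rfl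

/-- The bracket of even elements in components. -/
theorem aN6_ee_eq (V a b c a₂ b₂ c₂ U V' a' b' c' a₂' b₂' c₂' U' : O) :
    (aN6 D).ee (V, sl2mk a b c, sl2mk a₂ b₂ c₂, U) (V', sl2mk a' b' c', sl2mk a₂' b₂' c₂', U')
      = (V * D V' - V' * D V,
        sl2mk (V * D a' - V' * D a + (b * c' - b' * c))
          (V * D b' - V' * D b + 2 * (a * b' - a' * b))
          (V * D c' - V' * D c + 2 * (a' * c - a * c')),
        sl2mk (V * D a₂' - V' * D a₂ + (b₂ * c₂' - b₂' * c₂))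
          (V * D b₂' - V' * D b₂ + 2 * (a₂ * b₂' - a₂' * b₂))
          (V * D c₂' - V' * D c₂ + 2 * (a₂' * c₂ - a₂ * c₂')),
        V * D U' - V' * D U) := by
  simp only [aN6, coe_sl2mk, map_of, Matrix.mul_fin_two, m2_add, m2_sub, m2_smul,
    traceless_of, Prod.mk.injEq, true_and, and_true, sl2mk_inj, smul_eq_mul, map_neg]
  refine ⟨⟨?_, ?_, ?_⟩, ⟨?_, ?_, ?_⟩⟩ <;> algebra

/-- The bracket of an even and an odd element in components. -/
theorem aN6_eo_eq (V a b c a₂ b₂ c₂ U g₁ g₂ g₃ g₄ s₁ s₂ s₃ s₄ : O) :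
    (aN6 D).eo (V, sl2mk a b c, sl2mk a₂ b₂ c₂, U) (!![g₁, g₂; g₃, g₄], !![s₁, s₂; s₃, s₄])
      = (!![V * D g₁ - (2⁻¹ : ℂ) • (D V * g₁) + (a * g₁ + b * g₃) + (g₁ * a₂ + g₂ * b₂),
          V * D g₂ - (2⁻¹ : ℂ) • (D V * g₂) + (a * g₂ + b * g₄) + (g₁ * c₂ - g₂ * a₂);
          V * D g₃ - (2⁻¹ : ℂ) • (D V * g₃) + (c * g₁ - a * g₃) + (g₃ * a₂ + g₄ * b₂),
          V * D g₄ - (2⁻¹ : ℂ) • (D V * g₄) + (c * g₂ - a * g₄) + (g₃ * c₂ - g₄ * a₂)],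
        !![V * D s₁ + (2⁻¹ : ℂ) • (D V * s₁) - (a * s₁ + c * s₃) - (s₁ * a₂ + s₂ * c₂)
            - (2⁻¹ : ℂ) • (D a * g₄ - D c * g₂) + (2⁻¹ : ℂ) • (g₄ * D a₂ - g₃ * D c₂) - D U * g₄,
          V * D s₂ + (2⁻¹ : ℂ) • (D V * s₂) - (a * s₂ + c * s₄) - (s₁ * b₂ - s₂ * a₂)
            - (2⁻¹ : ℂ) • (D c * g₁ - D a * g₃) + (2⁻¹ : ℂ) • (g₄ * D b₂ + g₃ * D a₂) + D U * g₃;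
          V * D s₃ + (2⁻¹ : ℂ) • (D V * s₃) - (b * s₁ - a * s₃) - (s₃ * a₂ + s₄ * c₂)
            - (2⁻¹ : ℂ) • (D b * g₄ + D a * g₂) + (2⁻¹ : ℂ) • (g₁ * D c₂ - g₂ * D a₂) + D U * g₂,
          V * D s₄ + (2⁻¹ : ℂ) • (D V * s₄) - (b * s₂ - a * s₄) - (s₃ * b₂ - s₄ * a₂)
            + (2⁻¹ : ℂ) • (D b * g₃ + D a * g₁) - (2⁻¹ : ℂ) • (g₂ * D b₂ + g₁ * D a₂)
            - D U * g₁]) := by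
  simp only [aN6, actVec, actCovec, lieDer, vee_of, transpose_of, coe_sl2mk, map_of,
    Matrix.mul_fin_two, m2_add, m2_sub, m2_smul, Prod.mk.injEq, m2_inj, smul_eq_mul, map_neg]
  refine ⟨⟨?_, ?_, ?_, ?_⟩, ⟨?_, ?_, ?_, ?_⟩⟩ <;> algebra

/-- The bracket of odd elements in components. -/
theorem aN6_oo_eq (g₁ g₂ g₃ g₄ s₁ s₂ s₃ s₄ h₁ h₂ h₃ h₄ t₁ t₂ t₃ t₄ : O) :
    (aN6 D).oo (!![g₁, g₂; g₃, g₄], !![s₁, s₂; s₃, s₄]) (!![h₁, h₂; h₃, h₄], !![t₁, t₂; t₃, t₄])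
      = (h₁ * g₄ - h₂ * g₃ - h₃ * g₂ + h₄ * g₁,
        sl2mk
          ((4⁻¹ : ℂ) • (g₁ * D h₄ - g₂ * D h₃ + g₃ * D h₂ - g₄ * D h₁
              + (h₁ * D g₄ - h₂ * D g₃ + h₃ * D g₂ - h₄ * D g₁))
            + (2⁻¹ : ℂ) • (g₁ * t₁ + g₂ * t₂ - g₃ * t₃ - g₄ * t₄
              + (h₁ * s₁ + h₂ * s₂ - h₃ * s₃ - h₄ * s₄)))
          ((2⁻¹ : ℂ) • (g₂ * D h₁ - g₁ * D h₂ + (h₂ * D g₁ - h₁ * D g₂))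
            + (g₁ * t₃ + g₂ * t₄ + (h₁ * s₃ + h₂ * s₄)))
          ((2⁻¹ : ℂ) • (g₃ * D h₄ - g₄ * D h₃ + (h₃ * D g₄ - h₄ * D g₃))
            + (g₃ * t₁ + g₄ * t₂ + (h₃ * s₁ + h₄ * s₂))),
        sl2mk
          ((4⁻¹ : ℂ) • (g₁ * D h₄ - g₃ * D h₂ + g₂ * D h₃ - g₄ * D h₁
              + (h₁ * D g₄ - h₃ * D g₂ + h₂ * D g₃ - h₄ * D g₁))
            - (2⁻¹ : ℂ) • (g₁ * t₁ + g₃ * t₃ - g₂ * t₂ - g₄ * t₄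
              + (h₁ * s₁ + h₃ * s₃ - h₂ * s₂ - h₄ * s₄)))
          ((2⁻¹ : ℂ) • (g₃ * D h₁ - g₁ * D h₃ + (h₃ * D g₁ - h₁ * D g₃))
            - (g₁ * t₂ + g₃ * t₄ + (h₁ * s₂ + h₃ * s₄)))
          ((2⁻¹ : ℂ) • (g₂ * D h₄ - g₄ * D h₂ + (h₂ * D g₄ - h₄ * D g₂))
            - (g₂ * t₁ + g₄ * t₃ + (h₂ * s₁ + h₄ * s₃))),
        (2⁻¹ : ℂ) • (g₁ * t₁ + g₂ * t₂ + g₃ * t₃ + g₄ * t₄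
          + (h₁ * s₁ + h₂ * s₂ + h₃ * s₃ + h₄ * s₄))) := by
  simp only [aN6, vee_of, transpose_of, map_of, Matrix.mul_fin_two, m2_add, m2_sub, m2_smul,
    traceless_of, Prod.mk.injEq, sl2mk_inj, map_neg, Matrix.trace_fin_two_of]
  refine ⟨?_, ⟨?_, ?_, ?_⟩, ⟨?_, ?_, ?_⟩, ?_⟩ <;> algebra

theorem aN6_ee_linear : ∀ x, IsLinearMap ℂ ((aN6 D).ee x) := by
  intro x
  obtain ⟨V, S, St, U⟩ := x
  obtain ⟨a, b, c, rfl⟩ := exists_sl2mk S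
  obtain ⟨a₂, b₂, c₂, rfl⟩ := exists_sl2mk St
  constructor
  · rintro ⟨V', S', St', U'⟩ ⟨V'', S'', St'', U''⟩
    obtain ⟨a', b', c', rfl⟩ := exists_sl2mk S'
    obtain ⟨a₂', b₂', c₂', rfl⟩ := exists_sl2mk St'
    obtain ⟨a'', b'', c'', rfl⟩ := exists_sl2mk S''
    obtain ⟨a₂'', b₂'', c₂'', rfl⟩ := exists_sl2mk St''
    simp only [Prod.mk_add_mk, sl2mk_add, aN6_ee_eq, Prod.mk.injEq, sl2mk_inj, map_add]
    refine ⟨?_, ⟨?_, ?_, ?_⟩, ⟨?_, ?_, ?_⟩, ?_⟩ <;> algebra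
  · rintro r ⟨V', S', St', U'⟩
    obtain ⟨a', b', c', rfl⟩ := exists_sl2mk S'
    obtain ⟨a₂', b₂', c₂', rfl⟩ := exists_sl2mk St'
    simp only [Prod.smul_mk, sl2mk_smul, aN6_ee_eq, Prod.mk.injEq, sl2mk_inj, Derivation.map_smul]
    refine ⟨?_, ⟨?_, ?_, ?_⟩, ⟨?_, ?_, ?_⟩, ?_⟩ <;> algebra

theorem aN6_eo_linear_right : ∀ x, IsLinearMap ℂ ((aN6 D).eo x) := by
  intro x
  obtain ⟨V, S, St, U⟩ := x
  obtain ⟨a, b, c, rfl⟩ := exists_sl2mk S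
  obtain ⟨a₂, b₂, c₂, rfl⟩ := exists_sl2mk St
  constructor
  · rintro ⟨G, T⟩ ⟨G', T'⟩
    obtain ⟨g₁, g₂, g₃, g₄, rfl⟩ := exists_mat G
    obtain ⟨s₁, s₂, s₃, s₄, rfl⟩ := exists_mat T
    obtain ⟨h₁, h₂, h₃, h₄, rfl⟩ := exists_mat G'
    obtain ⟨t₁, t₂, t₃, t₄, rfl⟩ := exists_mat T'
    simp only [Prod.mk_add_mk, m2_add, aN6_eo_eq, Prod.mk.injEq, m2_inj, map_add]
    refine ⟨⟨?_, ?_, ?_, ?_⟩, ⟨?_, ?_, ?_, ?_⟩⟩ <;> algebra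
  · rintro r ⟨G, T⟩
    obtain ⟨g₁, g₂, g₃, g₄, rfl⟩ := exists_mat G
    obtain ⟨s₁, s₂, s₃, s₄, rfl⟩ := exists_mat T
    simp only [Prod.smul_mk, m2_smul, aN6_eo_eq, Prod.mk.injEq, m2_inj, Derivation.map_smul]
    refine ⟨⟨?_, ?_, ?_, ?_⟩, ⟨?_, ?_, ?_, ?_⟩⟩ <;> algebra

theorem aN6_eo_linear_left : ∀ u, IsLinearMap ℂ (fun x => (aN6 D).eo x u) := by
  intro u
  obtain ⟨G, T⟩ := u
  obtain ⟨g₁, g₂, g₃, g₄, rfl⟩ := exists_mat G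
  obtain ⟨s₁, s₂, s₃, s₄, rfl⟩ := exists_mat T
  constructor
  · rintro ⟨V, S, St, U⟩ ⟨V', S', St', U'⟩
    obtain ⟨a, b, c, rfl⟩ := exists_sl2mk S
    obtain ⟨a₂, b₂, c₂, rfl⟩ := exists_sl2mk St
    obtain ⟨a', b', c', rfl⟩ := exists_sl2mk S'
    obtain ⟨a₂', b₂', c₂', rfl⟩ := exists_sl2mk St'
    simp only [Prod.mk_add_mk, sl2mk_add, m2_add, aN6_eo_eq, Prod.mk.injEq, m2_inj, map_add]
    refine ⟨⟨?_, ?_, ?_, ?_⟩, ⟨?_, ?_, ?_, ?_⟩⟩ <;> algebra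
  · rintro r ⟨V, S, St, U⟩
    obtain ⟨a, b, c, rfl⟩ := exists_sl2mk S
    obtain ⟨a₂, b₂, c₂, rfl⟩ := exists_sl2mk St
    simp only [Prod.smul_mk, sl2mk_smul, m2_smul, aN6_eo_eq, Prod.mk.injEq, m2_inj,
      Derivation.map_smul]
    refine ⟨⟨?_, ?_, ?_, ?_⟩, ⟨?_, ?_, ?_, ?_⟩⟩ <;> algebra

theorem aN6_oo_linear : ∀ u, IsLinearMap ℂ ((aN6 D).oo u) := by
  intro u
  obtain ⟨G, T⟩ := u
  obtain ⟨g₁, g₂, g₃, g₄, rfl⟩ := exists_mat G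
  obtain ⟨s₁, s₂, s₃, s₄, rfl⟩ := exists_mat T
  constructor
  · rintro ⟨G', T'⟩ ⟨G'', T''⟩
    obtain ⟨h₁, h₂, h₃, h₄, rfl⟩ := exists_mat G'
    obtain ⟨t₁, t₂, t₃, t₄, rfl⟩ := exists_mat T'
    obtain ⟨k₁, k₂, k₃, k₄, rfl⟩ := exists_mat G''
    obtain ⟨r₁, r₂, r₃, r₄, rfl⟩ := exists_mat T''
    simp only [Prod.mk_add_mk, sl2mk_add, m2_add, aN6_oo_eq, Prod.mk.injEq, sl2mk_inj, map_add]
    refine ⟨?_, ⟨?_, ?_, ?_⟩, ⟨?_, ?_, ?_⟩, ?_⟩ <;> algebra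
  · rintro r ⟨G', T'⟩
    obtain ⟨h₁, h₂, h₃, h₄, rfl⟩ := exists_mat G'
    obtain ⟨t₁, t₂, t₃, t₄, rfl⟩ := exists_mat T'
    simp only [Prod.smul_mk, sl2mk_smul, m2_smul, aN6_oo_eq, Prod.mk.injEq, sl2mk_inj,
      Derivation.map_smul]
    refine ⟨?_, ⟨?_, ?_, ?_⟩, ⟨?_, ?_, ?_⟩, ?_⟩ <;> algebra

theorem aN6_ee_skew : ∀ x y, (aN6 D).ee x y = -(aN6 D).ee y x := by
  rintro ⟨V, S, St, U⟩ ⟨V', S', St', U'⟩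
  obtain ⟨a, b, c, rfl⟩ := exists_sl2mk S
  obtain ⟨a₂, b₂, c₂, rfl⟩ := exists_sl2mk St
  obtain ⟨a', b', c', rfl⟩ := exists_sl2mk S'
  obtain ⟨a₂', b₂', c₂', rfl⟩ := exists_sl2mk St'
  simp only [aN6_ee_eq, Prod.neg_mk, sl2mk_neg, Prod.mk.injEq, sl2mk_inj]
  refine ⟨?_, ⟨?_, ?_, ?_⟩, ⟨?_, ?_, ?_⟩, ?_⟩ <;> ring

theorem aN6_oo_symm : ∀ u v, (aN6 D).oo u v = (aN6 D).oo v u := by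
  rintro ⟨G, T⟩ ⟨G', T'⟩
  obtain ⟨g₁, g₂, g₃, g₄, rfl⟩ := exists_mat G
  obtain ⟨s₁, s₂, s₃, s₄, rfl⟩ := exists_mat T
  obtain ⟨h₁, h₂, h₃, h₄, rfl⟩ := exists_mat G'
  obtain ⟨t₁, t₂, t₃, t₄, rfl⟩ := exists_mat T'
  simp only [aN6_oo_eq, Prod.mk.injEq, sl2mk_inj]
  refine ⟨?_, ⟨?_, ?_, ?_⟩, ⟨?_, ?_, ?_⟩, ?_⟩ <;> algebra

theorem aN6_jacobi_eee : ∀ x y z, (aN6 D).ee x ((aN6 D).ee y z) = (aN6 D).ee ((aN6 D).ee x y) z + (aN6 D).ee y ((aN6 D).ee x z) := by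
  rintro ⟨V, S, St, U⟩ ⟨V', S', St', U'⟩ ⟨V'', S'', St'', U''⟩
  obtain ⟨a, b, c, rfl⟩ := exists_sl2mk S
  obtain ⟨a₂, b₂, c₂, rfl⟩ := exists_sl2mk St
  obtain ⟨a', b', c', rfl⟩ := exists_sl2mk S'
  obtain ⟨a₂', b₂', c₂', rfl⟩ := exists_sl2mk St'
  obtain ⟨a'', b'', c'', rfl⟩ := exists_sl2mk S''
  obtain ⟨a₂'', b₂'', c₂'', rfl⟩ := exists_sl2mk St''
  simp only [aN6_ee_eq, Prod.mk_add_mk, sl2mk_add, Prod.mk.injEq, sl2mk_inj, map_add, map_sub,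
    Derivation.leibniz, smul_eq_mul, two_mul]
  refine ⟨?_, ⟨?_, ?_, ?_⟩, ⟨?_, ?_, ?_⟩, ?_⟩ <;> ring

theorem aN6_jacobi_eeo : ∀ x y u, (aN6 D).eo x ((aN6 D).eo y u) = (aN6 D).eo ((aN6 D).ee x y) u + (aN6 D).eo y ((aN6 D).eo x u) := by
  rintro ⟨V, S, St, U⟩ ⟨V', S', St', U'⟩ ⟨G, T⟩
  obtain ⟨a, b, c, rfl⟩ := exists_sl2mk S
  obtain ⟨a₂, b₂, c₂, rfl⟩ := exists_sl2mk St
  obtain ⟨a', b', c', rfl⟩ := exists_sl2mk S'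
  obtain ⟨a₂', b₂', c₂', rfl⟩ := exists_sl2mk St'
  obtain ⟨g₁, g₂, g₃, g₄, rfl⟩ := exists_mat G
  obtain ⟨s₁, s₂, s₃, s₄, rfl⟩ := exists_mat T
  simp only [aN6_ee_eq, aN6_eo_eq, Prod.mk_add_mk, m2_add, Prod.mk.injEq, m2_inj, map_add,
    map_sub, Derivation.leibniz, Derivation.map_smul, smul_eq_mul, two_mul]
  refine ⟨⟨?_, ?_, ?_, ?_⟩, ⟨?_, ?_, ?_, ?_⟩⟩ <;> algebra

theorem aN6_jacobi_eoo : ∀ x u v, (aN6 D).ee x ((aN6 D).oo u v) = (aN6 D).oo ((aN6 D).eo x u) v + (aN6 D).oo u ((aN6 D).eo x v) := by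
  rintro ⟨V, S, St, U⟩ ⟨G, T⟩ ⟨G', T'⟩
  obtain ⟨a, b, c, rfl⟩ := exists_sl2mk S
  obtain ⟨a₂, b₂, c₂, rfl⟩ := exists_sl2mk St
  obtain ⟨g₁, g₂, g₃, g₄, rfl⟩ := exists_mat G
  obtain ⟨s₁, s₂, s₃, s₄, rfl⟩ := exists_mat T
  obtain ⟨h₁, h₂, h₃, h₄, rfl⟩ := exists_mat G'
  obtain ⟨t₁, t₂, t₃, t₄, rfl⟩ := exists_mat T'
  simp only [aN6_ee_eq, aN6_eo_eq, aN6_oo_eq, Prod.mk_add_mk, sl2mk_add, Prod.mk.injEq,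
    sl2mk_inj, map_add, map_sub, Derivation.leibniz, Derivation.map_smul, smul_eq_mul]
  refine ⟨?_, ⟨?_, ?_, ?_⟩, ⟨?_, ?_, ?_⟩, ?_⟩ <;> algebra

/-- The Jacobi identity for three odd elements, a polynomial identity in the components and their
derivatives. -/
theorem aN6_jacobi_ooo : ∀ u v w, (aN6 D).eo ((aN6 D).oo u v) w + (aN6 D).eo ((aN6 D).oo v w) u + (aN6 D).eo ((aN6 D).oo w u) v = 0 := by
  rintro ⟨G, T⟩ ⟨G', T'⟩ ⟨G'', T''⟩
  obtain ⟨g₁, g₂, g₃, g₄, rfl⟩ := exists_mat G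
  obtain ⟨s₁, s₂, s₃, s₄, rfl⟩ := exists_mat T
  obtain ⟨h₁, h₂, h₃, h₄, rfl⟩ := exists_mat G'
  obtain ⟨t₁, t₂, t₃, t₄, rfl⟩ := exists_mat T'
  obtain ⟨k₁, k₂, k₃, k₄, rfl⟩ := exists_mat G''
  obtain ⟨r₁, r₂, r₃, r₄, rfl⟩ := exists_mat T''
  have h0 : (0 : AOdd O) = (!![0, 0; 0, 0], !![0, 0; 0, 0]) := by
    refine Prod.ext ?_ ?_ <;> ext i j <;> fin_cases i <;> fin_cases j <;> rfl
  simp only [aN6_eo_eq, aN6_oo_eq, h0, Prod.mk_add_mk, m2_add, Prod.mk.injEq, m2_inj, map_add,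
    map_sub, Derivation.leibniz, Derivation.map_smul, smul_eq_mul]
  refine ⟨⟨?_, ?_, ?_, ?_⟩, ⟨?_, ?_, ?_, ?_⟩⟩ <;> algebra

theorem isLieSuperalgebra_aN6 : IsLieSuperalgebra (aN6 D) where
  ee_linear := aN6_ee_linear D
  eo_linear_right := aN6_eo_linear_right D
  eo_linear_left := aN6_eo_linear_left D
  oo_linear := aN6_oo_linear D
  ee_skew := aN6_ee_skew D
  oo_symm := aN6_oo_symm D
  jacobi_eee := aN6_jacobi_eee D
  jacobi_eeo := aN6_jacobi_eeo D
  jacobi_eoo := aN6_jacobi_eoo D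
  jacobi_ooo := aN6_jacobi_ooo D

theorem oddPartIsExtension_aN6 : OddPartIsExtension D := by
  refine ⟨LinearMap.inr ℂ _ _, LinearMap.fst ℂ _ _, LinearMap.inr_injective,
    LinearMap.fst_surjective, LinearMap.range_inr ℂ _ _, ?_, fun x u => rfl, ?_⟩
  · rintro ⟨V, S, St, U⟩ T
    have hv : vee (0 : M2 O) = 0 := by ext i j; fin_cases i <;> fin_cases j <;> simp [vee]
    simp [aN6, actVec, lieDer, hv]
  · intro T T'
    have hv : vee (0 : M2 O) = 0 := by ext i j; fin_cases i <;> fin_cases j <;> simp [vee]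
    have h0 : traceless (0 : M2 O) = 0 := by ext; simp [traceless]
    simp [aN6, hv, h0]

end AlgebraPart

/-! ### The even part and `𝔰𝔬(4)` -/

section

variable {O : Type*} [CommRing O] [Algebra ℂ O] (D : Derivation ℂ O O)

/-- The skew-symmetric matrix with the given entries above the diagonal. -/
def so4mk (p q r s t u : O) : LieAlgebra.Orthogonal.so (Fin 4) O :=
  ⟨!![0, p, q, r; -p, 0, s, t; -q, -s, 0, u; -r, -t, -u, 0], by
    rw [LieAlgebra.Orthogonal.mem_so]
    ext i j; fin_cases i <;> fin_cases j <;> simp⟩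

theorem exists_so4mk (h2 : IsUnit (2 : O)) (M : LieAlgebra.Orthogonal.so (Fin 4) O) :
    M = so4mk (M.1 0 1) (M.1 0 2) (M.1 0 3) (M.1 1 2) (M.1 1 3) (M.1 2 3) := by
  have h := (LieAlgebra.Orthogonal.mem_so _ _ _).1 M.2
  have hij : ∀ i j, M.1 j i = -M.1 i j := fun i j => congrFun (congrFun h i) j
  have hii : ∀ i, M.1 i i = 0 := fun i => by
    have : 2 * M.1 i i = 0 := by linear_combination hij i i
    exact (h2.mul_right_eq_zero).1 this
  apply Subtype.ext
  ext i j
  fin_cases i <;> fin_cases j <;>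
    first
    | exact hii _
    | rfl
    | exact hij _ _

theorem so4mk_add (p q r s t u p' q' r' s' t' u' : O) :
    so4mk p q r s t u + so4mk p' q' r' s' t' u'
      = so4mk (p + p') (q + q') (r + r') (s + s') (t + t') (u + u') := by
  apply Subtype.ext
  ext i j
  fin_cases i <;> fin_cases j <;>
    first
    | exact add_zero 0
    | rfl
    | exact (neg_add _ _).symm

theorem so4mk_smul (c : ℂ) (p q r s t u : O) :
    c • so4mk p q r s t u = so4mk (c • p) (c • q) (c • r) (c • s) (c • t) (c • u) := by
  apply Subtype.ext
  ext i j
  fin_cases i <;> fin_cases j <;>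
    first
    | exact smul_zero c
    | rfl
    | exact smul_neg c _

/-- The action of `(S, S̃)` on the coordinates of `Γ`, in a basis that is orthonormal up to a
factor for the quadratic form `det Γ`. -/
def so4OfSL2 : (SL2 O × SL2 O) ≃ₗ[ℂ] LieAlgebra.Orthogonal.so (Fin 4) O where
  toFun x := so4mk (Complex.I • (x.1.1 0 0 + x.2.1 0 0))
    ((-Complex.I / 2) • (x.1.1 0 1 + x.2.1 0 1 + (x.1.1 1 0 + x.2.1 1 0)))
    ((2⁻¹ : ℂ) • (x.1.1 1 0 - x.2.1 1 0 - (x.1.1 0 1 - x.2.1 0 1)))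
    ((2⁻¹ : ℂ) • (x.1.1 1 0 + x.2.1 1 0 - (x.1.1 0 1 + x.2.1 0 1)))
    ((Complex.I / 2) • (x.1.1 1 0 - x.2.1 1 0 + (x.1.1 0 1 - x.2.1 0 1)))
    (Complex.I • (x.1.1 0 0 - x.2.1 0 0))
  invFun M :=
    (sl2mk ((-Complex.I / 2) • (M.1 0 1 + M.1 2 3))
      ((2⁻¹ : ℂ) • (Complex.I • M.1 0 2 - M.1 1 2 - M.1 0 3 - Complex.I • M.1 1 3))
      ((2⁻¹ : ℂ) • (Complex.I • M.1 0 2 + M.1 1 2 + M.1 0 3 - Complex.I • M.1 1 3)),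
    sl2mk ((-Complex.I / 2) • (M.1 0 1 - M.1 2 3))
      ((2⁻¹ : ℂ) • (Complex.I • M.1 0 2 - M.1 1 2 + M.1 0 3 + Complex.I • M.1 1 3))
      ((2⁻¹ : ℂ) • (Complex.I • M.1 0 2 + M.1 1 2 - M.1 0 3 + Complex.I • M.1 1 3)))
  map_add' x y := by
    rw [so4mk_add]
    simp only [Prod.fst_add, Prod.snd_add, Submodule.coe_add, Matrix.add_apply]
    congr 1 <;> module
  map_smul' c x := by
    rw [so4mk_smul]
    simp only [Prod.smul_fst, Prod.smul_snd, Submodule.coe_smul, Matrix.smul_apply,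
      RingHom.id_apply]
    congr 1 <;> module
  left_inv x := by
    obtain ⟨S, St⟩ := x
    obtain ⟨a, b, c, rfl⟩ := exists_sl2mk S
    obtain ⟨a₂, b₂, c₂, rfl⟩ := exists_sl2mk St
    have hI := Complex.I_mul_I
    simp only [so4mk, coe_sl2mk, Prod.mk.injEq, sl2mk_inj, Matrix.of_apply, Matrix.cons_val]
    refine ⟨⟨?_, ?_, ?_⟩, ⟨?_, ?_, ?_⟩⟩ <;> match_scalars <;> grind
  right_inv M := by
    have h2 : IsUnit (2 : O) := by
      have : (2 : O) = algebraMap ℂ O 2 := (map_ofNat _ 2).symm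
      rw [this]
      exact (IsUnit.mk0 (2 : ℂ) two_ne_zero).map _
    have hI := Complex.I_mul_I
    obtain ⟨p, q, r, s, t, u, rfl⟩ : ∃ p q r s t u, M = so4mk p q r s t u :=
      ⟨_, _, _, _, _, _, exists_so4mk h2 M⟩
    change so4mk _ _ _ _ _ _ = so4mk _ _ _ _ _ _
    congr 1
    all_goals simp only [so4mk, sl2mk, Matrix.of_apply, Matrix.cons_val]
    all_goals match_scalars <;> grind

theorem so4OfSL2_mk (a b c a₂ b₂ c₂ : O) :
    (so4OfSL2 (sl2mk a b c, sl2mk a₂ b₂ c₂)).1 =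
      !![0, Complex.I • (a + a₂), (-Complex.I / 2) • (b + b₂ + (c + c₂)),
          (2⁻¹ : ℂ) • (c - c₂ - (b - b₂));
        -(Complex.I • (a + a₂)), 0, (2⁻¹ : ℂ) • (c + c₂ - (b + b₂)),
          (Complex.I / 2) • (c - c₂ + (b - b₂));
        -((-Complex.I / 2) • (b + b₂ + (c + c₂))), -((2⁻¹ : ℂ) • (c + c₂ - (b + b₂))), 0,
          Complex.I • (a - a₂);
        -((2⁻¹ : ℂ) • (c - c₂ - (b - b₂))), -((Complex.I / 2) • (c - c₂ + (b - b₂))),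
          -(Complex.I • (a - a₂)), 0] := rfl

/-- `𝔰𝔩(2) ⊕ 𝔰𝔩(2)` acts on `2 × 2` matrices by `Γ ↦ S Γ + Γ S̃ᵀ` and preserves the quadratic form
`det Γ`, whence the isomorphism with `𝔰𝔬(4)`. -/
theorem evenPartIsVectSO4GL1 : EvenPartIsVectSO4GL1 D := by
  refine ⟨(LinearEquiv.refl ℂ O).prodCongr
    ((LinearEquiv.prodAssoc ℂ _ _ _).symm.trans (so4OfSL2.prodCongr (LinearEquiv.refl ℂ O))),
    fun x => ⟨rfl, rfl⟩, ?_⟩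
  rintro ⟨V, S, St, U⟩ ⟨V', S', St', U'⟩
  refine ⟨rfl, ?_, rfl⟩
  obtain ⟨a, b, c, rfl⟩ := exists_sl2mk S
  obtain ⟨a₂, b₂, c₂, rfl⟩ := exists_sl2mk St
  obtain ⟨a', b', c', rfl⟩ := exists_sl2mk S'
  obtain ⟨a₂', b₂', c₂', rfl⟩ := exists_sl2mk St'
  rw [aN6_ee_eq]
  have hI : algebraMap ℂ O Complex.I * algebraMap ℂ O Complex.I = -1 := by
    rw [← map_mul, Complex.I_mul_I, map_neg, map_one]
  have h2 : 2 * algebraMap ℂ O 2⁻¹ = 1 := by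
    have : (2 : O) = algebraMap ℂ O 2 := (map_ofNat _ 2).symm
    rw [this, ← map_mul, mul_inv_cancel₀ two_ne_zero, map_one]
  change (so4OfSL2 (_, _)).1 = V • (so4OfSL2 (sl2mk a' b' c', sl2mk a₂' b₂' c₂')).1.map D
    - V' • (so4OfSL2 (sl2mk a b c, sl2mk a₂ b₂ c₂)).1.map D
    + ⁅(so4OfSL2 (sl2mk a b c, sl2mk a₂ b₂ c₂)).1, (so4OfSL2 (sl2mk a' b' c', sl2mk a₂' b₂' c₂')).1⁆
  simp only [so4OfSL2_mk, Ring.lie_def]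
  ext i j
  simp only [Matrix.add_apply, Matrix.sub_apply, Matrix.smul_apply, Matrix.map_apply,
    Matrix.mul_apply, Fin.sum_univ_four]
  fin_cases i <;> fin_cases j <;>
    simp only [Fin.zero_eta, Fin.mk_one, Fin.reduceFinMk, Matrix.of_apply, Matrix.cons_val,
      map_add, map_sub, map_neg, map_zero, Derivation.map_smul, smul_eq_mul] <;>
    simp only [Algebra.smul_def, div_eq_mul_inv, map_mul, map_neg] <;>
    grind

end

/-! ### The conformal algebra `K'₄` -/

section Modes
variable {O : Type*} [CommRing O] [Algebra ℂ O] (D : Derivation ℂ O O)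

/-- The operator `p(-D)`. -/
def polyOp : Polynomial ℂ →ₗ[ℂ] O →ₗ[ℂ] O :=
  (Polynomial.aeval (-(D : O →ₗ[ℂ] O)) : Polynomial ℂ →ₐ[ℂ] Module.End ℂ O).toLinearMap

theorem polyOp_one (f : O) : polyOp D 1 f = f := by simp [polyOp]

theorem polyOp_X_mul (p : Polynomial ℂ) (f : O) : polyOp D (X * p) f = -D (polyOp D p f) := by
  simp [polyOp]

theorem polyOp_mul_X (p : Polynomial ℂ) (f : O) : polyOp D (p * X) f = polyOp D p (-D f) := by
  simp [polyOp]

theorem polyOp_comm (p : Polynomial ℂ) (f : O) : D (polyOp D p f) = polyOp D p (D f) := by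
  have h := polyOp_X_mul D p f
  rw [mul_comm, polyOp_mul_X, map_neg, neg_inj] at h
  exact h.symm

theorem polyOp_C (c : ℂ) (f : O) : polyOp D (C c) f = c • f := by
  simp [polyOp, Polynomial.aeval_C, Module.algebraMap_end_apply]

theorem polyOp_X (f : O) : polyOp D X f = -D f := by simp [polyOp]

/-- `∑ λʲ cⱼ(∂) ↦ ∑ cⱼ(-D) (Dʲf · g)`. -/
def lamEval (f g : O) : Polynomial (Polynomial ℂ) →ₗ[ℂ] O :=
  Polynomial.lsum fun j => (LinearMap.applyₗ ((fun h => D h)^[j] f * g)) ∘ₗ polyOp D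

theorem lamEval_monomial (f g : O) (j : ℕ) (c : Polynomial ℂ) :
    lamEval D f g (Polynomial.monomial j c) = polyOp D c ((fun h => D h)^[j] f * g) := by
  simp [lamEval, Polynomial.lsum_apply]

theorem lamEval_eq_sum (f g : O) (L : Polynomial (Polynomial ℂ)) (n : ℕ) (hn : L.natDegree < n) :
    lamEval D f g L = ∑ j ∈ Finset.range n, polyOp D (L.coeff j) ((fun h => D h)^[j] f * g) := by
  conv_lhs => rw [L.as_sum_range' n hn]
  rw [map_sum]
  exact Finset.sum_congr rfl fun j _ => lamEval_monomial D f g j _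

theorem lamEval_add_left (f f' g : O) (L : Polynomial (Polynomial ℂ)) :
    lamEval D (f + f') g L = lamEval D f g L + lamEval D f' g L := by
  induction L using Polynomial.induction_on' with
  | add p q hp hq => simp only [map_add, hp, hq]; abel
  | monomial j c =>
    have : (fun h => D h)^[j] (f + f') = (fun h => D h)^[j] f + (fun h => D h)^[j] f' :=
      iterate_map_add D.toLinearMap j f f'
    simp only [lamEval_monomial, this, add_mul, map_add]

theorem lamEval_smul_left (r : ℂ) (f g : O) (L : Polynomial (Polynomial ℂ)) :
    lamEval D (r • f) g L = r • lamEval D f g L := by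
  induction L using Polynomial.induction_on' with
  | add p q hp hq => simp only [map_add, hp, hq, smul_add]
  | monomial j c =>
    have : (fun h => D h)^[j] (r • f) = r • (fun h => D h)^[j] f :=
      Function.Commute.iterate_left (f := fun h => D h) (g := fun h => r • h)
        (fun h => D.map_smul r h) j f
    simp only [lamEval_monomial, this, smul_mul_assoc, map_smul]

theorem lamEval_add_right (f g g' : O) (L : Polynomial (Polynomial ℂ)) :
    lamEval D f (g + g') L = lamEval D f g L + lamEval D f g' L := by
  induction L using Polynomial.induction_on' with
  | add p q hp hq => simp only [map_add, hp, hq]; abel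
  | monomial j c => simp only [lamEval_monomial, mul_add, map_add]

theorem lamEval_smul_right (r : ℂ) (f g : O) (L : Polynomial (Polynomial ℂ)) :
    lamEval D f (r • g) L = r • lamEval D f g L := by
  induction L using Polynomial.induction_on' with
  | add p q hp hq => simp only [map_add, hp, hq, smul_add]
  | monomial j c => simp only [lamEval_monomial, mul_smul_comm, map_smul]

theorem lamEval_X_mul (f g : O) (L : Polynomial (Polynomial ℂ)) :
    lamEval D f g (X * L) = lamEval D (D f) g L := by
  induction L using Polynomial.induction_on' with
  | add p q hp hq => simp only [mul_add, map_add, hp, hq]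
  | monomial j c =>
    rw [Polynomial.X_mul_monomial, lamEval_monomial, lamEval_monomial, Function.iterate_succ_apply]

theorem lamEval_C_mul (f g : O) (p : Polynomial ℂ) (L : Polynomial (Polynomial ℂ)) :
    lamEval D f g (C p * L) = polyOp D p (lamEval D f g L) := by
  induction L using Polynomial.induction_on' with
  | add p q hp hq => simp only [mul_add, map_add, hp, hq]
  | monomial j c =>
    rw [Polynomial.C_mul_monomial, lamEval_monomial, lamEval_monomial]
    simp [polyOp]

theorem lamEval_shift_mul (f g : O) (L : Polynomial (Polynomial ℂ)) :
    lamEval D f g ((C X + X) * L) = -lamEval D f (D g) L := by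
  induction L using Polynomial.induction_on' with
  | add p q hp hq => simp only [mul_add, map_add, hp, hq, neg_add]
  | monomial j c =>
    rw [add_mul, map_add, lamEval_C_mul, lamEval_X_mul, lamEval_monomial, lamEval_monomial,
      lamEval_monomial, polyOp_X, polyOp_comm, ← map_neg (polyOp D c), ← map_add,
      ← map_neg (polyOp D c)]
    congr 1
    rw [Derivation.leibniz, ← Function.iterate_succ_apply (fun h => D h),
      Function.iterate_succ_apply']
    simp only [smul_eq_mul]
    ring

/-- Sesquilinearity of the `λ`-bracket, after evaluation on functions. -/
theorem lamEval_sesqui (f g : O) (p q : Polynomial ℂ) (L : Polynomial (Polynomial ℂ)) :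
    lamEval D f g (Polynomial.aeval (-X : Polynomial (Polynomial ℂ)) p
      * Polynomial.aeval (C X + X : Polynomial (Polynomial ℂ)) q * L)
      = lamEval D (polyOp D p f) (polyOp D q g) L := by
  induction p using Polynomial.induction_on generalizing f with
  | add p p' hp hp' =>
    simp only [map_add, add_mul, hp, hp', LinearMap.add_apply, lamEval_add_left]
  | monomial n c ih =>
    have h : C c * X ^ (n + 1) = X * (C c * X ^ n) := by ring
    have hneg : ∀ M : Polynomial (Polynomial ℂ),
        lamEval D f g (-X * M) = -lamEval D (D f) g M := fun M => by
      rw [show -X * M = -(X * M) by ring, map_neg, lamEval_X_mul]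
    rw [h, map_mul (Polynomial.aeval _), Polynomial.aeval_X, mul_assoc,
      mul_assoc, hneg, ← mul_assoc, ih, mul_comm X, polyOp_mul_X,
      map_neg, ← neg_one_smul ℂ (polyOp D _ _), lamEval_smul_left, neg_one_smul]
  | C c =>
    rw [polyOp_C, lamEval_smul_left, Polynomial.aeval_C, mul_assoc, ← Algebra.smul_def, map_smul]
    congr 1
    induction q using Polynomial.induction_on generalizing g with
    | add p p' hp hp' =>
      simp only [map_add, add_mul, hp, hp', LinearMap.add_apply, lamEval_add_right]
    | monomial n c ih =>
      rw [pow_succ', ← mul_assoc, mul_comm (C c) X, mul_assoc,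
        map_mul (Polynomial.aeval _), Polynomial.aeval_X, mul_assoc, lamEval_shift_mul, ih, mul_comm X, polyOp_mul_X, map_neg,
        ← neg_one_smul ℂ (polyOp D _ _), lamEval_smul_right, neg_one_smul]
    | C c =>
      rw [polyOp_C, lamEval_smul_right, Polynomial.aeval_C, ← Algebra.smul_def, map_smul]

end Modes

section K4Algebra

/-- The `ξ₁ξ₂ξ₃ξ₄`-component of a bracket is divisible by `∂`: it only arises from `|I| + |J| = 4`, when
the coefficient of `λ` vanishes. -/
theorem lamStruct_univ (I J : Finset (Fin 4)) :
    lamStruct I J Finset.univ = C X * (if Disjoint I J ∧ Finset.univ = I ∪ J then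
      C (C (grSign I J * ((I.card : ℂ) / 2 - 1))) else 0) := by
  unfold lamStruct
  rw [Finset.sum_eq_zero, add_zero]
  · split_ifs with h
    · have hc : (I.card : ℂ) + J.card = 4 := by
        have := Finset.card_union_of_disjoint h.1
        rw [← h.2, Finset.card_univ, Fintype.card_fin] at this
        exact_mod_cast this.symm
      rw [hc]
      norm_num
      ring
    · rw [mul_zero]
  · intro i _
    rw [if_neg]
    rintro ⟨-, -, -, h⟩
    have := h ▸ Finset.mem_univ i
    simp at this

/-- The brackets with `1`, which produce every element of `K'₄`. -/
theorem lamStruct_empty (I K : Finset (Fin 4)) :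
    lamStruct ∅ I K = if K = I then -C (X : Polynomial ℂ) + C (C ((I.card : ℂ) / 2 - 2)) * X else 0 := by
  unfold lamStruct
  rw [Finset.sum_eq_zero fun i _ => if_neg (by simp), add_zero]
  simp only [Finset.disjoint_empty_left, Finset.empty_union, true_and]
  split_ifs with h
  · simp [grSign]
  · rfl

/-- The quotient of the `ξ₁ξ₂ξ₃ξ₄`-component of a `λ`-bracket by `∂`. -/
def lamBrTop (a b : K4) : Polynomial (Polynomial ℂ) :=
  ∑ I, ∑ J, Polynomial.aeval (-X : Polynomial (Polynomial ℂ)) (a I)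
    * Polynomial.aeval (C X + X : Polynomial (Polynomial ℂ)) (b J)
    * (if Disjoint I J ∧ Finset.univ = I ∪ J then
      C (C (grSign I J * ((I.card : ℂ) / 2 - 1))) else 0)

theorem lamBr_univ (a b : K4) : lamBr a b Finset.univ = C X * lamBrTop a b := by
  simp only [lamBr, lamBrTop, lamStruct_univ, Finset.mul_sum]
  refine Finset.sum_congr rfl fun I _ => Finset.sum_congr rfl fun J _ => ?_
  ring

theorem lamBr_single (I : Finset (Fin 4)) (p : Polynomial ℂ) :
    lamBr (Pi.single ∅ 1) (Pi.single I p) = Pi.single I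
      (Polynomial.aeval (C X + X : Polynomial (Polynomial ℂ)) p
        * (-C (X : Polynomial ℂ) + C (C ((I.card : ℂ) / 2 - 2)) * X)) := by
  funext K
  unfold lamBr
  rw [Finset.sum_eq_single ∅, Finset.sum_eq_single I]
  · rw [Pi.single_eq_same, Pi.single_eq_same, lamStruct_empty, map_one, one_mul]
    by_cases h : K = I
    · subst h; simp
    · simp [h]
  · intro J _ hJ; simp [Pi.single_eq_of_ne hJ]
  · simp
  · intro J _ hJ; simp [Pi.single_eq_of_ne hJ]
  · simp

theorem lamCoeff_single (j : ℕ) (I : Finset (Fin 4)) (p : Polynomial ℂ) :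
    lamCoeff j (Pi.single ∅ 1) (Pi.single I p) = Pi.single I
      ((Polynomial.aeval (C X + X : Polynomial (Polynomial ℂ)) p
        * (-C (X : Polynomial ℂ) + C (C ((I.card : ℂ) / 2 - 2)) * X)).coeff j) := by
  funext K
  unfold lamCoeff
  rw [lamBr_single]
  by_cases h : K = I
  · subst h; simp
  · simp [h]

theorem coeff_zero_aeval_shift (p : Polynomial ℂ) :
    (Polynomial.aeval (C X + X : Polynomial (Polynomial ℂ)) p).coeff 0 = p := by
  induction p using Polynomial.induction_on' with
  | add p q hp hq => rw [map_add, Polynomial.coeff_add, hp, hq]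
  | monomial n c =>
    rw [Polynomial.aeval_monomial, Polynomial.mul_coeff_zero, Polynomial.coeff_zero_eq_eval_zero,
      Polynomial.coeff_zero_eq_eval_zero, Polynomial.eval_pow]
    simp [Polynomial.C_mul_X_pow_eq_monomial]

theorem single_X_mul_mem (I : Finset (Fin 4)) (p : Polynomial ℂ) :
    (Pi.single I (X * p) : K4) ∈ K4' := by
  have h : (Pi.single I (-(X * p)) : K4) ∈ K4' := by
    refine Submodule.subset_span ⟨0, Pi.single ∅ 1, Pi.single I p, ?_⟩
    rw [lamCoeff_single, Polynomial.mul_coeff_zero, coeff_zero_aeval_shift]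
    congr 1
    simp
    ring
  have := K4'.neg_mem h
  rwa [← Pi.single_neg, neg_neg] at this

theorem single_mem (I : Finset (Fin 4)) (hI : I ≠ Finset.univ) (p : Polynomial ℂ) :
    (Pi.single I p : K4) ∈ K4' := by
  have hc : ((I.card : ℂ) / 2 - 2) ≠ 0 := by
    intro h
    have h4 : (I.card : ℂ) = (4 : ℕ) := by push_cast; linear_combination 2 * h
    exact hI ((Finset.card_eq_iff_eq_univ I).1 (by rw [Fintype.card_fin]; exact_mod_cast h4))
  set q := (Polynomial.aeval (C X + X : Polynomial (Polynomial ℂ)) p).coeff 1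
  have h1 : (Pi.single I (C ((I.card : ℂ) / 2 - 2) * p - X * q) : K4) ∈ K4' := by
    refine Submodule.subset_span ⟨1, Pi.single ∅ 1, Pi.single I p, ?_⟩
    rw [lamCoeff_single, Polynomial.mul_coeff_one, coeff_zero_aeval_shift]
    congr 1
    simp [Polynomial.coeff_X, q]
    ring
  have h2 := K4'.add_mem h1 (single_X_mul_mem I q)
  rw [← Pi.single_add, sub_add_cancel] at h2
  have h3 := K4'.smul_mem ((I.card : ℂ) / 2 - 2)⁻¹ h2
  rwa [← Pi.single_smul, ← Polynomial.smul_eq_C_mul, smul_smul, inv_mul_cancel₀ hc, one_smul] at h3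

/-- `K'₄` is cut out by divisibility of the `ξ₁ξ₂ξ₃ξ₄`-component by `∂`. -/
theorem mem_K4'_iff (a : K4) : a ∈ K4' ↔ (a Finset.univ).coeff 0 = 0 := by
  constructor
  · intro ha
    refine Submodule.span_induction (p := fun x _ => (x Finset.univ).coeff 0 = 0) ?_ ?_ ?_ ?_ ha
    · rintro x ⟨j, a, b, rfl⟩
      rw [lamCoeff, lamBr_univ, Polynomial.coeff_C_mul, Polynomial.mul_coeff_zero,
        Polynomial.coeff_X_zero, zero_mul]
    · simp
    · intro x y _ _ hx hy; simp [hx, hy]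
    · intro r x _ hx; simp [hx]
  · intro ha
    have : a = ∑ I, Pi.single I (a I) := (Finset.univ_sum_single a).symm
    rw [this]
    refine K4'.sum_mem fun I _ => ?_
    by_cases hI : I = Finset.univ
    · subst hI
      obtain ⟨q, hq⟩ := Polynomial.X_dvd_iff.2 ha
      rw [hq]
      exact single_X_mul_mem _ q
    · exact single_mem I hI _

end K4Algebra

/-! ### Modes of `K'₄` in coordinates -/

section ModeMap
variable {O : Type*} [CommRing O] [Algebra ℂ O] (D : Derivation ℂ O O)

theorem divX_X_mul (p : Polynomial ℂ) : (X * p).divX = p := by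
  ext n; simp

/-- The coordinates of an element of `K'₄` over `ℂ[∂]`, with respect to the free generators `ξ_I`,
`I` proper, and `∂ξ₁ξ₂ξ₃ξ₄`. -/
def k4Coord (I : Finset (Fin 4)) : K4 →ₗ[ℂ] Polynomial ℂ where
  toFun a := if I = Finset.univ then (a I).divX else a I
  map_add' a b := by split_ifs <;> simp [Polynomial.divX_add]
  map_smul' c a := by split_ifs <;> simp [Polynomial.smul_eq_C_mul, Polynomial.divX_C_mul]

/-- The element of `K'₄` with the given coordinate `p` along the generator with index `I`. -/
def k4Gen (I : Finset (Fin 4)) (p : Polynomial ℂ) : K4' :=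
  ⟨Pi.single I (if I = Finset.univ then X * p else p), by
    split_ifs with h
    · exact single_X_mul_mem I p
    · exact single_mem I h p⟩

theorem coe_k4Gen (I : Finset (Fin 4)) (p : Polynomial ℂ) :
    (k4Gen I p : K4) = Pi.single I (if I = Finset.univ then X * p else p) := rfl

theorem k4Gen_coord (a : K4') : a = ∑ I, k4Gen I (k4Coord I a) := by
  apply Subtype.ext
  rw [Submodule.coe_sum]
  conv_lhs => rw [← Finset.univ_sum_single (a : K4)]
  refine Finset.sum_congr rfl fun I _ => ?_
  rw [coe_k4Gen]
  congr 1
  split_ifs with h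
  · subst h
    have h0 := (mem_K4'_iff _).1 a.2
    have := Polynomial.divX_mul_X_add ((a : K4) Finset.univ)
    rw [h0, map_zero, add_zero, mul_comm] at this
    simp only [k4Coord, LinearMap.coe_mk, AddHom.coe_mk, if_true]
    exact this.symm
  · simp [k4Coord, h]

theorem k4Coord_k4Gen (I J : Finset (Fin 4)) (p : Polynomial ℂ) :
    k4Coord J (k4Gen I p : K4) = Pi.single (M := fun _ => Polynomial ℂ) I p J := by
  rw [coe_k4Gen]
  by_cases hJ : J = I
  · subst hJ
    by_cases h : J = Finset.univ <;> simp [k4Coord, h, divX_X_mul]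
  · simp [k4Coord, Pi.single_eq_of_ne hJ]

theorem k4Gen_add (I : Finset (Fin 4)) (p q : Polynomial ℂ) :
    k4Gen I (p + q) = k4Gen I p + k4Gen I q := by
  apply Subtype.ext
  rw [Submodule.coe_add, coe_k4Gen, coe_k4Gen, coe_k4Gen, ← Pi.single_add]
  congr 1
  split_ifs <;> ring

theorem k4Gen_smul (I : Finset (Fin 4)) (c : ℂ) (q : Polynomial ℂ) :
    k4Gen I (c • q) = c • k4Gen I q := by
  apply Subtype.ext
  rw [Submodule.coe_smul, coe_k4Gen, coe_k4Gen, ← Pi.single_smul]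
  congr 1
  split_ifs <;> simp

theorem k4Gen_X_mul (I : Finset (Fin 4)) (q : Polynomial ℂ) :
    (k4Gen I (X * q) : K4) = (X : Polynomial ℂ) • (k4Gen I q : K4) := by
  rw [coe_k4Gen, coe_k4Gen, ← Pi.single_smul]
  congr 1
  split_ifs <;> simp

/-- The coordinates `a ⊗ f ↦ a_I(-D) f` of the class of `a ⊗ f`. -/
def modeCoord : K4' ⊗[ℂ] O →ₗ[ℂ] (Finset (Fin 4) → O) :=
  LinearMap.pi fun I => TensorProduct.lift (polyOp D ∘ₗ k4Coord I ∘ₗ K4'.subtype)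

theorem modeCoord_tmul (a : K4') (f : O) (I : Finset (Fin 4)) :
    modeCoord D (a ⊗ₜ f) I = polyOp D (k4Coord I a) f := rfl

theorem k4Coord_X_smul (a : K4') (I : Finset (Fin 4)) :
    k4Coord I ((X : Polynomial ℂ) • (a : K4)) = X * k4Coord I a := by
  simp only [k4Coord, LinearMap.coe_mk, AddHom.coe_mk, Pi.smul_apply, smul_eq_mul]
  split_ifs with h
  · subst h
    have h0 := (mem_K4'_iff _).1 a.2
    have := Polynomial.divX_mul_X_add ((a : K4) Finset.univ)
    rw [h0, map_zero, add_zero, mul_comm] at this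
    rw [this, divX_X_mul]
  · rfl

variable (O) in
/-- The right inverse of `modeCoord` given by the free generators. -/
def modeSection : (Finset (Fin 4) → O) →ₗ[ℂ] K4' ⊗[ℂ] O :=
  ∑ I, TensorProduct.mk ℂ K4' O (k4Gen I 1) ∘ₗ LinearMap.proj I

theorem modeSection_apply (F : Finset (Fin 4) → O) :
    modeSection O F = ∑ I, k4Gen I 1 ⊗ₜ[ℂ] F I := by
  simp [modeSection]

theorem modeCoord_modeSection (F : Finset (Fin 4) → O) : modeCoord D (modeSection O F) = F := by
  funext J
  rw [modeSection_apply, map_sum, Finset.sum_apply, Finset.sum_eq_single J]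
  · rw [modeCoord_tmul, k4Coord_k4Gen, Pi.single_eq_same, polyOp_one]
  · intro I _ hI
    rw [modeCoord_tmul, k4Coord_k4Gen, Pi.single_eq_of_ne hI.symm, map_zero, LinearMap.zero_apply]
  · simp

/-- The relations `∂a ⊗ f + a ⊗ Df`. -/
def modeRel : Submodule ℂ (K4' ⊗[ℂ] O) := Submodule.span ℂ
  {t | ∃ (a a' : K4') (f : O), (a' : K4) = (X : Polynomial ℂ) • (a : K4) ∧
    t = a' ⊗ₜ[ℂ] f + a ⊗ₜ[ℂ] D f}

/-- Modulo the relations, `p(∂)ξ_I ⊗ f` is `ξ_I ⊗ p(-D)f`. -/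
theorem k4Gen_tmul_sub_mem (I : Finset (Fin 4)) (p : Polynomial ℂ) (f : O) :
    k4Gen I p ⊗ₜ[ℂ] f + (-1 : ℂ) • (k4Gen I 1 ⊗ₜ[ℂ] polyOp D p f) ∈ modeRel D := by
  induction p using Polynomial.induction_on generalizing f with
  | add p q hp hq =>
    rw [k4Gen_add, map_add, LinearMap.add_apply, TensorProduct.add_tmul, TensorProduct.tmul_add,
      smul_add, add_add_add_comm]
    exact add_mem (hp f) (hq f)
  | C c =>
    rw [polyOp_C, TensorProduct.tmul_smul, TensorProduct.smul_tmul', ← k4Gen_smul,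
      Polynomial.smul_eq_C_mul, mul_one]
    convert zero_mem (modeRel D) using 1
    module
  | monomial n c ih =>
    have h : C c * X ^ (n + 1) = X * (C c * X ^ n) := by ring
    have h1 : k4Gen I (X * (C c * X ^ n)) ⊗ₜ[ℂ] f + k4Gen I (C c * X ^ n) ⊗ₜ[ℂ] D f ∈ modeRel D :=
      Submodule.subset_span ⟨_, _, f, k4Gen_X_mul I _, rfl⟩
    have h2 := add_mem h1 (Submodule.smul_mem _ (-1 : ℂ) (ih (D f)))
    rw [h, polyOp_X_mul, polyOp_comm, ← neg_one_smul ℂ (polyOp D _ _), TensorProduct.tmul_smul]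
    convert h2 using 1
    module

/-- As `K'₄` is free over `ℂ[∂]` on eight even and eight odd generators, its modes are families of
sixteen functions. -/
theorem ker_modeCoord : LinearMap.ker (modeCoord D) = modeRel D := by
  apply le_antisymm
  · have key : ∀ t, t + (-1 : ℂ) • modeSection O (modeCoord D t) ∈ modeRel D := by
      intro t
      induction t using TensorProduct.induction_on with
      | zero => simp
      | add x y hx hy =>
        rw [map_add, map_add, smul_add, add_add_add_comm]
        exact add_mem hx hy
      | tmul a f =>
        rw [modeSection_apply]
        have h : a ⊗ₜ[ℂ] f = ∑ I, k4Gen I (k4Coord I a) ⊗ₜ[ℂ] f := by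
          conv_lhs => rw [k4Gen_coord a]
          rw [TensorProduct.sum_tmul]
        rw [h, Finset.smul_sum, ← Finset.sum_add_distrib]
        refine sum_mem fun I _ => ?_
        rw [← h, modeCoord_tmul]
        exact k4Gen_tmul_sub_mem D I _ f
    intro t ht
    have := key t
    rwa [LinearMap.mem_ker.1 ht, map_zero, smul_zero, add_zero] at this
  · refine Submodule.span_le.2 ?_
    rintro t ⟨a, a', f, h, rfl⟩
    rw [SetLike.mem_coe, LinearMap.mem_ker]
    funext I
    rw [map_add, Pi.add_apply, modeCoord_tmul, modeCoord_tmul, h, k4Coord_X_smul, polyOp_X_mul,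
      polyOp_comm, Pi.zero_apply, neg_add_cancel]

/-- The coefficient functions of `∑ a_I ⊗ f` with respect to the `ξ_I`; the coordinate `F_⊤` along
`∂ξ₁ξ₂ξ₃ξ₄` contributes `-D F_⊤`. -/
def fullCoord (F : Finset (Fin 4) → O) (I : Finset (Fin 4)) : O :=
  if I = Finset.univ then -D (F I) else F I

theorem polyOp_apply_eq (a : K4') (f : O) (I : Finset (Fin 4)) :
    polyOp D ((a : K4) I) f = fullCoord D (modeCoord D (a ⊗ₜ f)) I := by
  unfold fullCoord
  rw [modeCoord_tmul]
  split_ifs with h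
  · subst h
    have h0 := (mem_K4'_iff _).1 a.2
    have := Polynomial.divX_mul_X_add ((a : K4) Finset.univ)
    rw [h0, map_zero, add_zero, mul_comm] at this
    simp only [k4Coord, LinearMap.coe_mk, AddHom.coe_mk, if_true]
    rw [← polyOp_X_mul, this]
  · simp [k4Coord, h]

/-- The coordinates of a bracket of modes in terms of those of its arguments. -/
def modeBr (F G : Finset (Fin 4) → O) (K : Finset (Fin 4)) : O :=
  if K = Finset.univ then
    ∑ I ∈ K.powerset, (grSign I (K \ I) * ((I.card : ℂ) / 2 - 1)) • (fullCoord D F I * fullCoord D G (K \ I))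
  else
    ∑ I ∈ K.powerset, grSign I (K \ I) •
        (-((I.card : ℂ) / 2 - 1) • D (fullCoord D F I * fullCoord D G (K \ I))
          + (((I.card : ℂ) + ((K \ I).card : ℂ)) / 2 - 2) • (D (fullCoord D F I) * fullCoord D G (K \ I)))
    + ∑ i, if i ∈ K then 0 else ∑ I ∈ K.powerset,
        ((-1) ^ (insert i I).card / 2 * (derSign i (insert i I) * derSign i (insert i (K \ I))
          * grSign I (K \ I))) • (fullCoord D F (insert i I) * fullCoord D G (insert i (K \ I)))

theorem sum_disjoint_union {M : Type*} [AddCommMonoid M] (K : Finset (Fin 4))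
    (h : Finset (Fin 4) → Finset (Fin 4) → M) :
    ∑ I, ∑ J, (if Disjoint I J ∧ K = I ∪ J then h I J else 0) = ∑ I ∈ K.powerset, h I (K \ I) := by
  rw [← Finset.sum_filter_add_sum_filter_not Finset.univ (fun I => I ⊆ K)]
  have h2 : Finset.univ.filter (fun I => I ⊆ K) = K.powerset := by ext; simp
  rw [h2, Finset.sum_eq_zero (s := Finset.univ.filter fun I => ¬I ⊆ K), add_zero]
  · refine Finset.sum_congr rfl fun I hI => ?_
    rw [Finset.mem_powerset] at hI
    rw [Finset.sum_eq_single (K \ I)]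
    · rw [if_pos ⟨Finset.disjoint_sdiff, (Finset.union_sdiff_of_subset hI).symm⟩]
    · rintro J - hJ
      refine if_neg ?_
      rintro ⟨h1, h2⟩
      exact hJ (by rw [h2, Finset.union_sdiff_cancel_left h1])
    · simp
  · intro I hI
    refine Finset.sum_eq_zero fun J _ => if_neg ?_
    rintro ⟨-, rfl⟩
    simp at hI

theorem sum_meet_once {M : Type*} [AddCommMonoid M] (K : Finset (Fin 4)) (i : Fin 4)
    (h : Finset (Fin 4) → Finset (Fin 4) → M) :
    ∑ I, ∑ J, (if i ∈ I ∧ i ∈ J ∧ Disjoint (I.erase i) (J.erase i) ∧ K = I.erase i ∪ J.erase i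
        then h I J else 0)
      = if i ∈ K then 0 else ∑ I ∈ K.powerset, h (insert i I) (insert i (K \ I)) := by
  split_ifs with hi
  · refine Finset.sum_eq_zero fun I _ => Finset.sum_eq_zero fun J _ => if_neg ?_
    rintro ⟨-, -, -, rfl⟩
    simp at hi
  rw [← sum_disjoint_union K fun I J => h (insert i I) (insert i J), ← Finset.sum_product',
    ← Finset.sum_product', ← Finset.sum_filter, ← Finset.sum_filter]
  symm
  refine Finset.sum_bij' (fun p _ => (insert i p.1, insert i p.2))
    (fun p _ => (p.1.erase i, p.2.erase i)) ?_ ?_ ?_ ?_ ?_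
  · rintro ⟨I, J⟩ hp
    simp only [Finset.univ_product_univ, Finset.mem_filter, Finset.mem_univ, true_and] at hp ⊢
    obtain ⟨h1, rfl⟩ := hp
    rw [Finset.mem_union, not_or] at hi
    refine ⟨Finset.mem_insert_self _ _, Finset.mem_insert_self _ _, ?_, ?_⟩ <;>
      rw [Finset.erase_insert hi.1, Finset.erase_insert hi.2]
    exact h1
  · rintro ⟨I, J⟩ hp
    simp only [Finset.univ_product_univ, Finset.mem_filter, Finset.mem_univ, true_and] at hp ⊢
    exact ⟨hp.2.2.1, hp.2.2.2⟩
  · rintro ⟨I, J⟩ hp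
    simp only [Finset.univ_product_univ, Finset.mem_filter, Finset.mem_univ, true_and] at hp ⊢
    obtain ⟨h1, rfl⟩ := hp
    rw [Finset.mem_union, not_or] at hi
    rw [Finset.erase_insert hi.1, Finset.erase_insert hi.2]
  · rintro ⟨I, J⟩ hp
    simp only [Finset.univ_product_univ, Finset.mem_filter, Finset.mem_univ, true_and] at hp ⊢
    rw [Finset.insert_erase hp.1, Finset.insert_erase hp.2.1]
  · rintro ⟨I, J⟩ hp
    rfl

theorem lamEval_lamStruct (f g : O) (I J K : Finset (Fin 4)) :
    lamEval D f g (lamStruct I J K) =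
      (if Disjoint I J ∧ K = I ∪ J then grSign I J •
        (-((I.card : ℂ) / 2 - 1) • D (f * g)
          + (((I.card : ℂ) + (J.card : ℂ)) / 2 - 2) • (D f * g)) else 0)
      + ∑ i : Fin 4, (if i ∈ I ∧ i ∈ J ∧ Disjoint (I.erase i) (J.erase i) ∧
          K = I.erase i ∪ J.erase i then
        ((-1) ^ I.card / 2 * (derSign i I * derSign i J * grSign (I.erase i) (J.erase i))) • (f * g)
        else 0) := by
  have h0 : lamEval D f g 1 = f * g := by
    have := lamEval_monomial D f g 0 1
    rwa [Polynomial.monomial_zero_one, polyOp_one] at this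
  have hX : lamEval D f g X = D f * g := by
    rw [← mul_one X, lamEval_X_mul]
    have := lamEval_monomial D (D f) g 0 1
    rwa [Polynomial.monomial_zero_one, polyOp_one] at this
  have hC : ∀ c : ℂ, lamEval D f g (C (C c)) = c • (f * g) := fun c => by
    rw [← mul_one (C (C c)), lamEval_C_mul, h0, polyOp_C]
  unfold lamStruct
  rw [map_add, map_sum]
  congr 1
  · split_ifs
    · rw [lamEval_C_mul, polyOp_C, map_add, lamEval_C_mul, hX, polyOp_C]
      congr 2
      have h := lamEval_C_mul D f g (C ((I.card : ℂ) / 2 - 1) * X) 1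
      rw [mul_one, h0] at h
      rw [h, mul_comm, polyOp_X_mul, polyOp_C, Derivation.map_smul, neg_smul]
    · exact map_zero _
  · refine Finset.sum_congr rfl fun i _ => ?_
    split_ifs
    · exact hC _
    · exact map_zero _

/-- The bracket of modes in coordinates. The coordinate along `∂ξ₁ξ₂ξ₃ξ₄` is obtained by dividing the
`λ`-bracket by `∂`, which is the reason for the separate case in `modeBr`. -/
theorem sum_polyOp_lamCoeff (a b : K4') (f g : O) (K : Finset (Fin 4)) (n : ℕ)
    (hn : (lamBr a b K).natDegree < n) (hn' : (lamBrTop a b).natDegree < n) :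
    ∑ j ∈ Finset.range n, modeCoord D (lamCoeff' j a b ⊗ₜ ((fun h => D h)^[j] f * g)) K
      = modeBr D (modeCoord D (a ⊗ₜ f)) (modeCoord D (b ⊗ₜ g)) K := by
  unfold modeBr
  split_ifs with hK
  · subst hK
    have hj : ∀ j, k4Coord Finset.univ (lamCoeff' j a b : K4) = (lamBrTop a b).coeff j := by
      intro j
      simp only [k4Coord, LinearMap.coe_mk, AddHom.coe_mk, if_true, lamCoeff', lamCoeff,
        lamBr_univ, Polynomial.coeff_C_mul]
      rw [divX_X_mul]
    simp only [modeCoord_tmul, hj]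
    rw [← lamEval_eq_sum D f g _ n hn', lamBrTop, map_sum]
    simp only [map_sum, lamEval_sesqui, polyOp_apply_eq]
    rw [← sum_disjoint_union Finset.univ fun I J => (grSign I J * ((I.card : ℂ) / 2 - 1)) •
      (fullCoord D (modeCoord D (a ⊗ₜ f)) I * fullCoord D (modeCoord D (b ⊗ₜ g)) J)]
    refine Finset.sum_congr rfl fun I _ => Finset.sum_congr rfl fun J _ => ?_
    split_ifs
    · have h := lamEval_monomial D (fullCoord D (modeCoord D (a ⊗ₜ f)) I)
        (fullCoord D (modeCoord D (b ⊗ₜ g)) J) 0 (C (grSign I J * ((I.card : ℂ) / 2 - 1)))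
      rwa [Polynomial.monomial_zero_left, polyOp_C] at h
    · exact map_zero _
  · have hj : ∀ j, k4Coord K (lamCoeff' j a b : K4) = (lamBr a b K).coeff j := by
      intro j
      simp [k4Coord, hK, lamCoeff', lamCoeff]
    simp only [modeCoord_tmul, hj]
    rw [← lamEval_eq_sum D f g _ n hn, lamBr, map_sum]
    simp only [map_sum, lamEval_sesqui, polyOp_apply_eq, lamEval_lamStruct, Finset.sum_add_distrib]
    rw [sum_disjoint_union K fun I J => grSign I J •
        (-((I.card : ℂ) / 2 - 1) • D (fullCoord D (modeCoord D (a ⊗ₜ f)) I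
            * fullCoord D (modeCoord D (b ⊗ₜ g)) J)
          + (((I.card : ℂ) + (J.card : ℂ)) / 2 - 2) • (D (fullCoord D (modeCoord D (a ⊗ₜ f)) I)
            * fullCoord D (modeCoord D (b ⊗ₜ g)) J))]
    congr 1
    have hcomm : ∀ h : Finset (Fin 4) → Finset (Fin 4) → Fin 4 → O,
        ∑ I, ∑ J, ∑ i, h I J i = ∑ i, ∑ I, ∑ J, h I J i := fun h => by
      rw [Finset.sum_comm]
      simp only [Finset.sum_comm (s := Finset.univ (α := Finset (Fin 4))) (t := Finset.univ (α := Fin 4))]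
      exact Finset.sum_congr rfl fun i _ => Finset.sum_comm
    rw [hcomm]
    refine Finset.sum_congr rfl fun i _ => ?_
    rw [sum_meet_once K i fun I J =>
      ((-1) ^ I.card / 2 * (derSign i I * derSign i J * grSign (I.erase i) (J.erase i))) •
        (fullCoord D (modeCoord D (a ⊗ₜ f)) I * fullCoord D (modeCoord D (b ⊗ₜ g)) J)]
    split_ifs with hi
    · rfl
    · refine Finset.sum_congr rfl fun I hI => ?_
      rw [Finset.mem_powerset] at hI
      rw [Finset.erase_insert fun h => hi (hI h),
        Finset.erase_insert fun h => hi (Finset.sdiff_subset h)]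

end ModeMap

/-! ### Modes of `K'₄` and `𝔞_{𝒩=6}` -/

section K4Bracket
variable {O : Type*} [CommRing O] [Algebra ℂ O] (D : Derivation ℂ O O)

theorem neg_one_pow_ite (n : ℕ) : (-1 : ℂ) ^ n = if Even n then 1 else -1 := by
  split_ifs with h
  · exact h.neg_one_pow
  · exact (Nat.not_even_iff_odd.1 h).neg_one_pow

theorem card_fin4 (I : Finset (Fin 4)) : (I.card : ℂ) =
    (if 0 ∈ I then 1 else 0) + (if 1 ∈ I then 1 else 0) + (if 2 ∈ I then 1 else 0)
      + (if 3 ∈ I then 1 else 0) := by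
  have h : I.card = ∑ i, if i ∈ I then 1 else 0 := by simp
  rw [h, Fin.sum_univ_four]
  push_cast
  rfl

theorem finset_fin4_cases (I : Finset (Fin 4)) :
    I = ∅ ∨ I = {0} ∨ I = {1} ∨ I = {2} ∨ I = {3} ∨ I = {0, 1} ∨ I = {0, 2} ∨ I = {0, 3}
      ∨ I = {1, 2} ∨ I = {1, 3} ∨ I = {2, 3} ∨ I = {0, 1, 2} ∨ I = {0, 1, 3} ∨ I = {0, 2, 3}
      ∨ I = {1, 2, 3} ∨ I = Finset.univ := by
  revert I
  decide

/-- A case distinction that determines the value of a function of subsets of `Fin 4`. -/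
theorem fullCoord_ite (F : Finset (Fin 4) → O) (I : Finset (Fin 4)) : fullCoord D F I =
    if 0 ∈ I then
      if 1 ∈ I then
        if 2 ∈ I then if 3 ∈ I then -D (F Finset.univ) else F {0, 1, 2}
        else if 3 ∈ I then F {0, 1, 3} else F {0, 1}
      else
        if 2 ∈ I then if 3 ∈ I then F {0, 2, 3} else F {0, 2}
        else if 3 ∈ I then F {0, 3} else F {0}
    else
      if 1 ∈ I then
        if 2 ∈ I then if 3 ∈ I then F {1, 2, 3} else F {1, 2}
        else if 3 ∈ I then F {1, 3} else F {1}
      else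
        if 2 ∈ I then if 3 ∈ I then F {2, 3} else F {2}
        else if 3 ∈ I then F {3} else F ∅ := by
  rcases finset_fin4_cases I with h | h | h | h | h | h | h | h | h | h | h | h | h | h | h | h <;>
    subst h <;> simp (decide := true) only [fullCoord, if_true, if_false]

/-- The element of `𝔞_{𝒩=6}` with given coordinates. The coordinate along `1` is the vector field,
those along the `ξ_i` are the components of `Γ` in a basis of matrices that is orthogonal for the
quadratic form `det Γ`, the quadratic ones are the self-dual and anti-self-dual parts of a
skew-symmetric matrix, the cubic ones give `Σ`, and `∂ξ₁ξ₂ξ₃ξ₄` gives `𝔤𝔩(1)`. -/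
def assemble : (Finset (Fin 4) → O) →ₗ[ℂ] AEven O × AOdd O where
  toFun F :=
    ((F ∅,
      sl2mk ((4⁻¹ : ℂ) • (Complex.I • F {0, 1} + Complex.I • F {2, 3}))
        ((4⁻¹ : ℂ) • (-(Complex.I • F {0, 2}) + F {0, 3} + F {1, 2} + Complex.I • F {1, 3}))
        ((4⁻¹ : ℂ) • (-(Complex.I • F {0, 2}) - F {0, 3} - F {1, 2} + Complex.I • F {1, 3})),
      sl2mk ((4⁻¹ : ℂ) • (Complex.I • F {0, 1} - Complex.I • F {2, 3}))
        ((4⁻¹ : ℂ) • (-(Complex.I • F {0, 2}) - F {0, 3} + F {1, 2} - Complex.I • F {1, 3}))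
        ((4⁻¹ : ℂ) • (-(Complex.I • F {0, 2}) + F {0, 3} - F {1, 2} - Complex.I • F {1, 3})),
      (4⁻¹ : ℂ) • F Finset.univ),
     !![(2⁻¹ : ℂ) • (Complex.I • F {0} - F {1}), (2⁻¹ : ℂ) • (F {2} + Complex.I • F {3});
        (2⁻¹ : ℂ) • (F {2} - Complex.I • F {3}), (2⁻¹ : ℂ) • (Complex.I • F {0} + F {1})],
     !![(4⁻¹ : ℂ) • (-F {0, 2, 3} + Complex.I • F {1, 2, 3}),
        (4⁻¹ : ℂ) • (-(Complex.I • F {0, 1, 2}) - F {0, 1, 3});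
        (4⁻¹ : ℂ) • (Complex.I • F {0, 1, 2} - F {0, 1, 3}),
        (4⁻¹ : ℂ) • (F {0, 2, 3} + Complex.I • F {1, 2, 3})])
  map_add' F G := by
    simp only [Prod.mk_add_mk, sl2mk_add, m2_add, Prod.mk.injEq, sl2mk_inj, m2_inj, Pi.add_apply]
    refine ⟨⟨trivial, ⟨?_, ?_, ?_⟩, ⟨?_, ?_, ?_⟩, ?_⟩, ⟨?_, ?_, ?_, ?_⟩, ⟨?_, ?_, ?_, ?_⟩⟩ <;> module
  map_smul' c F := by
    simp only [Prod.smul_mk, sl2mk_smul, m2_smul, Prod.mk.injEq, sl2mk_inj, m2_inj, Pi.smul_apply,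
      RingHom.id_apply]
    refine ⟨⟨trivial, ⟨?_, ?_, ?_⟩, ⟨?_, ?_, ?_⟩, ?_⟩, ⟨?_, ?_, ?_, ?_⟩, ⟨?_, ?_, ?_, ?_⟩⟩ <;> module

theorem assemble_apply (F : Finset (Fin 4) → O) : assemble F =
    ((F ∅,
      sl2mk ((4⁻¹ : ℂ) • (Complex.I • F {0, 1} + Complex.I • F {2, 3}))
        ((4⁻¹ : ℂ) • (-(Complex.I • F {0, 2}) + F {0, 3} + F {1, 2} + Complex.I • F {1, 3}))
        ((4⁻¹ : ℂ) • (-(Complex.I • F {0, 2}) - F {0, 3} - F {1, 2} + Complex.I • F {1, 3})),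
      sl2mk ((4⁻¹ : ℂ) • (Complex.I • F {0, 1} - Complex.I • F {2, 3}))
        ((4⁻¹ : ℂ) • (-(Complex.I • F {0, 2}) - F {0, 3} + F {1, 2} - Complex.I • F {1, 3}))
        ((4⁻¹ : ℂ) • (-(Complex.I • F {0, 2}) + F {0, 3} - F {1, 2} - Complex.I • F {1, 3})),
      (4⁻¹ : ℂ) • F Finset.univ),
     !![(2⁻¹ : ℂ) • (Complex.I • F {0} - F {1}), (2⁻¹ : ℂ) • (F {2} + Complex.I • F {3});
        (2⁻¹ : ℂ) • (F {2} - Complex.I • F {3}), (2⁻¹ : ℂ) • (Complex.I • F {0} + F {1})],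
     !![(4⁻¹ : ℂ) • (-F {0, 2, 3} + Complex.I • F {1, 2, 3}),
        (4⁻¹ : ℂ) • (-(Complex.I • F {0, 1, 2}) - F {0, 1, 3});
        (4⁻¹ : ℂ) • (Complex.I • F {0, 1, 2} - F {0, 1, 3}),
        (4⁻¹ : ℂ) • (F {0, 2, 3} + Complex.I • F {1, 2, 3})]) := rfl

variable (O) in
theorem assemble_injective : Function.Injective (assemble (O := O)) := by
  rw [← LinearMap.ker_eq_bot, LinearMap.ker_eq_bot']
  intro F hF
  have h0 : (0 : AEven O × AOdd O)
      = ((0, sl2mk 0 0 0, sl2mk 0 0 0, 0), !![0, 0; 0, 0], !![0, 0; 0, 0]) := by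
    refine Prod.ext (Prod.ext rfl (Prod.ext sl2mk_zero (Prod.ext sl2mk_zero rfl)))
      (Prod.ext ?_ ?_) <;> ext i j <;> fin_cases i <;> fin_cases j <;> rfl
  have hI := Complex.I_mul_I
  have hz : ∀ x : O, Complex.I • x = 0 → x = 0 := fun x hx =>
    (smul_eq_zero_iff_right Complex.I_ne_zero).1 hx
  simp only [assemble_apply, h0, Prod.mk.injEq, sl2mk_inj, m2_inj] at hF
  obtain ⟨⟨e0, ⟨a1, a2, a3⟩, ⟨b1, b2, b3⟩, u⟩, ⟨g1, g2, g3, g4⟩, s1, s2, s3, s4⟩ := hF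
  funext I
  rw [Pi.zero_apply]
  rcases finset_fin4_cases I with h | h | h | h | h | h | h | h | h | h | h | h | h | h | h | h <;>
    subst h
  · exact e0
  · apply hz; linear_combination (norm := module) (1 : ℂ) • g1 + (1 : ℂ) • g4
  · linear_combination (norm := module) (1 : ℂ) • g4 - (1 : ℂ) • g1
  · linear_combination (norm := module) (1 : ℂ) • g2 + (1 : ℂ) • g3
  · apply hz; linear_combination (norm := module) (1 : ℂ) • g2 - (1 : ℂ) • g3
  · apply hz; linear_combination (norm := module) (2 : ℂ) • a1 + (2 : ℂ) • b1
  · apply hz; linear_combination (norm := module) (-1 : ℂ) • a2 - (1 : ℂ) • a3 - (1 : ℂ) • b2 - (1 : ℂ) • b3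
  · linear_combination (norm := module) (1 : ℂ) • a2 - (1 : ℂ) • a3 - (1 : ℂ) • b2 + (1 : ℂ) • b3
  · linear_combination (norm := module) (1 : ℂ) • a2 - (1 : ℂ) • a3 + (1 : ℂ) • b2 - (1 : ℂ) • b3
  · apply hz; linear_combination (norm := module) (1 : ℂ) • a2 + (1 : ℂ) • a3 - (1 : ℂ) • b2 - (1 : ℂ) • b3
  · apply hz; linear_combination (norm := module) (2 : ℂ) • a1 - (2 : ℂ) • b1
  · apply hz; linear_combination (norm := module) (2 : ℂ) • s3 - (2 : ℂ) • s2
  · linear_combination (norm := module) (-2 : ℂ) • s3 - (2 : ℂ) • s2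
  · linear_combination (norm := module) (2 : ℂ) • s4 - (2 : ℂ) • s1
  · apply hz; linear_combination (norm := module) (2 : ℂ) • s1 + (2 : ℂ) • s4
  · linear_combination (norm := module) (4 : ℂ) • u

theorem assemble_surjective : Function.Surjective (assemble (O := O)) := by
  rintro ⟨⟨V, S, St, U⟩, G, T⟩
  obtain ⟨a, b, c, rfl⟩ := exists_sl2mk S
  obtain ⟨a₂, b₂, c₂, rfl⟩ := exists_sl2mk St
  obtain ⟨g₁, g₂, g₃, g₄, rfl⟩ := exists_mat G
  obtain ⟨s₁, s₂, s₃, s₄, rfl⟩ := exists_mat T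
  have hI := Complex.I_mul_I
  refine ⟨fun I => if I = ∅ then V else if I = {0} then -Complex.I • (g₁ + g₄)
    else if I = {1} then g₄ - g₁ else if I = {2} then g₂ + g₃
    else if I = {3} then -Complex.I • (g₂ - g₃)
    else if I = {0, 1} then -Complex.I • (2 : ℂ) • (a + a₂)
    else if I = {0, 2} then Complex.I • (b + c + b₂ + c₂)
    else if I = {0, 3} then b - c - b₂ + c₂
    else if I = {1, 2} then b - c + b₂ - c₂
    else if I = {1, 3} then -Complex.I • (b + c - b₂ - c₂)
    else if I = {2, 3} then -Complex.I • (2 : ℂ) • (a - a₂)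
    else if I = {0, 1, 2} then -Complex.I • (2 : ℂ) • (s₃ - s₂)
    else if I = {0, 1, 3} then (-2 : ℂ) • (s₃ + s₂)
    else if I = {0, 2, 3} then (2 : ℂ) • (s₄ - s₁)
    else if I = {1, 2, 3} then -Complex.I • (2 : ℂ) • (s₄ + s₁)
    else (4 : ℂ) • U, ?_⟩
  simp (decide := true) only [assemble_apply, Prod.mk.injEq, sl2mk_inj, m2_inj, if_true, if_false]
  refine ⟨⟨trivial, ⟨?_, ?_, ?_⟩, ⟨?_, ?_, ?_⟩, ?_⟩, ⟨?_, ?_, ?_, ?_⟩, ⟨?_, ?_, ?_, ?_⟩⟩ <;>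
    match_scalars <;> grind

/-- Sums over the subsets of each of the subsets of `Fin 4`. -/
theorem sum_powerset_fin4 {M : Type*} [AddCommMonoid M] (f : Finset (Fin 4) → M) :
    (∑ I ∈ Finset.powerset (∅ : Finset (Fin 4)), f I = f ∅) ∧
    (∑ I ∈ Finset.powerset ({0} : Finset (Fin 4)), f I = f ∅ + f {0}) ∧
    (∑ I ∈ Finset.powerset ({1} : Finset (Fin 4)), f I = f ∅ + f {1}) ∧
    (∑ I ∈ Finset.powerset ({2} : Finset (Fin 4)), f I = f ∅ + f {2}) ∧
    (∑ I ∈ Finset.powerset ({3} : Finset (Fin 4)), f I = f ∅ + f {3}) ∧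
    (∑ I ∈ Finset.powerset ({0, 1} : Finset (Fin 4)), f I = f ∅ + f {0} + f {1} + f {0, 1}) ∧
    (∑ I ∈ Finset.powerset ({0, 2} : Finset (Fin 4)), f I = f ∅ + f {0} + f {2} + f {0, 2}) ∧
    (∑ I ∈ Finset.powerset ({0, 3} : Finset (Fin 4)), f I = f ∅ + f {0} + f {3} + f {0, 3}) ∧
    (∑ I ∈ Finset.powerset ({1, 2} : Finset (Fin 4)), f I = f ∅ + f {1} + f {2} + f {1, 2}) ∧
    (∑ I ∈ Finset.powerset ({1, 3} : Finset (Fin 4)), f I = f ∅ + f {1} + f {3} + f {1, 3}) ∧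
    (∑ I ∈ Finset.powerset ({2, 3} : Finset (Fin 4)), f I = f ∅ + f {2} + f {3} + f {2, 3}) ∧
    (∑ I ∈ Finset.powerset ({0, 1, 2} : Finset (Fin 4)), f I = f ∅ + f {0} + f {1} + f {2} + f {0, 1} + f {0, 2} + f {1, 2} + f {0, 1, 2}) ∧
    (∑ I ∈ Finset.powerset ({0, 1, 3} : Finset (Fin 4)), f I = f ∅ + f {0} + f {1} + f {3} + f {0, 1} + f {0, 3} + f {1, 3} + f {0, 1, 3}) ∧
    (∑ I ∈ Finset.powerset ({0, 2, 3} : Finset (Fin 4)), f I = f ∅ + f {0} + f {2} + f {3} + f {0, 2} + f {0, 3} + f {2, 3} + f {0, 2, 3}) ∧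
    (∑ I ∈ Finset.powerset ({1, 2, 3} : Finset (Fin 4)), f I = f ∅ + f {1} + f {2} + f {3} + f {1, 2} + f {1, 3} + f {2, 3} + f {1, 2, 3}) ∧
    (∑ I ∈ Finset.powerset (Finset.univ : Finset (Fin 4)), f I = f ∅ + f {0} + f {1} + f {2} + f {3} + f {0, 1} + f {0, 2} + f {0, 3} + f {1, 2} + f {1, 3} + f {2, 3} + f {0, 1, 2} + f {0, 1, 3} + f {0, 2, 3} + f {1, 2, 3} + f Finset.univ) := by
  refine ⟨?_, ?_, ?_, ?_, ?_, ?_, ?_, ?_, ?_, ?_, ?_, ?_, ?_, ?_, ?_, ?_⟩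
  · rw [show Finset.powerset (∅ : Finset (Fin 4)) = {∅} by decide]
    rw [Finset.sum_singleton]
  · rw [show Finset.powerset ({0} : Finset (Fin 4)) = {∅, {0}} by decide]
    repeat rw [Finset.sum_insert (by decide)]
    rw [Finset.sum_singleton]
  · rw [show Finset.powerset ({1} : Finset (Fin 4)) = {∅, {1}} by decide]
    repeat rw [Finset.sum_insert (by decide)]
    rw [Finset.sum_singleton]
  · rw [show Finset.powerset ({2} : Finset (Fin 4)) = {∅, {2}} by decide]
    repeat rw [Finset.sum_insert (by decide)]
    rw [Finset.sum_singleton]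
  · rw [show Finset.powerset ({3} : Finset (Fin 4)) = {∅, {3}} by decide]
    repeat rw [Finset.sum_insert (by decide)]
    rw [Finset.sum_singleton]
  · rw [show Finset.powerset ({0, 1} : Finset (Fin 4)) = {∅, {0}, {1}, {0, 1}} by decide]
    repeat rw [Finset.sum_insert (by decide)]
    rw [Finset.sum_singleton]; ac_rfl
  · rw [show Finset.powerset ({0, 2} : Finset (Fin 4)) = {∅, {0}, {2}, {0, 2}} by decide]
    repeat rw [Finset.sum_insert (by decide)]
    rw [Finset.sum_singleton]; ac_rfl
  · rw [show Finset.powerset ({0, 3} : Finset (Fin 4)) = {∅, {0}, {3}, {0, 3}} by decide]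
    repeat rw [Finset.sum_insert (by decide)]
    rw [Finset.sum_singleton]; ac_rfl
  · rw [show Finset.powerset ({1, 2} : Finset (Fin 4)) = {∅, {1}, {2}, {1, 2}} by decide]
    repeat rw [Finset.sum_insert (by decide)]
    rw [Finset.sum_singleton]; ac_rfl
  · rw [show Finset.powerset ({1, 3} : Finset (Fin 4)) = {∅, {1}, {3}, {1, 3}} by decide]
    repeat rw [Finset.sum_insert (by decide)]
    rw [Finset.sum_singleton]; ac_rfl
  · rw [show Finset.powerset ({2, 3} : Finset (Fin 4)) = {∅, {2}, {3}, {2, 3}} by decide]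
    repeat rw [Finset.sum_insert (by decide)]
    rw [Finset.sum_singleton]; ac_rfl
  · rw [show Finset.powerset ({0, 1, 2} : Finset (Fin 4)) = {∅, {0}, {1}, {2}, {0, 1}, {0, 2}, {1, 2}, {0, 1, 2}} by decide]
    repeat rw [Finset.sum_insert (by decide)]
    rw [Finset.sum_singleton]; ac_rfl
  · rw [show Finset.powerset ({0, 1, 3} : Finset (Fin 4)) = {∅, {0}, {1}, {3}, {0, 1}, {0, 3}, {1, 3}, {0, 1, 3}} by decide]
    repeat rw [Finset.sum_insert (by decide)]
    rw [Finset.sum_singleton]; ac_rfl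
  · rw [show Finset.powerset ({0, 2, 3} : Finset (Fin 4)) = {∅, {0}, {2}, {3}, {0, 2}, {0, 3}, {2, 3}, {0, 2, 3}} by decide]
    repeat rw [Finset.sum_insert (by decide)]
    rw [Finset.sum_singleton]; ac_rfl
  · rw [show Finset.powerset ({1, 2, 3} : Finset (Fin 4)) = {∅, {1}, {2}, {3}, {1, 2}, {1, 3}, {2, 3}, {1, 2, 3}} by decide]
    repeat rw [Finset.sum_insert (by decide)]
    rw [Finset.sum_singleton]; ac_rfl
  · rw [show Finset.powerset (Finset.univ : Finset (Fin 4)) = {∅, {0}, {1}, {2}, {3}, {0, 1}, {0, 2}, {0, 3}, {1, 2}, {1, 3}, {2, 3}, {0, 1, 2}, {0, 1, 3}, {0, 2, 3}, {1, 2, 3}, Finset.univ} by decide]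
    repeat rw [Finset.sum_insert (by decide)]
    rw [Finset.sum_singleton]; ac_rfl

set_option maxHeartbeats 2000000 in
/-- The identification of coordinates of modes with elements of `𝔞_{𝒩=6}` respects brackets. Each of
the sixteen components is a polynomial identity in the coordinates and their derivatives. -/
theorem br_assemble (F G : Finset (Fin 4) → O) :
    (aN6 D).br (assemble F) (assemble G) = assemble (modeBr D F G) := by
  have hpow := sum_powerset_fin4 (M := O)
  have hI : algebraMap ℂ O Complex.I * algebraMap ℂ O Complex.I = -1 := by
    rw [← map_mul, Complex.I_mul_I, map_neg, map_one]
  have h2 : 2 * algebraMap ℂ O 2⁻¹ = 1 := by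
    have : (2 : O) = algebraMap ℂ O 2 := (map_ofNat _ 2).symm
    rw [this, ← map_mul, mul_inv_cancel₀ two_ne_zero, map_one]
  have h4 : algebraMap ℂ O 4⁻¹ = algebraMap ℂ O 2⁻¹ * algebraMap ℂ O 2⁻¹ := by
    rw [← map_mul]; norm_num
  simp only [SuperBracket.br, assemble_apply, aN6_ee_eq, aN6_oo_eq, aN6_eo_eq, Prod.mk_add_mk,
    Prod.mk_sub_mk, sl2mk_add, m2_sub, Prod.mk.injEq, sl2mk_inj, m2_inj]
  refine ⟨⟨?_, ⟨?_, ?_, ?_⟩, ⟨?_, ?_, ?_⟩, ?_⟩, ⟨?_, ?_, ?_, ?_⟩, ⟨?_, ?_, ?_, ?_⟩⟩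
  all_goals
    simp (decide := true) only [modeBr, if_true, if_false, hpow, Fin.sum_univ_four]
    simp (decide := true) only [if_true, if_false, grSign, derSign, neg_one_pow_ite, card_fin4,
      fullCoord_ite]
    simp only [map_add, map_sub, map_neg, Derivation.map_smul, Derivation.leibniz, smul_eq_mul]
    simp only [Algebra.smul_def, map_mul, map_add, map_sub, map_neg, map_one, map_zero, map_ofNat, div_eq_mul_inv, h4]
  all_goals
    clear hpow
    generalize algebraMap ℂ O Complex.I = i at *
    generalize algebraMap ℂ O 2⁻¹ = h at *
    clear h4
  all_goals grind

end K4Bracket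
section K4Mode
variable {O : Type*} [CommRing O] [Algebra ℂ O] (D : Derivation ℂ O O)

theorem modeCoord_eq_zero (a : K4') (f : O) (I : Finset (Fin 4)) (h : (a : K4) I = 0) :
    modeCoord D (a ⊗ₜ f) I = 0 := by
  have : k4Coord I (a : K4) = 0 := by simp [k4Coord, h]
  rw [modeCoord_tmul, this, map_zero, LinearMap.zero_apply]

theorem isModeAlgebraK4'_aN6 : IsModeAlgebraK4' D (aN6 D) := by
  refine ⟨assemble ∘ₗ modeCoord D, ?_, ?_, ?_, ?_, ?_⟩
  · exact assemble_surjective.comp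
      (Function.RightInverse.surjective (modeCoord_modeSection D))
  · rw [LinearMap.ker_comp, LinearMap.ker_eq_bot.2 (assemble_injective O), Submodule.comap_bot,
      ker_modeCoord, modeRel]
  · intro a f h
    have h0 : ∀ I : Finset (Fin 4), Odd I.card → modeCoord D (a ⊗ₜ f) I = 0 :=
      fun I hI => modeCoord_eq_zero D a f I (h I hI)
    rw [LinearMap.comp_apply, assemble_apply]
    simp only [h0 {0} (by decide), h0 {1} (by decide), h0 {2} (by decide), h0 {3} (by decide),
      h0 {0, 1, 2} (by decide), h0 {0, 1, 3} (by decide), h0 {0, 2, 3} (by decide),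
      h0 {1, 2, 3} (by decide), smul_zero, neg_zero, sub_zero, add_zero]
    refine Prod.ext ?_ ?_ <;> ext i j <;> fin_cases i <;> fin_cases j <;> rfl
  · intro a f h
    have h0 : ∀ I : Finset (Fin 4), Even I.card → modeCoord D (a ⊗ₜ f) I = 0 :=
      fun I hI => modeCoord_eq_zero D a f I (h I hI)
    rw [LinearMap.comp_apply, assemble_apply]
    simp only [h0 ∅ (by decide), h0 {0, 1} (by decide), h0 {0, 2} (by decide),
      h0 {0, 3} (by decide), h0 {1, 2} (by decide), h0 {1, 3} (by decide), h0 {2, 3} (by decide),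
      h0 Finset.univ (by decide), smul_zero, neg_zero, sub_zero, add_zero]
    exact Prod.ext rfl (Prod.ext sl2mk_zero.symm (Prod.ext sl2mk_zero.symm rfl))
  · intro a b f g
    obtain ⟨n, hn⟩ : ∃ n, (lamBrTop a b).natDegree < n ∧ ∀ K, (lamBr a b K).natDegree < n := by
      refine ⟨(lamBrTop a b).natDegree + ∑ K, (lamBr a b K).natDegree + 1, by omega, fun K => ?_⟩
      have := Finset.single_le_sum (f := fun K => (lamBr (a : K4) b K).natDegree)
        (fun _ _ => Nat.zero_le _) (Finset.mem_univ K)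
      omega
    rw [finsum_eq_sum_of_support_subset (s := Finset.range n)]
    · rw [LinearMap.comp_apply, LinearMap.comp_apply, br_assemble, ← map_sum]
      have : modeBr D (modeCoord D (a ⊗ₜ f)) (modeCoord D (b ⊗ₜ g)) = modeCoord D
          (∑ j ∈ Finset.range n, lamCoeff' j a b ⊗ₜ[ℂ] ((fun h => D h)^[j] f * g)) := by
        funext K
        rw [map_sum, Finset.sum_apply, sum_polyOp_lamCoeff D a b f g K n (hn.2 K) hn.1]
      rw [this]
      rfl
    · intro j hj
      by_contra hj'
      apply hj
      have h0 : lamCoeff' j a b = 0 := by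
        refine Subtype.ext (funext fun K => ?_)
        exact Polynomial.coeff_eq_zero_of_natDegree_lt
          ((hn.2 K).trans_le (by simpa using hj'))
      change (assemble ∘ₗ modeCoord D) _ = 0
      rw [h0, TensorProduct.zero_tmul, map_zero]

end K4Mode

/-! ### Directional derivatives of polynomial maps -/

section DirDeriv

variable {E E' E'' : Type*} [AddCommGroup E] [Module ℂ E] [AddCommGroup E'] [Module ℂ E']
  [AddCommGroup E''] [Module ℂ E'']

/-- The value at `s` of the polynomial with the given coefficients. -/
def evalAt (s : ℂ) : (ℕ →₀ E') →ₗ[ℂ] E' := Finsupp.lsum ℂ fun n => s ^ n • LinearMap.id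

theorem evalAt_apply (s : ℂ) (c : ℕ →₀ E') : evalAt s c = c.sum fun n v => s ^ n • v := rfl

theorem hasDirDeriv_iff {F : E → E'} {φ ψ : E} {d : E'} : HasDirDeriv F φ ψ d ↔
    ∃ c : ℕ →₀ E', (∀ s : ℂ, F (φ + s • ψ) = evalAt s c) ∧ c 1 = d := by
  simp only [HasDirDeriv, evalAt_apply]

theorem evalAt_single (s : ℂ) (n : ℕ) (v : E') : evalAt s (Finsupp.single n v) = s ^ n • v := by
  simp [evalAt]

theorem evalAt_zero (c : ℕ →₀ E') : evalAt 0 c = c 0 := by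
  induction c using Finsupp.induction_linear with
  | zero => simp
  | add f g hf hg => simp [hf, hg]
  | single n v =>
    rw [evalAt_single]
    rcases n with _ | n <;> simp

/-- Affine functions. -/
theorem HasDirDeriv.of_affine {F : E → E'} {φ ψ : E} {d : E'}
    (h : ∀ s : ℂ, F (φ + s • ψ) = F φ + s • d) : HasDirDeriv F φ ψ d := by
  refine hasDirDeriv_iff.2 ⟨Finsupp.single 0 (F φ) + Finsupp.single 1 d, fun s => ?_, ?_⟩
  · rw [map_add, evalAt_single, evalAt_single, h]; simp
  · simp

theorem hasDirDeriv_const (v : E') (φ ψ : E) : HasDirDeriv (fun _ => v) φ ψ 0 :=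
  .of_affine fun s => by simp

theorem HasDirDeriv.linear_comp {F : E → E'} {φ ψ : E} {d : E'} (L : E' →ₗ[ℂ] E'')
    (h : HasDirDeriv F φ ψ d) : HasDirDeriv (fun x => L (F x)) φ ψ (L d) := by
  obtain ⟨c, hc, rfl⟩ := hasDirDeriv_iff.1 h
  refine hasDirDeriv_iff.2 ⟨c.mapRange L (map_zero L), fun s => ?_, by simp⟩
  have key : ∀ c : ℕ →₀ E', L (evalAt s c) = evalAt s (c.mapRange L (map_zero L)) := by
    intro c
    induction c using Finsupp.induction_linear with
    | zero => simp
    | add f g hf hg => rw [map_add, map_add, hf, hg, Finsupp.mapRange_add (by simp), map_add]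
    | single n v => rw [evalAt_single, Finsupp.mapRange_single, evalAt_single, map_smul]
  rw [hc, key]

theorem HasDirDeriv.add {F G : E → E'} {φ ψ : E} {d e : E'}
    (h : HasDirDeriv F φ ψ d) (h' : HasDirDeriv G φ ψ e) :
    HasDirDeriv (fun x => F x + G x) φ ψ (d + e) := by
  obtain ⟨c, hc, rfl⟩ := hasDirDeriv_iff.1 h
  obtain ⟨c', hc', rfl⟩ := hasDirDeriv_iff.1 h'
  exact hasDirDeriv_iff.2 ⟨c + c', fun s => by rw [hc, hc', map_add], rfl⟩

theorem HasDirDeriv.neg {F : E → E'} {φ ψ : E} {d : E'} (h : HasDirDeriv F φ ψ d) :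
    HasDirDeriv (fun x => -F x) φ ψ (-d) := h.linear_comp (-LinearMap.id)

theorem HasDirDeriv.sub {F G : E → E'} {φ ψ : E} {d e : E'}
    (h : HasDirDeriv F φ ψ d) (h' : HasDirDeriv G φ ψ e) :
    HasDirDeriv (fun x => F x - G x) φ ψ (d - e) := by
  simpa only [sub_eq_add_neg] using h.add h'.neg

theorem HasDirDeriv.const_smul {F : E → E'} {φ ψ : E} {d : E'} (c : ℂ)
    (h : HasDirDeriv F φ ψ d) : HasDirDeriv (fun x => c • F x) φ ψ (c • d) :=
  h.linear_comp (c • LinearMap.id)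

theorem HasDirDeriv.sum {κ : Type*} (s : Finset κ) {F : κ → E → E'} {φ ψ : E} {d : κ → E'}
    (h : ∀ i, HasDirDeriv (F i) φ ψ (d i)) :
    HasDirDeriv (fun x => ∑ i ∈ s, F i x) φ ψ (∑ i ∈ s, d i) := by
  classical
  induction s using Finset.induction_on with
  | empty => simpa using hasDirDeriv_const (0 : E') φ ψ
  | insert i s hi ih => simpa only [Finset.sum_insert hi] using (h i).add ih

theorem HasDirDeriv.pi {κ : Type*} [Finite κ] {F : E → κ → E'} {φ ψ : E} {d : κ → E'}
    (h : ∀ i, HasDirDeriv (fun x => F x i) φ ψ (d i)) : HasDirDeriv F φ ψ d := by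
  classical
  cases nonempty_fintype κ
  have h' := HasDirDeriv.sum Finset.univ
    (fun i => (h i).linear_comp (LinearMap.single ℂ (fun _ : κ => E') i))
  have e1 : (fun x => ∑ i, LinearMap.single ℂ (fun _ : κ => E') i (F x i)) = F := by
    funext x
    exact Finset.univ_sum_single (F x)
  have e2 : (∑ i, LinearMap.single ℂ (fun _ : κ => E') i (d i)) = d := Finset.univ_sum_single d
  rwa [e1, e2] at h'

theorem exists_polynomial_evalAt {A : Type*} [Ring A] [Algebra ℂ A] (c : ℕ →₀ A) :
    ∃ P : Polynomial A, (∀ s, evalAt s c = P.eval (algebraMap ℂ A s)) ∧ ∀ n, P.coeff n = c n := by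
  induction c using Finsupp.induction_linear with
  | zero => exact ⟨0, by simp, by simp⟩
  | add f g hf hg =>
    obtain ⟨P, hP, hP'⟩ := hf
    obtain ⟨P₂, hP₂, hP₂'⟩ := hg
    exact ⟨P + P₂, fun s => by rw [map_add, hP, hP₂, Polynomial.eval_add], fun n => by
      rw [Polynomial.coeff_add, hP', hP₂', Finsupp.add_apply]⟩
  | single n v =>
    refine ⟨Polynomial.monomial n v, fun s => ?_, fun k => ?_⟩
    · rw [evalAt_single, Polynomial.eval_monomial, Algebra.smul_def, map_pow]
      exact Commute.pow_left (Algebra.commutes s v) n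
    · rw [Polynomial.coeff_monomial, Finsupp.single_apply]

theorem exists_evalAt_polynomial {A : Type*} [Ring A] [Algebra ℂ A] (P : Polynomial A) :
    ∃ c : ℕ →₀ A, (∀ s, evalAt s c = P.eval (algebraMap ℂ A s)) ∧ ∀ n, c n = P.coeff n := by
  induction P using Polynomial.induction_on' with
  | add p q hp hq =>
    obtain ⟨c, hc, h⟩ := hp
    obtain ⟨c', hc', h'⟩ := hq
    exact ⟨c + c', fun s => by rw [map_add, hc, hc', Polynomial.eval_add], fun n => by
      rw [Polynomial.coeff_add, ← h, ← h', Finsupp.add_apply]⟩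
  | monomial n v =>
    refine ⟨Finsupp.single n v, fun s => ?_, fun k => ?_⟩
    · rw [evalAt_single, Polynomial.eval_monomial, Algebra.smul_def, map_pow]
      exact Commute.pow_left (Algebra.commutes s v) n
    · rw [Polynomial.coeff_monomial, Finsupp.single_apply]

theorem HasDirDeriv.mul {A : Type*} [Ring A] [Algebra ℂ A] {F G : E → A} {φ ψ : E} {d e : A}
    (h : HasDirDeriv F φ ψ d) (h' : HasDirDeriv G φ ψ e) :
    HasDirDeriv (fun x => F x * G x) φ ψ (d * G φ + F φ * e) := by
  obtain ⟨c, hc, rfl⟩ := hasDirDeriv_iff.1 h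
  obtain ⟨c', hc', rfl⟩ := hasDirDeriv_iff.1 h'
  obtain ⟨P, hP, hP1⟩ := exists_polynomial_evalAt c
  obtain ⟨P', hP', hP1'⟩ := exists_polynomial_evalAt c'
  obtain ⟨r, hr, hr1⟩ := exists_evalAt_polynomial (P * P')
  have h0 : F φ = c 0 := by simpa [evalAt_zero] using hc 0
  have h0' : G φ = c' 0 := by simpa [evalAt_zero] using hc' 0
  refine hasDirDeriv_iff.2 ⟨r, fun s => ?_, ?_⟩
  · rw [hr, hc, hc', hP, hP']
    exact (Polynomial.eval₂_mul_noncomm (RingHom.id A) _ fun k =>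
      (Algebra.commutes s (P'.coeff k) : Commute _ _).symm).symm
  · rw [hr1, Polynomial.mul_coeff_one, hP1, hP1, hP1', hP1', h0, h0', add_comm]

end DirDeriv

/-! ### Tensor calculus of the gauge data -/

section GaugeAlgebra

variable {ι m : Type*} [Fintype ι] [DecidableEq ι] [Fintype m]

/-- The properties of the structure constants of a metric Lie algebra with a representation at
nonzero level that satisfies the fundamental identity. -/
structure IsGWData (T : GaugeData ι m) : Prop where
  rep : ∀ b c s u, ∑ t, (T.ρ b s t * T.ρ c t u - T.ρ c s t * T.ρ b t u) = ∑ a, T.f b c a * T.ρ a s u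
  skew : ∀ b c a, T.f b c a = -T.f c b a
  jac : ∀ a b c d, ∑ e, (T.f b c e * T.f a e d + T.f c a e * T.f b e d + T.f a b e * T.f c e d) = 0
  K_symm : ∀ a b, T.K a b = T.K b a
  Kinv_symm : ∀ a b, T.K⁻¹ a b = T.K⁻¹ b a
  K_mul_Kinv : T.K * T.K⁻¹ = 1
  Kinv_mul_K : T.K⁻¹ * T.K = 1
  inv : ∀ a b c, ∑ d, T.f a b d * T.K d c = ∑ d, T.f b c d * T.K a d
  k_ne : T.k ≠ 0
  fund : FundamentalIdentity T

variable {A : Type*} [Ring A] [Algebra ℂ A] (T : GaugeData ι m)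

/-- The bilinear map `(c, v) ↦ ∑ t i j k • (c j * v k)` with coefficients in an algebra, for a tensor
`t` with complex entries. -/
def contract {I J K : Type*} [Fintype J] [Fintype K] (t : I → J → K → ℂ) :
    (J → A) →ₗ[ℂ] (K → A) →ₗ[ℂ] (I → A) :=
  LinearMap.mk₂ ℂ (fun c v i => ∑ j, ∑ k, t i j k • (c j * v k))
    (fun c c' v => by
      funext i; simp only [Pi.add_apply, add_mul, smul_add, Finset.sum_add_distrib])
    (fun z c v => by
      funext i; simp only [Pi.smul_apply, smul_mul_assoc, Finset.smul_sum, smul_comm z])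
    (fun c v v' => by
      funext i; simp only [Pi.add_apply, mul_add, smul_add, Finset.sum_add_distrib])
    (fun z c v => by
      funext i; simp only [Pi.smul_apply, mul_smul_comm, Finset.smul_sum, smul_comm z])

theorem contract_apply {I J K : Type*} [Fintype J] [Fintype K] (t : I → J → K → ℂ) (c : J → A)
    (v : K → A) (i : I) : contract t c v i = ∑ j, ∑ k, t i j k • (c j * v k) := rfl

/-- The action of `𝔤` on `R`, with coefficients in an algebra. -/
def gact : (ι → A) →ₗ[ℂ] (m → A) →ₗ[ℂ] (m → A) := contract fun s a t => T.ρ a s t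

/-- The action of `𝔤` on `R^*`, with coefficients in an algebra. -/
def gdact : (ι → A) →ₗ[ℂ] (m → A) →ₗ[ℂ] (m → A) := contract fun s a t => -T.ρ a t s

/-- The moment map `R^* × R → 𝔤^*`, with coefficients in an algebra. -/
def gmom : (m → A) →ₗ[ℂ] (m → A) →ₗ[ℂ] (ι → A) := contract fun a s t => T.ρ a s t

/-- The Lie bracket of `𝔤`, with coefficients in an algebra. -/
def gbrk : (ι → A) →ₗ[ℂ] (ι → A) →ₗ[ℂ] (ι → A) := contract fun a b c => T.f b c a

/-- The coadjoint action, with coefficients in an algebra. -/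
def gcoad : (ι → A) →ₗ[ℂ] (ι → A) →ₗ[ℂ] (ι → A) := contract fun a b c => -T.f b a c

/-- The pairing of `R^*` and `R`, or of `𝔤^*` and `𝔤`. -/
def gdot {n : Type*} [Fintype n] : (n → A) →ₗ[ℂ] (n → A) →ₗ[ℂ] A :=
  LinearMap.mk₂ ℂ (fun w v => ∑ s, w s * v s)
    (fun w w' v => by simp only [Pi.add_apply, add_mul, Finset.sum_add_distrib])
    (fun z w v => by simp only [Pi.smul_apply, smul_mul_assoc, Finset.smul_sum])
    (fun w v v' => by simp only [Pi.add_apply, mul_add, Finset.sum_add_distrib])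
    (fun z w v => by simp only [Pi.smul_apply, mul_smul_comm, Finset.smul_sum])

theorem gdot_apply {n : Type*} [Fintype n] (w v : n → A) : gdot w v = ∑ s, w s * v s := rfl

/-- Raising an index with the inverse metric. -/
def graise : (ι → A) →ₗ[ℂ] (ι → A) where
  toFun w a := ∑ b, T.K⁻¹ a b • w b
  map_add' w w' := by funext a; simp only [Pi.add_apply, smul_add, Finset.sum_add_distrib]
  map_smul' z w := by
    funext a; simp only [Pi.smul_apply, Finset.smul_sum, smul_comm z, RingHom.id_apply]

theorem graise_apply (w : ι → A) (a : ι) : graise T w a = ∑ b, T.K⁻¹ a b • w b := rfl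

/-- Lowering an index with the metric. -/
def glower : (ι → A) →ₗ[ℂ] (ι → A) where
  toFun w a := ∑ b, T.K a b • w b
  map_add' w w' := by funext a; simp only [Pi.add_apply, smul_add, Finset.sum_add_distrib]
  map_smul' z w := by
    funext a; simp only [Pi.smul_apply, Finset.smul_sum, smul_comm z, RingHom.id_apply]

theorem glower_apply (w : ι → A) (a : ι) : glower T w a = ∑ b, T.K a b • w b := rfl

variable {I J K L M N : Type*} [Fintype J] [Fintype K] [Fintype L] [Fintype M] [Fintype N]

theorem sum_reverse {B : Type*} [AddCommMonoid B] (F : J → K → L → B) :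
    ∑ j, ∑ k, ∑ l, F j k l = ∑ l, ∑ k, ∑ j, F j k l := by
  calc _ = ∑ k, ∑ j, ∑ l, F j k l := Finset.sum_comm
    _ = ∑ k, ∑ l, ∑ j, F j k l := Finset.sum_congr rfl fun _ _ => Finset.sum_comm
    _ = _ := Finset.sum_comm

/-- A family of central elements. -/
def Central (c : J → A) : Prop := ∀ j b, c j * b = b * c j

theorem contract_contract_right (t : I → J → K → ℂ) (t' : K → L → M → ℂ) (c : J → A) (c' : L → A)
    (v : M → A) (i : I) : contract t c (contract t' c' v) i
      = ∑ j, ∑ l, ∑ n, (∑ k, t i j k * t' k l n) • (c j * (c' l * v n)) := by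
  simp only [contract_apply, Finset.mul_sum, Finset.smul_sum, Finset.sum_smul, mul_smul_comm,
    smul_smul]
  refine Finset.sum_congr rfl fun j _ => ?_
  rw [Finset.sum_comm]
  refine Finset.sum_congr rfl fun l _ => ?_
  rw [Finset.sum_comm]

theorem contract_contract_left (t : I → J → K → ℂ) (t' : J → L → M → ℂ) (c : K → A) (c' : L → A)
    (v : M → A) (i : I) : contract t (contract t' c' v) c i
      = ∑ l, ∑ n, ∑ k, (∑ j, t i j k * t' j l n) • (c' l * v n * c k) := by
  simp only [contract_apply, Finset.sum_mul, Finset.smul_sum, Finset.sum_smul, smul_mul_assoc,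
    smul_smul]
  have h : ∀ F : J → K → L → M → A, ∑ j, ∑ k, ∑ l, ∑ n, F j k l n = ∑ l, ∑ n, ∑ k, ∑ j, F j k l n := by
    intro F
    calc _ = ∑ j, ∑ l, ∑ k, ∑ n, F j k l n := Finset.sum_congr rfl fun j _ => Finset.sum_comm
      _ = ∑ l, ∑ j, ∑ k, ∑ n, F j k l n := Finset.sum_comm
      _ = ∑ l, ∑ j, ∑ n, ∑ k, F j k l n := Finset.sum_congr rfl fun l _ =>
          Finset.sum_congr rfl fun j _ => Finset.sum_comm
      _ = ∑ l, ∑ n, ∑ j, ∑ k, F j k l n := Finset.sum_congr rfl fun l _ => Finset.sum_comm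
      _ = _ := Finset.sum_congr rfl fun l _ => Finset.sum_congr rfl fun n _ => Finset.sum_comm
  exact h _

/-- Two nested contractions with central first arguments, in both orders, against a third one:
the relation of tensors that expresses `ρ([c, c']) = [ρ(c), ρ(c')]`. -/
theorem contract_comm {t : K → J → K → ℂ} {f : J → J → J → ℂ}
    (h : ∀ i j l n, ∑ k, t i j k * t k l n - ∑ k, t i l k * t k j n = ∑ a, t i a n * f a j l)
    {c : J → A} (hc : Central c) (c' : J → A) (v : K → A) :
    contract t c (contract t c' v) = contract t (contract f c c') v + contract t c' (contract t c v) := by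
  funext i
  rw [Pi.add_apply, contract_contract_right, contract_contract_right, contract_contract_left]
  have e1 : ∑ l, ∑ j, ∑ n, (∑ k, t i l k * t k j n) • (c' l * (c j * v n))
      = ∑ j, ∑ l, ∑ n, (∑ k, t i l k * t k j n) • (c j * (c' l * v n)) := by
    rw [Finset.sum_comm]
    refine Finset.sum_congr rfl fun l _ => Finset.sum_congr rfl fun j _ =>
      Finset.sum_congr rfl fun n _ => ?_
    rw [← mul_assoc, ← hc l (c' j), mul_assoc]
  rw [e1, ← Finset.sum_add_distrib]
  refine Finset.sum_congr rfl fun j _ => ?_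
  rw [← Finset.sum_add_distrib]
  refine Finset.sum_congr rfl fun l _ => ?_
  rw [← Finset.sum_add_distrib]
  refine Finset.sum_congr rfl fun n _ => ?_
  rw [mul_assoc, ← add_smul, ← h, sub_add_cancel]

theorem gact_gact (hT : IsGWData T) {c : ι → A} (hc : Central c) (c' : ι → A) (v : m → A) :
    gact T c (gact T c' v) = gact T (gbrk T c c') v + gact T c' (gact T c v) :=
  contract_comm (fun i j l n => by
    rw [← Finset.sum_sub_distrib, hT.rep]
    exact Finset.sum_congr rfl fun a _ => mul_comm _ _) hc c' v

theorem gdact_gdact (hT : IsGWData T) {c : ι → A} (hc : Central c) (c' : ι → A) (v : m → A) :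
    gdact T c (gdact T c' v) = gdact T (gbrk T c c') v + gdact T c' (gdact T c v) :=
  contract_comm (fun i j l n => by
    have e : ∑ a, -T.ρ a n i * T.f j l a = -∑ a, T.f j l a * T.ρ a n i := by
      rw [← Finset.sum_neg_distrib]
      exact Finset.sum_congr rfl fun a _ => by ring
    rw [e, ← hT.rep, ← Finset.sum_sub_distrib, ← Finset.sum_neg_distrib]
    exact Finset.sum_congr rfl fun a _ => by ring) hc c' v

theorem gbrk_gbrk (hT : IsGWData T) {c : ι → A} (hc : Central c) (c' b : ι → A) :
    gbrk T c (gbrk T c' b) = gbrk T (gbrk T c c') b + gbrk T c' (gbrk T c b) :=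
  contract_comm (fun i j l n => by
    have h := hT.jac j l n i
    rw [← sub_eq_zero, ← Finset.sum_sub_distrib, ← Finset.sum_sub_distrib, ← h]
    refine Finset.sum_congr rfl fun a _ => ?_
    rw [hT.skew n j a, hT.skew n a i]
    ring) hc c' b

/-- Contraction of a commuting pair with the transposed tensor. -/
theorem contract_swap {t : I → J → K → ℂ} {t' : I → K → J → ℂ} (h : ∀ i j k, t i j k = -t' i k j)
    {c : J → A} {v : K → A} (hcv : ∀ j k, c j * v k = v k * c j) :
    contract t c v = -contract t' v c := by
  funext i
  rw [Pi.neg_apply, contract_apply, contract_apply, Finset.sum_comm, ← Finset.sum_neg_distrib]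
  refine Finset.sum_congr rfl fun k _ => ?_
  rw [← Finset.sum_neg_distrib]
  exact Finset.sum_congr rfl fun j _ => by rw [h, neg_smul, hcv]

theorem gbrk_skew (hT : IsGWData T) {c c' : ι → A} (h : ∀ a b, c a * c' b = c' b * c a) :
    gbrk T c c' = -gbrk T c' c :=
  contract_swap (fun _ _ _ => hT.skew _ _ _) h

/-- The bracket with lowered index is totally skew-symmetric. -/
theorem f_K_skew (hT : IsGWData T) (a b c : ι) :
    ∑ d, T.f a b d * T.K d c = -∑ d, T.f a c d * T.K d b := by
  rw [hT.inv a b c, hT.inv a c b, ← Finset.sum_neg_distrib]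
  exact Finset.sum_congr rfl fun d _ => by rw [hT.skew b c]; ring

theorem f_Kinv (hT : IsGWData T) (a b c : ι) :
    ∑ x, T.K⁻¹ b x * T.f a x c = -∑ x, T.f a x b * T.K⁻¹ x c := by
  let M : Matrix ι ι ℂ := Matrix.of fun x y => T.f a x y
  have h1 : M * T.K = -(T.K * M.transpose) := by
    ext x y
    rw [Matrix.neg_apply, Matrix.mul_apply, Matrix.mul_apply]
    refine (f_K_skew T hT a x y).trans ?_
    refine congrArg Neg.neg (Finset.sum_congr rfl fun d _ => ?_)
    rw [hT.K_symm d x, mul_comm]; rfl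
  have h2 : T.K⁻¹ * M = -(M.transpose * T.K⁻¹) := by
    calc T.K⁻¹ * M = T.K⁻¹ * (M * T.K) * T.K⁻¹ := by
          rw [Matrix.mul_assoc, Matrix.mul_assoc, hT.K_mul_Kinv, Matrix.mul_one]
      _ = -(T.K⁻¹ * T.K * M.transpose * T.K⁻¹) := by
          rw [h1, Matrix.mul_neg, Matrix.neg_mul, ← Matrix.mul_assoc]
      _ = _ := by rw [hT.Kinv_mul_K, Matrix.one_mul]
  exact congrFun (congrFun h2 b) c

theorem graise_gcoad (hT : IsGWData T) (c b : ι → A) :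
    graise T (gcoad T c b) = gbrk T c (graise T b) := by
  funext i
  have h1 : graise T (gcoad T c b) i = ∑ j, ∑ k, (∑ x, T.K⁻¹ i x * -T.f j x k) • (c j * b k) := by
    simp only [graise_apply, gcoad, contract_apply, Finset.smul_sum, smul_smul, Finset.sum_smul]
    rw [Finset.sum_comm]
    exact Finset.sum_congr rfl fun j _ => Finset.sum_comm
  have h2 : gbrk T c (graise T b) i = ∑ j, ∑ k, (∑ x, T.f j x i * T.K⁻¹ x k) • (c j * b k) := by
    simp only [graise_apply, gbrk, contract_apply, Finset.mul_sum, mul_smul_comm, Finset.smul_sum,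
      smul_smul, Finset.sum_smul]
    exact Finset.sum_congr rfl fun j _ => Finset.sum_comm
  rw [h1, h2]
  refine Finset.sum_congr rfl fun j _ => Finset.sum_congr rfl fun k _ => ?_
  have h := f_Kinv T hT j i k
  simp only [mul_neg, Finset.sum_neg_distrib]
  rw [h, neg_neg]

theorem glower_graise (hT : IsGWData T) (b : ι → A) : glower T (graise T b) = b := by
  funext i
  simp only [graise_apply, glower_apply, Finset.smul_sum, smul_smul]
  rw [Finset.sum_comm]
  have : ∀ j, ∑ x, (T.K i x * T.K⁻¹ x j) • b j = (1 : Matrix ι ι ℂ) i j • b j := fun j => by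
    rw [← Finset.sum_smul, ← hT.K_mul_Kinv, Matrix.mul_apply]
  simp only [this, Matrix.one_apply, ite_smul, one_smul, zero_smul, Finset.sum_ite_eq,
    Finset.mem_univ, if_true]

theorem graise_glower (hT : IsGWData T) (b : ι → A) : graise T (glower T b) = b := by
  funext i
  simp only [graise_apply, glower_apply, Finset.smul_sum, smul_smul]
  rw [Finset.sum_comm]
  have : ∀ j, ∑ x, (T.K⁻¹ i x * T.K x j) • b j = (1 : Matrix ι ι ℂ) i j • b j := fun j => by
    rw [← Finset.sum_smul, ← hT.Kinv_mul_K, Matrix.mul_apply]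
  simp only [this, Matrix.one_apply, ite_smul, one_smul, zero_smul, Finset.sum_ite_eq,
    Finset.mem_univ, if_true]

theorem glower_gbrk (hT : IsGWData T) (c b : ι → A) :
    glower T (gbrk T c b) = gcoad T c (glower T b) := by
  conv_lhs => rw [← graise_glower T hT b]
  rw [← graise_gcoad T hT, glower_graise T hT]

theorem gcoad_graise_skew (hT : IsGWData T) {b b' : ι → A} (h : ∀ i j, b i * b' j = b' j * b i) :
    gcoad T (graise T b) b' = -gcoad T (graise T b') b := by
  have key : ∀ b b' : ι → A, gcoad T (graise T b) b'
      = contract (fun a x y => -∑ d, T.f d a y * T.K⁻¹ d x) b b' := by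
    intro b b'
    funext i
    simp only [graise_apply, gcoad, contract_apply, Finset.smul_sum, Finset.sum_mul,
      smul_mul_assoc, smul_smul, ← Finset.sum_neg_distrib, Finset.sum_smul, neg_mul]
    rw [sum_reverse]
  rw [key, key]
  refine contract_swap (fun i j k => ?_) h
  have h1 := f_Kinv T hT i j k
  have e1 : ∑ d, T.f d i k * T.K⁻¹ d j = -∑ d, T.K⁻¹ j d * T.f i d k := by
    rw [← Finset.sum_neg_distrib]
    exact Finset.sum_congr rfl fun d _ => by rw [hT.skew d i, hT.Kinv_symm d j]; ring
  have e2 : ∑ d, T.f d i j * T.K⁻¹ d k = -∑ d, T.f i d j * T.K⁻¹ d k := by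
    rw [← Finset.sum_neg_distrib]
    exact Finset.sum_congr rfl fun d _ => by rw [hT.skew d i]; ring
  rw [e1, e2, h1]

/-- The moment map is equivariant. -/
theorem gmom_equivariant (hT : IsGWData T) {c : ι → A} (hc : Central c) (w v : m → A) :
    gmom T (gdact T c w) v + gmom T w (gact T c v) = gcoad T c (gmom T w v) := by
  funext a
  have h1 : gmom T (gdact T c w) v a
      = ∑ l, ∑ n, ∑ k, (∑ j, -(T.ρ a j k * T.ρ l n j)) • (c l * (w n * v k)) := by
    simp only [gmom, gdact, contract_contract_left, mul_neg, mul_assoc]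
  have h2 : gmom T w (gact T c v) a
      = ∑ l, ∑ n, ∑ k, (∑ j, T.ρ a n j * T.ρ l j k) • (c l * (w n * v k)) := by
    simp only [gmom, gact, contract_contract_right]
    rw [Finset.sum_comm]
    refine Finset.sum_congr rfl fun l _ => Finset.sum_congr rfl fun n _ =>
      Finset.sum_congr rfl fun k _ => ?_
    rw [← mul_assoc, ← hc l (w n), mul_assoc]
  have h3 : gcoad T c (gmom T w v) a
      = ∑ l, ∑ n, ∑ k, (∑ j, -T.f l a j * T.ρ j n k) • (c l * (w n * v k)) := by
    simp only [gmom, gcoad, contract_contract_right]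
  rw [Pi.add_apply, h1, h2, h3, ← Finset.sum_add_distrib]
  refine Finset.sum_congr rfl fun l _ => ?_
  rw [← Finset.sum_add_distrib]
  refine Finset.sum_congr rfl fun n _ => ?_
  rw [← Finset.sum_add_distrib]
  refine Finset.sum_congr rfl fun k _ => ?_
  rw [← add_smul]
  congr 1
  have h := hT.rep a l n k
  rw [Finset.sum_congr rfl fun j _ => show -T.f l a j * T.ρ j n k = T.f a l j * T.ρ j n k by
    rw [hT.skew a l]] 
  rw [← h, ← Finset.sum_add_distrib]
  exact Finset.sum_congr rfl fun j _ => by ring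

theorem gdot_gact {c : ι → A} (hc : Central c) (w v : m → A) :
    gdot w (gact T c v) = gdot c (gmom T w v) := by
  simp only [gdot_apply, gact, gmom, contract_apply, Finset.mul_sum, mul_smul_comm]
  rw [Finset.sum_comm]
  refine Finset.sum_congr rfl fun a _ => Finset.sum_congr rfl fun s _ =>
    Finset.sum_congr rfl fun t _ => ?_
  rw [← mul_assoc, ← hc a (w s), mul_assoc]

theorem gdot_gdact {c : ι → A} (w v : m → A) :
    gdot (gdact T c w) v = -gdot c (gmom T w v) := by
  simp only [gdot_apply, gdact, gmom, contract_apply, Finset.mul_sum, Finset.sum_mul,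
    mul_smul_comm, smul_mul_assoc, ← Finset.sum_neg_distrib, neg_smul, neg_mul, mul_assoc]
  rw [Finset.sum_comm]
  exact Finset.sum_congr rfl fun a _ => Finset.sum_comm

theorem gact_graise_gmom (w v v' : m → A) (s : m) : gact T (graise T (gmom T w v)) v' s
    = ∑ u, ∑ n, ∑ t, (∑ a, ∑ b, T.K⁻¹ a b * (T.ρ a s t * T.ρ b u n)) • (w u * v n * v' t) := by
  have : ∀ a, graise T (gmom T w v) a
      = contract (fun a u n => ∑ b, T.K⁻¹ a b * T.ρ b u n) w v a := by
    intro a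
    simp only [graise_apply, gmom, contract_apply, Finset.smul_sum, smul_smul, Finset.sum_smul]
    rw [Finset.sum_comm]
    exact Finset.sum_congr rfl fun u _ => Finset.sum_comm
  rw [funext this, gact, contract_contract_left]
  refine Finset.sum_congr rfl fun u _ => Finset.sum_congr rfl fun n _ =>
    Finset.sum_congr rfl fun t _ => ?_
  congr 1
  refine Finset.sum_congr rfl fun a _ => ?_
  rw [Finset.mul_sum]
  exact Finset.sum_congr rfl fun b _ => by ring

/-- The tensor of the fundamental identity is skew in its lower indices. -/
theorem fund_lower (hT : IsGWData T) (s t u v : m) :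
    ∑ a, ∑ b, T.K⁻¹ a b * (T.ρ a s t * T.ρ b u v)
      = -∑ a, ∑ b, T.K⁻¹ a b * (T.ρ a s v * T.ρ b u t) := by
  have h := hT.fund s t u v
  simp only [mul_add, Finset.sum_add_distrib] at h
  exact eq_neg_of_add_eq_zero_left h

/-- The tensor of the fundamental identity is skew in its upper indices. -/
theorem fund_upper (hT : IsGWData T) (s t u v : m) :
    ∑ a, ∑ b, T.K⁻¹ a b * (T.ρ a s t * T.ρ b u v)
      = -∑ a, ∑ b, T.K⁻¹ a b * (T.ρ a u t * T.ρ b s v) := by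
  rw [fund_lower T hT, Finset.sum_comm]
  congr 1
  refine Finset.sum_congr rfl fun a _ => Finset.sum_congr rfl fun b _ => ?_
  rw [hT.Kinv_symm]
  ring

/-- The fundamental identity for the action of a moment map on `R`. -/
theorem gact_fund (hT : IsGWData T) (w : m → A) {v v' : m → A}
    (h : ∀ i j, v i * v' j = v' j * v i) :
    gact T (graise T (gmom T w v)) v' = -gact T (graise T (gmom T w v')) v := by
  funext s
  rw [Pi.neg_apply, gact_graise_gmom, gact_graise_gmom, ← Finset.sum_neg_distrib]
  refine Finset.sum_congr rfl fun u _ => ?_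
  rw [Finset.sum_comm, ← Finset.sum_neg_distrib]
  refine Finset.sum_congr rfl fun t _ => ?_
  rw [← Finset.sum_neg_distrib]
  refine Finset.sum_congr rfl fun n _ => ?_
  rw [fund_lower T hT, neg_smul, mul_assoc, h, mul_assoc]

theorem gdact_graise_gmom (w v w' : m → A) (t : m) : gdact T (graise T (gmom T w v)) w' t
    = -∑ u, ∑ n, ∑ s, (∑ a, ∑ b, T.K⁻¹ a b * (T.ρ a s t * T.ρ b u n)) • (w u * v n * w' s) := by
  have : ∀ a, graise T (gmom T w v) a
      = contract (fun a u n => ∑ b, T.K⁻¹ a b * T.ρ b u n) w v a := by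
    intro a
    simp only [graise_apply, gmom, contract_apply, Finset.smul_sum, smul_smul, Finset.sum_smul]
    rw [Finset.sum_comm]
    exact Finset.sum_congr rfl fun u _ => Finset.sum_comm
  rw [funext this, gdact, contract_contract_left]
  simp only [← Finset.sum_neg_distrib, ← neg_smul]
  refine Finset.sum_congr rfl fun u _ => Finset.sum_congr rfl fun n _ =>
    Finset.sum_congr rfl fun t _ => ?_
  congr 1
  refine Finset.sum_congr rfl fun a _ => ?_
  rw [Finset.mul_sum]
  exact Finset.sum_congr rfl fun b _ => by ring

/-- The fundamental identity for the action of a moment map on `R^*`. -/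
theorem gdact_fund (hT : IsGWData T) {w v w' : m → A}
    (h : ∀ i j, v i * w' j = w' j * v i) (h' : ∀ i j, w i * w' j = w' j * w i)
    (h'' : ∀ i j, w i * v j = v j * w i) :
    gdact T (graise T (gmom T w v)) w' = -gdact T (graise T (gmom T w' v)) w := by
  funext s
  rw [Pi.neg_apply, gdact_graise_gmom, gdact_graise_gmom, sum_reverse]
  simp only [← Finset.sum_neg_distrib]
  refine Finset.sum_congr rfl fun u _ => Finset.sum_congr rfl fun n _ =>
    Finset.sum_congr rfl fun x _ => ?_
  rw [fund_upper T hT, neg_smul, neg_neg, neg_neg, mul_assoc, h, ← mul_assoc, h', mul_assoc, h'',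
    mul_assoc]

/-- The quartic invariant `μ_a K^{ab} μ_b` of an anticommuting `μ` vanishes. -/
theorem gdot_graise_self (hT : IsGWData T) {w : ι → A} (h : ∀ i j, w i * w j = -(w j * w i)) :
    gdot w (graise T w) = 0 := by
  have e : gdot w (graise T w) = -gdot w (graise T w) := by
    simp only [gdot_apply, graise_apply, Finset.mul_sum, mul_smul_comm, ← Finset.sum_neg_distrib]
    rw [Finset.sum_comm]
    refine Finset.sum_congr rfl fun a _ => Finset.sum_congr rfl fun b _ => ?_
    rw [h, smul_neg, hT.Kinv_symm]
  have e2 : (2 : ℂ) • gdot w (graise T w) = 0 := by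
    rw [two_smul]
    nth_rewrite 2 [e]
    rw [add_neg_cancel]
  exact (smul_eq_zero_iff_right two_ne_zero).1 e2

end GaugeAlgebra

/-! ### Covariant derivatives -/

section Covariant

variable {E A : Type*} [CommRing E] [Algebra ℂ E] [Ring A] [Algebra ℂ A] [Algebra E A]
  [IsScalarTower ℂ E A]
variable {I J K L M N : Type*} [Fintype J] [Fintype K] [Fintype L] [Fintype M] [Fintype N]

theorem contract_smul_left (t : I → J → K → ℂ) (e : E) (c : J → A) (v : K → A) :
    contract t (e • c) v = e • contract t c v := by
  funext i
  simp only [contract_apply, Pi.smul_apply, smul_mul_assoc, Finset.smul_sum, smul_comm e]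

theorem contract_smul_right (t : I → J → K → ℂ) (e : E) (c : J → A) (v : K → A) :
    contract t c (e • v) = e • contract t c v := by
  funext i
  simp only [contract_apply, Pi.smul_apply, mul_smul_comm, Finset.smul_sum, smul_comm e]

theorem contract_mul_left (t : I → J → K → ℂ) (τ : A) (c : J → A) (v : K → A) :
    contract t (τ • c) v = τ • contract t c v := by
  funext i
  simp only [contract_apply, Pi.smul_apply, smul_eq_mul, mul_assoc, Finset.mul_sum, mul_smul_comm]

theorem contract_mul_right (t : I → J → K → ℂ) {τ : A} {c : J → A} (h : ∀ j, c j * τ = τ * c j)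
    (v : K → A) : contract t c (τ • v) = τ • contract t c v := by
  funext i
  simp only [contract_apply, Pi.smul_apply, smul_eq_mul, ← mul_assoc, h, Finset.mul_sum,
    mul_smul_comm]

theorem contract_mul_right_neg (t : I → J → K → ℂ) {τ : A} {c : J → A}
    (h : ∀ j, c j * τ = -(τ * c j)) (v : K → A) :
    contract t c (τ • v) = -(τ • contract t c v) := by
  funext i
  simp only [contract_apply, Pi.smul_apply, Pi.neg_apply, smul_eq_mul, ← mul_assoc, h,
    Finset.mul_sum, mul_smul_comm, neg_mul, smul_neg, Finset.sum_neg_distrib]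

theorem gdot_smul_left (e : E) (w v : K → A) : gdot (e • w) v = e • gdot w v := by
  simp only [gdot_apply, Pi.smul_apply, smul_mul_assoc, Finset.smul_sum]

theorem gdot_smul_right (e : E) (w v : K → A) : gdot w (e • v) = e • gdot w v := by
  simp only [gdot_apply, Pi.smul_apply, mul_smul_comm, Finset.smul_sum]

theorem gdot_mul_left (τ : A) (w v : K → A) : gdot (τ • w) v = τ * gdot w v := by
  simp only [gdot_apply, Pi.smul_apply, smul_eq_mul, mul_assoc, Finset.mul_sum]

theorem gdot_mul_right {τ : A} {w : K → A} (h : ∀ j, w j * τ = τ * w j) (v : K → A) :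
    gdot w (τ • v) = τ * gdot w v := by
  simp only [gdot_apply, Pi.smul_apply, smul_eq_mul, ← mul_assoc, h, Finset.mul_sum]

theorem gdot_mul_right_neg {τ : A} {w : K → A} (h : ∀ j, w j * τ = -(τ * w j)) (v : K → A) :
    gdot w (τ • v) = -(τ * gdot w v) := by
  simp only [gdot_apply, Pi.smul_apply, smul_eq_mul, ← mul_assoc, h, Finset.mul_sum, neg_mul,
    Finset.sum_neg_distrib]

theorem gdot_comm {w v : K → A} (h : ∀ j, w j * v j = v j * w j) : gdot w v = gdot v w :=
  Finset.sum_congr rfl fun j _ => h j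

theorem gdot_anticomm {w v : K → A} (h : ∀ j, w j * v j = -(v j * w j)) :
    gdot w v = -gdot v w := by
  rw [gdot_apply, gdot_apply, ← Finset.sum_neg_distrib]
  exact Finset.sum_congr rfl fun j _ => h j

variable {ι m : Type*} [Fintype ι] [DecidableEq ι] [Fintype m] (T : GaugeData ι m)

theorem graise_smul (e : E) (w : ι → A) : graise T (e • w) = e • graise T w := by
  funext i
  simp only [graise_apply, Pi.smul_apply, Finset.smul_sum, smul_comm e]

theorem graise_mul (τ : A) (w : ι → A) : graise T (τ • w) = τ • graise T w := by
  funext i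
  simp only [graise_apply, Pi.smul_apply, Finset.mul_sum, smul_eq_mul, mul_smul_comm]

theorem glower_mul (τ : A) (w : ι → A) : glower T (τ • w) = τ • glower T w := by
  funext i
  simp only [glower_apply, Pi.smul_apply, Finset.mul_sum, smul_eq_mul, mul_smul_comm]

/-- `δ` is a derivation of `A` that extends the derivation `D` of the central subalgebra `E`. -/
structure IsDer (D : Derivation ℂ E E) (δ : A →ₗ[ℂ] A) : Prop where
  mul : ∀ a b, δ (a * b) = δ a * b + a * δ b
  alg : ∀ e, δ (algebraMap E A e) = algebraMap E A (D e)

variable {D D' : Derivation ℂ E E} {δ δ' : A →ₗ[ℂ] A}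

theorem IsDer.smul (h : IsDer D δ) (e : E) (a : A) : δ (e • a) = D e • a + e • δ a := by
  rw [Algebra.smul_def, h.mul, h.alg, ← Algebra.smul_def, ← Algebra.smul_def]

/-- Componentwise application of a linear map. -/
abbrev vec (δ : A →ₗ[ℂ] A) : (K → A) →ₗ[ℂ] (K → A) := δ.compLeft K

theorem vec_smul (h : IsDer D δ) (e : E) (v : K → A) :
    vec δ (e • v) = D e • v + e • vec δ v := funext fun i => h.smul e (v i)

theorem vec_mul (h : IsDer D δ) (τ : A) (v : K → A) :
    vec δ (τ • v) = δ τ • v + τ • vec δ v := funext fun i => h.mul τ (v i)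

theorem vec_contract (h : IsDer D δ) (t : I → J → K → ℂ) (c : J → A) (v : K → A) :
    vec δ (contract t c v) = contract t (vec δ c) v + contract t c (vec δ v) := by
  funext i
  simp only [LinearMap.compLeft_apply, contract_apply, Pi.add_apply, map_sum, map_smul, h.mul,
    smul_add, Finset.sum_add_distrib, Function.comp]

theorem vec_graise (c : ι → A) : vec δ (graise T c) = graise T (vec δ c) := by
  funext i
  simp only [LinearMap.compLeft_apply, graise_apply, map_sum, map_smul, Function.comp]

theorem vec_glower (c : ι → A) : vec δ (glower T c) = glower T (vec δ c) := by
  funext i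
  simp only [LinearMap.compLeft_apply, glower_apply, map_sum, map_smul, Function.comp]

theorem der_gdot (h : IsDer D δ) (w v : K → A) :
    δ (gdot w v) = gdot (vec δ w) v + gdot w (vec δ v) := by
  simp only [gdot_apply, LinearMap.compLeft_apply, map_sum, h.mul, Finset.sum_add_distrib,
    Function.comp]

/-- The covariant derivative `δ + c` for a connection `c` that acts through the tensor `t`. -/
def cov (t : K → J → K → ℂ) (δ : A →ₗ[ℂ] A) (c : J → A) : (K → A) →ₗ[ℂ] (K → A) :=
  vec δ + contract t c

theorem cov_apply (t : K → J → K → ℂ) (c : J → A) (v : K → A) :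
    cov t δ c v = vec δ v + contract t c v := rfl

theorem cov_smul (h : IsDer D δ) (t : K → J → K → ℂ) (c : J → A) (e : E) (v : K → A) :
    cov t δ c (e • v) = D e • v + e • cov t δ c v := by
  rw [cov_apply, cov_apply, vec_smul h, contract_smul_right, smul_add, add_assoc]

theorem cov_mul (h : IsDer D δ) (t : K → J → K → ℂ) {c : J → A} {τ : A} (hτ : δ τ = 0)
    (hc : ∀ j, c j * τ = τ * c j) (v : K → A) : cov t δ c (τ • v) = τ • cov t δ c v := by
  rw [cov_apply, cov_apply, vec_mul h, hτ, zero_smul, zero_add, contract_mul_right t hc, smul_add]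

/-- The curvature of a pair of covariant derivatives. -/
theorem cov_cov {t : K → J → K → ℂ} {f : J → J → J → ℂ}
    (ht : ∀ i j l n, ∑ k, t i j k * t k l n - ∑ k, t i l k * t k j n = ∑ a, t i a n * f a j l)
    (h : IsDer D δ) (h' : IsDer D' δ') {c : J → A} (hc : Central c) (c' : J → A) (v : K → A)
    (hcomm : ∀ a, δ (δ' a) = δ' (δ a)) :
    cov t δ c (cov t δ' c' v) = cov t δ' c' (cov t δ c v)
      + contract t (vec δ c' - vec δ' c + contract f c c') v := by
  have e : vec δ (vec δ' v) = vec δ' (vec δ v) := funext fun i => hcomm (v i)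
  simp only [cov_apply, map_add, vec_contract h, vec_contract h', contract_comm ht hc, e, map_sub,
    LinearMap.add_apply, LinearMap.sub_apply]
  abel

/-- Covariant derivative on `R`. -/
abbrev covR (δ : A →ₗ[ℂ] A) (c : ι → A) : (m → A) →ₗ[ℂ] (m → A) := cov (fun s a t => T.ρ a s t) δ c

/-- Covariant derivative on `R^*`. -/
abbrev covRd (δ : A →ₗ[ℂ] A) (c : ι → A) : (m → A) →ₗ[ℂ] (m → A) := cov (fun s a t => -T.ρ a t s) δ c

/-- Covariant derivative on `𝔤`. -/
abbrev covG (δ : A →ₗ[ℂ] A) (c : ι → A) : (ι → A) →ₗ[ℂ] (ι → A) := cov (fun a b c => T.f b c a) δ c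

/-- Covariant derivative on `𝔤^*`. -/
abbrev covGd (δ : A →ₗ[ℂ] A) (c : ι → A) : (ι → A) →ₗ[ℂ] (ι → A) := cov (fun a b c => -T.f b a c) δ c

variable {T}

theorem covRd_gmom (hT : IsGWData T) (h : IsDer D δ) {c : ι → A} (hc : Central c) (w v : m → A) :
    gmom T (covRd T δ c w) v + gmom T w (covR T δ c v) = covGd T δ c (gmom T w v) := by
  have := gmom_equivariant T hT hc w v
  simp only [cov_apply, gmom, gact, gdact, gcoad] at *
  rw [vec_contract h, ← this, map_add, map_add, LinearMap.add_apply]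
  abel

theorem covR_gact (hT : IsGWData T) (h : IsDer D δ) {c : ι → A} (hc : Central c) (b : ι → A)
    (v : m → A) : covR T δ c (gact T b v) = gact T (covG T δ c b) v + gact T b (covR T δ c v) := by
  have := gact_gact T hT hc b v
  simp only [cov_apply, gbrk, gact] at *
  rw [vec_contract h, this, map_add, map_add, LinearMap.add_apply]
  abel

theorem covRd_gdact (hT : IsGWData T) (h : IsDer D δ) {c : ι → A} (hc : Central c) (b : ι → A)
    (w : m → A) :
    covRd T δ c (gdact T b w) = gdact T (covG T δ c b) w + gdact T b (covRd T δ c w) := by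
  have := gdact_gdact T hT hc b w
  simp only [cov_apply, gbrk, gdact] at *
  rw [vec_contract h, this, map_add, map_add, LinearMap.add_apply]
  abel

theorem graise_covGd (hT : IsGWData T) (c b : ι → A) :
    graise T (covGd T δ c b) = covG T δ c (graise T b) := by
  have := graise_gcoad T hT c b
  simp only [cov_apply, gbrk, gcoad] at *
  rw [map_add, this, vec_graise]

theorem der_gdot_cov (h : IsDer D δ) {c : ι → A} (hc : Central c) (w v : m → A) :
    gdot (covRd T δ c w) v + gdot w (covR T δ c v) = δ (gdot w v) := by
  have h1 := gdot_gact T hc w v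
  have h2 := gdot_gdact T (c := c) w v
  simp only [gact, gdact] at h1 h2
  simp only [cov_apply, map_add, LinearMap.add_apply, h1, h2, der_gdot h]
  abel

theorem der_gdot_cov' (h : IsDer D δ) {c : ι → A} (hc : Central c) (v w : m → A) :
    gdot (covR T δ c v) w + gdot v (covRd T δ c w) = δ (gdot v w) := by
  have h1 : gdot (gact T c v) w + gdot v (gdact T c w) = 0 := by
    simp only [gdot_apply, gact, gdact, contract_apply, Finset.mul_sum, Finset.sum_mul,
      mul_smul_comm, smul_mul_assoc]
    rw [sum_reverse, ← Finset.sum_add_distrib]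
    refine Finset.sum_eq_zero fun s _ => ?_
    rw [← Finset.sum_add_distrib]
    refine Finset.sum_eq_zero fun a _ => ?_
    rw [← Finset.sum_add_distrib]
    refine Finset.sum_eq_zero fun t _ => ?_
    rw [← mul_assoc (v s), ← hc a (v s), neg_smul, add_neg_cancel]
  simp only [gact, gdact] at h1
  simp only [cov_apply, map_add, LinearMap.add_apply, der_gdot h]
  rw [← add_zero (gdot (vec δ v) w + gdot v (vec δ w)), ← h1]
  abel

end Covariant

/-! ### First order operators on doublets -/

section Rotations

variable {E : Type*} [CommRing E] [Algebra ℂ E] (D : Derivation ℂ E E)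

/-- The infinitesimal rotation of `𝐗`. -/
def rotX (x : AEven E) : M2 E := (x.2.1 : M2 E) + x.2.2.2 • (1 : M2 E)

/-- The infinitesimal rotation of `𝐘`. -/
def rotY (x : AEven E) : M2 E := (x.2.2.1 : M2 E) - x.2.2.2 • (1 : M2 E)

theorem rotX_mk (V a b c a₂ b₂ c₂ U : E) :
    rotX (V, sl2mk a b c, sl2mk a₂ b₂ c₂, U) = !![a + U, b; c, -a + U] := by
  ext i j; fin_cases i <;> fin_cases j <;> simp [rotX, coe_sl2mk]

theorem rotY_mk (V a b c a₂ b₂ c₂ U : E) :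
    rotY (V, sl2mk a b c, sl2mk a₂ b₂ c₂, U) = !![a₂ - U, b₂; c₂, -a₂ - U] := by
  ext i j; fin_cases i <;> fin_cases j <;> simp [rotY, coe_sl2mk]

theorem m2_neg (a b c d : E) : -(!![a, b; c, d] : M2 E) = !![-a, -b; -c, -d] := by
  ext i j; fin_cases i <;> fin_cases j <;> rfl

theorem exists_aEven (x : AEven E) : ∃ V a b c a₂ b₂ c₂ U,
    x = (V, sl2mk a b c, sl2mk a₂ b₂ c₂, U) := by
  obtain ⟨V, S, St, U⟩ := x
  obtain ⟨a, b, c, rfl⟩ := exists_sl2mk S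
  obtain ⟨a₂, b₂, c₂, rfl⟩ := exists_sl2mk St
  exact ⟨_, _, _, _, _, _, _, _, rfl⟩

theorem exists_aOdd (u : AOdd E) : ∃ g₁ g₂ g₃ g₄ s₁ s₂ s₃ s₄,
    u = (!![g₁, g₂; g₃, g₄], !![s₁, s₂; s₃, s₄]) := by
  obtain ⟨G, T⟩ := u
  obtain ⟨g₁, g₂, g₃, g₄, rfl⟩ := exists_mat G
  obtain ⟨s₁, s₂, s₃, s₄, rfl⟩ := exists_mat T
  exact ⟨_, _, _, _, _, _, _, _, rfl⟩

theorem rotX_ee (x y : AEven E) : rotX ((aN6 D).ee x y) = x.1 • (rotX y).map D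
    - y.1 • (rotX x).map D + (rotX x * rotX y - rotX y * rotX x) := by
  obtain ⟨V, a, b, c, a₂, b₂, c₂, U, rfl⟩ := exists_aEven x
  obtain ⟨V', a', b', c', a₂', b₂', c₂', U', rfl⟩ := exists_aEven y
  simp only [aN6_ee_eq, rotX_mk, map_of, Matrix.mul_fin_two, m2_add, m2_sub, m2_smul, m2_inj,
    map_add, map_neg, map_sub, smul_eq_mul]
  refine ⟨?_, ?_, ?_, ?_⟩ <;> algebra

theorem rotY_ee (x y : AEven E) : rotY ((aN6 D).ee x y) = x.1 • (rotY y).map D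
    - y.1 • (rotY x).map D + (rotY x * rotY y - rotY y * rotY x) := by
  obtain ⟨V, a, b, c, a₂, b₂, c₂, U, rfl⟩ := exists_aEven x
  obtain ⟨V', a', b', c', a₂', b₂', c₂', U', rfl⟩ := exists_aEven y
  simp only [aN6_ee_eq, rotY_mk, map_of, Matrix.mul_fin_two, m2_add, m2_sub, m2_smul, m2_inj,
    map_add, map_neg, map_sub, smul_eq_mul]
  refine ⟨?_, ?_, ?_, ?_⟩ <;> algebra

theorem eo_fst (x : AEven E) (u : AOdd E) : ((aN6 D).eo x u).1 = x.1 • u.1.map D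
    + (4⁻¹ - 3 / 4 : ℂ) • (D x.1 • u.1) + (rotX x * u.1 - u.1 * -(rotY x).transpose) := by
  obtain ⟨V, a, b, c, a₂, b₂, c₂, U, rfl⟩ := exists_aEven x
  obtain ⟨g₁, g₂, g₃, g₄, s₁, s₂, s₃, s₄, rfl⟩ := exists_aOdd u
  simp only [aN6_eo_eq, rotX_mk, rotY_mk, map_of, transpose_of, m2_neg, Matrix.mul_fin_two, m2_add,
    m2_sub, m2_smul, m2_inj, smul_eq_mul]
  refine ⟨?_, ?_, ?_, ?_⟩ <;> algebra

theorem eo_fst_transpose (x : AEven E) (u : AOdd E) : ((aN6 D).eo x u).1.transpose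
    = x.1 • u.1.transpose.map D + (4⁻¹ - 3 / 4 : ℂ) • (D x.1 • u.1.transpose)
      + (rotY x * u.1.transpose - u.1.transpose * -(rotX x).transpose) := by
  obtain ⟨V, a, b, c, a₂, b₂, c₂, U, rfl⟩ := exists_aEven x
  obtain ⟨g₁, g₂, g₃, g₄, s₁, s₂, s₃, s₄, rfl⟩ := exists_aOdd u
  simp only [aN6_eo_eq, rotX_mk, rotY_mk, map_of, transpose_of, m2_neg, Matrix.mul_fin_two, m2_add,
    m2_sub, m2_smul, m2_inj, smul_eq_mul]
  refine ⟨?_, ?_, ?_, ?_⟩ <;> algebra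

theorem eo_vee (x : AEven E) (u : AOdd E) : vee ((aN6 D).eo x u).1
    = x.1 • (vee u.1).map D - (2⁻¹ : ℂ) • (D x.1 • vee u.1)
      + (-(rotX x).transpose * vee u.1 - vee u.1 * rotY x) := by
  obtain ⟨V, a, b, c, a₂, b₂, c₂, U, rfl⟩ := exists_aEven x
  obtain ⟨g₁, g₂, g₃, g₄, s₁, s₂, s₃, s₄, rfl⟩ := exists_aOdd u
  simp only [aN6_eo_eq, rotX_mk, rotY_mk, map_of, transpose_of, m2_neg, Matrix.mul_fin_two, m2_add,
    m2_sub, m2_smul, m2_inj, smul_eq_mul, vee_of, map_neg]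
  refine ⟨?_, ?_, ?_, ?_⟩ <;> algebra

theorem eo_snd (x : AEven E) (u : AOdd E) : ((aN6 D).eo x u).2
    = x.1 • u.2.map D + (2⁻¹ : ℂ) • (D x.1 • u.2) + (-(rotX x).transpose * u.2 - u.2 * rotY x)
      + (2⁻¹ : ℂ) • ((-(rotX x).transpose).map D * vee u.1 + vee u.1 * (rotY x).map D) := by
  obtain ⟨V, a, b, c, a₂, b₂, c₂, U, rfl⟩ := exists_aEven x
  obtain ⟨g₁, g₂, g₃, g₄, s₁, s₂, s₃, s₄, rfl⟩ := exists_aOdd u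
  simp only [aN6_eo_eq, rotX_mk, rotY_mk, map_of, transpose_of, m2_neg, Matrix.mul_fin_two, m2_add,
    m2_sub, m2_smul, m2_inj, smul_eq_mul, vee_of, map_neg, map_add, map_sub]
  refine ⟨?_, ?_, ?_, ?_⟩ <;> algebra

theorem eo_vee_transpose (x : AEven E) (u : AOdd E) : (vee ((aN6 D).eo x u).1).transpose
    = x.1 • (vee u.1).transpose.map D - (2⁻¹ : ℂ) • (D x.1 • (vee u.1).transpose)
      + (-(rotY x).transpose * (vee u.1).transpose - (vee u.1).transpose * rotX x) := by
  obtain ⟨V, a, b, c, a₂, b₂, c₂, U, rfl⟩ := exists_aEven x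
  obtain ⟨g₁, g₂, g₃, g₄, s₁, s₂, s₃, s₄, rfl⟩ := exists_aOdd u
  simp only [aN6_eo_eq, rotX_mk, rotY_mk, map_of, transpose_of, m2_neg, Matrix.mul_fin_two, m2_add,
    m2_sub, m2_smul, m2_inj, smul_eq_mul, vee_of, map_neg]
  refine ⟨?_, ?_, ?_, ?_⟩ <;> algebra

theorem eo_snd_transpose (x : AEven E) (u : AOdd E) : -((aN6 D).eo x u).2.transpose
    = x.1 • (-u.2.transpose).map D + (2⁻¹ : ℂ) • (D x.1 • -u.2.transpose)
      + (-(rotY x).transpose * -u.2.transpose - -u.2.transpose * rotX x)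
      + (2⁻¹ : ℂ) • ((-(rotY x).transpose).map D * (vee u.1).transpose
        + (vee u.1).transpose * (rotX x).map D) := by
  obtain ⟨V, a, b, c, a₂, b₂, c₂, U, rfl⟩ := exists_aEven x
  obtain ⟨g₁, g₂, g₃, g₄, s₁, s₂, s₃, s₄, rfl⟩ := exists_aOdd u
  simp only [aN6_eo_eq, rotX_mk, rotY_mk, map_of, transpose_of, m2_neg, Matrix.mul_fin_two, m2_add,
    m2_sub, m2_smul, m2_inj, smul_eq_mul, vee_of, map_neg, map_add, map_sub]
  refine ⟨?_, ?_, ?_, ?_⟩ <;> algebra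

end Rotations

section MatterBrackets

variable {E M : Type*} [CommRing E] [Algebra ℂ E] [AddCommGroup M] [Module ℂ M] [Module E M]
  [IsScalarTower ℂ E M] (D : Derivation ℂ E E)

/-- The covariant Lie derivative of a doublet of weight `w` along `V`, plus a rotation `P`. -/
def wtr (nab : M →ₗ[ℂ] M) (w : ℂ) (V : E) (P : M2 E) (x : Fin 2 → M) (α : Fin 2) : M :=
  V • nab (x α) + w • (D V • x α) + ∑ β, P α β • x β

/-- The first order operator `H ∇ + ½ (∂H) - Z` on doublets. -/
def xtr (nab : M →ₗ[ℂ] M) (H Z : M2 E) (x : Fin 2 → M) (α : Fin 2) : M :=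
  ∑ β, (H α β • nab (x β) + (2⁻¹ : ℂ) • (D (H α β) • x β) - Z α β • x β)

variable {D} {nab : M →ₗ[ℂ] M}

/-- The commutator of two even symmetries on a doublet of matter fields. -/
theorem wtr_wtr (hn : ∀ (e : E) v, nab (e • v) = D e • v + e • nab v) (w : ℂ) (V V' : E) (P P' : M2 E) (x : Fin 2 → M) (α : Fin 2) :
    wtr D nab w V P (wtr D nab w V' P' x) α - wtr D nab w V' P' (wtr D nab w V P x) α
      = wtr D nab w (V * D V' - V' * D V) (V • P'.map D - V' • P.map D + (P * P' - P' * P)) x α := by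
  simp only [wtr, Fin.sum_univ_two, map_add, map_smul, hn, Matrix.add_apply, Matrix.sub_apply,
    Matrix.smul_apply, Matrix.map_apply, Matrix.mul_apply, map_sub, Derivation.leibniz, smul_eq_mul]
  fin_cases α <;> simp only [Fin.zero_eta, Fin.mk_one, Fin.isValue] <;> match_scalars <;> algebra

theorem wtr_rot (hn : ∀ (e : E) v, nab (e • v) = D e • v + e • nab v) (w w' : ℂ) (V : E) (P P' g : M2 E) (y : Fin 2 → M) (α : Fin 2) :
    wtr D nab w V P (fun α => ∑ β, g α β • y β) α - ∑ β, g α β • wtr D nab w' V P' y β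
      = ∑ β, (V • g.map D + (w - w') • (D V • g) + (P * g - g * P')) α β • y β := by
  simp only [wtr, Fin.sum_univ_two, map_add, map_smul, hn, Matrix.add_apply, Matrix.sub_apply,
    Matrix.smul_apply, Matrix.map_apply, Matrix.mul_apply, map_sub, Derivation.leibniz, smul_eq_mul]
  fin_cases α <;> simp only [Fin.zero_eta, Fin.mk_one, Fin.isValue] <;> match_scalars <;> algebra

/-- The commutator of an even symmetry with the part of an odd symmetry that contains derivatives. -/
theorem wtr_xtr (hn : ∀ (e : E) v, nab (e • v) = D e • v + e • nab v) (V : E) (P P' H Z : M2 E) (y : Fin 2 → M) (α : Fin 2) :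
    wtr D nab (3 / 4) V P (xtr D nab H Z y) α - xtr D nab H Z (wtr D nab 4⁻¹ V P' y) α
      = xtr D nab (V • H.map D - (2⁻¹ : ℂ) • (D V • H) + (P * H - H * P'))
        (V • Z.map D + (2⁻¹ : ℂ) • (D V • Z) + (P * Z - Z * P') +
          (2⁻¹ : ℂ) • (P.map D * H + H * P'.map D)) y α := by
  simp only [wtr, xtr, Fin.sum_univ_two, map_add, map_smul, hn, Matrix.add_apply, Matrix.sub_apply,
    Matrix.smul_apply, Matrix.map_apply, Matrix.mul_apply, map_sub, Derivation.leibniz,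
    smul_eq_mul, Derivation.map_smul]
  fin_cases α <;> simp only [Fin.zero_eta, Fin.mk_one, Fin.isValue] <;> match_scalars <;> algebra

/-- Two odd symmetries compose on `𝐗` to the even symmetry given by their bracket. -/
theorem oo_X (hn : ∀ (e : E) v, nab (e • v) = D e • v + e • nab v) (u v : AOdd E)
    (x : Fin 2 → M) (α : Fin 2) :
    ∑ β, u.1 α β • xtr D nab (vee v.1).transpose (-v.2.transpose) x β
      + ∑ β, v.1 α β • xtr D nab (vee u.1).transpose (-u.2.transpose) x β
      = wtr D nab 4⁻¹ ((aN6 D).oo u v).1 (rotX ((aN6 D).oo u v)) x α := by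
  obtain ⟨g₁, g₂, g₃, g₄, s₁, s₂, s₃, s₄, rfl⟩ := exists_aOdd u
  obtain ⟨h₁, h₂, h₃, h₄, t₁, t₂, t₃, t₄, rfl⟩ := exists_aOdd v
  simp only [wtr, xtr, aN6_oo_eq, rotX_mk, rotY_mk, vee_of, transpose_of, m2_neg, Fin.sum_univ_two,
    Matrix.of_apply, Matrix.cons_val', Matrix.cons_val_zero, Matrix.cons_val_one,
    Matrix.cons_val_fin_one, Matrix.empty_val']
  fin_cases α <;> simp only [Fin.zero_eta, Fin.mk_one, Fin.isValue, Matrix.cons_val_zero,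
    Matrix.cons_val_one, map_add, map_sub, map_neg, hn, Derivation.leibniz, smul_eq_mul] <;>
    match_scalars <;> algebra

theorem oo_Y (hn : ∀ (e : E) v, nab (e • v) = D e • v + e • nab v) (u v : AOdd E)
    (x : Fin 2 → M) (α : Fin 2) :
    ∑ β, u.1.transpose α β • xtr D nab (vee v.1) v.2 x β
      + ∑ β, v.1.transpose α β • xtr D nab (vee u.1) u.2 x β
      = wtr D nab 4⁻¹ ((aN6 D).oo u v).1 (rotY ((aN6 D).oo u v)) x α := by
  obtain ⟨g₁, g₂, g₃, g₄, s₁, s₂, s₃, s₄, rfl⟩ := exists_aOdd u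
  obtain ⟨h₁, h₂, h₃, h₄, t₁, t₂, t₃, t₄, rfl⟩ := exists_aOdd v
  simp only [wtr, xtr, aN6_oo_eq, rotX_mk, rotY_mk, vee_of, transpose_of, m2_neg, Fin.sum_univ_two,
    Matrix.of_apply, Matrix.cons_val', Matrix.cons_val_zero, Matrix.cons_val_one,
    Matrix.cons_val_fin_one, Matrix.empty_val']
  fin_cases α <;> simp only [Fin.zero_eta, Fin.mk_one, Fin.isValue, Matrix.cons_val_zero,
    Matrix.cons_val_one, map_add, map_sub, map_neg, hn, Derivation.leibniz, smul_eq_mul] <;>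
    match_scalars <;> algebra

theorem oo_PX (hn : ∀ (e : E) v, nab (e • v) = D e • v + e • nab v) (u v : AOdd E)
    (x : Fin 2 → M) (α : Fin 2) :
    xtr D nab (vee u.1) u.2 (fun γ => ∑ β, v.1.transpose γ β • x β) α
      + xtr D nab (vee v.1) v.2 (fun γ => ∑ β, u.1.transpose γ β • x β) α
      = wtr D nab (3 / 4) ((aN6 D).oo u v).1 (-(rotX ((aN6 D).oo u v)).transpose) x α := by
  obtain ⟨g₁, g₂, g₃, g₄, s₁, s₂, s₃, s₄, rfl⟩ := exists_aOdd u
  obtain ⟨h₁, h₂, h₃, h₄, t₁, t₂, t₃, t₄, rfl⟩ := exists_aOdd v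
  simp only [wtr, xtr, aN6_oo_eq, rotX_mk, rotY_mk, vee_of, transpose_of, m2_neg, Fin.sum_univ_two,
    Matrix.of_apply, Matrix.cons_val', Matrix.cons_val_zero, Matrix.cons_val_one,
    Matrix.cons_val_fin_one, Matrix.empty_val']
  fin_cases α <;> simp only [Fin.zero_eta, Fin.mk_one, Fin.isValue, Matrix.cons_val_zero,
    Matrix.cons_val_one, map_add, map_sub, map_neg, hn, Derivation.leibniz, smul_eq_mul] <;>
    match_scalars <;> algebra

theorem oo_PY (hn : ∀ (e : E) v, nab (e • v) = D e • v + e • nab v) (u v : AOdd E)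
    (x : Fin 2 → M) (α : Fin 2) :
    xtr D nab (vee u.1).transpose (-u.2.transpose) (fun γ => ∑ β, v.1 γ β • x β) α
      + xtr D nab (vee v.1).transpose (-v.2.transpose) (fun γ => ∑ β, u.1 γ β • x β) α
      = wtr D nab (3 / 4) ((aN6 D).oo u v).1 (-(rotY ((aN6 D).oo u v)).transpose) x α := by
  obtain ⟨g₁, g₂, g₃, g₄, s₁, s₂, s₃, s₄, rfl⟩ := exists_aOdd u
  obtain ⟨h₁, h₂, h₃, h₄, t₁, t₂, t₃, t₄, rfl⟩ := exists_aOdd v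
  simp only [wtr, xtr, aN6_oo_eq, rotX_mk, rotY_mk, vee_of, transpose_of, m2_neg, Fin.sum_univ_two,
    Matrix.of_apply, Matrix.cons_val', Matrix.cons_val_zero, Matrix.cons_val_one,
    Matrix.cons_val_fin_one, Matrix.empty_val']
  fin_cases α <;> simp only [Fin.zero_eta, Fin.mk_one, Fin.isValue, Matrix.cons_val_zero,
    Matrix.cons_val_one, map_add, map_sub, map_neg, hn, Derivation.leibniz, smul_eq_mul] <;>
    match_scalars <;> algebra

end MatterBrackets

/-! ### Symmetry transformations and their derivatives -/

section FieldSpace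

variable {A : Type*} {ι m : Type*}

/-- The components of a configuration of fields with values in an algebra. -/
abbrev fA (φ : FieldIdx ι m → A) : ι → A := fun a => φ (.A a)
/-- The components `𝐁`. -/
abbrev fB (φ : FieldIdx ι m → A) : ι → A := fun a => φ (.B a)
/-- The components `𝐗`. -/
abbrev fX (φ : FieldIdx ι m → A) (α : Fin 2) : m → A := fun s => φ (.X α s)
/-- The components `𝐘`. -/
abbrev fY (φ : FieldIdx ι m → A) (α : Fin 2) : m → A := fun s => φ (.Y α s)
/-- The components `𝚿_𝐗`. -/
abbrev fPX (φ : FieldIdx ι m → A) (α : Fin 2) : m → A := fun s => φ (.PX α s)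
/-- The components `𝚿_𝐘`. -/
abbrev fPY (φ : FieldIdx ι m → A) (α : Fin 2) : m → A := fun s => φ (.PY α s)

/-- The configuration with given components. -/
def mkF (a b : ι → A) (x y px py : Fin 2 → m → A) : FieldIdx ι m → A
  | .A i => a i
  | .B i => b i
  | .X α s => x α s
  | .Y α s => y α s
  | .PX α s => px α s
  | .PY α s => py α s

theorem mkF_inj {a b a' b' : ι → A} {x y px py x' y' px' py' : Fin 2 → m → A} (ha : a = a')
    (hb : b = b') (hx : ∀ α, x α = x' α) (hy : ∀ α, y α = y' α) (hpx : ∀ α, px α = px' α)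
    (hpy : ∀ α, py α = py' α) : mkF a b x y px py = mkF a' b' x' y' px' py' := by
  rw [ha, hb, funext hx, funext hy, funext hpx, funext hpy]

instance [Finite ι] [Finite m] : Finite (FieldIdx ι m) := by
  let F : (ι ⊕ ι) ⊕ (Fin 4 × Fin 2 × m) → FieldIdx ι m
    | .inl (.inl a) => .A a
    | .inl (.inr a) => .B a
    | .inr (0, α, s) => .X α s
    | .inr (1, α, s) => .Y α s
    | .inr (2, α, s) => .PX α s
    | .inr (3, α, s) => .PY α s
  refine Finite.of_surjective F fun i => ?_
  cases i with
  | A a => exact ⟨.inl (.inl a), rfl⟩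
  | B a => exact ⟨.inl (.inr a), rfl⟩
  | X α s => exact ⟨.inr (0, α, s), rfl⟩
  | Y α s => exact ⟨.inr (1, α, s), rfl⟩
  | PX α s => exact ⟨.inr (2, α, s), rfl⟩
  | PY α s => exact ⟨.inr (3, α, s), rfl⟩

end FieldSpace

section FieldDerivatives

variable {E A : Type*} [CommRing E] [Algebra ℂ E] [Ring A] [Algebra ℂ A] [Algebra E A]
  [IsScalarTower ℂ E A] {ι m : Type*}
variable {B : Type*} [AddCommGroup B] [Module ℂ B] {φ ψ : B}

theorem HasDirDeriv.congr_deriv {B' : Type*} [AddCommGroup B'] [Module ℂ B'] {F : B → B'}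
    {d d' : B'} (h : HasDirDeriv F φ ψ d) (e : d = d') : HasDirDeriv F φ ψ d' := e ▸ h

theorem HasDirDeriv.mkF [Finite ι] [Finite m] {a b : B → ι → A} {x y px py : B → Fin 2 → m → A}
    {a' b' : ι → A} {x' y' px' py' : Fin 2 → m → A} (ha : HasDirDeriv a φ ψ a')
    (hb : HasDirDeriv b φ ψ b')
    (hx : ∀ α, HasDirDeriv (fun f => x f α) φ ψ (x' α))
    (hy : ∀ α, HasDirDeriv (fun f => y f α) φ ψ (y' α))
    (hpx : ∀ α, HasDirDeriv (fun f => px f α) φ ψ (px' α))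
    (hpy : ∀ α, HasDirDeriv (fun f => py f α) φ ψ (py' α)) :
    HasDirDeriv (fun f => HTTwist.mkF (a f) (b f) (x f) (y f) (px f) (py f)) φ ψ
      (HTTwist.mkF a' b' x' y' px' py') := by
  refine HasDirDeriv.pi fun i => ?_
  cases i with
  | A i => exact ha.linear_comp (LinearMap.proj i)
  | B i => exact hb.linear_comp (LinearMap.proj i)
  | X α s => exact (hx α).linear_comp (LinearMap.proj s)
  | Y α s => exact (hy α).linear_comp (LinearMap.proj s)
  | PX α s => exact (hpx α).linear_comp (LinearMap.proj s)
  | PY α s => exact (hpy α).linear_comp (LinearMap.proj s)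

theorem HasDirDeriv.contract {I J K : Type*} [Finite I] [Fintype J] [Fintype K] (t : I → J → K → ℂ)
    {c : B → J → A} {v : B → K → A} {c' : J → A} {v' : K → A} (hc : HasDirDeriv c φ ψ c')
    (hv : HasDirDeriv v φ ψ v') :
    HasDirDeriv (fun f => HTTwist.contract t (c f) (v f)) φ ψ
      (HTTwist.contract t c' (v φ) + HTTwist.contract t (c φ) v') := by
  refine HasDirDeriv.pi fun i => ?_
  have h := HasDirDeriv.sum Finset.univ fun j => HasDirDeriv.sum Finset.univ fun k =>
    ((hc.linear_comp (LinearMap.proj j)).mul (hv.linear_comp (LinearMap.proj k))).const_smul (t i j k)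
  simpa only [Pi.add_apply, contract_apply, smul_add, Finset.sum_add_distrib,
    LinearMap.proj_apply] using h

theorem HasDirDeriv.gdot {K : Type*} [Fintype K]
    {c : B → K → A} {v : B → K → A} {c' : K → A} {v' : K → A} (hc : HasDirDeriv c φ ψ c')
    (hv : HasDirDeriv v φ ψ v') :
    HasDirDeriv (fun f => HTTwist.gdot (c f) (v f)) φ ψ
      (HTTwist.gdot c' (v φ) + HTTwist.gdot (c φ) v') := by
  have h := HasDirDeriv.sum Finset.univ fun k =>
    ((hc.linear_comp (LinearMap.proj k)).mul (hv.linear_comp (LinearMap.proj k)))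
  simpa only [gdot_apply, Finset.sum_add_distrib, LinearMap.proj_apply] using h

theorem HasDirDeriv.esmul {M : Type*} [AddCommGroup M] [Module ℂ M] [Module E M]
    [IsScalarTower ℂ E M] {F : B → M} {d : M} (e : E)
    (h : HasDirDeriv F φ ψ d) : HasDirDeriv (fun f => e • F f) φ ψ (e • d) :=
  h.linear_comp (Algebra.lsmul ℂ ℂ M e)

theorem HasDirDeriv.asmul {K : Type*} {F : B → K → A} {d : K → A} (τ : A)
    (h : HasDirDeriv F φ ψ d) : HasDirDeriv (fun f => τ • F f) φ ψ (τ • d) :=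
  h.linear_comp ((LinearMap.mulLeft ℂ τ).compLeft K)

theorem hasDirDeriv_component {κ K : Type*} (i : K → κ) (φ ψ : κ → A) :
    HasDirDeriv (fun f : κ → A => fun s => f (i s)) φ ψ (fun s => ψ (i s)) :=
  .of_affine fun _ => rfl

end FieldDerivatives

section Transformations

variable {E A : Type*} [CommRing E] [Algebra ℂ E] [Ring A] [Algebra ℂ A] [Algebra E A]
  [IsScalarTower ℂ E A] {ι m : Type*} [Fintype ι] [DecidableEq ι] [Fintype m] (T : GaugeData ι m)
  (D : Derivation ℂ E E) (δ : A →ₗ[ℂ] A)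

/-- The connection `-(2π/k) 𝐁`. -/
def conB (b : ι → A) : ι → A := -kappa T • graise T b

/-- `ν^{αβ}`. -/
def gnu (φ : FieldIdx ι m → A) (α β : Fin 2) : ι → A := gmom T (fY φ β) (fX φ α)

/-- The moment map `μ`. -/
def gmu (φ : FieldIdx ι m → A) : ι → A :=
  ∑ α, (gmom T (fPX φ α) (fX φ α) - gmom T (fY φ α) (fPY φ α))

/-- The derivative of `ν^{αβ}`. -/
def gnu' (φ ψ : FieldIdx ι m → A) (α β : Fin 2) : ι → A :=
  gmom T (fY ψ β) (fX φ α) + gmom T (fY φ β) (fX ψ α)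

/-- The derivative of `μ`. -/
def gmu' (φ ψ : FieldIdx ι m → A) : ι → A :=
  ∑ α, (gmom T (fPX ψ α) (fX φ α) + gmom T (fPX φ α) (fX ψ α)
    - (gmom T (fY ψ α) (fPY φ α) + gmom T (fY φ α) (fPY ψ α)))

theorem hasDirDeriv_gnu (φ ψ : FieldIdx ι m → A) (α β : Fin 2) :
    HasDirDeriv (fun f => gnu T f α β) φ ψ (gnu' T φ ψ α β) :=
  HasDirDeriv.contract _ (hasDirDeriv_component _ φ ψ) (hasDirDeriv_component _ φ ψ)

theorem hasDirDeriv_gmu (φ ψ : FieldIdx ι m → A) :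
    HasDirDeriv (fun f => gmu T f) φ ψ (gmu' T φ ψ) :=
  HasDirDeriv.sum _ fun _ =>
    (HasDirDeriv.contract _ (hasDirDeriv_component _ φ ψ) (hasDirDeriv_component _ φ ψ)).sub
    (HasDirDeriv.contract _ (hasDirDeriv_component _ φ ψ) (hasDirDeriv_component _ φ ψ))

/-- The infinitesimal transformation of matter with parameters `x + τ u`, at fixed connection `c`,
together with a given transformation `a` of `𝐀`. -/
def mtr (x : AEven E) (u : AOdd E) (τ : A) (a c : ι → A) (φ : FieldIdx ι m → A) :
    FieldIdx ι m → A :=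
  mkF a 0
    (fun α => wtr D (covR T δ c) 4⁻¹ x.1 (rotX x) (fX φ) α - ∑ β, u.1 α β • (τ • fPY φ β))
    (fun α => wtr D (covRd T δ c) 4⁻¹ x.1 (rotY x) (fY φ) α
      + ∑ β, u.1.transpose α β • (τ • fPX φ β))
    (fun α => wtr D (covRd T δ c) (3 / 4) x.1 (-(rotX x).transpose) (fPX φ) α
      + xtr D (covRd T δ c) (vee u.1) u.2 (fun β => τ • fY φ β) α)
    (fun α => wtr D (covR T δ c) (3 / 4) x.1 (-(rotY x).transpose) (fPY φ) α
      - xtr D (covR T δ c) (vee u.1).transpose (-u.2.transpose) (fun β => τ • fX φ β) α)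

/-- The part of the derivative of a transformation that comes from the variation `w` of the
connection. -/
def wvar (x : AEven E) (u : AOdd E) (τ : A) (w : ι → A) (φ : FieldIdx ι m → A) :
    FieldIdx ι m → A :=
  mkF 0 0 (fun α => x.1 • gact T w (fX φ α)) (fun α => x.1 • gdact T w (fY φ α))
    (fun α => x.1 • gdact T w (fPX φ α) + ∑ β, vee u.1 α β • gdact T w (τ • fY φ β))
    (fun α => x.1 • gact T w (fPY φ α) - ∑ β, (vee u.1).transpose α β • gact T w (τ • fX φ β))

/-- The transformation of `𝐀` with index lowered. -/
def atr (x : AEven E) (u : AOdd E) (τ : A) (mu : ι → A) (nu : Fin 2 → Fin 2 → ι → A) : ι → A :=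
  x.1 • mu + ∑ α, ∑ β, vee u.1 α β • (τ • nu α β)

/-- The infinitesimal transformation with parameters `x + τ u`. -/
def ptr (x : AEven E) (u : AOdd E) (τ : A) (φ : FieldIdx ι m → A) : FieldIdx ι m → A :=
  mtr T D δ x u τ (kappa T • graise T (atr x u τ (gmu T φ) (gnu T φ))) (conB T (fB φ)) φ

theorem hasDirDeriv_wtr {B M : Type*} [AddCommGroup B] [Module ℂ B] {φ ψ : B} [AddCommGroup M]
    [Module ℂ M] [Module E M] [IsScalarTower ℂ E M] (nab : B → M →ₗ[ℂ] M) (x : B → Fin 2 → M)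
    {n' x' : Fin 2 → M} (hn : ∀ α, HasDirDeriv (fun f => nab f (x f α)) φ ψ (nab φ (x' α) + n' α))
    (hx : ∀ α, HasDirDeriv (fun f => x f α) φ ψ (x' α)) (w : ℂ) (V : E) (P : M2 E) (α : Fin 2) :
    HasDirDeriv (fun f => wtr D (nab f) w V P (x f) α) φ ψ (wtr D (nab φ) w V P x' α + V • n' α) := by
  have h := (((hn α).esmul V).add (((hx α).esmul (D V)).const_smul w)).add
    (HasDirDeriv.sum Finset.univ fun β => (hx β).esmul (P α β))
  refine h.congr_deriv ?_
  simp only [wtr, smul_add]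
  abel

theorem hasDirDeriv_xtr {B M : Type*} [AddCommGroup B] [Module ℂ B] {φ ψ : B} [AddCommGroup M]
    [Module ℂ M] [Module E M] [IsScalarTower ℂ E M] (nab : B → M →ₗ[ℂ] M) (x : B → Fin 2 → M)
    {n' x' : Fin 2 → M} (hn : ∀ α, HasDirDeriv (fun f => nab f (x f α)) φ ψ (nab φ (x' α) + n' α))
    (hx : ∀ α, HasDirDeriv (fun f => x f α) φ ψ (x' α)) (H Z : M2 E) (α : Fin 2) :
    HasDirDeriv (fun f => xtr D (nab f) H Z (x f) α) φ ψ
      (xtr D (nab φ) H Z x' α + ∑ β, H α β • n' β) := by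
  have h := HasDirDeriv.sum Finset.univ fun β => (((hn β).esmul (H α β)).add
    (((hx β).esmul (D (H α β))).const_smul 2⁻¹)).sub ((hx β).esmul (Z α β))
  refine h.congr_deriv ?_
  simp only [xtr, ← Finset.sum_add_distrib]
  refine Finset.sum_congr rfl fun β _ => ?_
  simp only [smul_add]
  abel

theorem hasDirDeriv_cov {B : Type*} [AddCommGroup B] [Module ℂ B] {φ ψ : B} {J K : Type*}
    [Fintype J] [Fintype K] (t : K → J → K → ℂ) {c : B → J → A} {v : B → K → A} {c' : J → A}
    {v' : K → A} (hc : HasDirDeriv c φ ψ c') (hv : HasDirDeriv v φ ψ v') :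
    HasDirDeriv (fun f => cov t δ (c f) (v f)) φ ψ (cov t δ (c φ) v' + contract t c' (v φ)) := by
  have h := (hv.linear_comp (δ.compLeft K)).add (hc.contract t hv)
  refine h.congr_deriv ?_
  simp only [cov_apply]
  abel

theorem hasDirDeriv_ptr (x : AEven E) (u : AOdd E) (τ : A) (φ ψ : FieldIdx ι m → A) :
    HasDirDeriv (ptr T D δ x u τ) φ ψ
      (mtr T D δ x u τ (kappa T • graise T (atr x u τ (gmu' T φ ψ) (gnu' T φ ψ))) (conB T (fB φ)) ψ
        + wvar T x u τ (conB T (fB ψ)) φ) := by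
  have hB : HasDirDeriv (fun f : FieldIdx ι m → A => conB T (fB f)) φ ψ (conB T (fB ψ)) :=
    ((hasDirDeriv_component _ φ ψ).linear_comp (graise T)).const_smul (-kappa T)
  have hA : HasDirDeriv (fun f => kappa T • graise T (atr x u τ (gmu T f) (gnu T f))) φ ψ
      (kappa T • graise T (atr x u τ (gmu' T φ ψ) (gnu' T φ ψ))) :=
    ((((hasDirDeriv_gmu T φ ψ).esmul x.1).add (HasDirDeriv.sum _ fun α => HasDirDeriv.sum _ fun β =>
      (((hasDirDeriv_gnu T φ ψ α β).asmul τ).esmul (vee u.1 α β)))).linear_comp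
        (graise T)).const_smul (kappa T)
  have h := HasDirDeriv.mkF hA (hasDirDeriv_const 0 φ ψ)
    (fun α => (hasDirDeriv_wtr D _ _ (fun β => hasDirDeriv_cov δ (fun s a t => T.ρ a s t) hB (hasDirDeriv_component
      (FieldIdx.X β) φ ψ)) (fun β => hasDirDeriv_component (FieldIdx.X β) φ ψ) 4⁻¹ x.1 (rotX x) α).sub
      (HasDirDeriv.sum Finset.univ fun β =>
        ((hasDirDeriv_component (FieldIdx.PY β) φ ψ).asmul τ).esmul (u.1 α β)))
    (fun α => (hasDirDeriv_wtr D _ _ (fun β => hasDirDeriv_cov δ (fun s a t => -T.ρ a t s) hB (hasDirDeriv_component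
      (FieldIdx.Y β) φ ψ)) (fun β => hasDirDeriv_component (FieldIdx.Y β) φ ψ) 4⁻¹ x.1 (rotY x) α).add
      (HasDirDeriv.sum Finset.univ fun β =>
        ((hasDirDeriv_component (FieldIdx.PX β) φ ψ).asmul τ).esmul (u.1.transpose α β)))
    (fun α => (hasDirDeriv_wtr D _ _ (fun β => hasDirDeriv_cov δ (fun s a t => -T.ρ a t s) hB (hasDirDeriv_component
      (FieldIdx.PX β) φ ψ)) (fun β => hasDirDeriv_component (FieldIdx.PX β) φ ψ) (3 / 4) x.1
      (-(rotX x).transpose) α).add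
      (hasDirDeriv_xtr D _ _ (fun β => hasDirDeriv_cov δ (fun s a t => -T.ρ a t s) hB ((hasDirDeriv_component
        (FieldIdx.Y β) φ ψ).asmul τ)) (fun β => (hasDirDeriv_component (FieldIdx.Y β) φ ψ).asmul τ)
        (vee u.1) u.2 α))
    (fun α => (hasDirDeriv_wtr D _ _ (fun β => hasDirDeriv_cov δ (fun s a t => T.ρ a s t) hB (hasDirDeriv_component
      (FieldIdx.PY β) φ ψ)) (fun β => hasDirDeriv_component (FieldIdx.PY β) φ ψ) (3 / 4) x.1
      (-(rotY x).transpose) α).sub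
      (hasDirDeriv_xtr D _ _ (fun β => hasDirDeriv_cov δ (fun s a t => T.ρ a s t) hB ((hasDirDeriv_component
        (FieldIdx.X β) φ ψ).asmul τ)) (fun β => (hasDirDeriv_component (FieldIdx.X β) φ ψ).asmul τ)
        (vee u.1).transpose (-u.2.transpose) α))
  refine h.congr_deriv ?_
  funext i
  cases i <;> simp only [mtr, wvar, mkF, Pi.add_apply, Pi.sub_apply, Pi.zero_apply, gact, gdact] <;>
    abel

end Transformations

/-! ### Moment maps under symmetry transformations -/

section MatterLemmas

variable {E M N Q : Type*} [CommRing E] [Algebra ℂ E] [AddCommGroup M] [Module ℂ M] [Module E M]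
  [IsScalarTower ℂ E M] [AddCommGroup N] [Module ℂ N] [Module E N] [IsScalarTower ℂ E N]
  [AddCommGroup Q] [Module ℂ Q] [Module E Q] [IsScalarTower ℂ E Q]
  {D : Derivation ℂ E E}

/-- Multiplication of the parameters of an even element by a function. -/
def escale (e : E) (x : AEven E) : AEven E :=
  (e * x.1, ⟨e • (x.2.1 : M2 E), by
    have h := x.2.1.2
    rw [LinearMap.mem_ker, Matrix.traceLinearMap_apply] at h ⊢
    rw [Matrix.trace_smul, h, smul_zero]⟩, ⟨e • (x.2.2.1 : M2 E), by
    have h := x.2.2.1.2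
    rw [LinearMap.mem_ker, Matrix.traceLinearMap_apply] at h ⊢
    rw [Matrix.trace_smul, h, smul_zero]⟩, e * x.2.2.2)

theorem rotX_escale (e : E) (x : AEven E) : rotX (escale e x) = e • rotX x := by
  simp only [rotX, escale, smul_add, mul_smul]

theorem rotY_escale (e : E) (x : AEven E) : rotY (escale e x) = e • rotY x := by
  simp only [rotY, escale, smul_sub, mul_smul]

theorem wtr_smul {e : E} (he : D e = 0) (nab : M →ₗ[ℂ] M) (w : ℂ) (V : E) (P : M2 E)
    (x : Fin 2 → M) (α : Fin 2) : wtr D nab w (e * V) (e • P) x α = e • wtr D nab w V P x α := by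
  simp only [wtr, Derivation.leibniz, he, smul_zero, add_zero, smul_eq_mul, Matrix.smul_apply,
    Fin.sum_univ_two]
  match_scalars <;> algebra

theorem wtr_map {t : M →ₗ[ℂ] M} {nab : M →ₗ[ℂ] M} (ht : ∀ (e : E) v, t (e • v) = e • t v)
    (hn : ∀ v, nab (t v) = t (nab v)) (w : ℂ) (V : E) (P : M2 E) (x : Fin 2 → M) (α : Fin 2) :
    wtr D nab w V P (fun β => t (x β)) α = t (wtr D nab w V P x α) := by
  simp only [wtr, map_add, map_sum, ht, hn, map_smul]

theorem xtr_map {t : M →ₗ[ℂ] M} {nab : M →ₗ[ℂ] M} (ht : ∀ (e : E) v, t (e • v) = e • t v)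
    (hn : ∀ v, nab (t v) = t (nab v)) (H Z : M2 E) (x : Fin 2 → M) (α : Fin 2) :
    xtr D nab H Z (fun β => t (x β)) α = t (xtr D nab H Z x α) := by
  simp only [xtr, map_add, map_sub, map_sum, ht, hn, map_smul]

theorem wtr_zero (nab : M →ₗ[ℂ] M) (w : ℂ) (x : Fin 2 → M) (α : Fin 2) :
    wtr D nab w 0 0 x α = 0 := by
  simp [wtr]

theorem xtr_zero (nab : M →ₗ[ℂ] M) (x : Fin 2 → M) (α : Fin 2) : xtr D nab 0 0 x α = 0 := by
  simp [xtr]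

theorem wtr_neg (nab : M →ₗ[ℂ] M) (w : ℂ) (V : E) (P : M2 E) (x : Fin 2 → M) (α : Fin 2) :
    wtr D nab w V P (fun β => -x β) α = -wtr D nab w V P x α := by
  simp only [wtr, map_neg, smul_neg, Finset.sum_neg_distrib]
  abel

theorem xtr_neg (nab : M →ₗ[ℂ] M) (H Z : M2 E) (x : Fin 2 → M) (α : Fin 2) :
    xtr D nab H Z (fun β => -x β) α = -xtr D nab H Z x α := by
  simp only [xtr, map_neg, smul_neg, ← Finset.sum_neg_distrib]
  refine Finset.sum_congr rfl fun β _ => ?_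
  abel

variable (mom : M →ₗ[ℂ] N →ₗ[ℂ] Q) {nabM : M →ₗ[ℂ] M} {nabN : N →ₗ[ℂ] N}

/-- The variation of an invariant bilinear expression of total weight one. -/
theorem mom_wtr (hl : ∀ (e : E) a b, mom (e • a) b = e • mom a b)
    (hr : ∀ (e : E) a b, mom a (e • b) = e • mom a b) {w w' : ℂ} (hw : w + w' = 1) (V : E)
    {P P' : M2 E} (hP : P' = -P.transpose) (x : Fin 2 → M) (y : Fin 2 → N) :
    ∑ α, (mom (wtr D nabM w V P x α) (y α) + mom (x α) (wtr D nabN w' V P' y α))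
      = V • ∑ α, (mom (nabM (x α)) (y α) + mom (x α) (nabN (y α))) + D V • ∑ α, mom (x α) (y α) := by
  subst hP
  obtain rfl : w' = 1 - w := by rw [← hw]; ring
  simp only [wtr, map_add, LinearMap.add_apply, Fin.sum_univ_two, hl, hr, map_smul,
    LinearMap.smul_apply, Matrix.neg_apply, Matrix.transpose_apply]
  match_scalars <;> algebra

theorem mom_xtr (hl : ∀ (e : E) a b, mom (e • a) b = e • mom a b)
    (hr : ∀ (e : E) a b, mom a (e • b) = e • mom a b) (H Z : M2 E)
    (x : Fin 2 → N) (y : Fin 2 → M) :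
    ∑ α, (mom (xtr D nabM H Z y α) (x α) + mom (y α) (xtr D nabN H.transpose (-Z.transpose) x α))
      = ∑ α, ∑ β, (H α β • (mom (nabM (y β)) (x α) + mom (y β) (nabN (x α)))
        + D (H α β) • mom (y β) (x α)) := by
  simp only [xtr, map_add, map_sub, LinearMap.add_apply, LinearMap.sub_apply, Fin.sum_univ_two, hl,
    hr, map_smul, LinearMap.smul_apply, Matrix.neg_apply, Matrix.transpose_apply, map_neg]
  match_scalars <;> algebra

theorem nu_wtr (hl : ∀ (e : E) a b, mom (e • a) b = e • mom a b)
    (hr : ∀ (e : E) a b, mom a (e • b) = e • mom a b) (V : E) (P P' : M2 E) (H : M2 E)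
    (x : Fin 2 → N) (y : Fin 2 → M) :
    V • ∑ α, ∑ β, (H α β • (mom (nabM (y β)) (x α) + mom (y β) (nabN (x α)))
        + D (H α β) • mom (y β) (x α))
      - ∑ α, ∑ β, H α β • (mom (wtr D nabM 4⁻¹ V P' y β) (x α) + mom (y β) (wtr D nabN 4⁻¹ V P x α))
      = ∑ α, ∑ β, (V • H.map D - (2⁻¹ : ℂ) • (D V • H) + (-P.transpose * H - H * P')) α β
          • mom (y β) (x α) := by
  simp only [wtr, map_add, LinearMap.add_apply, Fin.sum_univ_two, hl, hr, map_smul,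
    LinearMap.smul_apply, Matrix.neg_apply, Matrix.transpose_apply, Matrix.add_apply,
    Matrix.sub_apply, Matrix.smul_apply, Matrix.map_apply, Matrix.mul_apply, smul_eq_mul]
  match_scalars <;> algebra

theorem nu_rot (hl : ∀ (e : E) a b, mom (e • a) b = e • mom a b)
    (hr : ∀ (e : E) a b, mom a (e • b) = e • mom a b) (u v : AOdd E)
    (x : Fin 2 → N) (px : Fin 2 → M) :
    ∑ α, ∑ β, vee u.1 α β • mom (∑ γ, v.1.transpose β γ • px γ) (x α)
      + ∑ α, ∑ β, vee v.1 α β • mom (∑ γ, u.1.transpose β γ • px γ) (x α)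
      = ((aN6 D).oo u v).1 • ∑ α, mom (px α) (x α) := by
  obtain ⟨g₁, g₂, g₃, g₄, s₁, s₂, s₃, s₄, rfl⟩ := exists_aOdd u
  obtain ⟨h₁, h₂, h₃, h₄, t₁, t₂, t₃, t₄, rfl⟩ := exists_aOdd v
  simp only [aN6_oo_eq, vee_of, transpose_of, Fin.sum_univ_two, Matrix.of_apply,
    Matrix.cons_val', Matrix.cons_val_zero, Matrix.cons_val_one,
    Matrix.cons_val_fin_one, Matrix.empty_val', map_add, LinearMap.add_apply, hl]
  match_scalars <;> algebra

theorem nu_rot' (hl : ∀ (e : E) a b, mom (e • a) b = e • mom a b)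
    (hr : ∀ (e : E) a b, mom a (e • b) = e • mom a b) (u v : AOdd E)
    (py : Fin 2 → N) (y : Fin 2 → M) :
    ∑ α, ∑ β, vee u.1 α β • mom (y β) (∑ γ, v.1 α γ • py γ)
      + ∑ α, ∑ β, vee v.1 α β • mom (y β) (∑ γ, u.1 α γ • py γ)
      = ((aN6 D).oo u v).1 • ∑ α, mom (y α) (py α) := by
  obtain ⟨g₁, g₂, g₃, g₄, s₁, s₂, s₃, s₄, rfl⟩ := exists_aOdd u
  obtain ⟨h₁, h₂, h₃, h₄, t₁, t₂, t₃, t₄, rfl⟩ := exists_aOdd v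
  simp only [aN6_oo_eq, vee_of, Fin.sum_univ_two, Matrix.of_apply,
    Matrix.cons_val', Matrix.cons_val_zero, Matrix.cons_val_one,
    Matrix.cons_val_fin_one, Matrix.empty_val', map_add, hr]
  match_scalars <;> algebra

end MatterLemmas

/-! ### Commutators of the symmetries -/

section Commutators

variable {E A : Type*} [CommRing E] [Algebra ℂ E] [Ring A] [Algebra ℂ A] [Algebra E A]
  [IsScalarTower ℂ E A] {ι m : Type*} [Fintype ι] [DecidableEq ι] [Fintype m] (T : GaugeData ι m)
  {D : Derivation ℂ E E} {δ : A →ₗ[ℂ] A}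

theorem mkF_sub (a b a' b' : ι → A) (x y px py x' y' px' py' : Fin 2 → m → A) :
    mkF a b x y px py - mkF a' b' x' y' px' py' = mkF (a - a') (b - b') (fun α => x α - x' α)
      (fun α => y α - y' α) (fun α => px α - px' α) (fun α => py α - py' α) := by
  funext i
  cases i <;> rfl

theorem mkF_add (a b a' b' : ι → A) (x y px py x' y' px' py' : Fin 2 → m → A) :
    mkF a b x y px py + mkF a' b' x' y' px' py' = mkF (a + a') (b + b') (fun α => x α + x' α)
      (fun α => y α + y' α) (fun α => px α + px' α) (fun α => py α + py' α) := by
  funext i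
  cases i <;> rfl

theorem wvar_zero (x : AEven E) (u : AOdd E) (τ : A) (φ : FieldIdx ι m → A) :
    wvar T x u τ 0 φ = 0 := by
  funext i
  cases i <;> simp [wvar, mkF, gact, gdact]

variable (δ) in
/-- The commutator of two symmetry transformations. -/
theorem isComm_ptr (x y : AEven E) (u v : AOdd E) (τ τ' : A) (φ ξ : FieldIdx ι m → A)
    (h : ξ = mtr T D δ x u τ (kappa T • graise T (atr x u τ (gmu' T φ (ptr T D δ y v τ' φ))
        (gnu' T φ (ptr T D δ y v τ' φ)))) (conB T (fB φ)) (ptr T D δ y v τ' φ)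
      - mtr T D δ y v τ' (kappa T • graise T (atr y v τ' (gmu' T φ (ptr T D δ x u τ φ))
        (gnu' T φ (ptr T D δ x u τ φ)))) (conB T (fB φ)) (ptr T D δ x u τ φ)) :
    IsComm (ptr T D δ x u τ) (ptr T D δ y v τ') φ ξ := by
  have h0 : ∀ x u τ, conB T (fB (ptr T D δ x u τ φ)) = 0 := fun x u τ => by
    rw [show fB (ptr T D δ x u τ φ) = 0 from rfl, conB, map_zero, smul_zero]
  refine ⟨_, _, hasDirDeriv_ptr T D δ x u τ φ _, hasDirDeriv_ptr T D δ y v τ' φ _, ?_⟩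
  rw [h, h0, h0, wvar_zero, wvar_zero, add_zero, add_zero]

theorem vee_zero : vee (0 : M2 E) = 0 := by
  ext i j; fin_cases i <;> fin_cases j <;> simp [vee]

theorem mtr_even (x : AEven E) (τ : A) (a c : ι → A) (φ : FieldIdx ι m → A) :
    mtr T D δ x 0 τ a c φ = mkF a 0
      (wtr D (covR T δ c) 4⁻¹ x.1 (rotX x) (fX φ)) (wtr D (covRd T δ c) 4⁻¹ x.1 (rotY x) (fY φ))
      (wtr D (covRd T δ c) (3 / 4) x.1 (-(rotX x).transpose) (fPX φ))
      (wtr D (covR T δ c) (3 / 4) x.1 (-(rotY x).transpose) (fPY φ)) := by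
  have ht : (-(0 : M2 E).transpose) = 0 := by rw [Matrix.transpose_zero, neg_zero]
  refine mkF_inj rfl rfl (fun α => ?_) (fun α => ?_) (fun α => ?_) (fun α => ?_)
  · simp
  · simp
  · rw [Prod.fst_zero, Prod.snd_zero, vee_zero, xtr_zero, add_zero]
  · rw [Prod.fst_zero, Prod.snd_zero, vee_zero, ht, Matrix.transpose_zero, xtr_zero, sub_zero]

theorem rotX_zero : rotX (0 : AEven E) = 0 := by simp [rotX]

theorem rotY_zero : rotY (0 : AEven E) = 0 := by simp [rotY]

theorem mtr_odd (u : AOdd E) (τ : A) (a c : ι → A) (φ : FieldIdx ι m → A) :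
    mtr T D δ 0 u τ a c φ = mkF a 0
      (fun α => -∑ β, u.1 α β • (τ • fPY φ β)) (fun α => ∑ β, u.1.transpose α β • (τ • fPX φ β))
      (xtr D (covRd T δ c) (vee u.1) u.2 (fun β => τ • fY φ β))
      (fun α => -xtr D (covR T δ c) (vee u.1).transpose (-u.2.transpose) (fun β => τ • fX φ β) α) := by
  have ht : (-(0 : M2 E).transpose) = 0 := by rw [Matrix.transpose_zero, neg_zero]
  refine mkF_inj rfl rfl (fun α => ?_) (fun α => ?_) (fun α => ?_) (fun α => ?_)
  · rw [rotX_zero, Prod.fst_zero, wtr_zero, zero_sub]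
  · rw [rotY_zero, Prod.fst_zero, wtr_zero, zero_add]
  · rw [rotX_zero, Prod.fst_zero, ht, wtr_zero, zero_add]
  · rw [rotY_zero, Prod.fst_zero, ht, wtr_zero, zero_sub]

theorem atr_even (x : AEven E) (τ : A) (mu : ι → A) (nu : Fin 2 → Fin 2 → ι → A) :
    atr x 0 τ mu nu = x.1 • mu := by
  simp [atr, vee_zero]

theorem atr_odd (u : AOdd E) (τ : A) (mu : ι → A) (nu : Fin 2 → Fin 2 → ι → A) :
    atr 0 u τ mu nu = ∑ α, ∑ β, vee u.1 α β • (τ • nu α β) := by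
  simp [atr]

/-- The tensors in the covariant derivatives of `μ`. -/
def gmuD (δ : A →ₗ[ℂ] A) (φ : FieldIdx ι m → A) : ι → A :=
  ∑ α, (gmom T (covRd T δ (conB T (fB φ)) (fPX φ α)) (fX φ α)
      + gmom T (fPX φ α) (covR T δ (conB T (fB φ)) (fX φ α)))
    - ∑ α, (gmom T (covRd T δ (conB T (fB φ)) (fY φ α)) (fPY φ α)
      + gmom T (fY φ α) (covR T δ (conB T (fB φ)) (fPY φ α)))

theorem gmu_eq (φ : FieldIdx ι m → A) : gmu T φ
    = ∑ α, gmom T (fPX φ α) (fX φ α) - ∑ α, gmom T (fY φ α) (fPY φ α) :=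
  Finset.sum_sub_distrib _ _

theorem gmu'_even (x : AEven E) (τ : A) (φ : FieldIdx ι m → A) :
    gmu' T φ (ptr T D δ x 0 τ φ) = x.1 • gmuD T δ φ + D x.1 • gmu T φ := by
  have h1 := mom_wtr (D := D) (gmom T (A := A)) (nabM := covRd T δ (conB T (fB φ)))
    (nabN := covR T δ (conB T (fB φ))) (fun e a b => contract_smul_left _ e a b)
    (fun e a b => contract_smul_right _ e a b) (w := 3 / 4) (w' := 4⁻¹) (by norm_num) x.1
    (P := -(rotX x).transpose) (P' := rotX x) (by simp) (fPX φ) (fX φ)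
  have h2 := mom_wtr (D := D) (gmom T (A := A)) (nabM := covRd T δ (conB T (fB φ)))
    (nabN := covR T δ (conB T (fB φ))) (fun e a b => contract_smul_left _ e a b)
    (fun e a b => contract_smul_right _ e a b) (w := 4⁻¹) (w' := 3 / 4) (by norm_num) x.1
    (P := rotY x) (P' := -(rotY x).transpose) rfl (fY φ) (fPY φ)
  rw [gmu', ptr, mtr_even, Finset.sum_sub_distrib]
  change ∑ α, (gmom T (wtr D (covRd T δ (conB T (fB φ))) (3 / 4) x.1 (-(rotX x).transpose) (fPX φ) α)
      (fX φ α) + gmom T (fPX φ α) (wtr D (covR T δ (conB T (fB φ))) 4⁻¹ x.1 (rotX x) (fX φ) α))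
    - ∑ α, (gmom T (wtr D (covRd T δ (conB T (fB φ))) 4⁻¹ x.1 (rotY x) (fY φ) α)
      (fPY φ α) + gmom T (fY φ α)
        (wtr D (covR T δ (conB T (fB φ))) (3 / 4) x.1 (-(rotY x).transpose) (fPY φ) α)) = _
  rw [h1, h2, gmuD, gmu_eq]
  simp only [smul_sub]
  abel

/-- The even symmetries represent the even part of `𝔞_{𝒩=6}`. -/
theorem isComm_even_even (h : IsDer D δ) (x y : AEven E) (τ : A) (φ : FieldIdx ι m → A) :
    IsComm (ptr T D δ x 0 τ) (ptr T D δ y 0 τ) φ (ptr T D δ ((aN6 D).ee x y) 0 τ φ) := by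
  apply isComm_ptr
  rw [mtr_even, mtr_even, mkF_sub, ptr, mtr_even]
  have hR : ∀ (e : E) v, covR T δ (conB T (fB φ)) (e • v) = D e • v + e • covR T δ (conB T (fB φ)) v :=
    fun e v => cov_smul h _ _ e v
  have hRd : ∀ (e : E) v,
      covRd T δ (conB T (fB φ)) (e • v) = D e • v + e • covRd T δ (conB T (fB φ)) v :=
    fun e v => cov_smul h _ _ e v
  have hx : ptr T D δ x 0 τ φ = _ := mtr_even T x τ _ _ φ
  have hy : ptr T D δ y 0 τ φ = _ := mtr_even T y τ _ _ φ
  have ht : ∀ P P' : M2 E, x.1 • (-P'.transpose).map D - y.1 • (-P.transpose).map D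
      + (-P.transpose * -P'.transpose - -P'.transpose * -P.transpose)
      = -(x.1 • P'.map D - y.1 • P.map D + (P * P' - P' * P)).transpose := by
    intro P P'
    ext i j
    simp only [Matrix.add_apply, Matrix.sub_apply, Matrix.smul_apply, Matrix.neg_apply,
      Matrix.transpose_apply, Matrix.map_apply, Matrix.mul_apply, Fin.sum_univ_two, smul_eq_mul,
      map_neg]
    ring
  refine mkF_inj ?_ (sub_zero _).symm (fun α => ?_) (fun α => ?_) (fun α => ?_) (fun α => ?_)
  · rw [atr_even, atr_even, atr_even, gmu'_even, gmu'_even, ← smul_sub, ← map_sub]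
    congr 2
    simp only [aN6]
    module
  · rw [rotX_ee, hx, hy]; exact (wtr_wtr (M := m → A) (D := D) (nab := covR T δ (conB T (fB φ))) hR _ _ _ _ _ _ _).symm
  · rw [rotY_ee, hx, hy]; exact (wtr_wtr (M := m → A) (D := D) (nab := covRd T δ (conB T (fB φ))) hRd _ _ _ _ _ _ _).symm
  · rw [rotX_ee, ← ht, hx, hy]; exact (wtr_wtr (M := m → A) (D := D) (nab := covRd T δ (conB T (fB φ))) hRd _ _ _ _ _ _ _).symm
  · rw [rotY_ee, ← ht, hx, hy]; exact (wtr_wtr (M := m → A) (D := D) (nab := covR T δ (conB T (fB φ))) hR _ _ _ _ _ _ _).symm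

/-- The algebraic hypotheses on fields that enter the commutators with odd transformations. -/
structure CommWith (τ : A) (φ : FieldIdx ι m → A) : Prop where
  B : ∀ a, φ (.B a) * τ = τ * φ (.B a)
  Y : ∀ α s, φ (.Y α s) * τ = τ * φ (.Y α s)
  PX : ∀ α s, φ (.PX α s) * τ = -(τ * φ (.PX α s))

theorem CommWith.conB {τ : A} {φ : FieldIdx ι m → A} (h : CommWith τ φ) (a : ι) :
    HTTwist.conB T (fB φ) a * τ = τ * HTTwist.conB T (fB φ) a := by
  simp only [HTTwist.conB, Pi.smul_apply, graise_apply, smul_mul_assoc, mul_smul_comm,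
    Finset.sum_mul, Finset.mul_sum, h.B]

theorem smul_wtr (h : IsDer D δ) (t : m → ι → m → ℂ) {c : ι → A} {τ : A} (hτ : δ τ = 0)
    (hc : ∀ a, c a * τ = τ * c a) (w : ℂ) (V : E) (P : M2 E) (x : Fin 2 → m → A) (α : Fin 2) :
    wtr D (cov t δ c) w V P (fun β => τ • x β) α = τ • wtr D (cov t δ c) w V P x α :=
  wtr_map (t := (LinearMap.mulLeft ℂ τ).compLeft m) (fun e v => smul_comm τ e v)
    (fun v => cov_mul h t hτ hc v) w V P x α

theorem smul_xtr (h : IsDer D δ) (t : m → ι → m → ℂ) {c : ι → A} {τ : A} (hτ : δ τ = 0)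
    (hc : ∀ a, c a * τ = τ * c a) (H Z : M2 E) (x : Fin 2 → m → A) (α : Fin 2) :
    xtr D (cov t δ c) H Z (fun β => τ • x β) α = τ • xtr D (cov t δ c) H Z x α :=
  xtr_map (t := (LinearMap.mulLeft ℂ τ).compLeft m) (fun e v => smul_comm τ e v)
    (fun v => cov_mul h t hτ hc v) H Z x α

theorem gmom_mul_left (τ : A) (w v : m → A) : gmom T (τ • w) v = τ • gmom T w v :=
  contract_mul_left _ _ _ _

theorem gmom_smul_left (e : E) (w v : m → A) : gmom T (e • w) v = e • gmom T w v :=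
  contract_smul_left _ _ _ _

theorem gmom_smul_right (e : E) (w v : m → A) : gmom T w (e • v) = e • gmom T w v :=
  contract_smul_right _ _ _ _

theorem gmu'_odd (h : IsDer D δ) (u : AOdd E) {τ : A} (hτ : δ τ = 0) {φ : FieldIdx ι m → A}
    (hφ : CommWith τ φ) : gmu' T φ (ptr T D δ 0 u τ φ)
      = τ • ∑ α, ∑ β, (vee u.1 α β • (gmom T (covRd T δ (conB T (fB φ)) (fY φ β)) (fX φ α)
          + gmom T (fY φ β) (covR T δ (conB T (fB φ)) (fX φ α)))
        + D (vee u.1 α β) • gmom T (fY φ β) (fX φ α)) := by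
  have h1 := mom_xtr (D := D) (gmom T (A := A)) (nabM := covRd T δ (conB T (fB φ)))
    (nabN := covR T δ (conB T (fB φ))) (gmom_smul_left T) (gmom_smul_right T) (vee u.1) u.2
    (fX φ) (fY φ)
  rw [← h1, gmu', ptr, mtr_odd]
  change ∑ α, (gmom T (xtr D (covRd T δ (conB T (fB φ))) (vee u.1) u.2 (fun β => τ • fY φ β) α) (fX φ α)
      + gmom T (fPX φ α) (-∑ β, u.1 α β • (τ • fPY φ β))
      - (gmom T (∑ β, u.1.transpose α β • (τ • fPX φ β)) (fPY φ α)
      + gmom T (fY φ α) (-xtr D (covR T δ (conB T (fB φ))) (vee u.1).transpose (-u.2.transpose)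
        (fun β => τ • fX φ β) α))) = _
  have hY : ∀ α v, gmom T (fY φ α) (τ • v) = τ • gmom T (fY φ α) v := fun α v =>
    contract_mul_right _ (fun s => hφ.Y α s) v
  have hPX : ∀ α v, gmom T (fPX φ α) (τ • v) = -(τ • gmom T (fPX φ α) v) := fun α v =>
    contract_mul_right_neg _ (fun s => hφ.PX α s) v
  simp only [smul_xtr h _ hτ (hφ.conB T), map_neg, map_add, hY, hPX, gmom_mul_left,
    gmom_smul_left, gmom_smul_right, LinearMap.add_apply, Fin.sum_univ_two, smul_add, smul_neg,
    Matrix.transpose_apply]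
  abel

/-- The odd symmetries form the odd part of `𝔞_{𝒩=6}` as a module over the even part. -/
theorem isComm_even_odd (h : IsDer D δ) (x : AEven E) (u : AOdd E) {τ : A} (hτ : δ τ = 0)
    {φ : FieldIdx ι m → A} (hφ : CommWith τ φ) :
    IsComm (ptr T D δ x 0 τ) (ptr T D δ 0 u τ) φ (ptr T D δ 0 ((aN6 D).eo x u) τ φ) := by
  apply isComm_ptr
  rw [mtr_even, mtr_odd, mkF_sub, ptr, mtr_odd]
  have hR : ∀ (e : E) v, covR T δ (conB T (fB φ)) (e • v) = D e • v + e • covR T δ (conB T (fB φ)) v :=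
    fun e v => cov_smul h _ _ e v
  have hRd : ∀ (e : E) v,
      covRd T δ (conB T (fB φ)) (e • v) = D e • v + e • covRd T δ (conB T (fB φ)) v :=
    fun e v => cov_smul h _ _ e v
  have hx : ptr T D δ x 0 τ φ = _ := mtr_even T x τ _ _ φ
  have hu : ptr T D δ 0 u τ φ = _ := mtr_odd T u τ _ _ φ
  have hc := hφ.conB T
  refine mkF_inj ?_ (sub_zero _).symm (fun α => ?_) (fun α => ?_) (fun α => ?_) (fun α => ?_)
  · rw [atr_even, atr_odd, atr_odd, gmu'_odd T h u hτ hφ, ← smul_sub, ← map_sub]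
    congr 2
    have h1 := nu_wtr (D := D) (gmom T (A := A)) (nabM := covRd T δ (conB T (fB φ)))
      (nabN := covR T δ (conB T (fB φ))) (gmom_smul_left T) (gmom_smul_right T) x.1 (rotX x) (rotY x)
      (vee u.1) (fX φ) (fY φ)
    rw [← eo_vee] at h1
    have h2 := congrArg (τ • ·) h1
    simp only [smul_sub, Finset.smul_sum, smul_comm τ (_ : E)] at h2 ⊢
    refine h2.symm.trans ?_
    rw [hx]
    rfl
  · have h1 := wtr_rot (M := m → A) hR 4⁻¹ (3 / 4) x.1 (rotX x) (-(rotY x).transpose) u.1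
      (fun β => τ • fPY φ β) α
    simp only [smul_wtr h _ hτ hc] at h1
    rw [eo_fst, ← h1, hu, hx]
    change _ = wtr D (covR T δ (conB T (fB φ))) 4⁻¹ x.1 (rotX x)
        (fun α => -∑ β, u.1 α β • (τ • fPY φ β)) α
      - -∑ β, u.1 α β • τ • wtr D (covR T δ (conB T (fB φ))) (3 / 4) x.1 (-(rotY x).transpose)
        (fPY φ) β
    rw [wtr_neg]
    abel
  · have h1 := wtr_rot (M := m → A) hRd 4⁻¹ (3 / 4) x.1 (rotY x) (-(rotX x).transpose)
      u.1.transpose (fun β => τ • fPX φ β) α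
    simp only [smul_wtr h _ hτ hc] at h1
    rw [eo_fst_transpose, ← h1, hu, hx]
    rfl
  · have h1 := wtr_xtr (M := m → A) hRd x.1 (-(rotX x).transpose) (rotY x) (vee u.1) u.2
      (fun β => τ • fY φ β) α
    rw [← eo_vee, ← eo_snd] at h1
    have h2 : wtr D (covRd T δ (conB T (fB φ))) 4⁻¹ x.1 (rotY x) (fun β => τ • fY φ β)
        = fun β => τ • wtr D (covRd T δ (conB T (fB φ))) 4⁻¹ x.1 (rotY x) (fY φ) β :=
      funext fun β => smul_wtr h _ hτ hc 4⁻¹ x.1 (rotY x) (fY φ) β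
    rw [h2] at h1
    rw [← h1, hu, hx]
    rfl
  · have h1 := wtr_xtr (M := m → A) hR x.1 (-(rotY x).transpose) (rotX x) (vee u.1).transpose
      (-u.2.transpose) (fun β => τ • fX φ β) α
    rw [← eo_vee_transpose, ← eo_snd_transpose] at h1
    have h2 : wtr D (covR T δ (conB T (fB φ))) 4⁻¹ x.1 (rotX x) (fun β => τ • fX φ β)
        = fun β => τ • wtr D (covR T δ (conB T (fB φ))) 4⁻¹ x.1 (rotX x) (fX φ) β :=
      funext fun β => smul_wtr h _ hτ hc 4⁻¹ x.1 (rotX x) (fX φ) β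
    rw [h2] at h1
    rw [← h1, hu, hx]
    change _ = wtr D (covR T δ (conB T (fB φ))) (3 / 4) x.1 (-(rotY x).transpose)
        (fun α => -xtr D (covR T δ (conB T (fB φ))) (vee u.1).transpose (-u.2.transpose)
          (fun β => τ • fX φ β) α) α
      - -xtr D (covR T δ (conB T (fB φ))) (vee u.1).transpose (-u.2.transpose)
          (fun β => τ • wtr D (covR T δ (conB T (fB φ))) 4⁻¹ x.1 (rotX x) (fX φ) β) α
    rw [wtr_neg]
    abel

theorem smul_smul_of_mul_eq {τ τ' : A} {e : E} (h : τ * τ' = algebraMap E A e) {K : Type*}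
    (w : K → A) : τ • τ' • w = e • w := by
  rw [smul_smul, h]
  funext s
  rw [Pi.smul_apply, Pi.smul_apply, Algebra.smul_def, smul_eq_mul]

theorem smul_smul_of_mul_eq_neg {τ τ' : A} {e : E} (h : τ' * τ = -algebraMap E A e) {K : Type*}
    (w : K → A) : τ' • τ • w = -(e • w) := by
  rw [smul_smul, h, neg_smul]
  funext s
  rw [Pi.neg_apply, Pi.neg_apply, Pi.smul_apply, Pi.smul_apply, Algebra.smul_def, smul_eq_mul]

/-- The commutator of two odd symmetries is the even symmetry given by their bracket, with the
product of the odd parameters as coefficient. -/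
theorem isComm_odd_odd (h : IsDer D δ) (u v : AOdd E) {τ τ' : A} (hτ : δ τ = 0) (hτ' : δ τ' = 0)
    {φ : FieldIdx ι m → A} (hφ : CommWith τ φ) (hφ' : CommWith τ' φ) {e : E} (he : D e = 0)
    (htt : τ * τ' = algebraMap E A e) (htt' : τ' * τ = -algebraMap E A e) :
    IsComm (ptr T D δ 0 u τ) (ptr T D δ 0 v τ') φ (ptr T D δ (escale e ((aN6 D).oo u v)) 0 τ φ) := by
  apply isComm_ptr
  rw [mtr_odd, mtr_odd, mkF_sub, ptr, mtr_even, rotX_escale, rotY_escale,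
    Matrix.transpose_smul, Matrix.transpose_smul, ← smul_neg, ← smul_neg]
  have hR : ∀ (e : E) v, covR T δ (conB T (fB φ)) (e • v) = D e • v + e • covR T δ (conB T (fB φ)) v :=
    fun e v => cov_smul h _ _ e v
  have hRd : ∀ (e : E) v,
      covRd T δ (conB T (fB φ)) (e • v) = D e • v + e • covRd T δ (conB T (fB φ)) v :=
    fun e v => cov_smul h _ _ e v
  have hu : ptr T D δ 0 u τ φ = _ := mtr_odd T u τ _ _ φ
  have hv : ptr T D δ 0 v τ' φ = _ := mtr_odd T v τ' _ _ φ
  have hc := hφ.conB T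
  have hc' := hφ'.conB T
  have e1 := fun w : m → A => smul_smul_of_mul_eq htt w
  have e2 := fun w : m → A => smul_smul_of_mul_eq_neg htt' w
  have i1 := fun w : ι → A => smul_smul_of_mul_eq htt w
  have i2 := fun w : ι → A => smul_smul_of_mul_eq_neg htt' w
  have hxe : ∀ (t : m → ι → m → ℂ) (H Z : M2 E) (x : Fin 2 → m → A) (α : Fin 2),
      xtr D (cov t δ (conB T (fB φ))) H Z (fun β => e • x β) α
        = e • xtr D (cov t δ (conB T (fB φ))) H Z x α := fun t H Z x α =>
    xtr_map (t := (Algebra.lsmul ℂ ℂ (m → A) e : (m → A) →ₗ[ℂ] (m → A)))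
      (fun e' v => smul_comm e e' v)
      (fun v => (cov_smul h t _ e v).trans (by rw [he, zero_smul, zero_add]; rfl)) H Z x α
  refine mkF_inj ?_ (sub_zero _).symm (fun α => ?_) (fun α => ?_) (fun α => ?_) (fun α => ?_)
  · rw [atr_even, atr_odd, atr_odd, ← smul_sub, ← map_sub]
    congr 2
    rw [show (escale e ((aN6 D).oo u v)).1 = e * ((aN6 D).oo u v).1 from rfl, mul_smul, gmu_eq,
      smul_sub, ← nu_rot (D := D) (gmom T (A := A)) (gmom_smul_left T) (gmom_smul_right T) u v,
      ← nu_rot' (D := D) (gmom T (A := A)) (gmom_smul_left T) (gmom_smul_right T) u v, hu, hv]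
    change _ = ∑ α, ∑ β, vee u.1 α β • τ • (gmom T (∑ γ, v.1.transpose β γ • (τ' • fPX φ γ)) (fX φ α)
        + gmom T (fY φ β) (-∑ γ, v.1 α γ • (τ' • fPY φ γ)))
      - ∑ α, ∑ β, vee v.1 α β • τ' • (gmom T (∑ γ, u.1.transpose β γ • (τ • fPX φ γ)) (fX φ α)
        + gmom T (fY φ β) (-∑ γ, u.1 α γ • (τ • fPY φ γ)))
    have hY : ∀ α v, gmom T (fY φ α) (τ • v) = τ • gmom T (fY φ α) v := fun α v =>
      contract_mul_right _ (fun s => hφ.Y α s) v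
    have hY' : ∀ α v, gmom T (fY φ α) (τ' • v) = τ' • gmom T (fY φ α) v := fun α v =>
      contract_mul_right _ (fun s => hφ'.Y α s) v
    simp only [smul_comm (_ : E) τ (_ : m → A), smul_comm (_ : E) τ' (_ : m → A), ← Finset.smul_sum,
      ← smul_neg, gmom_mul_left, hY, hY', ← smul_add, i1, i2]
    simp only [map_neg, smul_add, smul_neg, Finset.sum_add_distrib, Finset.sum_neg_distrib,
      smul_comm (_ : E) e, ← Finset.smul_sum]
    simp only [smul_sub, smul_add]
    abel
  · rw [show (escale e ((aN6 D).oo u v)).1 = e * ((aN6 D).oo u v).1 from rfl, wtr_smul he,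
      ← oo_X (M := m → A) hR, hu, hv]
    change _ = -∑ β, u.1 α β • τ • -xtr D (covR T δ (conB T (fB φ))) (vee v.1).transpose
        (-v.2.transpose) (fun β => τ' • fX φ β) β
      - -∑ β, v.1 α β • τ' • -xtr D (covR T δ (conB T (fB φ))) (vee u.1).transpose
        (-u.2.transpose) (fun β => τ • fX φ β) β
    simp only [smul_xtr h _ hτ hc, smul_xtr h _ hτ' hc', smul_neg, e1, e2, Finset.smul_sum,
      Finset.sum_neg_distrib, smul_add, smul_comm e (_ : E)]
    abel
  · rw [show (escale e ((aN6 D).oo u v)).1 = e * ((aN6 D).oo u v).1 from rfl, wtr_smul he,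
      ← oo_Y (M := m → A) hRd, hu, hv]
    change _ = ∑ β, u.1.transpose α β • τ • xtr D (covRd T δ (conB T (fB φ))) (vee v.1)
        v.2 (fun β => τ' • fY φ β) β
      - ∑ β, v.1.transpose α β • τ' • xtr D (covRd T δ (conB T (fB φ))) (vee u.1)
        u.2 (fun β => τ • fY φ β) β
    simp only [smul_xtr h _ hτ hc, smul_xtr h _ hτ' hc', smul_neg, e1, e2, Finset.smul_sum,
      Finset.sum_neg_distrib, smul_add, smul_comm e (_ : E)]
    abel
  · rw [show (escale e ((aN6 D).oo u v)).1 = e * ((aN6 D).oo u v).1 from rfl, wtr_smul he,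
      ← oo_PX (M := m → A) hRd, hu, hv]
    change _ = xtr D (covRd T δ (conB T (fB φ))) (vee u.1) u.2
        (fun β => τ • ∑ γ, v.1.transpose β γ • (τ' • fPX φ γ)) α
      - xtr D (covRd T δ (conB T (fB φ))) (vee v.1) v.2
        (fun β => τ' • ∑ γ, u.1.transpose β γ • (τ • fPX φ γ)) α
    simp only [Finset.smul_sum, smul_comm τ (_ : E), smul_comm τ' (_ : E), e1, e2]
    simp only [smul_neg, Finset.sum_neg_distrib, xtr_neg, smul_comm (_ : E) e, ← Finset.smul_sum, hxe,
      smul_add]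
    abel
  · rw [show (escale e ((aN6 D).oo u v)).1 = e * ((aN6 D).oo u v).1 from rfl, wtr_smul he,
      ← oo_PY (M := m → A) hR, hu, hv]
    change _ = -xtr D (covR T δ (conB T (fB φ))) (vee u.1).transpose (-u.2.transpose)
        (fun β => τ • -∑ γ, v.1 β γ • (τ' • fPY φ γ)) α
      - -xtr D (covR T δ (conB T (fB φ))) (vee v.1).transpose (-v.2.transpose)
        (fun β => τ' • -∑ γ, u.1 β γ • (τ • fPY φ γ)) α
    simp only [smul_neg, Finset.smul_sum, smul_comm τ (_ : E), smul_comm τ' (_ : E), e1, e2]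
    simp only [smul_neg, Finset.sum_neg_distrib, xtr_neg, smul_comm (_ : E) e, ← Finset.smul_sum, hxe,
      smul_add]
    abel

end Commutators

/-! ### Algebras with an odd differential -/

/-- A supercommutative algebra with an odd differential `d`, an even derivation `del` that commutes
with it, and an ideal of elements of compact support. -/
structure SuperDiff (A : Type*) [Ring A] [Algebra ℂ A] where
  /-- the parity involution -/
  par : A →ₗ[ℂ] A
  /-- the odd differential -/
  d : A →ₗ[ℂ] A
  /-- the even derivation -/
  del : A →ₗ[ℂ] A
  /-- the elements of compact support -/
  cpt : Submodule ℂ A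
  par_one : par 1 = 1
  par_mul : ∀ a b, par (a * b) = par a * par b
  par_par : ∀ a, par (par a) = a
  even_comm : ∀ a b, par a = a → a * b = b * a
  odd_anticomm : ∀ a b, par a = -a → par b = -b → a * b = -(b * a)
  d_mul : ∀ a b, d (a * b) = d a * b + par a * d b
  del_mul : ∀ a b, del (a * b) = del a * b + a * del b
  par_d : ∀ a, par (d a) = -d (par a)
  par_del : ∀ a, par (del a) = del (par a)
  d_d : ∀ a, d (d a) = 0
  d_del : ∀ a, d (del a) = del (d a)
  cpt_mul_left : ∀ a b, b ∈ cpt → a * b ∈ cpt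

namespace SuperDiff

section Basic

variable {A : Type*} [Ring A] [Algebra ℂ A] (S : SuperDiff A)

/-- An odd element that is constant for both derivations. -/
structure OddConst (θ : A) : Prop where
  odd : S.par θ = -θ
  d : S.d θ = 0
  del : S.del θ = 0

theorem mul_odd {θ : A} (h : S.par θ = -θ) (a : A) : a * θ = θ * S.par a := by
  have h1 : (a + S.par a) * θ = θ * (a + S.par a) :=
    S.even_comm _ _ (by rw [map_add, S.par_par, add_comm])
  have h2 : (a - S.par a) * θ = -(θ * (a - S.par a)) :=
    S.odd_anticomm _ _ (by rw [map_sub, S.par_par, neg_sub]) h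
  have h3 : (2 : ℂ) • (a * θ) = (2 : ℂ) • (θ * S.par a) := by
    have := congrArg₂ (· + ·) h1 h2
    simp only [add_mul, mul_add, sub_mul, mul_sub] at this
    rw [two_smul, two_smul]
    calc a * θ + a * θ = a * θ + S.par a * θ + (a * θ - S.par a * θ) := by abel
      _ = _ := this
      _ = _ := by abel
  exact smul_right_injective A (two_ne_zero (α := ℂ)) h3

/-- The even derivation `θ d`. -/
def thd (θ : A) : A →ₗ[ℂ] A := LinearMap.mulLeft ℂ θ ∘ₗ S.d

theorem thd_apply (θ a : A) : S.thd θ a = θ * S.d a := rfl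

variable {S}

theorem OddConst.mul {θ θ' : A} (h : S.OddConst θ) (h' : S.OddConst θ') : θ * θ' = -(θ' * θ) :=
  S.odd_anticomm _ _ h.odd h'.odd

theorem OddConst.smul {θ : A} (h : S.OddConst θ) (c : ℂ) : S.OddConst (c • θ) where
  odd := by rw [map_smul, h.odd, smul_neg]
  d := by rw [map_smul, h.d, smul_zero]
  del := by rw [map_smul, h.del, smul_zero]

theorem OddConst.thd_mul {θ : A} (h : S.OddConst θ) (a b : A) :
    S.thd θ (a * b) = S.thd θ a * b + a * S.thd θ b := by
  simp only [thd_apply, S.d_mul, mul_add, ← mul_assoc]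
  rw [← S.mul_odd h.odd]

theorem OddConst.thd_del {θ : A} (h : S.OddConst θ) (a : A) :
    S.thd θ (S.del a) = S.del (S.thd θ a) := by
  rw [thd_apply, thd_apply, S.del_mul, h.del, zero_mul, zero_add, S.d_del]

theorem OddConst.d_mul {θ : A} (h : S.OddConst θ) (a : A) : S.d (θ * a) = -(θ * S.d a) := by
  rw [S.d_mul, h.d, zero_mul, zero_add, h.odd, neg_mul]

theorem OddConst.thd_odd {θ θ' : A} (h' : S.OddConst θ') : S.thd θ θ' = 0 := by
  rw [thd_apply, h'.d, mul_zero]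

theorem OddConst.thd_thd {θ θ' : A} (h' : S.OddConst θ') (a : A) :
    S.thd θ (S.thd θ' a) = 0 := by
  rw [thd_apply, thd_apply, h'.d_mul, S.d_d, mul_zero, neg_zero, mul_zero]

theorem OddConst.par_thd {θ : A} (h : S.OddConst θ) (a : A) :
    S.par (S.thd θ a) = S.thd θ (S.par a) := by
  rw [thd_apply, thd_apply, S.par_mul, h.odd, S.par_d, neg_mul_neg]

theorem OddConst.even_mul {θ a : A} (h : S.OddConst θ) (ha : S.par a = -a) : S.par (θ * a) = θ * a := by
  rw [S.par_mul, h.odd, ha, neg_mul_neg]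

theorem OddConst.odd_mul {θ a : A} (h : S.OddConst θ) (ha : S.par a = a) :
    S.par (θ * a) = -(θ * a) := by
  rw [S.par_mul, h.odd, ha, neg_mul]

theorem OddConst.comm {θ a : A} (_ : S.OddConst θ) (ha : S.par a = a) : a * θ = θ * a :=
  S.even_comm _ _ ha

theorem OddConst.anticomm {θ a : A} (h : S.OddConst θ) (ha : S.par a = -a) : a * θ = -(θ * a) :=
  S.odd_anticomm _ _ ha h.odd

variable {E : Type*} [CommRing E] [Algebra ℂ E] [Algebra E A] [IsScalarTower ℂ E A]

/-- `E` acts through even elements annihilated by `d`, on which `del` restricts to `D`. -/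
structure Scalars (S : SuperDiff A) (D : Derivation ℂ E E) : Prop where
  par : ∀ e : E, S.par (algebraMap E A e) = algebraMap E A e
  d : ∀ e : E, S.d (algebraMap E A e) = 0
  del : ∀ e : E, S.del (algebraMap E A e) = algebraMap E A (D e)

variable {D : Derivation ℂ E E}

theorem Scalars.isDer (h : S.Scalars D) : IsDer D S.del := ⟨S.del_mul, h.del⟩

theorem Scalars.isDer_thd (h : S.Scalars D) {θ : A} (hθ : S.OddConst θ) :
    IsDer (0 : Derivation ℂ E E) (S.thd θ) :=
  ⟨hθ.thd_mul, fun e => by rw [thd_apply, h.d, mul_zero, Derivation.zero_apply, map_zero]⟩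

theorem Scalars.par_smul (h : S.Scalars D) (e : E) (a : A) : S.par (e • a) = e • S.par a := by
  rw [Algebra.smul_def, S.par_mul, h.par, ← Algebra.smul_def]

end Basic

section Fields

variable {A : Type*} [Ring A] [Algebra ℂ A] (S : SuperDiff A) {ι m : Type*}

/-- The parities of the fields. -/
def IsField (φ : FieldIdx ι m → A) : Prop :=
  (∀ a, S.par (φ (.A a)) = -φ (.A a)) ∧ (∀ a, S.par (φ (.B a)) = φ (.B a)) ∧
  (∀ α s, S.par (φ (.X α s)) = φ (.X α s)) ∧ (∀ α s, S.par (φ (.Y α s)) = φ (.Y α s)) ∧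
  (∀ α s, S.par (φ (.PX α s)) = -φ (.PX α s)) ∧ (∀ α s, S.par (φ (.PY α s)) = -φ (.PY α s))

variable {K J I : Type*} [Fintype K] [Fintype J]

theorem par_contract (t : I → J → K → ℂ) (c : J → A) (v : K → A) :
    vec S.par (contract t c v) = contract t (vec S.par c) (vec S.par v) := by
  funext i
  simp only [contract_apply, LinearMap.compLeft_apply, Function.comp, map_sum, map_smul, S.par_mul]

/-- Families of even elements. -/
def Even (v : K → A) : Prop := vec S.par v = v

/-- Families of odd elements. -/
def Odd (v : K → A) : Prop := vec S.par v = -v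

variable {S}

theorem Even.apply {v : K → A} (h : S.Even v) (s : K) : S.par (v s) = v s := congrFun h s

theorem Odd.apply {v : K → A} (h : S.Odd v) (s : K) : S.par (v s) = -v s := congrFun h s

theorem Even.central {v : K → A} (h : S.Even v) : Central v :=
  fun s b => S.even_comm _ b (h.apply s)

theorem OddConst.even {θ : A} (hθ : S.OddConst θ) {v : K → A} (h : S.Odd v) : S.Even (θ • v) :=
  funext fun s => hθ.even_mul (h.apply s)

theorem OddConst.odd_vec {θ : A} (hθ : S.OddConst θ) {v : K → A} (h : S.Even v) : S.Odd (θ • v) :=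
  funext fun s => hθ.odd_mul (h.apply s)

theorem Even.add {v w : K → A} (h : S.Even v) (h' : S.Even w) : S.Even (v + w) := by
  rw [SuperDiff.Even, map_add, h, h']

theorem Even.sub {v w : K → A} (h : S.Even v) (h' : S.Even w) : S.Even (v - w) := by
  rw [SuperDiff.Even, map_sub, h, h']

theorem Even.smul {v : K → A} (h : S.Even v) (c : ℂ) : S.Even (c • v) := by
  rw [SuperDiff.Even, map_smul, h]

theorem Odd.add {v w : K → A} (h : S.Odd v) (h' : S.Odd w) : S.Odd (v + w) := by
  rw [SuperDiff.Odd, map_add, h, h', neg_add]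

theorem Odd.neg {v : K → A} (h : S.Odd v) : S.Odd (-v) := by
  rw [SuperDiff.Odd, map_neg, h]

theorem Odd.sub {v w : K → A} (h : S.Odd v) (h' : S.Odd w) : S.Odd (v - w) := by
  rw [sub_eq_add_neg]; exact h.add h'.neg

theorem Odd.smul {v : K → A} (h : S.Odd v) (c : ℂ) : S.Odd (c • v) := by
  rw [SuperDiff.Odd, map_smul, h, smul_neg]

theorem Even.contract {t : I → J → K → ℂ} {c : J → A} {v : K → A} (h : S.Even c) (h' : S.Even v) :
    S.Even (contract t c v) := (S.par_contract t c v).trans (by rw [h, h'])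

theorem Even.contract_odd {t : I → J → K → ℂ} {c : J → A} {v : K → A} (h : S.Even c)
    (h' : S.Odd v) : S.Odd (HTTwist.contract t c v) :=
  (S.par_contract t c v).trans (by rw [h, h', map_neg])

theorem Odd.contract_even {t : I → J → K → ℂ} {c : J → A} {v : K → A} (h : S.Odd c)
    (h' : S.Even v) : S.Odd (HTTwist.contract t c v) :=
  (S.par_contract t c v).trans (by rw [h, h', map_neg, LinearMap.neg_apply])

theorem Odd.contract {t : I → J → K → ℂ} {c : J → A} {v : K → A} (h : S.Odd c)
    (h' : S.Odd v) : S.Even (HTTwist.contract t c v) :=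
  (S.par_contract t c v).trans (by rw [h, h', map_neg, map_neg, LinearMap.neg_apply, neg_neg])

theorem Even.sum {L : Type*} (s : Finset L) {v : L → K → A} (h : ∀ l, S.Even (v l)) :
    S.Even (∑ l ∈ s, v l) := (map_sum _ _ _).trans (Finset.sum_congr rfl fun l _ => h l)

theorem Odd.sum {L : Type*} (s : Finset L) {v : L → K → A} (h : ∀ l, S.Odd (v l)) :
    S.Odd (∑ l ∈ s, v l) := (map_sum _ _ _).trans (by
      rw [← Finset.sum_neg_distrib]; exact Finset.sum_congr rfl fun l _ => h l)

variable [Fintype ι] [DecidableEq ι] [Fintype m] (T : GaugeData ι m)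

theorem Even.graise {v : ι → A} (h : S.Even v) : S.Even (graise T v) :=
  (vec_graise T v).trans (by rw [h])

theorem Odd.graise {v : ι → A} (h : S.Odd v) : S.Odd (HTTwist.graise T v) :=
  (vec_graise T v).trans (by rw [h, map_neg])

theorem Even.glower {v : ι → A} (h : S.Even v) : S.Even (glower T v) :=
  (vec_glower T v).trans (by rw [h])

variable {φ : FieldIdx ι m → A}

theorem IsField.compA (h : S.IsField φ) : S.Odd (fA φ) := funext h.1
theorem IsField.compB (h : S.IsField φ) : S.Even (fB φ) := funext h.2.1
theorem IsField.compX (h : S.IsField φ) (α : Fin 2) : S.Even (fX φ α) := funext (h.2.2.1 α)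
theorem IsField.compY (h : S.IsField φ) (α : Fin 2) : S.Even (fY φ α) := funext (h.2.2.2.1 α)
theorem IsField.compPX (h : S.IsField φ) (α : Fin 2) : S.Odd (fPX φ α) := funext (h.2.2.2.2.1 α)
theorem IsField.compPY (h : S.IsField φ) (α : Fin 2) : S.Odd (fPY φ α) := funext (h.2.2.2.2.2 α)

end Fields

section FieldConstr
variable {A : Type*} [Ring A] [Algebra ℂ A] {S : SuperDiff A} {ι m : Type*}
  [Fintype ι] [DecidableEq ι] [Fintype m]

theorem isField_mkF {a b : ι → A} {x y px py : Fin 2 → m → A} (ha : S.Odd a) (hb : S.Even b)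
    (hx : ∀ α, S.Even (x α)) (hy : ∀ α, S.Even (y α)) (hpx : ∀ α, S.Odd (px α))
    (hpy : ∀ α, S.Odd (py α)) : S.IsField (mkF a b x y px py) :=
  ⟨ha.apply, hb.apply, fun α => (hx α).apply, fun α => (hy α).apply, fun α => (hpx α).apply,
    fun α => (hpy α).apply⟩

theorem even_vec {δ : A →ₗ[ℂ] A} (hδ : ∀ a, S.par (δ a) = δ (S.par a)) {K : Type*} {v : K → A}
    (h : S.Even v) : S.Even (vec δ v) := funext fun s => (hδ _).trans (congrArg δ (congrFun h s))

theorem odd_vec {δ : A →ₗ[ℂ] A} (hδ : ∀ a, S.par (δ a) = δ (S.par a)) {K : Type*} {v : K → A}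
    (h : S.Odd v) : S.Odd (vec δ v) := funext fun s => (hδ _).trans
      ((congrArg δ (congrFun h s)).trans (map_neg _ _))

theorem even_cov {δ : A →ₗ[ℂ] A} (hδ : ∀ a, S.par (δ a) = δ (S.par a)) {K J : Type*} [Fintype K]
    [Fintype J] {t : K → J → K → ℂ} {c : J → A} (hc : S.Even c) {v : K → A}
    (h : S.Even v) : S.Even (cov t δ c v) := (even_vec hδ h).add (hc.contract h)

theorem odd_cov {δ : A →ₗ[ℂ] A} (hδ : ∀ a, S.par (δ a) = δ (S.par a)) {K J : Type*} [Fintype K]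
    [Fintype J] {t : K → J → K → ℂ} {c : J → A} (hc : S.Even c) {v : K → A}
    (h : S.Odd v) : S.Odd (cov t δ c v) := (odd_vec hδ h).add (hc.contract_odd h)

variable {E : Type*} [CommRing E] [Algebra ℂ E] [Algebra E A] [IsScalarTower ℂ E A]
  {D : Derivation ℂ E E}

theorem Scalars.even (hE : S.Scalars D) {K : Type*} {v : K → A} (h : S.Even v) (e : E) :
    S.Even (e • v) := funext fun s => (hE.par_smul e _).trans (congrArg (e • ·) (congrFun h s))

theorem Scalars.odd (hE : S.Scalars D) {K : Type*} {v : K → A} (h : S.Odd v) (e : E) :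
    S.Odd (e • v) := funext fun s => (hE.par_smul e _).trans
      ((congrArg (e • ·) (congrFun h s)).trans (smul_neg _ _))

theorem Scalars.even_wtr (hE : S.Scalars D) {nab : (m → A) →ₗ[ℂ] (m → A)} {x : Fin 2 → m → A}
    (hn : ∀ α, S.Even (nab (x α))) (hx : ∀ α, S.Even (x α)) (w : ℂ) (V : E) (P : M2 E) (α : Fin 2) :
    S.Even (wtr D nab w V P x α) :=
  ((hE.even (hn α) _).add ((hE.even (hx α) _).smul w)).add (Even.sum _ fun β => hE.even (hx β) _)

theorem Scalars.odd_wtr (hE : S.Scalars D) {nab : (m → A) →ₗ[ℂ] (m → A)} {x : Fin 2 → m → A}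
    (hn : ∀ α, S.Odd (nab (x α))) (hx : ∀ α, S.Odd (x α)) (w : ℂ) (V : E) (P : M2 E) (α : Fin 2) :
    S.Odd (wtr D nab w V P x α) :=
  ((hE.odd (hn α) _).add ((hE.odd (hx α) _).smul w)).add (Odd.sum _ fun β => hE.odd (hx β) _)

theorem Scalars.odd_xtr (hE : S.Scalars D) {nab : (m → A) →ₗ[ℂ] (m → A)} {x : Fin 2 → m → A}
    (hn : ∀ α, S.Odd (nab (x α))) (hx : ∀ α, S.Odd (x α)) (H Z : M2 E) (α : Fin 2) :
    S.Odd (xtr D nab H Z x α) :=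
  Odd.sum _ fun β => ((hE.odd (hn β) _).add ((hE.odd (hx β) _).smul _)).sub (hE.odd (hx β) _)

variable (T : GaugeData ι m)

theorem IsField.conB {φ : FieldIdx ι m → A} (h : S.IsField φ) : S.Even (conB T (fB φ)) :=
  (h.compB.graise T).smul _

theorem IsField.gnu {φ : FieldIdx ι m → A} (h : S.IsField φ) (α β : Fin 2) :
    S.Even (gnu T φ α β) := (h.compY β).contract (h.compX α)

theorem IsField.gmu {φ : FieldIdx ι m → A} (h : S.IsField φ) : S.Odd (gmu T φ) :=
  Odd.sum _ fun α => ((h.compPX α).contract_even (h.compX α)).sub ((h.compY α).contract_odd (h.compPY α))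

theorem IsField.commWith {φ : FieldIdx ι m → A} (h : S.IsField φ) {τ : A} (hτ : S.OddConst τ) :
    CommWith τ φ where
  B a := hτ.comm (h.compB.apply a)
  Y α s := hτ.comm ((h.compY α).apply s)
  PX α s := hτ.anticomm ((h.compPX α).apply s)

/-- Symmetry transformations preserve the parities of the fields. -/
theorem IsField.ptr (hE : S.Scalars D) {φ : FieldIdx ι m → A} (h : S.IsField φ) {τ : A}
    (hτ : S.OddConst τ) (x : AEven E) (u : AOdd E) : S.IsField (ptr T D S.del x u τ φ) := by
  have hc := h.conB T
  refine isField_mkF ?_ (map_zero _) (fun α => ?_) (fun α => ?_) (fun α => ?_) (fun α => ?_)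
  · refine (Odd.graise T ?_).smul _
    exact (hE.odd (h.gmu T) _).add (Odd.sum _ fun α => Odd.sum _ fun β =>
      hE.odd (hτ.odd_vec (h.gnu T α β)) _)
  · exact (hE.even_wtr (fun α => even_cov S.par_del hc (h.compX α)) h.compX _ _ _ α).sub
      (Even.sum _ fun β => hE.even (hτ.even (h.compPY β)) _)
  · exact (hE.even_wtr (fun α => even_cov S.par_del hc (h.compY α)) h.compY _ _ _ α).add
      (Even.sum _ fun β => hE.even (hτ.even (h.compPX β)) _)
  · exact (hE.odd_wtr (fun α => odd_cov S.par_del hc (h.compPX α)) h.compPX _ _ _ α).add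
      (hE.odd_xtr (fun β => odd_cov S.par_del hc (hτ.odd_vec (h.compY β)))
        (fun β => hτ.odd_vec (h.compY β)) _ _ α)
  · exact (hE.odd_wtr (fun α => odd_cov S.par_del hc (h.compPY α)) h.compPY _ _ _ α).sub
      (hE.odd_xtr (fun β => odd_cov S.par_del hc (hτ.odd_vec (h.compX β)))
        (fun β => hτ.odd_vec (h.compX β)) _ _ α)

end FieldConstr
end SuperDiff

/-! ### The supercharge -/

namespace SuperDiff

section Supercharge

variable {A : Type*} [Ring A] [Algebra ℂ A] (S : SuperDiff A) {ι m : Type*}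
  [Fintype ι] [DecidableEq ι] [Fintype m] (T : GaugeData ι m)

/-- The transformation `θ ⊗ Q`, in terms of the derivation `θ d` and of the even connection
`θ 𝐀`. -/
def gQ (θ : A) (φ : FieldIdx ι m → A) : FieldIdx ι m → A :=
  mkF (vec (S.thd θ) (fA φ) + (2⁻¹ : ℂ) • gbrk T (θ • fA φ) (fA φ))
    (covGd T (S.thd θ) (θ • fA φ) (fB φ) - θ • gmu T φ
      + (T.k / (2 * (Real.pi : ℂ))) • glower T (θ • vec S.del (fA φ)))
    (fun α => covR T (S.thd θ) (θ • fA φ) (fX φ α))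
    (fun α => covRd T (S.thd θ) (θ • fA φ) (fY φ α))
    (fun α => covRd T (S.thd θ) (θ • fA φ) (fPX φ α)
      - kappa T • gdact T (θ • graise T (gnu T φ (partner α) (partner α))) (fY φ α))
    (fun α => covR T (S.thd θ) (θ • fA φ) (fPY φ α)
      + kappa T • gact T (θ • graise T (gnu T φ (partner α) (partner α))) (fX φ α))

/-- The derivative of `θ ⊗ Q`. -/
def gQ' (θ : A) (φ ψ : FieldIdx ι m → A) : FieldIdx ι m → A :=
  mkF (vec (S.thd θ) (fA ψ) + (2⁻¹ : ℂ) • (gbrk T (θ • fA ψ) (fA φ) + gbrk T (θ • fA φ) (fA ψ)))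
    (covGd T (S.thd θ) (θ • fA φ) (fB ψ) + gcoad T (θ • fA ψ) (fB φ) - θ • gmu' T φ ψ
      + (T.k / (2 * (Real.pi : ℂ))) • glower T (θ • vec S.del (fA ψ)))
    (fun α => covR T (S.thd θ) (θ • fA φ) (fX ψ α) + gact T (θ • fA ψ) (fX φ α))
    (fun α => covRd T (S.thd θ) (θ • fA φ) (fY ψ α) + gdact T (θ • fA ψ) (fY φ α))
    (fun α => covRd T (S.thd θ) (θ • fA φ) (fPX ψ α) + gdact T (θ • fA ψ) (fPX φ α)
      - kappa T • (gdact T (θ • graise T (gnu' T φ ψ (partner α) (partner α))) (fY φ α)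
        + gdact T (θ • graise T (gnu T φ (partner α) (partner α))) (fY ψ α)))
    (fun α => covR T (S.thd θ) (θ • fA φ) (fPY ψ α) + gact T (θ • fA ψ) (fPY φ α)
      + kappa T • (gact T (θ • graise T (gnu' T φ ψ (partner α) (partner α))) (fX φ α)
        + gact T (θ • graise T (gnu T φ (partner α) (partner α))) (fX ψ α)))

theorem hasDirDeriv_gQ (θ : A) (φ ψ : FieldIdx ι m → A) :
    HasDirDeriv (S.gQ T θ) φ ψ (S.gQ' T θ φ ψ) := by
  have hA := (hasDirDeriv_component FieldIdx.A φ ψ)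
  have ha := hA.asmul θ
  have hB := (hasDirDeriv_component FieldIdx.B φ ψ)
  have hX := fun α => (hasDirDeriv_component (FieldIdx.X α) φ ψ)
  have hY := fun α => (hasDirDeriv_component (FieldIdx.Y α) φ ψ)
  have hPX := fun α => (hasDirDeriv_component (FieldIdx.PX α) φ ψ)
  have hPY := fun α => (hasDirDeriv_component (FieldIdx.PY α) φ ψ)
  have hn := fun α => ((hasDirDeriv_gnu T φ ψ α α).linear_comp (graise T)).asmul θ
  have h := HasDirDeriv.mkF
    ((hA.linear_comp (vec (S.thd θ))).add ((ha.contract (fun a b c => T.f b c a) hA).const_smul 2⁻¹))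
    (((hasDirDeriv_cov (S.thd θ) (fun a b c => -T.f b a c) ha hB).sub
      ((hasDirDeriv_gmu T φ ψ).asmul θ)).add
      ((((hA.linear_comp (vec S.del)).asmul θ).linear_comp (glower T)).const_smul
        (T.k / (2 * (Real.pi : ℂ)))))
    (fun α => hasDirDeriv_cov (S.thd θ) (fun s a t => T.ρ a s t) ha (hX α))
    (fun α => hasDirDeriv_cov (S.thd θ) (fun s a t => -T.ρ a t s) ha (hY α))
    (fun α => (hasDirDeriv_cov (S.thd θ) (fun s a t => -T.ρ a t s) ha (hPX α)).sub
      (((hn (partner α)).contract (fun s a t => -T.ρ a t s) (hY α)).const_smul (kappa T)))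
    (fun α => (hasDirDeriv_cov (S.thd θ) (fun s a t => T.ρ a s t) ha (hPY α)).add
      (((hn (partner α)).contract (fun s a t => T.ρ a s t) (hX α)).const_smul (kappa T)))
  exact h

end Supercharge

section Lemmas

variable {A : Type*} [Ring A] [Algebra ℂ A] {S : SuperDiff A} {ι m : Type*}
  [Fintype ι] [DecidableEq ι] [Fintype m] {T : GaugeData ι m}
  {E : Type*} [CommRing E] [Algebra ℂ E] [Algebra E A] [IsScalarTower ℂ E A]
  {D : Derivation ℂ E E}

theorem _root_.HTTwist.IsGWData.rep_tensor (hT : IsGWData T) (i : m) (j l : ι) (n : m) :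
    ∑ k, T.ρ j i k * T.ρ l k n - ∑ k, T.ρ l i k * T.ρ j k n = ∑ a, T.ρ a i n * T.f j l a := by
  rw [← Finset.sum_sub_distrib, hT.rep]
  exact Finset.sum_congr rfl fun a _ => mul_comm _ _

theorem _root_.HTTwist.IsGWData.dual_tensor (hT : IsGWData T) (i : m) (j l : ι) (n : m) :
    ∑ k, -T.ρ j k i * -T.ρ l n k - ∑ k, -T.ρ l k i * -T.ρ j n k = ∑ a, -T.ρ a n i * T.f j l a := by
  have e : ∑ a, -T.ρ a n i * T.f j l a = -∑ a, T.f j l a * T.ρ a n i := by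
    rw [← Finset.sum_neg_distrib]
    exact Finset.sum_congr rfl fun a _ => by ring
  rw [e, ← hT.rep, ← Finset.sum_neg_distrib, ← Finset.sum_sub_distrib]
  exact Finset.sum_congr rfl fun a _ => by ring

/-- The curvature of the pair `θ d + θ 𝐀`, `∂ + c`. -/
def gcurv (S : SuperDiff A) (T : GaugeData ι m) (θ : A) (a c : ι → A) : ι → A :=
  vec (S.thd θ) c - vec S.del (θ • a) + gbrk T (θ • a) c

variable {θ : A}

/-- The commutator of the `Q`-covariant derivative and of `∂_𝐁` on `R` is the curvature. -/
theorem covR_comm (hT : IsGWData T) (hE : S.Scalars D) (hθ : S.OddConst θ) {a : ι → A}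
    (ha : S.Odd a) (c : ι → A) (v : m → A) :
    covR T (S.thd θ) (θ • a) (covR T S.del c v) = covR T S.del c (covR T (S.thd θ) (θ • a) v)
      + gact T (gcurv S T θ a c) v :=
  cov_cov (fun i j l n => hT.rep_tensor i j l n) (hE.isDer_thd hθ) hE.isDer (hθ.even ha).central c v
    hθ.thd_del

/-- The commutator of the `Q`-covariant derivative and of `∂_𝐁` on `R^*` is the curvature. -/
theorem covRd_comm (hT : IsGWData T) (hE : S.Scalars D) (hθ : S.OddConst θ) {a : ι → A}
    (ha : S.Odd a) (c : ι → A) (v : m → A) :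
    covRd T (S.thd θ) (θ • a) (covRd T S.del c v) = covRd T S.del c (covRd T (S.thd θ) (θ • a) v)
      + gdact T (gcurv S T θ a c) v :=
  cov_cov (fun i j l n => hT.dual_tensor i j l n) (hE.isDer_thd hθ) hE.isDer (hθ.even ha).central c v
    hθ.thd_del

theorem kappa_mul (hk : T.k ≠ 0) : kappa T * (T.k / (2 * (Real.pi : ℂ))) = 1 := by
  have : (Real.pi : ℂ) ≠ 0 := by exact_mod_cast Real.pi_ne_zero
  unfold kappa
  field_simp

theorem vec_del_odd (hθ : S.OddConst θ) {K : Type*} (v : K → A) :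
    vec S.del (θ • v) = θ • vec S.del v := funext fun i => by
  change S.del (θ * v i) = θ * S.del (v i)
  rw [S.del_mul, hθ.del, zero_mul, zero_add]

/-- The variation of the connection `-(2π/k) 𝐁` under `Q`: up to a term in `μ` it is the curvature
of the pair `(Q-covariant derivative, ∂_𝐁)`. -/
theorem conB_gQ (hT : IsGWData T) (hθ : S.OddConst θ) (φ : FieldIdx ι m → A) :
    conB T (fB (S.gQ T θ φ)) = gcurv S T θ (fA φ) (conB T (fB φ))
      + kappa T • θ • graise T (gmu T φ) := by
  have e : fB (S.gQ T θ φ) = covGd T (S.thd θ) (θ • fA φ) (fB φ) - θ • gmu T φ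
      + (T.k / (2 * (Real.pi : ℂ))) • glower T (θ • vec S.del (fA φ)) := rfl
  rw [e, conB, map_add, map_sub, graise_covGd hT, LinearMap.map_smul, graise_glower T hT, smul_add, smul_smul,
    neg_mul, kappa_mul hT.k_ne, neg_one_smul, gcurv, vec_del_odd hθ, conB, LinearMap.map_smul, LinearMap.map_smul,
    cov_apply, graise_mul]
  change _ = _ - _ + -kappa T • gbrk T _ _ + _
  simp only [smul_add, smul_sub, neg_smul, gbrk]
  abel

theorem Scalars.covGd_graise (hT : IsGWData T) (δ : A →ₗ[ℂ] A) (c b : ι → A) :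
    covG T δ c (graise T b) = graise T (covGd T δ c b) := (graise_covGd hT c b).symm

theorem gnu'_gQ (hT : IsGWData T) (hE : S.Scalars D) (hθ : S.OddConst θ) {φ : FieldIdx ι m → A}
    (h : S.IsField φ) (α β : Fin 2) :
    gnu' T φ (S.gQ T θ φ) α β = covGd T (S.thd θ) (θ • fA φ) (gnu T φ α β) :=
  covRd_gmom hT (hE.isDer_thd hθ) (hθ.even h.compA).central _ _

theorem partner_zero : partner 0 = 1 := rfl

theorem partner_one : partner 1 = 0 := rfl

theorem gcoad_gnu_symm (hT : IsGWData T) {φ : FieldIdx ι m → A}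
    (h : S.IsField φ) (α β γ ε : Fin 2) :
    gcoad T (graise T (gnu T φ α β)) (gnu T φ γ ε)
      = -gcoad T (graise T (gnu T φ γ ε)) (gnu T φ α β) :=
  gcoad_graise_skew T hT fun i _ => (h.gnu T α β).central i _

/-- The moment map `μ` varies covariantly under `Q`: the superpotential does not contribute. -/
theorem gmu'_gQ (hT : IsGWData T) (hE : S.Scalars D) (hθ : S.OddConst θ) {φ : FieldIdx ι m → A}
    (h : S.IsField φ) :
    gmu' T φ (S.gQ T θ φ) = covGd T (S.thd θ) (θ • fA φ) (gmu T φ) := by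
  have ha := (hθ.even h.compA).central
  have h1 := fun w v : m → A => covRd_gmom hT (hE.isDer_thd hθ) ha w v
  have h2 : ∀ α β, gmom T (gdact T (θ • graise T (gnu T φ β β)) (fY φ α)) (fX φ α)
      + gmom T (fY φ α) (gact T (θ • graise T (gnu T φ β β)) (fX φ α))
      = θ • gcoad T (graise T (gnu T φ β β)) (gnu T φ α α) := by
    intro α β
    rw [gdact, contract_mul_left, gact, contract_mul_left, gmom_mul_left, gmom,
      contract_mul_right _ (fun s => hθ.comm ((h.compY α).apply s)), ← smul_add]
    exact congrArg (θ • ·) (gmom_equivariant T hT ((h.gnu T β β).graise T).central _ _)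
  have h3 := gcoad_gnu_symm (T := T) hT h 0 0 1 1
  have h4 : gmu' T φ (S.gQ T θ φ) = ∑ α, (covGd T (S.thd θ) (θ • fA φ)
      (gmom T (fPX φ α) (fX φ α) - gmom T (fY φ α) (fPY φ α))
      - kappa T • θ • gcoad T (graise T (gnu T φ (partner α) (partner α))) (gnu T φ α α)) := by
    refine Finset.sum_congr rfl fun α _ => ?_
    rw [map_sub, ← h1, ← h1, ← h2]
    change gmom T (covRd T (S.thd θ) (θ • fA φ) (fPX φ α)
      - kappa T • gdact T (θ • graise T (gnu T φ (partner α) (partner α))) (fY φ α)) (fX φ α)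
      + gmom T (fPX φ α) (covR T (S.thd θ) (θ • fA φ) (fX φ α))
      - (gmom T (covRd T (S.thd θ) (θ • fA φ) (fY φ α)) (fPY φ α)
      + gmom T (fY φ α) (covR T (S.thd θ) (θ • fA φ) (fPY φ α)
      + kappa T • gact T (θ • graise T (gnu T φ (partner α) (partner α))) (fX φ α))) = _
    rw [map_sub, map_add, LinearMap.sub_apply, LinearMap.map_smul, LinearMap.map_smul,
      LinearMap.smul_apply]
    module
  rw [h4, gmu, map_sum, Fin.sum_univ_two, Fin.sum_univ_two, partner_zero, partner_one, h3]
  simp only [smul_neg]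
  abel

end Lemmas
end SuperDiff

/-! ### Triple products and the superpotential -/

section Trilinear

variable {A : Type*} [Ring A] [Algebra ℂ A] {ι m : Type*}
  [Fintype ι] [DecidableEq ι] [Fintype m] (T : GaugeData ι m)
  {E : Type*} [CommRing E] [Algebra ℂ E] [Algebra E A] [IsScalarTower ℂ E A]

/-- The triple product `R^* × R × R^* → R^*`. -/
def dtri (y x y' : m → A) : m → A := gdact T (graise T (gmom T y x)) y'

/-- The triple product `R^* × R × R → R`. -/
def atri (y x x' : m → A) : m → A := gact T (graise T (gmom T y x)) x'

theorem dtri_add_left (y y₂ x y' : m → A) : dtri T (y + y₂) x y' = dtri T y x y' + dtri T y₂ x y' := by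
  simp only [dtri, map_add, LinearMap.add_apply]

theorem dtri_add_mid (y x x₂ y' : m → A) : dtri T y (x + x₂) y' = dtri T y x y' + dtri T y x₂ y' := by
  simp only [dtri, map_add, LinearMap.add_apply]

theorem dtri_add_right (y x y' y₂ : m → A) : dtri T y x (y' + y₂) = dtri T y x y' + dtri T y x y₂ := by
  simp only [dtri, map_add]

theorem dtri_smul_left (e : E) (y x y' : m → A) : dtri T (e • y) x y' = e • dtri T y x y' := by
  rw [dtri, gmom_smul_left, graise_smul, gdact, contract_smul_left, dtri, gdact]

theorem dtri_smul_mid (e : E) (y x y' : m → A) : dtri T y (e • x) y' = e • dtri T y x y' := by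
  rw [dtri, gmom_smul_right, graise_smul, gdact, contract_smul_left, dtri, gdact]

theorem dtri_smul_right (e : E) (y x y' : m → A) : dtri T y x (e • y') = e • dtri T y x y' := by
  rw [dtri, gdact, contract_smul_right, dtri, gdact]

theorem atri_add_left (y y₂ x y' : m → A) : atri T (y + y₂) x y' = atri T y x y' + atri T y₂ x y' := by
  simp only [atri, map_add, LinearMap.add_apply]

theorem atri_add_mid (y x x₂ y' : m → A) : atri T y (x + x₂) y' = atri T y x y' + atri T y x₂ y' := by
  simp only [atri, map_add, LinearMap.add_apply]

theorem atri_add_right (y x y' y₂ : m → A) : atri T y x (y' + y₂) = atri T y x y' + atri T y x y₂ := by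
  simp only [atri, map_add]

theorem atri_smul_left (e : E) (y x y' : m → A) : atri T (e • y) x y' = e • atri T y x y' := by
  rw [atri, gmom_smul_left, graise_smul, gact, contract_smul_left, atri, gact]

theorem atri_smul_mid (e : E) (y x y' : m → A) : atri T y (e • x) y' = e • atri T y x y' := by
  rw [atri, gmom_smul_right, graise_smul, gact, contract_smul_left, atri, gact]

theorem atri_smul_right (e : E) (y x y' : m → A) : atri T y x (e • y') = e • atri T y x y' := by
  rw [atri, gact, contract_smul_right, atri, gact]

variable {T}

/-- The fundamental identity: the triple product is skew in its outer arguments. -/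
theorem dtri_skew (hT : IsGWData T) {S : SuperDiff A} {y : m → A} (hy : S.Even y) (x y' : m → A)
    (h : S.Even y' ∨ S.Even x) : dtri T y x y' = -dtri T y' x y :=
  gdact_fund T hT (fun i j => h.elim (fun h => (h.central j _).symm) fun h => h.central i _)
    (fun i _ => hy.central i _) (fun i _ => hy.central i _)

theorem atri_skew (hT : IsGWData T) {S : SuperDiff A} (y : m → A) {x : m → A} (hx : S.Even x)
    (x' : m → A) : atri T y x x' = -atri T y x' x :=
  gact_fund T hT y fun i _ => hx.central i _

theorem eq_zero_of_eq_neg {M : Type*} [AddCommGroup M] [Module ℂ M] {x : M} (h : x = -x) :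
    x = 0 := by
  have h2 : (2 : ℂ) • x = 0 := by
    rw [two_smul]
    nth_rewrite 2 [h]
    exact add_neg_cancel x
  exact (smul_eq_zero_iff_right two_ne_zero).1 h2

variable {D : Derivation ℂ E E} {δ : A →ₗ[ℂ] A}

theorem covRd_dtri (hT : IsGWData T) (hδ : IsDer D δ) {c : ι → A} (hc : Central c)
    (y x y' : m → A) : covRd T δ c (dtri T y x y') = dtri T (covRd T δ c y) x y'
      + dtri T y (covR T δ c x) y' + dtri T y x (covRd T δ c y') := by
  rw [dtri, covRd_gdact hT hδ hc, ← graise_covGd hT, ← covRd_gmom hT hδ hc, map_add, map_add]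
  rfl

theorem covR_atri (hT : IsGWData T) (hδ : IsDer D δ) {c : ι → A} (hc : Central c)
    (y x x' : m → A) : covR T δ c (atri T y x x') = atri T (covRd T δ c y) x x'
      + atri T y (covR T δ c x) x' + atri T y x (covR T δ c x') := by
  rw [atri, covR_gact hT hδ hc, ← graise_covGd hT, ← covRd_gmom hT hδ hc, map_add, map_add]
  rfl

theorem rotY_one_one (x : AEven E) : rotY x 1 1 = -(rotX x 0 0 + rotX x 1 1 + rotY x 0 0) := by
  have hS : (x.2.1 : M2 E) 1 1 = -(x.2.1 : M2 E) 0 0 := by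
    have := x.2.1.2
    rw [LinearMap.mem_ker, Matrix.traceLinearMap_apply, Matrix.trace_fin_two] at this
    exact eq_neg_of_add_eq_zero_right this
  have hS' : (x.2.2.1 : M2 E) 1 1 = -(x.2.2.1 : M2 E) 0 0 := by
    have := x.2.2.1.2
    rw [LinearMap.mem_ker, Matrix.traceLinearMap_apply, Matrix.trace_fin_two] at this
    exact eq_neg_of_add_eq_zero_right this
  simp [rotX, rotY, hS, hS']
  ring

/-- Invariance of the superpotential under even symmetries, in terms of its `X`-derivative. -/
theorem dtri_wtr (hT : IsGWData T) (hδ : IsDer D δ) {c : ι → A} (hc : Central c) {S : SuperDiff A}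
    {X Y : Fin 2 → m → A} (hY : ∀ α, S.Even (Y α)) (x : AEven E)
    (α : Fin 2) :
    dtri T (wtr D (covRd T δ c) 4⁻¹ x.1 (rotY x) Y (partner α)) (X (partner α)) (Y α)
      + dtri T (Y (partner α)) (wtr D (covR T δ c) 4⁻¹ x.1 (rotX x) X (partner α)) (Y α)
      + dtri T (Y (partner α)) (X (partner α)) (wtr D (covRd T δ c) 4⁻¹ x.1 (rotY x) Y α)
      = wtr D (covRd T δ c) (3 / 4) x.1 (-(rotX x).transpose)
        (fun α => dtri T (Y (partner α)) (X (partner α)) (Y α)) α := by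
  have hs : ∀ α β γ, dtri T (Y α) (X β) (Y γ) = -dtri T (Y γ) (X β) (Y α) := fun α β γ =>
    dtri_skew hT (hY α) _ _ (.inl (hY γ))
  have h0 : ∀ α β, dtri T (Y α) (X β) (Y α) = 0 := fun α β => eq_zero_of_eq_neg (hs α β α)
  have hw : ∀ (w : ℂ) (e : E)
    (v : m → A), w • (e • v) = (w • e) • v := fun w e v => (smul_assoc w e v).symm
  simp only [wtr, Fin.sum_univ_two, dtri_add_left, dtri_add_mid, dtri_add_right, hw, dtri_smul_left,
    dtri_smul_mid, dtri_smul_right, covRd_dtri hT hδ hc, Matrix.neg_apply, Matrix.transpose_apply]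
  fin_cases α
  · simp only [Fin.zero_eta, SuperDiff.partner_zero, SuperDiff.partner_one, h0, hs 1 0 0,
      rotY_one_one]
    match_scalars <;> algebra
  · simp only [Fin.mk_one, SuperDiff.partner_zero, SuperDiff.partner_one, h0, hs 1 1 0,
      rotY_one_one]
    match_scalars <;> algebra

theorem atri_wtr (hT : IsGWData T) (hδ : IsDer D δ) {c : ι → A} (hc : Central c) {S : SuperDiff A}
    {X Y : Fin 2 → m → A} (hX : ∀ α, S.Even (X α)) (x : AEven E)
    (α : Fin 2) :
    atri T (wtr D (covRd T δ c) 4⁻¹ x.1 (rotY x) Y (partner α)) (X (partner α)) (X α)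
      + atri T (Y (partner α)) (wtr D (covR T δ c) 4⁻¹ x.1 (rotX x) X (partner α)) (X α)
      + atri T (Y (partner α)) (X (partner α)) (wtr D (covR T δ c) 4⁻¹ x.1 (rotX x) X α)
      = wtr D (covR T δ c) (3 / 4) x.1 (-(rotY x).transpose)
        (fun α => atri T (Y (partner α)) (X (partner α)) (X α)) α := by
  have hs : ∀ α β γ, atri T (Y β) (X α) (X γ) = -atri T (Y β) (X γ) (X α) := fun α β γ =>
    atri_skew hT _ (hX α) _
  have h0 : ∀ α β, atri T (Y β) (X α) (X α) = 0 := fun α β => eq_zero_of_eq_neg (hs α β α)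
  have hw : ∀ (w : ℂ) (e : E)
    (v : m → A), w • (e • v) = (w • e) • v := fun w e v => (smul_assoc w e v).symm
  simp only [wtr, Fin.sum_univ_two, atri_add_left, atri_add_mid, atri_add_right, hw, atri_smul_left,
    atri_smul_mid, atri_smul_right, covR_atri hT hδ hc, Matrix.neg_apply, Matrix.transpose_apply]
  fin_cases α
  · simp only [Fin.zero_eta, SuperDiff.partner_zero, SuperDiff.partner_one, h0, hs 1 0 0,
      rotY_one_one]
    match_scalars <;> algebra
  · simp only [Fin.mk_one, SuperDiff.partner_zero, SuperDiff.partner_one, h0, hs 1 1 0,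
      rotY_one_one]
    match_scalars <;> algebra

/-- Invariance of the superpotential under odd symmetries, in terms of its `X`-derivative. -/
theorem dtri_rot (hT : IsGWData T) {S : SuperDiff A} {X Y PX PY : Fin 2 → m → A}
    (hX : ∀ α, S.Even (X α)) (hY : ∀ α, S.Even (Y α)) (G : M2 E) (α : Fin 2) :
    ∑ β, ∑ γ, vee G β γ • dtri T (Y γ) (X β) (PX α)
      - (dtri T (∑ β, G.transpose (partner α) β • PX β) (X (partner α)) (Y α)
        - dtri T (Y (partner α)) (∑ β, G (partner α) β • PY β) (Y α)
        + dtri T (Y (partner α)) (X (partner α)) (∑ β, G.transpose α β • PX β))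
      = -∑ β, vee G α β • ∑ γ, (dtri T (PX γ) (X γ) (Y β) - dtri T (Y γ) (PY γ) (Y β)) := by
  have h1 : ∀ α β γ, dtri T (PX α) (X β) (Y γ) = -dtri T (Y γ) (X β) (PX α) := fun α β γ => by
    rw [dtri_skew hT (hY γ) _ _ (.inr (hX β)), neg_neg]
  have h2 : ∀ α β γ, dtri T (Y α) (PY β) (Y γ) = -dtri T (Y γ) (PY β) (Y α) := fun α β γ =>
    dtri_skew hT (hY α) _ _ (.inl (hY γ))
  have h0 : ∀ α β, dtri T (Y α) (PY β) (Y α) = 0 := fun α β => eq_zero_of_eq_neg (h2 α β α)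
  simp only [Fin.sum_univ_two, dtri_add_left, dtri_add_mid, dtri_add_right, dtri_smul_left,
    dtri_smul_mid, dtri_smul_right, Matrix.transpose_apply, h1, h0]
  fin_cases α
  · simp [SuperDiff.partner_zero, h2 1 0 0, h2 1 1 0, vee]
    module
  · simp [SuperDiff.partner_one, h2 1 1 0, vee]
    module

theorem atri_rot (hT : IsGWData T) {S : SuperDiff A} {X Y PX PY : Fin 2 → m → A}
    (hX : ∀ α, S.Even (X α)) (G : M2 E) (α : Fin 2) :
    ∑ β, ∑ γ, vee G β γ • atri T (Y γ) (X β) (PY α)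
      + (atri T (∑ β, G.transpose (partner α) β • PX β) (X (partner α)) (X α)
        - atri T (Y (partner α)) (∑ β, G (partner α) β • PY β) (X α)
        - atri T (Y (partner α)) (X (partner α)) (∑ β, G α β • PY β))
      = ∑ β, (vee G).transpose α β • ∑ γ, (atri T (PX γ) (X γ) (X β) - atri T (Y γ) (PY γ) (X β)) := by
  have h1 : ∀ α β γ, atri T (Y α) (PY β) (X γ) = -atri T (Y α) (X γ) (PY β) := fun α β γ => by
    rw [atri_skew hT _ (hX γ), neg_neg]
  have h2 : ∀ α β γ, atri T (PX α) (X β) (X γ) = -atri T (PX α) (X γ) (X β) := fun α β γ =>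
    atri_skew hT _ (hX β) _
  have h0 : ∀ α β, atri T (PX α) (X β) (X β) = 0 := fun α β => eq_zero_of_eq_neg (h2 α β β)
  simp only [Fin.sum_univ_two, atri_add_left, atri_add_mid, atri_add_right, atri_smul_left,
    atri_smul_mid, atri_smul_right, Matrix.transpose_apply, h1, h0]
  fin_cases α
  · simp [SuperDiff.partner_zero, h2 0 1 0, h2 1 1 0, vee]
    module
  · simp [SuperDiff.partner_one, h2 1 1 0, vee]
    module

end Trilinear

/-! ### The supercharge commutes with even symmetries -/

namespace SuperDiff

section Commute

variable {A : Type*} [Ring A] [Algebra ℂ A] {S : SuperDiff A} {ι m : Type*}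
  [Fintype ι] [DecidableEq ι] [Fintype m] {T : GaugeData ι m}
  {E : Type*} [CommRing E] [Algebra ℂ E] [Algebra E A] [IsScalarTower ℂ E A]
  {D : Derivation ℂ E E} {θ : A}

theorem gbrk_odd (hT : IsGWData T) {a b : ι → A} (ha : S.Odd a) (hb : S.Odd b) :
    gbrk T a b = gbrk T b a := by
  funext i
  rw [gbrk, contract_apply, contract_apply, Finset.sum_comm]
  refine Finset.sum_congr rfl fun k _ => Finset.sum_congr rfl fun j _ => ?_
  rw [hT.skew, S.odd_anticomm _ _ (ha.apply j) (hb.apply k), smul_neg, neg_smul, neg_neg]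

theorem gQ'_A (hT : IsGWData T) {a ψ : ι → A} (ha : S.Odd a) (hψ : S.Odd ψ) :
    vec (S.thd θ) ψ + (2⁻¹ : ℂ) • (gbrk T (θ • ψ) a + gbrk T (θ • a) ψ)
      = covG T (S.thd θ) (θ • a) ψ := by
  have h : gbrk T (θ • ψ) a = gbrk T (θ • a) ψ := by
    rw [gbrk, contract_mul_left, contract_mul_left]
    exact congrArg (θ • ·) (gbrk_odd hT hψ ha)
  rw [h, ← two_smul ℂ, inv_smul_smul₀ two_ne_zero, cov_apply, gbrk]

theorem gQ'_B (hT : IsGWData T) {b w : ι → A} (hb : S.Even b) :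
    gcoad T (θ • kappa T • graise T w) b
      + (T.k / (2 * (Real.pi : ℂ))) • glower T (θ • vec S.del (kappa T • graise T w))
      = θ • covGd T S.del (conB T b) w := by
  have h1 : gcoad T (graise T w) b = -gcoad T (graise T b) w :=
    neg_eq_iff_eq_neg.1 (gcoad_graise_skew T hT fun i j => hb.central i (w j)).symm
  have h2 : (T.k / (2 * (Real.pi : ℂ))) • glower T (θ • vec S.del (kappa T • graise T w))
      = θ • vec S.del w := by
    rw [LinearMap.map_smul, vec_graise, glower_mul, LinearMap.map_smul, glower_graise T hT, smul_comm,
      smul_smul, mul_comm, kappa_mul hT.k_ne, one_smul]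
  rw [h2, cov_apply, smul_add, add_comm]
  congr 1
  have h3 : gcoad T (θ • kappa T • graise T w) b = θ • kappa T • gcoad T (graise T w) b := by
    rw [gcoad, contract_mul_left, LinearMap.map_smul, LinearMap.smul_apply]
  rw [h3, h1, conB, LinearMap.map_smul, LinearMap.smul_apply, gcoad, neg_smul, smul_neg]

theorem cov_wtr {nab nab' k : (m → A) →ₗ[ℂ] (m → A)} (he : ∀ (e : E) v, nab' (e • v) = e • nab' v)
    {x : Fin 2 → m → A} (h : ∀ α, nab' (nab (x α)) = nab (nab' (x α)) + k (x α)) (w : ℂ) (V : E)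
    (P : M2 E) (α : Fin 2) : nab' (wtr D nab w V P x α)
      = wtr D nab w V P (fun β => nab' (x β)) α + V • k (x α) := by
  simp only [wtr, map_add, he, map_sum, h, smul_add, LinearMap.map_smul]
  abel

theorem cov_xtr {nab nab' k : (m → A) →ₗ[ℂ] (m → A)} (he : ∀ (e : E) v, nab' (e • v) = e • nab' v)
    {x : Fin 2 → m → A} (h : ∀ α, nab' (nab (x α)) = nab (nab' (x α)) + k (x α)) (H Z : M2 E)
    (α : Fin 2) : nab' (xtr D nab H Z x α)
      = xtr D nab H Z (fun β => nab' (x β)) α + ∑ β, H α β • k (x β) := by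
  simp only [xtr, map_add, he, map_sub, map_sum, h, smul_add, LinearMap.map_smul,
    ← Finset.sum_add_distrib]
  refine Finset.sum_congr rfl fun β _ => ?_
  abel

theorem Scalars.cov_thd_smul (hE : S.Scalars D) (hθ : S.OddConst θ) {J K : Type*} [Fintype J]
    [Fintype K] (t : K → J → K → ℂ) (c : J → A) (e : E) (v : K → A) :
    cov t (S.thd θ) c (e • v) = e • cov t (S.thd θ) c v := by
  rw [cov_smul (hE.isDer_thd hθ), Derivation.zero_apply, zero_smul, zero_add]

theorem wvar_even (x : AEven E) (τ : A) (w : ι → A) (φ : FieldIdx ι m → A) :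
    wvar T x 0 τ w φ = mkF 0 0 (fun α => x.1 • gact T w (fX φ α)) (fun α => x.1 • gdact T w (fY φ α))
      (fun α => x.1 • gdact T w (fPX φ α)) (fun α => x.1 • gact T w (fPY φ α)) := by
  simp [wvar, vee_zero]

theorem gmuD_eq (hT : IsGWData T) (hE : S.Scalars D) {φ : FieldIdx ι m → A} (h : S.IsField φ) :
    gmuD T S.del φ = covGd T S.del (conB T (fB φ)) (gmu T φ) := by
  have h1 := fun w v : m → A => covRd_gmom hT hE.isDer (h.conB T).central w v
  rw [gmuD, gmu_eq, map_sub, map_sum, map_sum]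
  simp only [h1]

theorem wtr_add {M : Type*} [AddCommGroup M] [Module ℂ M] [Module E M] (nab : M →ₗ[ℂ] M) (w : ℂ) (V : E)
    (P : M2 E) (x y : Fin 2 → M) (α : Fin 2) : wtr D nab w V P (fun β => x β + y β) α
      = wtr D nab w V P x α + wtr D nab w V P y α := by
  simp only [wtr, map_add, smul_add, Finset.sum_add_distrib]
  abel

theorem wtr_csmul {M : Type*} [AddCommGroup M] [Module ℂ M] [Module E M] [SMulCommClass ℂ E M]
    (nab : M →ₗ[ℂ] M) (w : ℂ) (V : E)
    (P : M2 E) (x : Fin 2 → M) (z : ℂ) (α : Fin 2) : wtr D nab w V P (fun β => z • x β) α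
      = z • wtr D nab w V P x α := by
  simp only [wtr, LinearMap.map_smul, smul_add, Finset.smul_sum, smul_comm z]

theorem gdact_theta (θ : A) (y x y' : m → A) :
    gdact T (θ • graise T (gmom T y x)) y' = θ • dtri T y x y' := contract_mul_left _ _ _ _

theorem gact_theta (θ : A) (y x x' : m → A) :
    gact T (θ • graise T (gmom T y x)) x' = θ • atri T y x x' := contract_mul_left _ _ _ _

theorem gdact_gnu' (θ : A) (φ ψ : FieldIdx ι m → A) (α : Fin 2) (y' : m → A) :
    gdact T (θ • graise T (gnu' T φ ψ α α)) y'
      = θ • (dtri T (fY ψ α) (fX φ α) y' + dtri T (fY φ α) (fX ψ α) y') := by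
  rw [gnu', map_add, smul_add, map_add, LinearMap.add_apply, gdact_theta, gdact_theta, smul_add]

theorem gact_gnu' (θ : A) (φ ψ : FieldIdx ι m → A) (α : Fin 2) (y' : m → A) :
    gact T (θ • graise T (gnu' T φ ψ α α)) y'
      = θ • (atri T (fY ψ α) (fX φ α) y' + atri T (fY φ α) (fX ψ α) y') := by
  rw [gnu', map_add, smul_add, map_add, LinearMap.add_apply, gact_theta, gact_theta, smul_add]

/-- `Q` commutes with the even symmetries. -/
theorem isComm_gQ_even (hT : IsGWData T) (hE : S.Scalars D) (hθ : S.OddConst θ) {τ : A}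
    (hτ : S.OddConst τ) {φ : FieldIdx ι m → A} (h : S.IsField φ) (x : AEven E) :
    IsComm (S.gQ T θ) (ptr T D S.del x 0 τ) φ 0 := by
  refine ⟨_, _, S.hasDirDeriv_gQ T θ φ _, hasDirDeriv_ptr T D S.del x 0 τ φ _, (sub_eq_zero.2 ?_).symm⟩
  have hψ : ptr T D S.del x 0 τ φ = mkF (kappa T • graise T (x.1 • gmu T φ)) 0 _ _ _ _ :=
    (mtr_even T x τ _ _ φ).trans (by rw [atr_even])
  have hf := h.ptr T hE hτ x 0
  have he := fun t : m → ι → m → ℂ => hE.cov_thd_smul hθ t (θ • fA φ)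
  have hX := fun v => covR_comm hT hE hθ h.compA (conB T (fB φ)) v
  have hY := fun v => covRd_comm hT hE hθ h.compA (conB T (fB φ)) v
  have hψA : θ • fA (ptr T D S.del x 0 τ φ) = x.1 • kappa T • θ • graise T (gmu T φ) := by
    rw [hψ]
    change θ • kappa T • graise T (x.1 • gmu T φ) = _
    rw [graise_smul, smul_comm θ (kappa T), smul_comm θ x.1, smul_comm (kappa T) x.1]
  have hR := conB_gQ hT hθ φ
  have hc := (h.conB T).central
  have hmu := gmu'_even T (D := D) (δ := S.del) x τ φ
  rw [mtr_even, wvar_even, mkF_add, gQ', atr_even, gmu'_gQ hT hE hθ h, add_zero, hR]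
  refine mkF_inj ?_ ?_ (fun α => ?_) (fun α => ?_) (fun α => ?_) (fun α => ?_)
  · rw [gQ'_A hT h.compA hf.compA, hψ]
    change covG T (S.thd θ) (θ • fA φ) (kappa T • graise T (x.1 • gmu T φ)) = _
    rw [LinearMap.map_smul, Scalars.covGd_graise hT, hE.cov_thd_smul hθ]
  · have e := gQ'_B (S := S) (θ := θ) hT (w := x.1 • gmu T φ) h.compB
    rw [cov_smul hE.isDer, ← gmuD_eq hT hE h, add_comm (D x.1 • _), ← hmu] at e
    have e0 : fA (ptr T D S.del x 0 τ φ) = kappa T • graise T (x.1 • gmu T φ) := by rw [hψ]; rfl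
    have e1 : fB (ptr T D S.del x 0 τ φ) = 0 := by rw [hψ]; rfl
    rw [e0, e1, map_zero, zero_add, sub_add_eq_add_sub, e, sub_self]
    exact (add_zero _).symm
  · rw [hψA]
    have e2 : fX (ptr T D S.del x 0 τ φ) α
        = wtr D (covR T S.del (conB T (fB φ))) 4⁻¹ x.1 (rotX x) (fX φ) α := by rw [hψ]; rfl
    rw [e2, cov_wtr (k := gact T (gcurv S T θ (fA φ) (conB T (fB φ)))) (he _) (fun α => hX _), map_add]
    simp only [LinearMap.add_apply, smul_add]
    rw [add_assoc]
    congr 2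
    exact contract_smul_left _ _ _ _
  · rw [hψA]
    have e2 : fY (ptr T D S.del x 0 τ φ) α
        = wtr D (covRd T S.del (conB T (fB φ))) 4⁻¹ x.1 (rotY x) (fY φ) α := by rw [hψ]; rfl
    rw [e2, cov_wtr (k := gdact T (gcurv S T θ (fA φ) (conB T (fB φ)))) (he _) (fun α => hY _), map_add]
    simp only [LinearMap.add_apply, smul_add]
    rw [add_assoc]
    congr 2
    exact contract_smul_left _ _ _ _
  · rw [hψA]
    have e2 : fPX (ptr T D S.del x 0 τ φ) α
        = wtr D (covRd T S.del (conB T (fB φ))) (3 / 4) x.1 (-(rotX x).transpose) (fPX φ) α := by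
      rw [hψ]; rfl
    have e3 : fPX (S.gQ T θ φ) = fun α => covRd T (S.thd θ) (θ • fA φ) (fPX φ α)
      + -kappa T • θ • dtri T (fY φ (partner α)) (fX φ (partner α)) (fY φ α) := by
      funext α
      rw [neg_smul, ← gdact_theta, ← sub_eq_add_neg]; rfl
    have e4 : gdact T (θ • graise T (gnu' T φ (ptr T D S.del x 0 τ φ) (partner α) (partner α))) (fY φ α)
        + gdact T (θ • graise T (gnu T φ (partner α) (partner α))) (fY (ptr T D S.del x 0 τ φ) α)
        = θ • wtr D (covRd T S.del (conB T (fB φ))) (3 / 4) x.1 (-(rotX x).transpose)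
        (fun α => dtri T (fY φ (partner α)) (fX φ (partner α)) (fY φ α)) α := by
      rw [gdact_gnu', gnu, gdact_theta, ← smul_add, ← dtri_wtr hT hE.isDer hc h.compY x, hψ]
      rfl
    rw [e2, e3, e4, wtr_add, wtr_csmul, smul_wtr hE.isDer _ hθ.del (fun a => hθ.comm ((h.conB T).apply a)),
      cov_wtr (k := gdact T (gcurv S T θ (fA φ) (conB T (fB φ)))) (he _) (fun α => hY _), map_add]
    have e5 : gdact T (x.1 • kappa T • θ • graise T (gmu T φ)) (fPX φ α)
      = x.1 • gdact T (kappa T • θ • graise T (gmu T φ)) (fPX φ α) := contract_smul_left _ _ _ _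
    rw [e5]
    simp only [LinearMap.add_apply, smul_add, neg_smul]
    abel
  · rw [hψA]
    have e2 : fPY (ptr T D S.del x 0 τ φ) α
        = wtr D (covR T S.del (conB T (fB φ))) (3 / 4) x.1 (-(rotY x).transpose) (fPY φ) α := by
      rw [hψ]; rfl
    have e3 : fPY (S.gQ T θ φ) = fun α => covR T (S.thd θ) (θ • fA φ) (fPY φ α)
      + kappa T • θ • atri T (fY φ (partner α)) (fX φ (partner α)) (fX φ α) := by
      funext α
      rw [← gact_theta]; rfl
    have e4 : gact T (θ • graise T (gnu' T φ (ptr T D S.del x 0 τ φ) (partner α) (partner α))) (fX φ α)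
        + gact T (θ • graise T (gnu T φ (partner α) (partner α))) (fX (ptr T D S.del x 0 τ φ) α)
        = θ • wtr D (covR T S.del (conB T (fB φ))) (3 / 4) x.1 (-(rotY x).transpose)
        (fun α => atri T (fY φ (partner α)) (fX φ (partner α)) (fX φ α)) α := by
      rw [gact_gnu', gnu, gact_theta, ← smul_add, ← atri_wtr hT hE.isDer hc h.compX x, hψ]
      rfl
    rw [e2, e3, e4, wtr_add, wtr_csmul, smul_wtr hE.isDer _ hθ.del (fun a => hθ.comm ((h.conB T).apply a)),
      cov_wtr (k := gact T (gcurv S T θ (fA φ) (conB T (fB φ)))) (he _) (fun α => hX _), map_add]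
    have e5 : gact T (x.1 • kappa T • θ • graise T (gmu T φ)) (fPY φ α)
      = x.1 • gact T (kappa T • θ • graise T (gmu T φ)) (fPY φ α) := contract_smul_left _ _ _ _
    rw [e5]
    simp only [LinearMap.add_apply, smul_add]
    abel

end Commute
end SuperDiff

/-! ### The supercharge commutes with odd symmetries -/

namespace SuperDiff

section CommuteOdd

variable {A : Type*} [Ring A] [Algebra ℂ A] {S : SuperDiff A} {ι m : Type*}
  [Fintype ι] [DecidableEq ι] [Fintype m] {T : GaugeData ι m}
  {E : Type*} [CommRing E] [Algebra ℂ E] [Algebra E A] [IsScalarTower ℂ E A]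
  {D : Derivation ℂ E E} {θ τ : A}

theorem dtri_mul_left (τ : A) (y x y' : m → A) : dtri T (τ • y) x y' = τ • dtri T y x y' := by
  rw [dtri, gmom_mul_left, graise_mul, gdact_theta]

theorem dtri_mul_mid (hτ : S.OddConst τ) {y : m → A} (hy : S.Even y) (x y' : m → A) :
    dtri T y (τ • x) y' = τ • dtri T y x y' := by
  have h : gmom T y (τ • x) = τ • gmom T y x :=
    contract_mul_right _ (fun s => hτ.comm (hy.apply s)) x
  rw [dtri, h, graise_mul, gdact_theta]

theorem dtri_neg_mid (y x y' : m → A) : dtri T y (-x) y' = -dtri T y x y' := by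
  simp only [dtri, map_neg, LinearMap.neg_apply]

theorem dtri_mul_right (hτ : S.OddConst τ) {y x : m → A} (hy : S.Even y) (hx : S.Even x)
    (y' : m → A) : dtri T y x (τ • y') = τ • dtri T y x y' :=
  contract_mul_right _ (fun s => hτ.comm (((hy.contract hx).graise T).apply s)) _

theorem atri_mul_left (τ : A) (y x y' : m → A) : atri T (τ • y) x y' = τ • atri T y x y' := by
  rw [atri, gmom_mul_left, graise_mul, gact_theta]

theorem atri_mul_mid (hτ : S.OddConst τ) {y : m → A} (hy : S.Even y) (x y' : m → A) :
    atri T y (τ • x) y' = τ • atri T y x y' := by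
  have h : gmom T y (τ • x) = τ • gmom T y x :=
    contract_mul_right _ (fun s => hτ.comm (hy.apply s)) x
  rw [atri, h, graise_mul, gact_theta]

theorem atri_neg_mid (y x y' : m → A) : atri T y (-x) y' = -atri T y x y' := by
  simp only [atri, map_neg, LinearMap.neg_apply]

theorem atri_neg_right (y x x' : m → A) : atri T y x (-x') = -atri T y x x' := by
  simp only [atri, map_neg]

theorem atri_mul_right (hτ : S.OddConst τ) {y x : m → A} (hy : S.Even y) (hx : S.Even x)
    (y' : m → A) : atri T y x (τ • y') = τ • atri T y x y' :=
  contract_mul_right _ (fun s => hτ.comm (((hy.contract hx).graise T).apply s)) _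

/-- The transformation of `𝐗` by odd symmetries followed by the superpotential. -/
theorem atri_vee (hT : IsGWData T) {X : Fin 2 → m → A} (Y : Fin 2 → m → A)
    (hX : ∀ α, S.Even (X α)) (G : M2 E) (α : Fin 2) :
    ∑ β, ∑ γ, vee G β γ • atri T (Y γ) (X β) (X α)
      = ∑ β, G α β • atri T (Y (partner β)) (X (partner β)) (X β) := by
  have h2 : ∀ α β γ, atri T (Y α) (X β) (X γ) = -atri T (Y α) (X γ) (X β) := fun α β γ =>
    atri_skew hT _ (hX β) _
  have h0 : ∀ α β, atri T (Y α) (X β) (X β) = 0 := fun α β => eq_zero_of_eq_neg (h2 α β β)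
  simp only [Fin.sum_univ_two, partner_zero, partner_one]
  fin_cases α
  · simp [h0, h2 0 1 0, h2 1 1 0, vee]
    abel
  · simp [h0, h2 1 1 0, vee]
    abel

theorem dtri_vee (hT : IsGWData T) (X : Fin 2 → m → A) {Y : Fin 2 → m → A}
    (hY : ∀ α, S.Even (Y α)) (G : M2 E) (α : Fin 2) :
    ∑ β, ∑ γ, vee G β γ • dtri T (Y γ) (X β) (Y α)
      = ∑ β, G.transpose α β • dtri T (Y (partner β)) (X (partner β)) (Y β) := by
  have h2 : ∀ α β γ, dtri T (Y α) (X β) (Y γ) = -dtri T (Y γ) (X β) (Y α) := fun α β γ =>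
    dtri_skew hT (hY α) _ _ (.inl (hY γ))
  have h0 : ∀ α β, dtri T (Y α) (X β) (Y α) = 0 := fun α β => eq_zero_of_eq_neg (h2 α β α)
  simp only [Fin.sum_univ_two, partner_zero, partner_one]
  fin_cases α
  · simp [h0, h2 1 0 0, h2 1 1 0, vee]
    abel
  · simp [h0, h2 1 1 0, vee]
    abel

theorem wvar_odd (u : AOdd E) (τ : A) (w : ι → A) (φ : FieldIdx ι m → A) :
    wvar T 0 u τ w φ = mkF 0 0 0 0 (fun α => ∑ β, vee u.1 α β • gdact T w (τ • fY φ β))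
      (fun α => -∑ β, (vee u.1).transpose α β • gact T w (τ • fX φ β)) := by
  refine mkF_inj rfl rfl (fun α => ?_) (fun α => ?_) (fun α => ?_) (fun α => ?_) <;> simp

theorem gdact_gmu (φ : FieldIdx ι m → A) (y : m → A) : gdact T (graise T (gmu T φ)) y
    = ∑ γ, (dtri T (fPX φ γ) (fX φ γ) y - dtri T (fY φ γ) (fPY φ γ) y) := by
  simp only [gmu, map_sum, map_sub, LinearMap.sum_apply, LinearMap.sub_apply, dtri]

theorem gact_gmu (φ : FieldIdx ι m → A) (y : m → A) : gact T (graise T (gmu T φ)) y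
    = ∑ γ, (atri T (fPX φ γ) (fX φ γ) y - atri T (fY φ γ) (fPY φ γ) y) := by
  simp only [gmu, map_sum, map_sub, LinearMap.sum_apply, LinearMap.sub_apply, atri]

theorem gdact_sum_gnu (H : M2 E) (τ : A) (φ : FieldIdx ι m → A) (v : m → A) :
    gdact T (θ • kappa T • graise T (∑ α, ∑ β, H α β • (τ • gnu T φ α β))) v
      = kappa T • θ • τ • ∑ α, ∑ β, H α β • dtri T (fY φ β) (fX φ α) v := by
  have e : ∀ (e : E) (w : ι → A), gdact T (e • w) v = e • gdact T w v :=
    fun e w => contract_smul_left _ _ _ _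
  have e' : ∀ (t : A) (w : ι → A), gdact T (t • w) v = t • gdact T w v :=
    fun e w => contract_mul_left _ _ _ _
  simp only [map_sum, graise_smul, graise_mul, LinearMap.sum_apply, e, e', LinearMap.map_smul,
    LinearMap.smul_apply, Finset.smul_sum, smul_comm θ (kappa T), smul_comm τ (_ : E)]
  rfl

theorem gact_sum_gnu (H : M2 E) (τ : A) (φ : FieldIdx ι m → A) (v : m → A) :
    gact T (θ • kappa T • graise T (∑ α, ∑ β, H α β • (τ • gnu T φ α β))) v
      = kappa T • θ • τ • ∑ α, ∑ β, H α β • atri T (fY φ β) (fX φ α) v := by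
  have e : ∀ (e : E) (w : ι → A), gact T (e • w) v = e • gact T w v :=
    fun e w => contract_smul_left _ _ _ _
  have e' : ∀ (t : A) (w : ι → A), gact T (t • w) v = t • gact T w v :=
    fun e w => contract_mul_left _ _ _ _
  simp only [map_sum, graise_smul, graise_mul, LinearMap.sum_apply, e, e', LinearMap.map_smul,
    LinearMap.smul_apply, Finset.smul_sum, smul_comm θ (kappa T), smul_comm τ (_ : E)]
  rfl

theorem OddConst.smul_swap (hθ : S.OddConst θ) (hτ : S.OddConst τ) {K : Type*} (v : K → A) :
    θ • τ • v = -(τ • θ • v) := by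
  rw [smul_smul, hθ.mul hτ, neg_smul, mul_smul]

theorem covGd_sum_gnu (hδ : IsDer D S.del) (hτ : S.OddConst τ) (H : M2 E) {c : ι → A} (hc : S.Even c)
    (φ : FieldIdx ι m → A) : covGd T S.del c (∑ α, ∑ β, H α β • (τ • gnu T φ α β))
      = τ • ∑ α, ∑ β, (H α β • covGd T S.del c (gnu T φ α β) + D (H α β) • gnu T φ α β) := by
  simp only [map_sum, cov_smul hδ, cov_mul hδ _ hτ.del (fun j => hτ.comm (hc.apply j)),
    Finset.smul_sum, smul_add, smul_comm τ (_ : E)]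
  refine Finset.sum_congr rfl fun α _ => Finset.sum_congr rfl fun β _ => add_comm _ _

/-- `Q` commutes with the odd symmetries. -/
theorem isComm_gQ_odd (hT : IsGWData T) (hE : S.Scalars D) (hθ : S.OddConst θ)
    (hτ : S.OddConst τ) {φ : FieldIdx ι m → A} (h : S.IsField φ) (u : AOdd E) :
    IsComm (S.gQ T θ) (ptr T D S.del 0 u τ) φ 0 := by
  refine ⟨_, _, S.hasDirDeriv_gQ T θ φ _, hasDirDeriv_ptr T D S.del 0 u τ φ _, (sub_eq_zero.2 ?_).symm⟩
  have hψ : ptr T D S.del 0 u τ φ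
      = mkF (kappa T • graise T (∑ α, ∑ β, vee u.1 α β • (τ • gnu T φ α β))) 0 _ _ _ _ :=
    (mtr_odd T u τ _ _ φ).trans (by rw [atr_odd])
  have hf := h.ptr T hE hτ 0 u
  have he := fun t : m → ι → m → ℂ => hE.cov_thd_smul hθ t (θ • fA φ)
  have hX := fun v => covR_comm hT hE hθ h.compA (conB T (fB φ)) v
  have hY := fun v => covRd_comm hT hE hθ h.compA (conB T (fB φ)) v
  have hcτ := fun j => hτ.comm ((h.conB T).apply j)
  have haτ := fun j => hτ.comm ((hθ.even h.compA).apply j)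
  have hR := conB_gQ hT hθ φ
  have hc := (h.conB T).central
  have e0 : fA (ptr T D S.del 0 u τ φ)
      = kappa T • graise T (∑ α, ∑ β, vee u.1 α β • (τ • gnu T φ α β)) := by rw [hψ]; rfl
  have e1 : fB (ptr T D S.del 0 u τ φ) = 0 := by rw [hψ]; rfl
  have eX : fX (ptr T D S.del 0 u τ φ) = fun α => τ • -∑ β, u.1 α β • fPY φ β := by
    rw [hψ]
    funext α
    rw [smul_neg, Finset.smul_sum]
    exact congrArg Neg.neg (Finset.sum_congr rfl fun β _ => (smul_comm _ _ _).symm)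
  have eY : fY (ptr T D S.del 0 u τ φ) = fun α => τ • ∑ β, u.1.transpose α β • fPX φ β := by
    rw [hψ]
    funext α
    rw [Finset.smul_sum]
    exact (Finset.sum_congr rfl fun β _ => (smul_comm _ _ _).symm)
  have hm : ∀ (t : m → ι → m → ℂ) v, cov t (S.thd θ) (θ • fA φ) (τ • v)
      = τ • cov t (S.thd θ) (θ • fA φ) v := fun t v => cov_mul (hE.isDer_thd hθ) t hτ.thd_odd haτ v
  have rPX : fPX (S.gQ T θ φ) = fun α => covRd T (S.thd θ) (θ • fA φ) (fPX φ α)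
      - kappa T • θ • dtri T (fY φ (partner α)) (fX φ (partner α)) (fY φ α) := by
    funext α
    rw [← gdact_theta]; rfl
  have rPY : fPY (S.gQ T θ φ) = fun α => covR T (S.thd θ) (θ • fA φ) (fPY φ α)
      + kappa T • θ • atri T (fY φ (partner α)) (fX φ (partner α)) (fX φ α) := by
    funext α
    rw [← gact_theta]; rfl
  rw [mtr_odd, wvar_odd, mkF_add, gQ', atr_odd, hR]
  refine mkF_inj ?_ ?_ (fun α => ?_) (fun α => ?_) (fun α => ?_) (fun α => ?_)
  · rw [gQ'_A hT h.compA hf.compA, e0, LinearMap.map_smul, Scalars.covGd_graise hT, map_sum]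
    simp only [map_sum, hE.cov_thd_smul hθ, cov_mul (hE.isDer_thd hθ) _ hτ.thd_odd haτ,
      gnu'_gQ hT hE hθ h]
    exact (add_zero _).symm
  · have e := gQ'_B (S := S) (θ := θ) hT (w := ∑ α, ∑ β, vee u.1 α β • (τ • gnu T φ α β)) h.compB
    have e2 : gmu' T φ (ptr T D S.del 0 u τ φ) = covGd T S.del (conB T (fB φ))
        (∑ α, ∑ β, vee u.1 α β • (τ • gnu T φ α β)) := by
      rw [gmu'_odd T hE.isDer u hτ.del (h.commWith hτ), covGd_sum_gnu hE.isDer hτ _ (h.conB T)]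
      simp only [gnu, covRd_gmom hT hE.isDer hc]
    rw [e0, e1, map_zero, zero_add, sub_add_eq_add_sub, e, e2, sub_self]
    exact (add_zero _).symm
  · rw [eX, e0, gact_sum_gnu, atri_vee hT _ h.compX, hm, hθ.smul_swap hτ, rPY]
    simp only [smul_comm (_ : E) τ (_ : m → A), ← Finset.smul_sum, smul_add, Finset.sum_add_distrib,
      map_neg, map_sum, he, smul_neg, smul_comm (_ : E) (kappa T) (_ : m → A),
      smul_comm (_ : E) θ (_ : m → A), smul_comm τ (kappa T) (_ : m → A)]
    change _ = _ + (0 : m → A)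
    abel
  · rw [eY, e0, gdact_sum_gnu, dtri_vee hT _ h.compY, hm, hθ.smul_swap hτ, rPX]
    simp only [smul_comm (_ : E) τ (_ : m → A), ← Finset.smul_sum, smul_sub, Finset.sum_sub_distrib,
      map_sum, he, smul_neg, smul_comm (_ : E) (kappa T) (_ : m → A),
      smul_comm (_ : E) θ (_ : m → A), smul_comm τ (kappa T) (_ : m → A)]
    change _ = _ + (0 : m → A)
    abel
  · have e2 : fPX (ptr T D S.del 0 u τ φ) α
        = xtr D (covRd T S.del (conB T (fB φ))) (vee u.1) u.2 (fun β => τ • fY φ β) α := by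
      rw [hψ]; rfl
    have e3 := dtri_rot (PX := fPX φ) (PY := fPY φ) hT h.compX h.compY u.1 α
    have e5 : ∀ β, gdact T (kappa T • θ • graise T (gmu T φ)) (τ • fY φ β)
        = -(kappa T • θ • τ • ∑ γ, (dtri T (fPX φ γ) (fX φ γ) (fY φ β)
          - dtri T (fY φ γ) (fPY φ γ) (fY φ β))) := by
      intro β
      have := contract_mul_left (fun s a t => -T.ρ a t s) θ (graise T (gmu T φ)) (τ • fY φ β)
      rw [LinearMap.map_smul, LinearMap.smul_apply, gdact, this, contract_mul_right_neg _
        (fun s => hτ.anticomm (((h.gmu T).graise T).apply s)), ← gdact_gmu, smul_neg, smul_neg]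
      rfl
    rw [e2, cov_xtr (k := gdact T (gcurv S T θ (fA φ) (conB T (fB φ)))) (he _) (fun α => hY _), e0,
      gdact_sum_gnu, gdact_gnu', gnu, gdact_theta, ← smul_add, eX, eY, dtri_mul_left,
      dtri_mul_mid hτ (h.compY _), dtri_mul_right hτ (h.compY _) (h.compX _)]
    have e6 : (fun β => covRd T (S.thd θ) (θ • fA φ) (τ • fY φ β))
        = fun β => τ • fY (S.gQ T θ φ) β := funext fun β => hm _ _
    rw [e6]
    simp only [map_add, LinearMap.add_apply, e5, smul_add, Finset.sum_add_distrib, smul_neg,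
      smul_comm (_ : E) (kappa T) (_ : m → A), smul_comm (_ : E) θ (_ : m → A),
      smul_comm (_ : E) τ (_ : m → A), ← Finset.smul_sum, Finset.sum_neg_distrib]
    rw [← smul_neg (kappa T), ← smul_neg θ, ← smul_neg τ, ← e3]
    simp only [dtri_neg_mid, smul_add, smul_sub, smul_neg]
    abel
  · have e2 : fPY (ptr T D S.del 0 u τ φ) α
        = -xtr D (covR T S.del (conB T (fB φ))) (vee u.1).transpose (-u.2.transpose)
          (fun β => τ • fX φ β) α := by
      rw [hψ]; rfl
    have e3 := atri_rot (Y := fY φ) (PX := fPX φ) (PY := fPY φ) hT h.compX u.1 α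
    have e5 : ∀ β, gact T (kappa T • θ • graise T (gmu T φ)) (τ • fX φ β)
        = -(kappa T • θ • τ • ∑ γ, (atri T (fPX φ γ) (fX φ γ) (fX φ β)
          - atri T (fY φ γ) (fPY φ γ) (fX φ β))) := by
      intro β
      have := contract_mul_left (fun s a t => T.ρ a s t) θ (graise T (gmu T φ)) (τ • fX φ β)
      rw [LinearMap.map_smul, LinearMap.smul_apply, gact, this, contract_mul_right_neg _
        (fun s => hτ.anticomm (((h.gmu T).graise T).apply s)), ← gact_gmu, smul_neg, smul_neg]
      rfl
    rw [e2, map_neg, cov_xtr (k := gact T (gcurv S T θ (fA φ) (conB T (fB φ)))) (he _) (fun α => hX _), e0,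
      gact_sum_gnu, gact_gnu', gnu, gact_theta, ← smul_add, eX, eY, atri_mul_left,
      atri_mul_mid hτ (h.compY _), atri_mul_right hτ (h.compY _) (h.compX _)]
    have e6 : (fun β => covR T (S.thd θ) (θ • fA φ) (τ • fX φ β))
        = fun β => τ • fX (S.gQ T θ φ) β := funext fun β => hm _ _
    rw [e6]
    simp only [map_add, LinearMap.add_apply, e5, smul_add, Finset.sum_add_distrib, smul_neg,
      smul_comm (_ : E) (kappa T) (_ : m → A), smul_comm (_ : E) θ (_ : m → A),
      smul_comm (_ : E) τ (_ : m → A), ← Finset.smul_sum, Finset.sum_neg_distrib]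
    rw [← smul_neg (kappa T), ← smul_neg θ, ← smul_neg τ, ← e3]
    simp only [atri_neg_right, atri_neg_mid, smul_add, smul_sub, smul_neg]
    abel

end CommuteOdd
end SuperDiff

/-! ### The supercharge squares to zero; vector fields -/

namespace SuperDiff

section Square

variable {A : Type*} [Ring A] [Algebra ℂ A] {S : SuperDiff A} {ι m : Type*}
  [Fintype ι] [DecidableEq ι] [Fintype m] {T : GaugeData ι m}
  {E : Type*} [CommRing E] [Algebra ℂ E] [Algebra E A] [IsScalarTower ℂ E A]
  {D : Derivation ℂ E E} {θ θ' : A}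

theorem IsField.gQ {φ : FieldIdx ι m → A} (h : S.IsField φ) (hθ : S.OddConst θ) :
    S.IsField (S.gQ T θ φ) := by
  have ha := hθ.even h.compA
  refine isField_mkF ?_ ?_ (fun α => ?_) (fun α => ?_) (fun α => ?_) (fun α => ?_)
  · exact (odd_vec hθ.par_thd h.compA).add ((ha.contract_odd h.compA).smul _)
  · exact ((even_cov hθ.par_thd ha h.compB).sub (hθ.even (h.gmu T))).add
      ((Even.glower T (hθ.even (odd_vec S.par_del h.compA))).smul _)
  · exact even_cov hθ.par_thd ha (h.compX α)
  · exact even_cov hθ.par_thd ha (h.compY α)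
  · exact (odd_cov hθ.par_thd ha (h.compPX α)).sub (Odd.smul
      ((hθ.odd_vec ((h.gnu T _ _).graise T)).contract_even (h.compY α)) _)
  · exact (odd_cov hθ.par_thd ha (h.compPY α)).add (Odd.smul
      ((hθ.odd_vec ((h.gnu T _ _).graise T)).contract_even (h.compX α)) _)

theorem vec_thd_smul (hθ' : S.OddConst θ') {K : Type*} (v : K → A) :
    vec (S.thd θ) (θ' • v) = -(θ • θ' • vec S.d v) := funext fun i => by
  change S.thd θ (θ' * v i) = -(θ * (θ' * S.d (v i)))
  rw [thd_apply, hθ'.d_mul, mul_neg]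

theorem vec_thd (θ : A) {K : Type*} (v : K → A) : vec (S.thd θ) v = θ • vec S.d v := rfl

theorem contract_smul_odd (hθ : S.OddConst θ) {J K I : Type*} [Fintype J] [Fintype K]
    (t : I → J → K → ℂ) {c : J → A} (hc : S.Odd c) (v : K → A) :
    contract t c (θ • v) = -(θ • contract t c v) :=
  contract_mul_right_neg _ (fun s => hθ.anticomm (hc.apply s)) v

/-- The curvature of a pair of `Q`-covariant derivatives is minus the antisymmetrized variation of
`𝐀`. -/
theorem curv_gQ (hθ : S.OddConst θ) (hθ' : S.OddConst θ') {φ : FieldIdx ι m → A}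
    (h : S.IsField φ) : vec (S.thd θ) (θ' • fA φ) - vec (S.thd θ') (θ • fA φ)
      + gbrk T (θ • fA φ) (θ' • fA φ)
      = θ' • fA (S.gQ T θ φ) - θ • fA (S.gQ T θ' φ) := by
  have e : ∀ θ, fA (S.gQ T θ φ) = θ • vec S.d (fA φ) + (2⁻¹ : ℂ) • (θ • gbrk T (fA φ) (fA φ)) :=
    fun θ => congrArg (fun x => _ + (2⁻¹ : ℂ) • x) (contract_mul_left _ _ _ _)
  have e2 : gbrk T (θ • fA φ) (θ' • fA φ) = -(θ • θ' • gbrk T (fA φ) (fA φ)) := by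
    rw [gbrk, contract_mul_left, contract_smul_odd hθ' _ h.compA, smul_neg]
  rw [vec_thd_smul hθ', vec_thd_smul hθ, e, e, e2]
  simp only [smul_add, smul_comm _ (2⁻¹ : ℂ), hθ'.smul_swap hθ]
  generalize θ • θ' • vec S.d (fA φ) = x
  generalize θ • θ' • gbrk T (fA φ) (fA φ) = y
  module

theorem gbrk_gbrk_odd (hT : IsGWData T) (hθ : S.OddConst θ) {a : ι → A} (ha : S.Odd a) :
    θ • gbrk T a (gbrk T a a) = 0 := by
  have h := gbrk_gbrk T hT (hθ.even ha).central a a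
  have h1 : gbrk T (θ • a) (gbrk T a a) = θ • gbrk T a (gbrk T a a) := contract_mul_left _ _ _ _
  have h2 : gbrk T (θ • a) a = θ • gbrk T a a := contract_mul_left _ _ _ _
  have h3 : gbrk T (θ • gbrk T a a) a = θ • gbrk T (gbrk T a a) a := contract_mul_left _ _ _ _
  have h4 : gbrk T a (θ • gbrk T a a) = -(θ • gbrk T a (gbrk T a a)) := contract_smul_odd hθ _ ha _
  have h5 : gbrk T (gbrk T a a) a = -gbrk T a (gbrk T a a) :=
    gbrk_skew T hT fun i j => (Odd.contract ha ha : S.Even (gbrk T a a)).central i _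
  rw [h1, h2, h3, h4, h5, smul_neg] at h
  have h6 : (3 : ℂ) • θ • gbrk T a (gbrk T a a) = 0 := by
    generalize θ • gbrk T a (gbrk T a a) = x at h
    have : (3 : ℂ) • x = x - (-x + -x) := by module
    rw [this, ← h, sub_self]
  exact (smul_eq_zero_iff_right three_ne_zero).1 h6

theorem vec_d_contract {J K I : Type*} [Fintype J] [Fintype K]
    (t : I → J → K → ℂ) (c : J → A) (v : K → A) :
    vec S.d (contract t c v) = contract t (vec S.d c) v + contract t (vec S.par c) (vec S.d v) := by
  funext i
  simp only [LinearMap.compLeft_apply, contract_apply, map_sum, map_smul, S.d_mul, Pi.add_apply,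
    smul_add, Finset.sum_add_distrib, Function.comp]

/-- The Bianchi identity. -/
theorem covG_gQ (hT : IsGWData T) (θ : A) (hθ' : S.OddConst θ') {φ : FieldIdx ι m → A}
    (h : S.IsField φ) : covG T (S.thd θ) (θ • fA φ) (fA (S.gQ T θ' φ)) = 0 := by
  have e : fA (S.gQ T θ' φ) = θ' • (vec S.d (fA φ) + (2⁻¹ : ℂ) • gbrk T (fA φ) (fA φ)) := by
    rw [smul_add, smul_comm]
    exact congrArg (fun x => _ + (2⁻¹ : ℂ) • x) (contract_mul_left _ _ _ _)
  have e1 : vec S.d (vec S.d (fA φ)) = 0 := funext fun i => S.d_d _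
  have hd : S.Even (vec S.d (fA φ)) := funext fun i => by
    change S.par (S.d _) = S.d _
    rw [S.par_d, h.compA.apply, map_neg, neg_neg]
  have e2 : vec S.d (gbrk T (fA φ) (fA φ)) = -(2 : ℂ) • gbrk T (fA φ) (vec S.d (fA φ)) := by
    rw [gbrk, vec_d_contract, h.compA, map_neg, LinearMap.neg_apply]
    have : contract (fun a b c => T.f b c a) (vec S.d (fA φ)) (fA φ)
        = -contract (fun a b c => T.f b c a) (fA φ) (vec S.d (fA φ)) :=
      gbrk_skew T hT fun i j => hd.central i _
    rw [this]
    module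
  have e3 := gbrk_gbrk_odd hT hθ' h.compA
  rw [e, cov_apply, contract_mul_left, contract_smul_odd hθ' _ h.compA, vec_thd_smul hθ', map_add,
    e1, LinearMap.map_smul, e2, map_add, LinearMap.map_smul, smul_add θ']
  change -(θ • (θ' • 0 + θ' • (2⁻¹ : ℂ) • -(2 : ℂ) • gbrk T (fA φ) (vec S.d (fA φ))))
    + θ • -(θ' • (gbrk T (fA φ) (vec S.d (fA φ))
      + (2⁻¹ : ℂ) • gbrk T (fA φ) (gbrk T (fA φ) (fA φ)))) = 0
  rw [smul_add θ', smul_comm θ' (2⁻¹ : ℂ) (gbrk T (fA φ) _), e3, smul_zero, smul_zero, add_zero,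
    zero_add, smul_neg, ← neg_add, ← smul_add, ← smul_add]
  have : ((2⁻¹ : ℂ) • -(2 : ℂ) • gbrk T (fA φ) (vec S.d (fA φ)))
      + gbrk T (fA φ) (vec S.d (fA φ)) = 0 := by module
  rw [this, smul_zero, smul_zero, neg_zero]

theorem smul_cov_swap (hθ : S.OddConst θ) (hθ' : S.OddConst θ') {J K : Type*} [Fintype J] [Fintype K]
    (t : K → J → K → ℂ) (a : J → A) (v : K → A) :
    θ • cov t (S.thd θ') (θ' • a) v = -(θ' • cov t (S.thd θ) (θ • a) v) := by
  rw [cov_apply, cov_apply, contract_mul_left, contract_mul_left, vec_thd, vec_thd, ← smul_add,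
    ← smul_add, hθ.smul_swap hθ']

theorem _root_.HTTwist.IsGWData.coad_tensor (hT : IsGWData T) (i j l n : ι) :
    ∑ k, -T.f j i k * -T.f l k n - ∑ k, -T.f l i k * -T.f j k n = ∑ a, -T.f a i n * T.f j l a := by
  have h := neg_eq_zero.2 (hT.jac j l i n)
  rw [← sub_eq_zero, ← Finset.sum_sub_distrib, ← Finset.sum_sub_distrib, ← h,
    ← Finset.sum_neg_distrib]
  refine Finset.sum_congr rfl fun a _ => ?_
  rw [hT.skew i j a, hT.skew i a n]
  ring

theorem glower_covG (hT : IsGWData T) (δ : A →ₗ[ℂ] A) (c b : ι → A) :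
    covGd T δ c (glower T b) = glower T (covG T δ c b) := by
  rw [cov_apply, cov_apply, map_add, vec_glower]
  exact congrArg _ (glower_gbrk T hT c b).symm

/-- `Q` squares to zero. -/
theorem isComm_gQ_gQ (hT : IsGWData T) (hE : S.Scalars D) (hθ : S.OddConst θ) (hθ' : S.OddConst θ')
    {φ : FieldIdx ι m → A} (h : S.IsField φ) : IsComm (S.gQ T θ) (S.gQ T θ') φ 0 := by
  refine ⟨_, _, S.hasDirDeriv_gQ T θ φ _, S.hasDirDeriv_gQ T θ' φ _, (sub_eq_zero.2 ?_).symm⟩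
  have hd : IsDer (0 : Derivation ℂ E E) (S.thd θ) := hE.isDer_thd hθ
  have hd' : IsDer (0 : Derivation ℂ E E) (S.thd θ') := hE.isDer_thd hθ'
  have ha := (hθ.even h.compA)
  have ha' := (hθ'.even h.compA)
  have hcurv := curv_gQ (T := T) hθ hθ' h
  have hdd : ∀ a, S.thd θ (S.thd θ' a) = S.thd θ' (S.thd θ a) := fun a => by
    rw [hθ'.thd_thd, hθ.thd_thd]
  have cR := fun v => cov_cov (fun i j l n => hT.rep_tensor i j l n) hd hd' ha.central (θ' • fA φ) v hdd
  have cRd := fun v => cov_cov (fun i j l n => hT.dual_tensor i j l n) hd hd' ha.central (θ' • fA φ) v hdd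
  have cGd := fun v => cov_cov (fun i j l n => hT.coad_tensor i j l n) hd hd' ha.central (θ' • fA φ) v hdd
  have hc := fun v : m → A => (cR v).trans (congrArg (fun w => _ + contract _ w v) hcurv)
  have hcd := fun v : m → A => (cRd v).trans (congrArg (fun w => _ + contract _ w v) hcurv)
  have hcG := fun v : ι → A => (cGd v).trans (congrArg (fun w => _ + contract _ w v) hcurv)
  rw [gQ', gQ']
  refine mkF_inj ?_ ?_ (fun α => ?_) (fun α => ?_) (fun α => ?_) (fun α => ?_)
  · rw [gQ'_A hT h.compA (h.gQ hθ').compA, gQ'_A hT h.compA (h.gQ hθ).compA, covG_gQ hT θ hθ' h,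
      covG_gQ hT θ' hθ h]
  · have e2 : ∀ θ, fB (S.gQ T θ φ) = covGd T (S.thd θ) (θ • fA φ) (fB φ) - θ • gmu T φ
        + (T.k / (2 * (Real.pi : ℂ))) • glower T (θ • vec S.del (fA φ)) := fun _ => rfl
    have e3 : covG T (S.thd θ) (θ • fA φ) (vec S.del (θ' • fA φ)) + vec S.del (θ • fA (S.gQ T θ' φ))
        = covG T (S.thd θ') (θ' • fA φ) (vec S.del (θ • fA φ)) + vec S.del (θ' • fA (S.gQ T θ φ)) := by
      have h1 := congrArg (vec S.del) hcurv
      have h2 : vec S.del (gbrk T (θ • fA φ) (θ' • fA φ))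
          = gbrk T (vec S.del (θ • fA φ)) (θ' • fA φ) + gbrk T (θ • fA φ) (vec S.del (θ' • fA φ)) :=
        vec_contract hE.isDer _ _ _
      have h3 : gbrk T (vec S.del (θ • fA φ)) (θ' • fA φ) = -gbrk T (θ' • fA φ) (vec S.del (θ • fA φ)) :=
        gbrk_skew T hT fun i j => (ha'.central j _).symm
      have h4 : ∀ θ, S.OddConst θ → ∀ v : ι → A, vec S.del (vec (S.thd θ) v) = vec (S.thd θ) (vec S.del v) :=
        fun θ hθ v => funext fun i => (hθ.thd_del _).symm
      rw [map_add, map_sub, map_sub, h2, h3, h4 θ hθ, h4 θ' hθ'] at h1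
      rw [cov_apply, cov_apply, ← sub_eq_zero]
      rw [← sub_eq_zero] at h1
      rw [← h1, gbrk]
      abel
    have e4 := congrArg (fun x => (T.k / (2 * (Real.pi : ℂ))) • glower T x) e3
    simp only [map_add, smul_add, ← glower_covG hT, vec_del_odd hθ', vec_del_odd hθ] at e4
    rw [e2, e2, gmu'_gQ hT hE hθ h, gmu'_gQ hT hE hθ' h, map_add, map_sub, map_add, map_sub, hcG,
      LinearMap.map_smul, LinearMap.map_smul,
      cov_mul hd _ hθ'.thd_odd (fun i => hθ'.comm (ha.apply i)),
      cov_mul hd' _ hθ.thd_odd (fun i => hθ.comm (ha'.apply i)), smul_cov_swap hθ hθ', map_sub,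
      LinearMap.sub_apply, gcoad, ← sub_eq_zero]
    rw [← sub_eq_zero] at e4
    rw [← e4]
    abel
  · change covR T (S.thd θ) (θ • fA φ) (covR T (S.thd θ') (θ' • fA φ) (fX φ α)) + _
      = covR T (S.thd θ') (θ' • fA φ) (covR T (S.thd θ) (θ • fA φ) (fX φ α)) + _
    rw [hc, map_sub, LinearMap.sub_apply, gact]
    abel
  · change covRd T (S.thd θ) (θ • fA φ) (covRd T (S.thd θ') (θ' • fA φ) (fY φ α)) + _
      = covRd T (S.thd θ') (θ' • fA φ) (covRd T (S.thd θ) (θ • fA φ) (fY φ α)) + _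
    rw [hcd, map_sub, LinearMap.sub_apply, gdact]
    abel
  · have e : ∀ {θ θ'}, S.OddConst θ → S.OddConst θ' →
        gdact T (θ • graise T (gnu' T φ (S.gQ T θ' φ) (partner α) (partner α))) (fY φ α)
        + gdact T (θ • graise T (gnu T φ (partner α) (partner α))) (fY (S.gQ T θ' φ) α)
        = θ • covRd T (S.thd θ') (θ' • fA φ)
          (dtri T (fY φ (partner α)) (fX φ (partner α)) (fY φ α)) := by
      intro θ θ' hθ hθ'
      rw [gdact_gnu', gnu, gdact_theta, ← smul_add, covRd_dtri hT (hE.isDer_thd hθ')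
        (hθ'.even h.compA).central]
      rfl
    have e2 : ∀ θ, fPX (S.gQ T θ φ) α = covRd T (S.thd θ) (θ • fA φ) (fPX φ α)
        - kappa T • θ • dtri T (fY φ (partner α)) (fX φ (partner α)) (fY φ α) := by
      intro θ
      rw [← gdact_theta]; rfl
    rw [e hθ hθ', e hθ' hθ, e2, e2, map_sub, map_sub, hcd, LinearMap.map_smul, LinearMap.map_smul,
      cov_mul hd _ hθ'.thd_odd (fun i => hθ'.comm (ha.apply i)),
      cov_mul hd' _ hθ.thd_odd (fun i => hθ.comm (ha'.apply i)), smul_cov_swap hθ hθ', map_sub,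
      LinearMap.sub_apply, gdact, smul_neg]
    abel
  · have e : ∀ {θ θ'}, S.OddConst θ → S.OddConst θ' →
        gact T (θ • graise T (gnu' T φ (S.gQ T θ' φ) (partner α) (partner α))) (fX φ α)
        + gact T (θ • graise T (gnu T φ (partner α) (partner α))) (fX (S.gQ T θ' φ) α)
        = θ • covR T (S.thd θ') (θ' • fA φ)
          (atri T (fY φ (partner α)) (fX φ (partner α)) (fX φ α)) := by
      intro θ θ' hθ hθ'
      rw [gact_gnu', gnu, gact_theta, ← smul_add, covR_atri hT (hE.isDer_thd hθ')
        (hθ'.even h.compA).central]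
      rfl
    have e2 : ∀ θ, fPY (S.gQ T θ φ) α = covR T (S.thd θ) (θ • fA φ) (fPY φ α)
        + kappa T • θ • atri T (fY φ (partner α)) (fX φ (partner α)) (fX φ α) := by
      intro θ
      rw [← gact_theta]; rfl
    rw [e hθ hθ', e hθ' hθ, e2, e2, map_add, map_add, hc, LinearMap.map_smul, LinearMap.map_smul,
      cov_mul hd _ hθ'.thd_odd (fun i => hθ'.comm (ha.apply i)),
      cov_mul hd' _ hθ.thd_odd (fun i => hθ.comm (ha'.apply i)), smul_cov_swap hθ hθ', map_sub,
      LinearMap.sub_apply, gact, smul_neg]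
    abel

/-- The transformation `𝐀 ↦ (2π/k) τ V 𝐁`. -/
def ghom (T : GaugeData ι m) (V : E) (τ : A) (φ : FieldIdx ι m → A) : FieldIdx ι m → A :=
  mkF (kappa T • V • τ • graise T (fB φ)) 0 0 0 0 0

/-- The Lie derivative along a vector field. -/
def ggeo (S : SuperDiff A) (D : Derivation ℂ E E) (V : E) (φ : FieldIdx ι m → A) : FieldIdx ι m → A :=
  mkF (V • vec S.del (fA φ)) (V • vec S.del (fB φ) + D V • fB φ)
    (fun α => V • vec S.del (fX φ α) + (4⁻¹ : ℂ) • (D V • fX φ α))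
    (fun α => V • vec S.del (fY φ α) + (4⁻¹ : ℂ) • (D V • fY φ α))
    (fun α => V • vec S.del (fPX φ α) + (3 / 4 : ℂ) • (D V • fPX φ α))
    (fun α => V • vec S.del (fPY φ α) + (3 / 4 : ℂ) • (D V • fPY φ α))

/-- The difference of the Lie derivative and of the symmetry generated by a vector field is
`Q`-exact. -/
theorem isComm_gQ_ghom (hT : IsGWData T) (hE : S.Scalars D) (hθ : S.OddConst θ) (hθ' : S.OddConst θ')
    {φ : FieldIdx ι m → A} (h : S.IsField φ) (V : E) {e : E} (he : D e = 0)
    (htt : θ * θ' = algebraMap E A e) :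
    IsComm (S.gQ T θ) (ghom T V θ') φ
      (ggeo S D (e * V) φ - ptr T D S.del (e * V, 0, 0, 0) 0 θ φ) := by
  have htt' : θ' * θ = -algebraMap E A e := by rw [hθ'.mul hθ, htt]
  have hd : HasDirDeriv (ghom T V θ') φ (S.gQ T θ φ)
      (mkF (kappa T • V • θ' • graise T (fB (S.gQ T θ φ))) 0 0 0 0 0) :=
    HasDirDeriv.mkF (((((hasDirDeriv_component FieldIdx.B φ _).linear_comp (graise T)).asmul θ').esmul
      V).const_smul (kappa T)) (hasDirDeriv_const _ _ _) (fun α => hasDirDeriv_const _ _ _)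
      (fun α => hasDirDeriv_const _ _ _) (fun α => hasDirDeriv_const _ _ _)
      fun α => hasDirDeriv_const _ _ _
  refine ⟨_, _, S.hasDirDeriv_gQ T θ φ _, hd, ?_⟩
  have hψ : S.Odd (fA (ghom T V θ' φ)) :=
    (hE.odd (hθ'.odd_vec (h.compB.graise T)) V).smul _
  have hg : fA (ghom T V θ' φ) = kappa T • graise T (V • θ' • fB φ) := by
    rw [graise_smul, graise_mul]; rfl
  have hV : D (e * V) = e * D V := by rw [D.leibniz, he, smul_zero, add_zero, smul_eq_mul]
  have hq : θ • fA (ghom T V θ' φ) = kappa T • (e * V) • graise T (fB φ) := by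
    change θ • kappa T • V • θ' • graise T (fB φ) = _
    rw [smul_comm θ (kappa T), smul_comm θ V, smul_smul_of_mul_eq htt, smul_smul, mul_comm]
  have hrot : rotX ((e * V, 0, 0, 0) : AEven E) = 0 := by simp [rotX]
  have hrot' : rotY ((e * V, 0, 0, 0) : AEven E) = 0 := by simp [rotY]
  have hw : ∀ (nab : (m → A) →ₗ[ℂ] (m → A)) (w : ℂ) (x : Fin 2 → m → A) (α : Fin 2),
      wtr D nab w (e * V) 0 x α = (e * V) • nab (x α) + w • (D (e * V) • x α) := fun nab w x α => by
    simp [wtr]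
  have ga : ∀ v : m → A, gact T (kappa T • (e * V) • graise T (fB φ)) v
      = -((e * V) • gact T (conB T (fB φ)) v) := fun v => by
    have := contract_smul_left (fun s a t => T.ρ a s t) (e * V) (graise T (fB φ)) v
    rw [LinearMap.map_smul, LinearMap.smul_apply, gact, this, conB, LinearMap.map_smul,
      LinearMap.smul_apply, neg_smul, smul_neg, neg_neg, smul_comm]
  have gd : ∀ v : m → A, gdact T (kappa T • (e * V) • graise T (fB φ)) v
      = -((e * V) • gdact T (conB T (fB φ)) v) := fun v => by
    have := contract_smul_left (fun s a t => -T.ρ a t s) (e * V) (graise T (fB φ)) v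
    rw [LinearMap.map_smul, LinearMap.smul_apply, gdact, this, conB, LinearMap.map_smul,
      LinearMap.smul_apply, neg_smul, smul_neg, neg_neg, smul_comm]
  have gx : ∀ α, fX (ghom T V θ' φ) α = 0 := fun _ => rfl
  have gy : ∀ α, fY (ghom T V θ' φ) α = 0 := fun _ => rfl
  have gpx : ∀ α, fPX (ghom T V θ' φ) α = 0 := fun _ => rfl
  have gpy : ∀ α, fPY (ghom T V θ' φ) α = 0 := fun _ => rfl
  have gmu0 : gmu' T φ (ghom T V θ' φ) = 0 := by simp [gmu', gx, gy, gpx, gpy]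
  have gnu0 : ∀ α, gnu' T φ (ghom T V θ' φ) α α = 0 := fun α => by simp [gnu', gx, gy]
  rw [ptr, mtr_even, atr_even, ggeo, mkF_sub, gQ', mkF_sub, hrot, hrot']
  refine mkF_inj ?_ ?_ (fun α => ?_) (fun α => ?_) (fun α => ?_) (fun α => ?_)
  · rw [gQ'_A hT h.compA hψ, hg, LinearMap.map_smul, Scalars.covGd_graise hT, hE.cov_thd_smul hθ,
      cov_mul (hE.isDer_thd hθ) _ hθ'.thd_odd (fun i => hθ'.comm ((hθ.even h.compA).apply i))]
    have e2 : fB (S.gQ T θ φ) = covGd T (S.thd θ) (θ • fA φ) (fB φ) - θ • gmu T φ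
        + (T.k / (2 * (Real.pi : ℂ))) • glower T (θ • vec S.del (fA φ)) := rfl
    have r : graise T (fB (S.gQ T θ φ)) = graise T (covGd T (S.thd θ) (θ • fA φ) (fB φ))
        - θ • graise T (gmu T φ) + (T.k / (2 * (Real.pi : ℂ))) • θ • vec S.del (fA φ) := by
      rw [e2, map_add, map_sub, graise_mul, LinearMap.map_smul, graise_glower T hT]
    have k1 : θ' • θ • graise T (gmu T φ) = -(e • graise T (gmu T φ)) := smul_smul_of_mul_eq_neg htt' _
    have k2 : θ' • θ • vec S.del (fA φ) = -(e • vec S.del (fA φ)) := smul_smul_of_mul_eq_neg htt' _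
    have k3 : kappa T • V • (T.k / (2 * (Real.pi : ℂ))) • (e • vec S.del (fA φ))
        = (e * V) • vec S.del (fA φ) := by
      rw [smul_comm V (T.k / (2 * (Real.pi : ℂ))), smul_smul (kappa T), kappa_mul hT.k_ne, one_smul,
        smul_smul, mul_comm]
    rw [r, graise_smul, graise_smul, graise_mul, smul_add θ', smul_sub θ',
      smul_comm θ' (T.k / (2 * (Real.pi : ℂ))), k1, k2, ← k3, mul_comm e V, mul_smul]
    simp only [smul_add, smul_sub, smul_neg]
    abel
  · have e3 := gQ'_B (S := S) (θ := θ) hT (w := V • θ' • fB φ) h.compB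
    have e4 : gcoad T (graise T (fB φ)) (fB φ) = 0 := eq_zero_of_eq_neg
      (gcoad_graise_skew T hT fun i j => h.compB.central i _)
    have e5 : covGd T S.del (conB T (fB φ)) (fB φ) = vec S.del (fB φ) := by
      have e6 : contract (fun a b c => -T.f b a c) (graise T (fB φ)) (fB φ) = 0 := e4
      rw [cov_apply, conB, LinearMap.map_smul, LinearMap.smul_apply, e6, smul_zero, add_zero]
    have e7 : fB (ghom T V θ' φ) = 0 := rfl
    rw [e7, map_zero, zero_add, gmu0, smul_zero, hg]
    simp only [sub_zero]
    rw [e3, cov_smul hE.isDer,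
      cov_mul hE.isDer _ hθ'.del (fun i => hθ'.comm ((h.conB T).apply i)), e5, smul_add,
      smul_comm θ (D V), smul_comm θ V, smul_smul_of_mul_eq htt, smul_smul_of_mul_eq htt, smul_smul,
      smul_smul, hV, mul_comm e V, mul_comm e (D V), add_comm]
  · rw [hw, gx, map_zero, zero_add, hq, ga, cov_apply, smul_add]
    change _ = _ - (0 : m → A)
    rw [gact]
    abel
  · rw [hw, gy, map_zero, zero_add, hq, gd, cov_apply, smul_add]
    change _ = _ - (0 : m → A)
    rw [gdact]
    abel
  · rw [Matrix.transpose_zero, neg_zero, hw, gpx, gnu0, gy, map_zero, map_zero, map_zero, smul_zero,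
      map_zero, LinearMap.zero_apply, add_zero, smul_zero, zero_add, hq, gd, cov_apply, smul_add]
    change _ = _ - 0 - (0 : m → A)
    rw [gdact]
    abel
  · rw [Matrix.transpose_zero, neg_zero, hw, gpy, gnu0, gx, map_zero, map_zero, map_zero, smul_zero,
      map_zero, LinearMap.zero_apply, add_zero, smul_zero, zero_add, hq, ga, cov_apply, smul_add]
    change _ = _ + 0 - (0 : m → A)
    rw [gact]
    abel

end Square
end SuperDiff

/-! ### Conservation of the currents -/

section Quartic

variable {A : Type*} [Ring A] [Algebra ℂ A] {ι m : Type*}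
  [Fintype ι] [DecidableEq ι] [Fintype m] (T : GaugeData ι m)

/-- The quartic form `K^{ab} (y ρ_a x) (y' ρ_b x')`. -/
def quartic (y x y' x' : m → A) : A := gdot (graise T (gmom T y x)) (gmom T y' x')

variable {T} {S : SuperDiff A}

theorem gdot_dtri (y x y' x' : m → A) : gdot (dtri T y x y') x' = -quartic T y x y' x' :=
  gdot_gdact T _ _

theorem gdot_gact_of_central {w : m → A} (hw : Central w) (c : ι → A) (v : m → A) :
    gdot w (gact T c v) = gdot c (gmom T w v) := by
  simp only [gdot_apply, gact, gmom, contract_apply, Finset.mul_sum, mul_smul_comm]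
  rw [Finset.sum_comm]
  refine Finset.sum_congr rfl fun a _ => Finset.sum_congr rfl fun s _ =>
    Finset.sum_congr rfl fun t _ => ?_
  rw [← mul_assoc, hw, mul_assoc]

theorem gdot_atri {y' : m → A} (hy' : S.Even y') (y x x' : m → A) :
    gdot y' (atri T y x x') = quartic T y x y' x' :=
  gdot_gact_of_central hy'.central _ _

theorem gdot_atri_of_even {y x : m → A} (hy : S.Even y) (hx : S.Even x) (y' x' : m → A) :
    gdot y' (atri T y x x') = quartic T y x y' x' :=
  gdot_gact T ((hy.contract hx).graise T).central _ _

/-- The quartic form is skew in its `R`-arguments. -/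
theorem quartic_skew_right (hT : IsGWData T) {y' : m → A} (hy' : S.Even y') (y : m → A) {x : m → A}
    (hx : S.Even x) (x' : m → A) : quartic T y x y' x' = -quartic T y x' y' x := by
  rw [← gdot_atri hy', atri_skew hT _ hx, map_neg, gdot_atri hy']

/-- The quartic form is skew in its `R^*`-arguments. -/
theorem quartic_skew_left (hT : IsGWData T) {y : m → A} (hy : S.Even y) (x y' x' : m → A)
    (h : S.Even y' ∨ S.Even x) : quartic T y x y' x' = -quartic T y' x y x' := by
  rw [eq_neg_iff_add_eq_zero, ← neg_eq_zero, neg_add, ← gdot_dtri, ← gdot_dtri,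
    dtri_skew hT hy x y' h, map_neg, LinearMap.neg_apply, neg_add_cancel]

theorem quartic_right_self (hT : IsGWData T) {y' : m → A} (hy' : S.Even y') (y : m → A) {x : m → A}
    (hx : S.Even x) : quartic T y x y' x = 0 :=
  eq_zero_of_eq_neg (quartic_skew_right hT hy' y hx x)

theorem quartic_left_self (hT : IsGWData T) {y : m → A} (hy : S.Even y) (x x' : m → A) :
    quartic T y x y x' = 0 :=
  eq_zero_of_eq_neg (quartic_skew_left hT hy x y x' (.inl hy))

theorem gdot_graise_comm (hT : IsGWData T) {w v : ι → A} (h : ∀ i j, w i * v j = v j * w i) :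
    gdot (graise T w) v = gdot (graise T v) w := by
  simp only [gdot_apply, graise_apply, Finset.sum_mul, smul_mul_assoc]
  rw [Finset.sum_comm]
  refine Finset.sum_congr rfl fun a _ => Finset.sum_congr rfl fun b _ => ?_
  rw [hT.Kinv_symm, h]

theorem quartic_symm (hT : IsGWData T) {y x : m → A} (hy : S.Even y) (hx : S.Even x)
    (y' x' : m → A) : quartic T y x y' x' = quartic T y' x' y x :=
  gdot_graise_comm hT fun i _ => (hy.contract hx).central i _

theorem gdot_gact_odd {r : ι → A} {w : m → A} (hr : S.Odd r) (hw : S.Odd w) (v : m → A) :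
    gdot w (gact T r v) = -gdot r (gmom T w v) := by
  simp only [gdot_apply, gact, gmom, contract_apply, Finset.mul_sum, mul_smul_comm]
  rw [Finset.sum_comm, ← Finset.sum_neg_distrib]
  refine Finset.sum_congr rfl fun a _ => ?_
  rw [← Finset.sum_neg_distrib]
  refine Finset.sum_congr rfl fun s _ => ?_
  rw [← Finset.sum_neg_distrib]
  refine Finset.sum_congr rfl fun t _ => ?_
  rw [← mul_assoc, S.odd_anticomm _ _ (hw.apply s) (hr.apply a), neg_mul, smul_neg, mul_assoc]

theorem gdot_gdact_odd {r : ι → A} {v w : m → A} (hr : S.Odd r) (hv : S.Odd v) (hw : S.Even w) :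
    gdot v (gdact T r w) = gdot r (gmom T w v) := by
  simp only [gdot_apply, gdact, gmom, contract_apply, Finset.mul_sum, mul_smul_comm]
  rw [Finset.sum_comm]
  refine Finset.sum_congr rfl fun a _ => ?_
  rw [Finset.sum_comm]
  refine Finset.sum_congr rfl fun s _ => Finset.sum_congr rfl fun t _ => ?_
  rw [hw.central s (v t), ← mul_assoc, S.odd_anticomm _ _ (hv.apply t) (hr.apply a), neg_mul,
    smul_neg, neg_smul, neg_neg, mul_assoc]

theorem gdot_gdact_even {v : m → A} (hv : S.Even v) (r : ι → A) (w : m → A) :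
    gdot v (gdact T r w) = -gdot r (gmom T w v) := by
  rw [← gdot_gdact]
  exact gdot_comm fun j => hv.central j _

end Quartic

namespace SuperDiff

section Currents

variable {A : Type*} [Ring A] [Algebra ℂ A] (S : SuperDiff A) {ι m : Type*}
  [Fintype ι] [DecidableEq ι] [Fintype m] (T : GaugeData ι m)
  {E : Type*} [CommRing E] [Algebra ℂ E] [Algebra E A] [IsScalarTower ℂ E A]

/-- The current of an even symmetry. -/
def ecur (x : AEven E) (φ : FieldIdx ι m → A) : A :=
  x.1 • ∑ α, ((3 / 4 : ℂ) • (gdot (fPX φ α) (covR T S.del (conB T (fB φ)) (fX φ α))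
      + gdot (fPY φ α) (covRd T S.del (conB T (fB φ)) (fY φ α)))
    - (4⁻¹ : ℂ) • (gdot (fX φ α) (covRd T S.del (conB T (fB φ)) (fPX φ α))
      + gdot (fY φ α) (covR T S.del (conB T (fB φ)) (fPY φ α))))
  + ∑ α, ∑ β, (rotX x α β • gdot (fPX φ α) (fX φ β) + rotY x α β • gdot (fPY φ α) (fY φ β))

/-- The derivative of the current of an even symmetry. -/
def ecur' (x : AEven E) (φ ψ : FieldIdx ι m → A) : A :=
  x.1 • ∑ α, ((3 / 4 : ℂ) • ((gdot (fPX ψ α) (covR T S.del (conB T (fB φ)) (fX φ α))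
        + gdot (fPX φ α) (covR T S.del (conB T (fB φ)) (fX ψ α) + gact T (conB T (fB ψ)) (fX φ α)))
      + (gdot (fPY ψ α) (covRd T S.del (conB T (fB φ)) (fY φ α))
        + gdot (fPY φ α) (covRd T S.del (conB T (fB φ)) (fY ψ α) + gdact T (conB T (fB ψ)) (fY φ α))))
    - (4⁻¹ : ℂ) • ((gdot (fX ψ α) (covRd T S.del (conB T (fB φ)) (fPX φ α))
        + gdot (fX φ α) (covRd T S.del (conB T (fB φ)) (fPX ψ α) + gdact T (conB T (fB ψ)) (fPX φ α)))
      + (gdot (fY ψ α) (covR T S.del (conB T (fB φ)) (fPY φ α))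
        + gdot (fY φ α) (covR T S.del (conB T (fB φ)) (fPY ψ α) + gact T (conB T (fB ψ)) (fPY φ α)))))
  + ∑ α, ∑ β, (rotX x α β • (gdot (fPX ψ α) (fX φ β) + gdot (fPX φ α) (fX ψ β))
    + rotY x α β • (gdot (fPY ψ α) (fY φ β) + gdot (fPY φ α) (fY ψ β)))

/-- The current of an odd symmetry, before multiplication by the odd parameter. -/
def ocur (u : AOdd E) (φ : FieldIdx ι m → A) : A :=
  ∑ α, ∑ β, (u.1 α β • gdot (fPX φ α) (fPY φ β)
    - (2⁻¹ : ℂ) • (vee u.1 α β • (gdot (fX φ α) (covRd T S.del (conB T (fB φ)) (fY φ β))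
        - gdot (fY φ β) (covR T S.del (conB T (fB φ)) (fX φ α))))
    + u.2 α β • gdot (fY φ β) (fX φ α))

/-- The derivative of the current of an odd symmetry. -/
def ocur' (u : AOdd E) (φ ψ : FieldIdx ι m → A) : A :=
  ∑ α, ∑ β, (u.1 α β • (gdot (fPX ψ α) (fPY φ β) + gdot (fPX φ α) (fPY ψ β))
    - (2⁻¹ : ℂ) • (vee u.1 α β • ((gdot (fX ψ α) (covRd T S.del (conB T (fB φ)) (fY φ β))
        + gdot (fX φ α) (covRd T S.del (conB T (fB φ)) (fY ψ β) + gdact T (conB T (fB ψ)) (fY φ β)))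
      - (gdot (fY ψ β) (covR T S.del (conB T (fB φ)) (fX φ α))
        + gdot (fY φ β) (covR T S.del (conB T (fB φ)) (fX ψ α) + gact T (conB T (fB ψ)) (fX φ α)))))
    + u.2 α β • (gdot (fY ψ β) (fX φ α) + gdot (fY φ β) (fX ψ α)))

theorem hasDirDeriv_conB (φ ψ : FieldIdx ι m → A) :
    HasDirDeriv (fun f : FieldIdx ι m → A => conB T (fB f)) φ ψ (conB T (fB ψ)) :=
  ((hasDirDeriv_component FieldIdx.B φ ψ).linear_comp (graise T)).const_smul (-kappa T)

theorem hasDirDeriv_ecur (x : AEven E) (φ ψ : FieldIdx ι m → A) :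
    HasDirDeriv (S.ecur T x) φ ψ (S.ecur' T x φ ψ) := by
  have hB := hasDirDeriv_conB (A := A) T φ ψ
  have hX := fun α => (hasDirDeriv_component (FieldIdx.X α) φ ψ)
  have hY := fun α => (hasDirDeriv_component (FieldIdx.Y α) φ ψ)
  have hPX := fun α => (hasDirDeriv_component (FieldIdx.PX α) φ ψ)
  have hPY := fun α => (hasDirDeriv_component (FieldIdx.PY α) φ ψ)
  have cR := fun {v : (FieldIdx ι m → A) → m → A} {v'} (h : HasDirDeriv v φ ψ v') =>
    hasDirDeriv_cov S.del (fun s a t => T.ρ a s t) hB h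
  have cRd := fun {v : (FieldIdx ι m → A) → m → A} {v'} (h : HasDirDeriv v φ ψ v') =>
    hasDirDeriv_cov S.del (fun s a t => -T.ρ a t s) hB h
  exact ((HasDirDeriv.sum _ fun α =>
      ((((hPX α).gdot (cR (hX α))).add ((hPY α).gdot (cRd (hY α)))).const_smul (3 / 4)).sub
      ((((hX α).gdot (cRd (hPX α))).add ((hY α).gdot (cR (hPY α)))).const_smul 4⁻¹)).esmul x.1).add
    (HasDirDeriv.sum _ fun α => HasDirDeriv.sum _ fun β =>
      (((hPX α).gdot (hX β)).esmul (rotX x α β)).add (((hPY α).gdot (hY β)).esmul (rotY x α β)))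

theorem hasDirDeriv_ocur (u : AOdd E) (φ ψ : FieldIdx ι m → A) :
    HasDirDeriv (S.ocur T u) φ ψ (S.ocur' T u φ ψ) := by
  have hB := hasDirDeriv_conB (A := A) T φ ψ
  have hX := fun α => (hasDirDeriv_component (FieldIdx.X α) φ ψ)
  have hY := fun α => (hasDirDeriv_component (FieldIdx.Y α) φ ψ)
  have hPX := fun α => (hasDirDeriv_component (FieldIdx.PX α) φ ψ)
  have hPY := fun α => (hasDirDeriv_component (FieldIdx.PY α) φ ψ)
  have cR := fun {v : (FieldIdx ι m → A) → m → A} {v'} (h : HasDirDeriv v φ ψ v') =>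
    hasDirDeriv_cov S.del (fun s a t => T.ρ a s t) hB h
  have cRd := fun {v : (FieldIdx ι m → A) → m → A} {v'} (h : HasDirDeriv v φ ψ v') =>
    hasDirDeriv_cov S.del (fun s a t => -T.ρ a t s) hB h
  exact HasDirDeriv.sum _ fun α => HasDirDeriv.sum _ fun β =>
    ((((hPX α).gdot (hPY β)).esmul (u.1 α β)).sub
    (((((hX α).gdot (cRd (hY β))).sub ((hY β).gdot (cR (hX α)))).esmul (vee u.1 α β)).const_smul
      2⁻¹)).add (((hY β).gdot (hX α)).esmul (u.2 α β))

end Currents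

section Conservation

variable {A : Type*} [Ring A] [Algebra ℂ A] {S : SuperDiff A} {ι m : Type*}
  [Fintype ι] [DecidableEq ι] [Fintype m] {T : GaugeData ι m}
  {E : Type*} [CommRing E] [Algebra ℂ E] [Algebra E A] [IsScalarTower ℂ E A]
  {D : Derivation ℂ E E} {θ : A}

theorem fPX_gQ (φ : FieldIdx ι m → A) (α : Fin 2) :
    fPX (S.gQ T θ φ) α = covRd T (S.thd θ) (θ • fA φ) (fPX φ α)
      - kappa T • θ • dtri T (fY φ (partner α)) (fX φ (partner α)) (fY φ α) := by
  rw [← gdact_theta]; rfl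

theorem fPY_gQ (φ : FieldIdx ι m → A) (α : Fin 2) :
    fPY (S.gQ T θ φ) α = covR T (S.thd θ) (θ • fA φ) (fPY φ α)
      + kappa T • θ • atri T (fY φ (partner α)) (fX φ (partner α)) (fX φ α) := by
  rw [← gact_theta]; rfl

theorem gact_add_smul_smul (g r : ι → A) (κ : ℂ) (v : m → A) :
    gact T (g + κ • θ • r) v = gact T g v + κ • θ • gact T r v := by
  rw [map_add, LinearMap.map_smul, LinearMap.add_apply, LinearMap.smul_apply]
  exact congrArg (fun x => _ + κ • x) (contract_mul_left _ _ _ _)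

theorem gdact_add_smul_smul (g r : ι → A) (κ : ℂ) (v : m → A) :
    gdact T (g + κ • θ • r) v = gdact T g v + κ • θ • gdact T r v := by
  rw [map_add, LinearMap.map_smul, LinearMap.add_apply, LinearMap.smul_apply]
  exact congrArg (fun x => _ + κ • x) (contract_mul_left _ _ _ _)

theorem thd_gdot_dual (hE : S.Scalars D) (hθ : S.OddConst θ) {a : ι → A} (ha : S.Odd a)
    (w v : m → A) : S.thd θ (gdot w v) = gdot (covRd T (S.thd θ) (θ • a) w) v
      + gdot w (covR T (S.thd θ) (θ • a) v) :=
  (der_gdot_cov (hE.isDer_thd hθ) (hθ.even ha).central w v).symm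

theorem thd_gdot (hE : S.Scalars D) (hθ : S.OddConst θ) {a : ι → A} (ha : S.Odd a)
    (v w : m → A) : S.thd θ (gdot v w) = gdot (covR T (S.thd θ) (θ • a) v) w
      + gdot v (covRd T (S.thd θ) (θ • a) w) :=
  (der_gdot_cov' (hE.isDer_thd hθ) (hθ.even ha).central v w).symm

/-- The first order variation of a kinetic density `w ∂_𝐁 v` under `Q`. -/
theorem gdot_covR_gQ (hT : IsGWData T) (hE : S.Scalars D) (hθ : S.OddConst θ) {a : ι → A}
    (ha : S.Odd a) (c r : ι → A) (w v : m → A) :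
    gdot (covRd T (S.thd θ) (θ • a) w) (covR T S.del c v)
      + gdot w (covR T S.del c (covR T (S.thd θ) (θ • a) v)
        + gact T (gcurv S T θ a c + kappa T • θ • r) v)
      = S.thd θ (gdot w (covR T S.del c v)) + kappa T • gdot w (θ • gact T r v) := by
  rw [thd_gdot_dual hE hθ ha, covR_comm hT hE hθ ha, gact_add_smul_smul, map_add, map_add, map_add,
    LinearMap.map_smul]
  abel

theorem gdot_covRd_gQ (hT : IsGWData T) (hE : S.Scalars D) (hθ : S.OddConst θ) {a : ι → A}
    (ha : S.Odd a) (c r : ι → A) (v w : m → A) :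
    gdot (covR T (S.thd θ) (θ • a) v) (covRd T S.del c w)
      + gdot v (covRd T S.del c (covRd T (S.thd θ) (θ • a) w)
        + gdact T (gcurv S T θ a c + kappa T • θ • r) w)
      = S.thd θ (gdot v (covRd T S.del c w)) + kappa T • gdot v (θ • gdact T r w) := by
  rw [thd_gdot hE hθ ha, covRd_comm hT hE hθ ha, gdact_add_smul_smul, map_add, map_add, map_add,
    LinearMap.map_smul]
  abel

/-- The variation of the kinetic density `¾ 𝚿 ∂_𝐁 𝐙 - ¼ 𝐙 ∂_𝐁 𝚿` of a pair of fields; the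
contributions of the superpotential are the terms in `G` and `H`. -/
theorem kinetic_gQ (hT : IsGWData T) (hE : S.Scalars D) (hθ : S.OddConst θ) {a c r : ι → A}
    (ha : S.Odd a) (hc : S.Even c) (hr : S.Odd r) {x y px py : m → A} (hx : S.Even x)
    (hy : S.Even y) (hpx : S.Odd px) (hpy : S.Odd py) (G H : m → A) {x' y' px' py' : m → A}
    {c' : ι → A} (ex : x' = covR T (S.thd θ) (θ • a) x) (ey : y' = covRd T (S.thd θ) (θ • a) y)
    (epx : px' = covRd T (S.thd θ) (θ • a) px - kappa T • θ • G)
    (epy : py' = covR T (S.thd θ) (θ • a) py + kappa T • θ • H)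
    (ec : c' = gcurv S T θ a c + kappa T • θ • r) :
    (3 / 4 : ℂ) • ((gdot px' (covR T S.del c x) + gdot px (covR T S.del c x' + gact T c' x))
        + (gdot py' (covRd T S.del c y) + gdot py (covRd T S.del c y' + gdact T c' y)))
      - (4⁻¹ : ℂ) • ((gdot x' (covRd T S.del c px) + gdot x (covRd T S.del c px' + gdact T c' px))
        + (gdot y' (covR T S.del c py) + gdot y (covR T S.del c py' + gact T c' py)))
    = S.thd θ ((3 / 4 : ℂ) • (gdot px (covR T S.del c x) + gdot py (covRd T S.del c y))
        - (4⁻¹ : ℂ) • (gdot x (covRd T S.del c px) + gdot y (covR T S.del c py)))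
      + kappa T • (θ * ((3 / 4 : ℂ) • (gdot H (covRd T S.del c y) - gdot G (covR T S.del c x))
        + (4⁻¹ : ℂ) • (gdot x (covRd T S.del c G) - gdot y (covR T S.del c H))
        + gdot r (gmom T px x - gmom T y py))) := by
  have k1 := gdot_covR_gQ hT hE hθ ha c r px x
  have k2 := gdot_covRd_gQ hT hE hθ ha c r py y
  have k3 := gdot_covRd_gQ hT hE hθ ha c r x px
  have k4 := gdot_covR_gQ hT hE hθ ha c r y py
  rw [← ec] at k1 k2 k3 k4
  rw [← ex] at k1 k3
  rw [← ey] at k2 k4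
  have sx : ∀ v : m → A, gdot x (θ • v) = θ * gdot x v := fun v =>
    gdot_mul_right (fun i => hθ.comm (hx.apply i)) v
  have sy : ∀ v : m → A, gdot y (θ • v) = θ * gdot y v := fun v =>
    gdot_mul_right (fun i => hθ.comm (hy.apply i)) v
  have spx : gdot px (θ • gact T r x) = θ * gdot r (gmom T px x) := by
    rw [gdot_mul_right_neg (fun i => hθ.anticomm (hpx.apply i)), gdot_gact_odd hr hpx, mul_neg,
      neg_neg]
  have spy : gdot py (θ • gdact T r y) = -(θ * gdot r (gmom T y py)) := by
    rw [gdot_mul_right_neg (fun i => hθ.anticomm (hpy.apply i)), gdot_gdact_odd hr hpy hy]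
  rw [spx] at k1
  rw [spy] at k2
  rw [sx, gdot_gdact_even hx] at k3
  rw [sy, gdot_gact_of_central hy.central] at k4
  rw [epx, epy]
  simp only [map_add, map_sub, LinearMap.map_smul, LinearMap.sub_apply, LinearMap.add_apply,
    LinearMap.smul_apply, gdot_mul_left, cov_mul hE.isDer _ hθ.del (fun i => hθ.comm (hc.apply i)),
    sx, sy, mul_add, mul_sub, mul_smul_comm] at k1 k2 k3 k4 ⊢
  have e : ∀ z, θ * z = LinearMap.mulLeft ℂ θ z := fun _ => rfl
  simp only [e, map_neg] at k1 k2 k3 k4 ⊢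
  linear_combination (norm := module) (3 / 4 : ℂ) • (k1 + k2) - (4⁻¹ : ℂ) • (k3 + k4)

/-- Invariance of the superpotential under the kinetic part of an even symmetry. -/
theorem quartic_kinetic (hT : IsGWData T) (hE : S.Scalars D) {c : ι → A} (hc : S.Even c)
    {X Y : Fin 2 → m → A} (hX : ∀ α, S.Even (X α)) (hY : ∀ α, S.Even (Y α)) :
    ∑ α, ((3 / 4 : ℂ) • (gdot (atri T (Y (partner α)) (X (partner α)) (X α)) (covRd T S.del c (Y α))
          - gdot (dtri T (Y (partner α)) (X (partner α)) (Y α)) (covR T S.del c (X α)))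
        + (4⁻¹ : ℂ) • (gdot (X α)
            (covRd T S.del c (dtri T (Y (partner α)) (X (partner α)) (Y α)))
          - gdot (Y α) (covR T S.del c (atri T (Y (partner α)) (X (partner α)) (X α))))) = 0 := by
  have cX := fun α => even_cov S.par_del (t := fun s a t => T.ρ a s t) hc (hX α)
  have cY := fun α => even_cov S.par_del (t := fun s a t => -T.ρ a t s) hc (hY α)
  have e1 : ∀ α y x x', gdot (atri T y x x') (covRd T S.del c (Y α))
      = quartic T y x (covRd T S.del c (Y α)) x' := fun α y x x' => by
    rw [← gdot_atri (cY α)]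
    exact gdot_comm fun j => ((cY α).central j _).symm
  have e2 : ∀ α (w : m → A), gdot (X α) w = gdot w (X α) := fun α w =>
    gdot_comm fun j => (hX α).central j _
  simp only [Fin.sum_univ_two, partner_zero, partner_one, covRd_dtri hT hE.isDer hc.central,
    covR_atri hT hE.isDer hc.central, e2, map_add, LinearMap.add_apply, e1, gdot_atri (hY _),
    gdot_dtri, quartic_symm hT (hY 0) (hX 0), quartic_symm hT (cY 0) (hX 0),
    quartic_symm hT (hY 0) (cX 0)]
  module

/-- Invariance of the superpotential under rotations. -/
theorem quartic_rot (hT : IsGWData T) {X Y : Fin 2 → m → A} (hX : ∀ α, S.Even (X α))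
    (hY : ∀ α, S.Even (Y α)) (x : AEven E) :
    ∑ α, ∑ β, (rotY x α β • gdot (atri T (Y (partner α)) (X (partner α)) (X α)) (Y β)
      - rotX x α β • gdot (dtri T (Y (partner α)) (X (partner α)) (Y α)) (X β)) = 0 := by
  have e1 : ∀ β (w : m → A), gdot w (Y β) = gdot (Y β) w := fun β w =>
    gdot_comm fun j => ((hY β).central j _).symm
  simp only [Fin.sum_univ_two, partner_zero, partner_one, e1, gdot_atri (hY _), gdot_dtri,
    quartic_right_self hT (hY _) _ (hX _), quartic_left_self hT (hY _),
    quartic_symm hT (hY 0) (hX 0), rotY_one_one]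
  match_scalars
  algebra

/-- The currents of the even symmetries are conserved. -/
theorem ecur'_gQ (hT : IsGWData T) (hE : S.Scalars D) (hθ : S.OddConst θ)
    {φ : FieldIdx ι m → A} (h : S.IsField φ) (x : AEven E) :
    S.ecur' T x φ (S.gQ T θ φ) = S.thd θ (S.ecur T x φ) := by
  have hr := (h.gmu T).graise T
  have k := fun α => kinetic_gQ hT hE hθ h.compA (h.conB T) hr (h.compX α) (h.compY α)
    (h.compPX α) (h.compPY α) _ _ (rfl : fX (S.gQ T θ φ) α = _) (rfl : fY (S.gQ T θ φ) α = _)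
    (fPX_gQ φ α) (fPY_gQ φ α) (conB_gQ hT hθ φ)
  have kX : ∀ α β, gdot (fPX (S.gQ T θ φ) α) (fX φ β) + gdot (fPX φ α) (fX (S.gQ T θ φ) β)
      = S.thd θ (gdot (fPX φ α) (fX φ β)) - kappa T • (θ * gdot (dtri T (fY φ (partner α))
        (fX φ (partner α)) (fY φ α)) (fX φ β)) := fun α β => by
    rw [fPX_gQ, thd_gdot_dual (T := T) hE hθ h.compA, map_sub, LinearMap.sub_apply, LinearMap.map_smul,
      LinearMap.smul_apply, gdot_mul_left, sub_add_eq_add_sub]; rfl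
  have kY : ∀ α β, gdot (fPY (S.gQ T θ φ) α) (fY φ β) + gdot (fPY φ α) (fY (S.gQ T θ φ) β)
      = S.thd θ (gdot (fPY φ α) (fY φ β)) + kappa T • (θ * gdot (atri T (fY φ (partner α))
        (fX φ (partner α)) (fX φ α)) (fY φ β)) := fun α β => by
    rw [fPY_gQ, thd_gdot (T := T) hE hθ h.compA, map_add, LinearMap.add_apply, LinearMap.map_smul,
      LinearMap.smul_apply, gdot_mul_left, add_right_comm]; rfl
  have hsm : ∀ (e : E) a, S.thd θ (e • a) = e • S.thd θ a := fun e a => by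
    rw [(hE.isDer_thd hθ).smul, Derivation.zero_apply, zero_smul, zero_add]
  have hmul : ∀ (e : E) a, θ * (e • a) = e • (θ * a) := fun e a => mul_smul_comm e θ a
  have q1 := congrArg (fun z => x.1 • kappa T • (θ * z))
    (quartic_kinetic hT hE (h.conB T) h.compX h.compY)
  have q2 := congrArg (fun z => kappa T • (θ * z)) (quartic_rot hT h.compX h.compY x)
  have q3 : ∑ α, gdot (graise T (gmu T φ))
      (gmom T (fPX φ α) (fX φ α) - gmom T (fY φ α) (fPY φ α)) = 0 := by
    rw [← map_sum]
    change gdot _ (gmu T φ) = 0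
    have e : gdot (graise T (gmu T φ)) (gmu T φ) = -gdot (gmu T φ) (graise T (gmu T φ)) := by
      simp only [gdot_apply, ← Finset.sum_neg_distrib]
      exact Finset.sum_congr rfl fun a _ => S.odd_anticomm _ _ (hr.apply a) ((h.gmu T).apply a)
    rw [e, gdot_graise_self T hT fun i j => S.odd_anticomm _ _ ((h.gmu T).apply i)
      ((h.gmu T).apply j), neg_zero]
  have q4 := congrArg (fun z => x.1 • kappa T • (θ * z)) q3
  rw [ecur', ecur]
  simp only [k, kX, kY]
  simp only [map_add, map_sum, hsm]
  simp only [Fin.sum_univ_two, mul_add, mul_sub, smul_add, smul_sub, mul_zero, smul_zero, hmul,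
    Algebra.mul_smul_comm] at q1 q2 q4 ⊢
  have e : ∀ z, θ * z = LinearMap.mulLeft ℂ θ z := fun _ => rfl
  simp only [e] at q1 q2 q4 ⊢
  clear hr k kX kY hsm hmul q3
  linear_combination (norm := skip) q1 + q2 + q4
  match_scalars <;> algebra

/-- Invariance of the superpotential under odd symmetries. -/
theorem quartic_odd (hT : IsGWData T) {X Y PX PY : Fin 2 → m → A} (hX : ∀ α, S.Even (X α))
    (hY : ∀ α, S.Even (Y α)) (G : M2 E) :
    ∑ α, ∑ β, (G α β • (quartic T (Y (partner α)) (X (partner α)) (Y α) (PY β)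
        - quartic T (Y (partner β)) (X (partner β)) (PX α) (X β))
      + vee G α β • ∑ γ, (quartic T (PX γ) (X γ) (Y β) (X α)
        - quartic T (Y γ) (PY γ) (Y β) (X α))) = 0 := by
  have r1 : ∀ γ s b t, quartic T (Y b) (X s) (PX γ) (X t) = -quartic T (PX γ) (X s) (Y b) (X t) :=
    fun γ s b t => quartic_skew_left hT (hY b) _ _ _ (.inr (hX s))
  have r2 : ∀ γ b, quartic T (PX γ) (X 1) (Y b) (X 0) = -quartic T (PX γ) (X 0) (Y b) (X 1) :=
    fun γ b => quartic_skew_right hT (hY b) _ (hX 1) _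
  have r4 : ∀ a γ b c, quartic T (Y a) (PY γ) (Y b) (X c) = -quartic T (Y a) (X c) (Y b) (PY γ) :=
    fun a γ b c => by rw [quartic_skew_right hT (hY b) _ (hX c), neg_neg]
  have r5 : ∀ a γ, quartic T (Y 1) (X a) (Y 0) (PY γ) = -quartic T (Y 0) (X a) (Y 1) (PY γ) :=
    fun a γ => quartic_skew_left hT (hY 1) _ _ _ (.inl (hY 0))
  obtain ⟨g₁, g₂, g₃, g₄, s₁, s₂, s₃, s₄, h⟩ := exists_aOdd (G, 0)
  obtain rfl : G = !![g₁, g₂; g₃, g₄] := congrArg Prod.fst h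
  simp only [Fin.sum_univ_two, partner_zero, partner_one, r1, r2, r4, r5,
    quartic_right_self hT (hY _) _ (hX _), quartic_left_self hT (hY _), vee_of,
    Matrix.of_apply, Matrix.cons_val', Matrix.cons_val_zero, Matrix.cons_val_one,
    Matrix.cons_val_fin_one, Matrix.empty_val']
  match_scalars <;> algebra

/-- The currents of the odd symmetries are conserved. -/
theorem ocur'_gQ (hT : IsGWData T) (hE : S.Scalars D) (hθ : S.OddConst θ)
    {φ : FieldIdx ι m → A} (h : S.IsField φ) (u : AOdd E) :
    S.ocur' T u φ (S.gQ T θ φ) = S.thd θ (S.ocur T u φ) := by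
  have kG : ∀ α β, gdot (fPX (S.gQ T θ φ) α) (fPY φ β) + gdot (fPX φ α) (fPY (S.gQ T θ φ) β)
      = S.thd θ (gdot (fPX φ α) (fPY φ β)) + kappa T • (θ *
        (quartic T (fY φ (partner α)) (fX φ (partner α)) (fY φ α) (fPY φ β)
        - quartic T (fY φ (partner β)) (fX φ (partner β)) (fPX φ α) (fX φ β))) := fun α β => by
    rw [fPX_gQ, fPY_gQ, thd_gdot_dual (T := T) hE hθ h.compA, map_sub, LinearMap.sub_apply,
      LinearMap.map_smul, LinearMap.smul_apply, gdot_mul_left, map_add, LinearMap.map_smul,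
      gdot_mul_right_neg (fun i => hθ.anticomm ((h.compPX α).apply i)), gdot_dtri,
      gdot_atri_of_even (h.compY _) (h.compX _), mul_sub, mul_neg, smul_neg, smul_sub, smul_neg]
    abel
  have kS : ∀ α β, gdot (fY (S.gQ T θ φ) β) (fX φ α) + gdot (fY φ β) (fX (S.gQ T θ φ) α)
      = S.thd θ (gdot (fY φ β) (fX φ α)) := fun α β =>
    (thd_gdot_dual (T := T) hE hθ h.compA _ _).symm
  have k1 : ∀ α β, gdot (fX (S.gQ T θ φ) α) (covRd T S.del (conB T (fB φ)) (fY φ β))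
      + gdot (fX φ α) (covRd T S.del (conB T (fB φ)) (fY (S.gQ T θ φ) β)
        + gdact T (conB T (fB (S.gQ T θ φ))) (fY φ β))
      = S.thd θ (gdot (fX φ α) (covRd T S.del (conB T (fB φ)) (fY φ β)))
        - kappa T • (θ * gdot (graise T (gmu T φ)) (gmom T (fY φ β) (fX φ α))) := fun α β => by
    rw [conB_gQ hT hθ]
    refine (gdot_covRd_gQ hT hE hθ h.compA _ _ _ _).trans ?_
    rw [gdot_mul_right (fun i => hθ.comm ((h.compX α).apply i)), gdot_gdact_even (h.compX α),
      mul_neg, smul_neg, sub_eq_add_neg]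
  have k2 : ∀ α β, gdot (fY (S.gQ T θ φ) β) (covR T S.del (conB T (fB φ)) (fX φ α))
      + gdot (fY φ β) (covR T S.del (conB T (fB φ)) (fX (S.gQ T θ φ) α)
        + gact T (conB T (fB (S.gQ T θ φ))) (fX φ α))
      = S.thd θ (gdot (fY φ β) (covR T S.del (conB T (fB φ)) (fX φ α)))
        + kappa T • (θ * gdot (graise T (gmu T φ)) (gmom T (fY φ β) (fX φ α))) := fun α β => by
    rw [conB_gQ hT hθ]
    refine (gdot_covR_gQ hT hE hθ h.compA _ _ _ _).trans ?_
    rw [gdot_mul_right (fun i => hθ.comm ((h.compY β).apply i)),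
      gdot_gact_of_central (h.compY β).central]
  have kr : ∀ α β, gdot (graise T (gmu T φ)) (gmom T (fY φ β) (fX φ α))
      = ∑ γ, (quartic T (fPX φ γ) (fX φ γ) (fY φ β) (fX φ α)
        - quartic T (fY φ γ) (fPY φ γ) (fY φ β) (fX φ α)) := fun α β => by
    rw [gmu, map_sum, map_sum, LinearMap.sum_apply]
    refine Finset.sum_congr rfl fun γ _ => ?_
    rw [map_sub, map_sub]; rfl
  have hsm : ∀ (e : E) a, S.thd θ (e • a) = e • S.thd θ a := fun e a => by
    rw [(hE.isDer_thd hθ).smul, Derivation.zero_apply, zero_smul, zero_add]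
  have q := congrArg (fun z => kappa T • (θ * z))
    (quartic_odd (PX := fPX φ) (PY := fPY φ) hT h.compX h.compY u.1)
  simp only [← kr] at q
  rw [ocur', ocur]
  simp only [kG, kS, k1, k2]
  have e : ∀ z, θ * z = LinearMap.mulLeft ℂ θ z := fun _ => rfl
  have hL : ∀ (e : E) a, LinearMap.mulLeft ℂ θ (e • a) = e • LinearMap.mulLeft ℂ θ a :=
    fun e a => mul_smul_comm e θ a
  clear kG kS k1 k2 kr
  simp only [e, Fin.sum_univ_two, map_add, map_sub, map_zero, smul_zero, hsm, hL,
    LinearMap.map_smul] at q ⊢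
  clear hsm hL e
  linear_combination (norm := skip) q
  match_scalars <;> algebra

end Conservation
end SuperDiff

/-! ### Currents as Hamiltonians -/

namespace SuperDiff

section Pairing

variable {A : Type*} [Ring A] [Algebra ℂ A] (S : SuperDiff A) {ι m : Type*}
  [Fintype ι] [DecidableEq ι] [Fintype m] (T : GaugeData ι m)
  {E : Type*} [CommRing E] [Algebra ℂ E] [Algebra E A] [IsScalarTower ℂ E A]
  {D : Derivation ℂ E E}

/-- The density of the BV symplectic pairing. -/
def gpair (ψ ξ : FieldIdx ι m → A) : A :=
  gdot (fA ψ) (fB ξ) - gdot (fB ψ) (fA ξ)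
  + ∑ α, (gdot (fPX ψ α) (fX ξ α) - gdot (fX ψ α) (fPX ξ α)
    + gdot (fPY ψ α) (fY ξ α) - gdot (fY ψ α) (fPY ξ α))

/-- Total derivatives of elements of compact support. -/
def totalDer : Submodule ℂ A := S.cpt.map S.d ⊔ S.cpt.map S.del

variable {S}

theorem d_mem_totalDer {a : A} (h : a ∈ S.cpt) : S.d a ∈ S.totalDer :=
  Submodule.mem_sup_left (Submodule.mem_map_of_mem h)

theorem del_mem_totalDer {a : A} (h : a ∈ S.cpt) : S.del a ∈ S.totalDer :=
  Submodule.mem_sup_right (Submodule.mem_map_of_mem h)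

theorem gdot_mem_cpt {K : Type*} [Fintype K] (w : K → A) {v : K → A} (h : ∀ i, v i ∈ S.cpt) :
    gdot w v ∈ S.cpt :=
  Submodule.sum_mem _ fun i _ => S.cpt_mul_left _ _ (h i)

theorem smul_mem_cpt (e : E) {a : A} (h : a ∈ S.cpt) : e • a ∈ S.cpt := by
  rw [Algebra.smul_def]; exact S.cpt_mul_left _ _ h

/-- The boundary term in the variation of the current of an even symmetry. -/
def ebdry (x : AEven E) (φ ψ : FieldIdx ι m → A) : A :=
  x.1 • ∑ α, ((3 / 4 : ℂ) • (gdot (fPX φ α) (fX ψ α) + gdot (fPY φ α) (fY ψ α))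
    - (4⁻¹ : ℂ) • (gdot (fX φ α) (fPX ψ α) + gdot (fY φ α) (fPY ψ α)))

/-- The boundary term in the variation of the current of an odd symmetry. -/
def obdry (u : AOdd E) (φ ψ : FieldIdx ι m → A) : A :=
  -(2⁻¹ : ℂ) • ∑ α, ∑ β, vee u.1 α β • (gdot (fX φ α) (fY ψ β) - gdot (fY φ β) (fX ψ α))

variable {φ ψ : FieldIdx ι m → A} {T}

theorem gdot_conB (hT : IsGWData T) {b : ι → A} (hb : S.Even b) (w : ι → A) :
    gdot (conB T b) w = -(kappa T • gdot b (graise T w)) := by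
  rw [conB, LinearMap.map_smul, LinearMap.smul_apply,
    gdot_graise_comm hT fun i j => hb.central i _, neg_smul]
  congr 2
  exact gdot_comm fun j => ((hb.central j _).symm)

theorem gpair_mkF (a b : ι → A) (x y px py : Fin 2 → m → A) : gpair ψ (mkF a b x y px py)
    = gdot (fA ψ) b - gdot (fB ψ) a + ∑ α, (gdot (fPX ψ α) (x α) - gdot (fX ψ α) (px α)
      + gdot (fPY ψ α) (y α) - gdot (fY ψ α) (py α)) := rfl

/-- The even symmetries are generated by their currents. -/
theorem ecur'_sub_gpair (hT : IsGWData T) (hE : S.Scalars D) (h : S.IsField φ)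
    (hψ : S.IsField ψ) (x : AEven E) (τ : A) :
    S.ecur' T x φ ψ - gpair ψ (ptr T D S.del x 0 τ φ) = S.del (ebdry x φ ψ) := by
  have hc := h.conB T
  have hc' := hψ.conB T
  have eX : ∀ α w, gdot (fX ψ α) w = gdot w (fX ψ α) := fun α w =>
    gdot_comm fun j => (hψ.compX α).central j _
  have eY : ∀ α w, gdot (fY ψ α) w = gdot w (fY ψ α) := fun α w =>
    gdot_comm fun j => (hψ.compY α).central j _
  have eX' : ∀ α w, gdot (fX φ α) w = gdot w (fX φ α) := fun α w =>
    gdot_comm fun j => (h.compX α).central j _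
  have eY' : ∀ α w, gdot (fY φ α) w = gdot w (fY φ α) := fun α w =>
    gdot_comm fun j => (h.compY α).central j _
  have n1 : ∀ α, gdot (fPX φ α) (covR T S.del (conB T (fB φ)) (fX ψ α))
      = S.del (gdot (fPX φ α) (fX ψ α))
        - gdot (covRd T S.del (conB T (fB φ)) (fPX φ α)) (fX ψ α) := fun α =>
    eq_sub_of_add_eq' (der_gdot_cov hE.isDer hc.central _ _)
  have n2 : ∀ α, gdot (fPY φ α) (covRd T S.del (conB T (fB φ)) (fY ψ α))
      = S.del (gdot (fPY φ α) (fY ψ α))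
        - gdot (covR T S.del (conB T (fB φ)) (fPY φ α)) (fY ψ α) := fun α =>
    eq_sub_of_add_eq' (der_gdot_cov' hE.isDer hc.central _ _)
  have n3 : ∀ α, gdot (covRd T S.del (conB T (fB φ)) (fPX ψ α)) (fX φ α)
      = S.del (gdot (fPX ψ α) (fX φ α))
        - gdot (fPX ψ α) (covR T S.del (conB T (fB φ)) (fX φ α)) := fun α =>
    eq_sub_of_add_eq (der_gdot_cov hE.isDer hc.central _ _)
  have n4 : ∀ α, gdot (covR T S.del (conB T (fB φ)) (fPY ψ α)) (fY φ α)
      = S.del (gdot (fPY ψ α) (fY φ α))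
        - gdot (fPY ψ α) (covRd T S.del (conB T (fB φ)) (fY φ α)) := fun α =>
    eq_sub_of_add_eq (der_gdot_cov' hE.isDer hc.central _ _)
  have b1 : ∀ α, gdot (fPX φ α) (gact T (conB T (fB ψ)) (fX φ α))
      = gdot (conB T (fB ψ)) (gmom T (fPX φ α) (fX φ α)) := fun α => gdot_gact T hc'.central _ _
  have b2 : ∀ α, gdot (fPY φ α) (gdact T (conB T (fB ψ)) (fY φ α))
      = -gdot (conB T (fB ψ)) (gmom T (fY φ α) (fPY φ α)) := fun α => by
    rw [← gdot_gdact]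
    exact gdot_comm fun j => ((hc'.contract (h.compY α)).central j _).symm
  have b3 : ∀ α, gdot (gdact T (conB T (fB ψ)) (fPX φ α)) (fX φ α)
      = -gdot (conB T (fB ψ)) (gmom T (fPX φ α) (fX φ α)) := fun α => gdot_gdact T _ _
  have b4 : ∀ α, gdot (gact T (conB T (fB ψ)) (fPY φ α)) (fY φ α)
      = gdot (conB T (fB ψ)) (gmom T (fY φ α) (fPY φ α)) := fun α => by
    rw [← eY', gdot_gact T hc'.central]
  have hB : x.1 • gdot (conB T (fB ψ)) (gmu T φ)
      = -(gdot (fB ψ) (kappa T • graise T (x.1 • gmu T φ))) := by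
    rw [gdot_conB hT hψ.compB, LinearMap.map_smul, graise_smul, gdot_smul_right, smul_neg, smul_comm]
  have hsm : ∀ (e : E) a, S.del (e • a) = D e • a + e • S.del a := hE.isDer.smul
  rw [ptr, mtr_even, atr_even, gpair_mkF, sub_eq_iff_eq_add, map_zero, zero_sub, ← hB, ecur',
    ebdry, gmu]
  simp only [map_add, map_sub, n1, n2, b1, b2, wtr, gdot_smul_right, eX, eY, eX', eY',
    LinearMap.add_apply, LinearMap.smul_apply, gdot_smul_left, LinearMap.map_smul, n3, n4, b3, b4, hsm, Fin.sum_univ_two,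
    Matrix.neg_apply, Matrix.transpose_apply]
  match_scalars <;> algebra

/-- The odd symmetries are generated by their currents. -/
theorem ocur'_sub_gpair (hT : IsGWData T) (hE : S.Scalars D) (h : S.IsField φ)
    (hψ : S.IsField ψ) (u : AOdd E) {τ : A} (hτ : S.OddConst τ) :
    τ * S.ocur' T u φ ψ - gpair ψ (ptr T D S.del 0 u τ φ) = S.del (τ * obdry u φ ψ) := by
  have hc := h.conB T
  have hc' := hψ.conB T
  have eX : ∀ α w, gdot (fX ψ α) w = gdot w (fX ψ α) := fun α w =>
    gdot_comm fun j => (hψ.compX α).central j _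
  have eY : ∀ α w, gdot (fY ψ α) w = gdot w (fY ψ α) := fun α w =>
    gdot_comm fun j => (hψ.compY α).central j _
  have eP : ∀ α β, gdot (fPY ψ α) (fPX φ β) = -gdot (fPX φ β) (fPY ψ α) := fun α β =>
    gdot_anticomm fun j => S.odd_anticomm _ _ ((hψ.compPY α).apply j) ((h.compPX β).apply j)
  have n1 : ∀ α β, gdot (fX φ α) (covRd T S.del (conB T (fB φ)) (fY ψ β))
      = S.del (gdot (fX φ α) (fY ψ β))
        - gdot (covR T S.del (conB T (fB φ)) (fX φ α)) (fY ψ β) := fun α β =>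
    eq_sub_of_add_eq' (der_gdot_cov' hE.isDer hc.central _ _)
  have n2 : ∀ α β, gdot (fY φ β) (covR T S.del (conB T (fB φ)) (fX ψ α))
      = S.del (gdot (fY φ β) (fX ψ α))
        - gdot (covRd T S.del (conB T (fB φ)) (fY φ β)) (fX ψ α) := fun α β =>
    eq_sub_of_add_eq' (der_gdot_cov hE.isDer hc.central _ _)
  have b1 : ∀ α β, gdot (fX φ α) (gdact T (conB T (fB ψ)) (fY φ β))
      = -gdot (conB T (fB ψ)) (gmom T (fY φ β) (fX φ α)) := fun α β =>
    gdot_gdact_even (h.compX α) _ _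
  have b2 : ∀ α β, gdot (fY φ β) (gact T (conB T (fB ψ)) (fX φ α))
      = gdot (conB T (fB ψ)) (gmom T (fY φ β) (fX φ α)) := fun α β =>
    gdot_gact_of_central (h.compY β).central _ _
  have pX : ∀ α (v : m → A), gdot (fPX ψ α) (τ • v) = -(τ * gdot (fPX ψ α) v) := fun α =>
    gdot_mul_right_neg fun i => hτ.anticomm ((hψ.compPX α).apply i)
  have pY : ∀ α (v : m → A), gdot (fPY ψ α) (τ • v) = -(τ * gdot (fPY ψ α) v) := fun α =>
    gdot_mul_right_neg fun i => hτ.anticomm ((hψ.compPY α).apply i)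
  have hB : ∑ α, ∑ β, vee u.1 α β • (τ * gdot (conB T (fB ψ)) (gnu T φ α β))
      = -(gdot (fB ψ) (kappa T • graise T (∑ α, ∑ β, vee u.1 α β • (τ • gnu T φ α β)))) := by
    have e : ∀ α β, gdot (fB ψ) (τ • graise T (gnu T φ α β))
        = τ * gdot (fB ψ) (graise T (gnu T φ α β)) := fun α β =>
      gdot_mul_right (fun i => hτ.comm (hψ.compB.apply i)) _
    rw [LinearMap.map_smul]
    simp only [gdot_conB hT hψ.compB, map_sum, graise_smul, graise_mul,
      gdot_smul_right, e, mul_neg, smul_neg, Finset.sum_neg_distrib, Algebra.mul_smul_comm,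
      Finset.smul_sum, smul_comm (kappa T)]
  have hsm : ∀ (e : E) a, S.del (e • a) = D e • a + e • S.del a := hE.isDer.smul
  have hd : S.del (τ * obdry u φ ψ) = τ * S.del (obdry u φ ψ) := by
    rw [S.del_mul, hτ.del, zero_mul, zero_add]
  have e : ∀ z, τ * z = LinearMap.mulLeft ℂ τ z := fun _ => rfl
  have hL : ∀ (e : E) a, LinearMap.mulLeft ℂ τ (e • a) = e • LinearMap.mulLeft ℂ τ a :=
    fun e a => mul_smul_comm e τ a
  rw [ptr, mtr_odd, atr_odd, gpair_mkF, sub_eq_iff_eq_add, map_zero, zero_sub, ← hB, hd, ocur',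
    obdry]
  simp only [map_add, map_sub, n1, n2, b1, b2, xtr, gdot_smul_right, eX, eY, pX, pY, eP,
    cov_mul hE.isDer _ hτ.del (fun i => hτ.comm (hc.apply i)), gdot_mul_left,
    LinearMap.add_apply, LinearMap.sub_apply, LinearMap.neg_apply, LinearMap.smul_apply,
    gdot_smul_left, LinearMap.map_smul, hsm, Fin.sum_univ_two, map_neg, Matrix.neg_apply,
    Matrix.transpose_apply, e, hL, gnu]
  match_scalars <;> algebra

end Pairing
end SuperDiff

/-! ### The action as Hamiltonian of the supercharge -/

namespace SuperDiff

section Action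

variable {A : Type*} [Ring A] [Algebra ℂ A] (S : SuperDiff A) {ι m : Type*}
  [Fintype ι] [DecidableEq ι] [Fintype m] (T : GaugeData ι m)

/-- The Lagrangian density. -/
def glag (φ : FieldIdx ι m → A) : A :=
  gdot (fB φ) (vec S.d (fA φ) + (2⁻¹ : ℂ) • gbrk T (fA φ) (fA φ))
  + (T.k / (4 * (Real.pi : ℂ))) • gdot (fA φ) (glower T (vec S.del (fA φ)))
  + ∑ α, (gdot (fPX φ α) (covR T S.d (fA φ) (fX φ α))
      + gdot (fPY φ α) (covRd T S.d (fA φ) (fY φ α)))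
  + kappa T • gdot (gnu T φ 0 0) (graise T (gnu T φ 1 1))

/-- The derivative of the Lagrangian density. -/
def glag' (φ ψ : FieldIdx ι m → A) : A :=
  (gdot (fB ψ) (vec S.d (fA φ) + (2⁻¹ : ℂ) • gbrk T (fA φ) (fA φ))
    + gdot (fB φ) (vec S.d (fA ψ) + (2⁻¹ : ℂ) • (gbrk T (fA ψ) (fA φ) + gbrk T (fA φ) (fA ψ))))
  + (T.k / (4 * (Real.pi : ℂ))) • (gdot (fA ψ) (glower T (vec S.del (fA φ)))
    + gdot (fA φ) (glower T (vec S.del (fA ψ))))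
  + ∑ α, ((gdot (fPX ψ α) (covR T S.d (fA φ) (fX φ α))
        + gdot (fPX φ α) (covR T S.d (fA φ) (fX ψ α) + gact T (fA ψ) (fX φ α)))
      + (gdot (fPY ψ α) (covRd T S.d (fA φ) (fY φ α))
        + gdot (fPY φ α) (covRd T S.d (fA φ) (fY ψ α) + gdact T (fA ψ) (fY φ α))))
  + kappa T • (gdot (gnu' T φ ψ 0 0) (graise T (gnu T φ 1 1))
    + gdot (gnu T φ 0 0) (graise T (gnu' T φ ψ 1 1)))

theorem hasDirDeriv_glag (φ ψ : FieldIdx ι m → A) :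
    HasDirDeriv (S.glag T) φ ψ (S.glag' T φ ψ) := by
  have hA := (hasDirDeriv_component FieldIdx.A φ ψ)
  have hB := (hasDirDeriv_component FieldIdx.B φ ψ)
  have hX := fun α => (hasDirDeriv_component (FieldIdx.X α) φ ψ)
  have hY := fun α => (hasDirDeriv_component (FieldIdx.Y α) φ ψ)
  have hPX := fun α => (hasDirDeriv_component (FieldIdx.PX α) φ ψ)
  have hPY := fun α => (hasDirDeriv_component (FieldIdx.PY α) φ ψ)
  exact (((hB.gdot ((hA.linear_comp (vec S.d)).add
      ((hA.contract (fun a b c => T.f b c a) hA).const_smul 2⁻¹))).add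
    ((hA.gdot ((hA.linear_comp (vec S.del)).linear_comp (glower T))).const_smul _)).add
    (HasDirDeriv.sum _ fun α =>
      ((hPX α).gdot (hasDirDeriv_cov S.d (fun s a t => T.ρ a s t) hA (hX α))).add
      ((hPY α).gdot (hasDirDeriv_cov S.d (fun s a t => -T.ρ a t s) hA (hY α))))).add
    (((hasDirDeriv_gnu T φ ψ 0 0).gdot
      ((hasDirDeriv_gnu T φ ψ 1 1).linear_comp (graise T))).const_smul _)

/-- The transformation `Q`. -/
def gQ₀ (φ : FieldIdx ι m → A) : FieldIdx ι m → A :=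
  mkF (vec S.d (fA φ) + (2⁻¹ : ℂ) • gbrk T (fA φ) (fA φ))
    (covGd T S.d (fA φ) (fB φ) - gmu T φ
      + (T.k / (2 * (Real.pi : ℂ))) • glower T (vec S.del (fA φ)))
    (fun α => covR T S.d (fA φ) (fX φ α))
    (fun α => covRd T S.d (fA φ) (fY φ α))
    (fun α => covRd T S.d (fA φ) (fPX φ α)
      - kappa T • gdact T (graise T (gnu T φ (partner α) (partner α))) (fY φ α))
    (fun α => covR T S.d (fA φ) (fPY φ α)
      + kappa T • gact T (graise T (gnu T φ (partner α) (partner α))) (fX φ α))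

theorem cov_thd {K J : Type*} [Fintype K] [Fintype J] (t : K → J → K → ℂ) (θ : A) (c : J → A)
    (v : K → A) : cov t (S.thd θ) (θ • c) v = θ • cov t S.d c v := by
  rw [cov_apply, contract_mul_left, cov_apply, smul_add]; rfl

/-- The parameter `θ` factors out of `θ ⊗ Q`. -/
theorem gQ_eq_smul (θ : A) (φ : FieldIdx ι m → A) : S.gQ T θ φ = θ • S.gQ₀ T φ := by
  have e : ∀ a b x y px py, θ • mkF a b x y px py = (mkF (θ • a) (θ • b) (fun α => θ • x α)
      (fun α => θ • y α) (fun α => θ • px α) (fun α => θ • py α) : FieldIdx ι m → A) := by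
    intros; funext i; cases i <;> rfl
  rw [gQ, gQ₀, e]
  simp only [cov_thd, gbrk, gdact, gact, contract_mul_left, smul_add, smul_sub, glower_mul,
    smul_comm θ]
  rfl

variable {S T}

theorem d_gdot {K : Type*} [Fintype K] (w v : K → A) :
    S.d (gdot w v) = gdot (vec S.d w) v + gdot (vec S.par w) (vec S.d v) := by
  simp only [gdot_apply, map_sum, S.d_mul, Finset.sum_add_distrib]
  rfl

variable {φ ψ : FieldIdx ι m → A}

theorem gdot_gcoad {c b v : ι → A} (hc : S.Odd c) (hb : S.Even b) (hv : S.Odd v) :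
    gdot v (gcoad T c b) = gdot b (gbrk T c v) := by
  simp only [gdot_apply, gcoad, gbrk, contract_apply, Finset.mul_sum, mul_smul_comm]
  rw [sum_reverse]
  refine Finset.sum_congr rfl fun k _ => Finset.sum_congr rfl fun j _ =>
    Finset.sum_congr rfl fun i _ => ?_
  rw [hb.central k, ← mul_assoc, S.odd_anticomm _ _ (hv.apply i) (hc.apply j), neg_mul, smul_neg,
    neg_smul, neg_neg]

theorem gbrk_comm_of_odd (hT : IsGWData T) {c v : ι → A} (hc : S.Odd c) (hv : S.Odd v) :
    gbrk T v c = gbrk T c v := by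
  funext a
  simp only [gbrk, contract_apply]
  rw [Finset.sum_comm]
  refine Finset.sum_congr rfl fun i _ => Finset.sum_congr rfl fun j _ => ?_
  rw [S.odd_anticomm _ _ (hv.apply j) (hc.apply i), hT.skew j i a, smul_neg, neg_smul, neg_neg]

theorem gdot_glower_comm (hT : IsGWData T) {v w : ι → A} (hv : S.Odd v) (hw : S.Odd w) :
    gdot w (glower T v) = -gdot v (glower T w) := by
  simp only [gdot_apply, glower_apply, Finset.mul_sum, mul_smul_comm, ← Finset.sum_neg_distrib]
  rw [Finset.sum_comm]
  refine Finset.sum_congr rfl fun i _ => Finset.sum_congr rfl fun j _ => ?_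
  rw [S.odd_anticomm _ _ (hw.apply j) (hv.apply i), hT.K_symm, smul_neg]

theorem gpair_smul (hψ : S.IsField ψ) {θ : A} (hθ : S.OddConst θ) (ξ : FieldIdx ι m → A) :
    gpair ψ (θ • ξ) = -(θ * (gdot (fA ψ) (fB ξ) + gdot (fB ψ) (fA ξ)
      + ∑ α, (gdot (fPX ψ α) (fX ξ α) + gdot (fX ψ α) (fPX ξ α)
        + gdot (fPY ψ α) (fY ξ α) + gdot (fY ψ α) (fPY ξ α)))) := by
  have e1 : gdot (fA ψ) (θ • fB ξ) = _ :=
    gdot_mul_right_neg (fun i => hθ.anticomm (hψ.compA.apply i)) _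
  have e2 : gdot (fB ψ) (θ • fA ξ) = _ := gdot_mul_right (fun i => hθ.comm (hψ.compB.apply i)) _
  have e3 : ∀ α, gdot (fPX ψ α) (θ • fX ξ α) = _ := fun α =>
    gdot_mul_right_neg (fun i => hθ.anticomm ((hψ.compPX α).apply i)) _
  have e4 : ∀ α, gdot (fX ψ α) (θ • fPX ξ α) = _ := fun α =>
    gdot_mul_right (fun i => hθ.comm ((hψ.compX α).apply i)) _
  have e5 : ∀ α, gdot (fPY ψ α) (θ • fY ξ α) = _ := fun α =>
    gdot_mul_right_neg (fun i => hθ.anticomm ((hψ.compPY α).apply i)) _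
  have e6 : ∀ α, gdot (fY ψ α) (θ • fPY ξ α) = _ := fun α =>
    gdot_mul_right (fun i => hθ.comm ((hψ.compY α).apply i)) _
  change gdot (fA ψ) (θ • fB ξ) - gdot (fB ψ) (θ • fA ξ)
    + ∑ α, (gdot (fPX ψ α) (θ • fX ξ α) - gdot (fX ψ α) (θ • fPX ξ α)
    + gdot (fPY ψ α) (θ • fY ξ α) - gdot (fY ψ α) (θ • fPY ξ α)) = _
  simp only [e1, e2, e3, e4, e5, e6, Fin.sum_univ_two, mul_add]
  abel

/-- The first variation of the action. -/
theorem gpair_gQ₀ (hT : IsGWData T) (h : S.IsField φ) (hψ : S.IsField ψ) :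
    gdot (fA ψ) (fB (S.gQ₀ T φ)) + gdot (fB ψ) (fA (S.gQ₀ T φ))
      + ∑ α, (gdot (fPX ψ α) (fX (S.gQ₀ T φ) α) + gdot (fX ψ α) (fPX (S.gQ₀ T φ) α)
        + gdot (fPY ψ α) (fY (S.gQ₀ T φ) α) + gdot (fY ψ α) (fPY (S.gQ₀ T φ) α))
      - S.glag' T φ ψ
    = S.d (∑ α, (gdot (fPX φ α) (fX ψ α) + gdot (fPY φ α) (fY ψ α)) - gdot (fB φ) (fA ψ))
      - (T.k / (4 * (Real.pi : ℂ))) • S.del (gdot (fA φ) (glower T (fA ψ))) := by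
  have hdB : S.Odd (vec S.d (fB φ)) := funext fun i => by
    change S.par (S.d _) = -S.d _
    rw [S.par_d, h.compB.apply i]
  have hr := fun α => (h.gnu T α α).graise T
  have eX : ∀ α w, gdot (fX ψ α) w = gdot w (fX ψ α) := fun α w =>
    gdot_comm fun j => (hψ.compX α).central j _
  have eY : ∀ α w, gdot (fY ψ α) w = gdot w (fY ψ α) := fun α w =>
    gdot_comm fun j => (hψ.compY α).central j _
  have d1 : S.d (gdot (fB φ) (fA ψ)) = gdot (vec S.d (fB φ)) (fA ψ)
      + gdot (fB φ) (vec S.d (fA ψ)) := by rw [d_gdot, h.compB]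
  have d2 : ∀ α, S.d (gdot (fPX φ α) (fX ψ α)) = gdot (vec S.d (fPX φ α)) (fX ψ α)
      - gdot (fPX φ α) (vec S.d (fX ψ α)) := fun α => by
    rw [d_gdot, h.compPX, map_neg, LinearMap.neg_apply, sub_eq_add_neg]
  have d3 : ∀ α, S.d (gdot (fPY φ α) (fY ψ α)) = gdot (vec S.d (fPY φ α)) (fY ψ α)
      - gdot (fPY φ α) (vec S.d (fY ψ α)) := fun α => by
    rw [d_gdot, h.compPY, map_neg, LinearMap.neg_apply, sub_eq_add_neg]
  have d4 : S.del (gdot (fA φ) (glower T (fA ψ))) = -gdot (fA ψ) (glower T (vec S.del (fA φ)))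
      + gdot (fA φ) (glower T (vec S.del (fA ψ))) := by
    rw [← gdot_glower_comm hT hψ.compA (odd_vec S.par_del h.compA), ← vec_glower]
    simp only [gdot_apply, map_sum, S.del_mul, Finset.sum_add_distrib]
    rfl
  have a1 : gdot (fA ψ) (vec S.d (fB φ)) = -gdot (vec S.d (fB φ)) (fA ψ) :=
    gdot_anticomm fun j => S.odd_anticomm _ _ (hψ.compA.apply j) (hdB.apply j)
  have a2 : gdot (fA ψ) (gcoad T (fA φ) (fB φ)) = gdot (fB φ) (gbrk T (fA φ) (fA ψ)) :=
    gdot_gcoad h.compA h.compB hψ.compA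
  have a3 : gbrk T (fA ψ) (fA φ) = gbrk T (fA φ) (fA ψ) := gbrk_comm_of_odd hT h.compA hψ.compA
  have m1 : ∀ {r : ι → A}, S.Odd r → ∀ α (v : m → A), gdot (fPX φ α) (gact T r v)
      = -gdot r (gmom T (fPX φ α) v) := fun hr α v => gdot_gact_odd hr (h.compPX α) v
  have m2 : ∀ {r : ι → A}, S.Odd r → ∀ α {w : m → A}, S.Even w → gdot (fPY φ α) (gdact T r w)
      = gdot r (gmom T w (fPY φ α)) := fun hr α w hw => gdot_gdact_odd hr (h.compPY α) hw
  have m3 : ∀ α (r : ι → A) (w : m → A), gdot (gdact T r w) (fX ψ α) = -gdot r (gmom T w (fX ψ α)) :=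
    fun α _ _ => gdot_gdact T _ _
  have m4 : ∀ α (r : ι → A) (v : m → A), gdot (gact T r v) (fY ψ α) = gdot r (gmom T (fY ψ α) v) := fun α r v => by
    rw [← eY, gdot_gact_of_central (hψ.compY α).central]
  have w1 : gdot (gnu' T φ ψ 0 0) (graise T (gnu T φ 1 1))
      = gdot (graise T (gnu T φ 1 1)) (gnu' T φ ψ 0 0) :=
    gdot_comm fun j => ((hr 1).central j _).symm
  have w2 : gdot (gnu T φ 0 0) (graise T (gnu' T φ ψ 1 1))
      = gdot (graise T (gnu T φ 0 0)) (gnu' T φ ψ 1 1) := by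
    rw [gdot_graise_comm hT fun i _ => (h.gnu T 0 0).central i _]
    exact gdot_comm fun j => (h.gnu T 0 0).central j _
  have c1 : ∀ v, covR T S.d (fA φ) v = vec S.d v + gact T (fA φ) v := fun _ => rfl
  have c2 : ∀ v, covRd T S.d (fA φ) v = vec S.d v + gdact T (fA φ) v := fun _ => rfl
  have c3 : covGd T S.d (fA φ) (fB φ) = vec S.d (fB φ) + gcoad T (fA φ) (fB φ) := rfl
  have qA : fA (S.gQ₀ T φ) = vec S.d (fA φ) + (2⁻¹ : ℂ) • gbrk T (fA φ) (fA φ) := rfl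
  have qB : fB (S.gQ₀ T φ) = covGd T S.d (fA φ) (fB φ) - gmu T φ
      + (T.k / (2 * (Real.pi : ℂ))) • glower T (vec S.del (fA φ)) := rfl
  have qX : ∀ α, fX (S.gQ₀ T φ) α = covR T S.d (fA φ) (fX φ α) := fun _ => rfl
  have qY : ∀ α, fY (S.gQ₀ T φ) α = covRd T S.d (fA φ) (fY φ α) := fun _ => rfl
  have qPX : ∀ α, fPX (S.gQ₀ T φ) α = covRd T S.d (fA φ) (fPX φ α)
      - kappa T • gdact T (graise T (gnu T φ (partner α) (partner α))) (fY φ α) := fun _ => rfl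
  have qPY : ∀ α, fPY (S.gQ₀ T φ) α = covR T S.d (fA φ) (fPY φ α)
      + kappa T • gact T (graise T (gnu T φ (partner α) (partner α))) (fX φ α) := fun _ => rfl
  rw [glag', w1, w2, map_sub, map_sum, d1, d4, a3, qA, qB]
  simp only [gnu', c3, qX, qY, qPX, qPY, gmu]
  simp only [c1, c2, map_add, map_sub, LinearMap.map_smul, Fin.sum_univ_two, partner_zero,
    partner_one, d2, d3, a1, a2, eX, eY, m1 h.compA, m1 hψ.compA,
    m2 h.compA _ (hψ.compY _), m2 hψ.compA _ (h.compY _), m3, m4, LinearMap.add_apply,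
    LinearMap.sub_apply, LinearMap.smul_apply]
  module

/-- `θ ⊗ Q` is the Hamiltonian vector field of the action. -/
theorem glag'_sub_gpair (hT : IsGWData T) (h : S.IsField φ) (hψ : S.IsField ψ) {θ : A}
    (hθ : S.OddConst θ) (hc : ∀ i, ψ i ∈ S.cpt) :
    -(θ * S.glag' T φ ψ) - gpair ψ (S.gQ T θ φ) ∈ S.totalDer := by
  have e : -(θ * S.glag' T φ ψ) - gpair ψ (S.gQ T θ φ)
      = -S.d (θ * (∑ α, (gdot (fPX φ α) (fX ψ α) + gdot (fPY φ α) (fY ψ α)) - gdot (fB φ) (fA ψ)))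
      - (T.k / (4 * (Real.pi : ℂ))) • S.del (θ * gdot (fA φ) (glower T (fA ψ))) := by
    rw [gQ_eq_smul, gpair_smul hψ hθ, sub_neg_eq_add, neg_add_eq_sub, ← mul_sub, gpair_gQ₀ hT h hψ,
      hθ.d_mul, S.del_mul, hθ.del, zero_mul, zero_add, neg_neg, mul_sub, mul_smul_comm]
  have hl : ∀ i, glower T (fA ψ) i ∈ S.cpt := fun i => by
    rw [glower_apply]
    exact Submodule.sum_mem _ fun j _ => Submodule.smul_mem _ _ (hc _)
  rw [e]
  refine Submodule.sub_mem _ (Submodule.neg_mem _ (d_mem_totalDer (S.cpt_mul_left _ _ ?_)))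
    (Submodule.smul_mem _ _ (del_mem_totalDer (S.cpt_mul_left _ _ (gdot_mem_cpt _ hl))))
  exact Submodule.sub_mem _ (Submodule.sum_mem _ fun α _ => Submodule.add_mem _
    (gdot_mem_cpt _ fun i => hc _) (gdot_mem_cpt _ fun i => hc _)) (gdot_mem_cpt _ fun i => hc _)

end Action
end SuperDiff

/-! ### Superfields -/

section TensorModel

variable {F G : Type*} [CommRing F] [Algebra ℂ F] [Ring G] [Algebra ℂ G]

/-- Linear maps that satisfy the Leibniz rule. -/
def IsLeibniz (δ : F →ₗ[ℂ] F) : Prop := ∀ a b, δ (a * b) = δ a * b + a * δ b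

theorem IsLeibniz.add {δ δ' : F →ₗ[ℂ] F} (h : IsLeibniz δ) (h' : IsLeibniz δ') :
    IsLeibniz (δ + δ') := fun a b => by
  simp only [LinearMap.add_apply, h a b, h' a b]; ring

theorem IsLeibniz.smul {δ : F →ₗ[ℂ] F} (h : IsLeibniz δ) (c : ℂ) : IsLeibniz (c • δ) :=
  fun a b => by
  rw [LinearMap.smul_apply, h a b, smul_add, LinearMap.smul_apply, LinearMap.smul_apply,
    smul_mul_assoc, mul_smul_comm]

theorem IsLeibniz.sub {δ δ' : F →ₗ[ℂ] F} (h : IsLeibniz δ) (h' : IsLeibniz δ') :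
    IsLeibniz (δ - δ') := fun a b => by
  simp only [LinearMap.sub_apply, h a b, h' a b]; ring

/-- A parity involution of a supercommutative algebra. -/
structure IsParity (p : G →ₗ[ℂ] G) : Prop where
  one : p 1 = 1
  mul : ∀ a b, p (a * b) = p a * p b
  par_par : ∀ a, p (p a) = a
  even_comm : ∀ a b, p a = a → a * b = b * a
  odd_mul : ∀ a b, p a = -a → a * b = p b * a

/-- The elements of a tensor product with first factors in a given ideal. -/
def tensorIdeal (G : Type*) [Ring G] [Algebra ℂ G] (c : Set F) : Submodule ℂ (F ⊗[ℂ] G) :=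
  Submodule.span ℂ {a | ∃ f η, f ∈ c ∧ a = f ⊗ₜ η}

theorem tensor_mul_induction {P : F ⊗[ℂ] G → F ⊗[ℂ] G → Prop} (a b : F ⊗[ℂ] G)
    (h0 : ∀ a, P a 0) (h0' : ∀ b, P 0 b) (ht : ∀ f η g ζ, P (f ⊗ₜ η) (g ⊗ₜ ζ))
    (hl : ∀ a a' b, P a b → P a' b → P (a + a') b) (hr : ∀ a b b', P a b → P a b' → P a (b + b')) :
    P a b := by
  induction a with
  | zero => exact h0' b
  | add a a' h h' => exact hl _ _ _ h h'
  | tmul f η =>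
    induction b with
    | zero => exact h0 _
    | add b b' h h' => exact hr _ _ _ h h'
    | tmul g ζ => exact ht f η g ζ

variable {p : G →ₗ[ℂ] G}

theorem tensor_even_comm (hp : IsParity p) (a b : F ⊗[ℂ] G) (ha : TensorProduct.map LinearMap.id p a = a) :
    a * b = b * a := by
  have key : (a + TensorProduct.map LinearMap.id p a) * b
      = b * (a + TensorProduct.map LinearMap.id p a) := by
    refine tensor_mul_induction (P := fun a b => (a + TensorProduct.map LinearMap.id p a) * b
      = b * (a + TensorProduct.map LinearMap.id p a)) a b ?_ ?_ ?_ ?_ ?_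
    · intro a; rw [mul_zero, zero_mul]
    · intro b; rw [map_zero, add_zero, mul_zero, zero_mul]
    · intro f η g ζ
      rw [TensorProduct.map_tmul, LinearMap.id_apply, ← TensorProduct.tmul_add,
        Algebra.TensorProduct.tmul_mul_tmul, Algebra.TensorProduct.tmul_mul_tmul, mul_comm f,
        hp.even_comm (η + p η) ζ (by rw [map_add, hp.par_par, add_comm])]
    · intro a a' b h h'
      rw [map_add, add_add_add_comm, add_mul, mul_add, h, h']
    · intro a b b' h h'
      rw [mul_add _ b b', add_mul b b', h, h']
  rw [ha, ← two_smul ℂ a, smul_mul_assoc, mul_smul_comm] at key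
  exact smul_right_injective _ (two_ne_zero (α := ℂ)) key

theorem tensor_odd_anticomm (hp : IsParity p) (a b : F ⊗[ℂ] G) (ha : TensorProduct.map LinearMap.id p a = -a)
    (hb : TensorProduct.map LinearMap.id p b = -b) : a * b = -(b * a) := by
  have key : (a - TensorProduct.map LinearMap.id p a) * (b - TensorProduct.map LinearMap.id p b)
      = -((b - TensorProduct.map LinearMap.id p b)
        * (a - TensorProduct.map LinearMap.id p a)) := by
    refine tensor_mul_induction (P := fun a b => (a - TensorProduct.map LinearMap.id p a)
      * (b - TensorProduct.map LinearMap.id p b) = -((b - TensorProduct.map LinearMap.id p b)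
        * (a - TensorProduct.map LinearMap.id p a))) a b ?_ ?_ ?_ ?_ ?_
    · intro a; rw [map_zero, sub_zero, mul_zero, zero_mul, neg_zero]
    · intro b; rw [map_zero, sub_zero, mul_zero, zero_mul, neg_zero]
    · intro f η g ζ
      rw [TensorProduct.map_tmul, TensorProduct.map_tmul, LinearMap.id_apply, LinearMap.id_apply,
        ← TensorProduct.tmul_sub, ← TensorProduct.tmul_sub,
        Algebra.TensorProduct.tmul_mul_tmul, Algebra.TensorProduct.tmul_mul_tmul, mul_comm f,
        hp.odd_mul (η - p η) (ζ - p ζ) (by rw [map_sub, hp.par_par, neg_sub]), map_sub, hp.par_par,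
        ← neg_sub ζ, neg_mul, TensorProduct.tmul_neg]
    · intro a a' b h h'
      rw [map_add, add_sub_add_comm, add_mul, mul_add, h, h', neg_add]
    · intro a b b' h h'
      rw [map_add, add_sub_add_comm, mul_add, add_mul, h, h', neg_add]
  rw [ha, hb, sub_neg_eq_add, sub_neg_eq_add, ← two_smul ℂ a, ← two_smul ℂ b, smul_mul_smul_comm,
    smul_mul_smul_comm, ← smul_neg] at key
  exact smul_right_injective _ (mul_ne_zero (two_ne_zero (α := ℂ)) two_ne_zero) key

theorem tensor_leibniz (hp : IsParity p) {δ : F →ₗ[ℂ] F} (hδ : IsLeibniz δ) {x : G} (hx : p x = -x)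
    (a b : F ⊗[ℂ] G) : TensorProduct.map δ (LinearMap.mulLeft ℂ x) (a * b)
      = TensorProduct.map δ (LinearMap.mulLeft ℂ x) a * b
        + TensorProduct.map LinearMap.id p a * TensorProduct.map δ (LinearMap.mulLeft ℂ x) b := by
  refine tensor_mul_induction (P := fun a b => TensorProduct.map δ (LinearMap.mulLeft ℂ x) (a * b)
      = TensorProduct.map δ (LinearMap.mulLeft ℂ x) a * b
        + TensorProduct.map LinearMap.id p a * TensorProduct.map δ (LinearMap.mulLeft ℂ x) b)
      a b ?_ ?_ ?_ ?_ ?_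
  · intro a; simp only [mul_zero, map_zero, add_zero]
  · intro b; simp only [zero_mul, map_zero, add_zero]
  · intro f η g ζ
    simp only [Algebra.TensorProduct.tmul_mul_tmul, TensorProduct.map_tmul, hδ f g,
      LinearMap.mulLeft_apply, LinearMap.id_apply, TensorProduct.add_tmul, ← mul_assoc]
    rw [hp.odd_mul x η hx]
  · intro a a' b h h'
    simp only [add_mul, map_add, h, h']
    abel
  · intro a b b' h h'
    simp only [mul_add, map_add, h, h']
    abel

theorem tensor_map_leibniz {δ : F →ₗ[ℂ] F} (hδ : IsLeibniz δ) (a b : F ⊗[ℂ] G) :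
    TensorProduct.map δ LinearMap.id (a * b) = TensorProduct.map δ LinearMap.id a * b
      + a * TensorProduct.map δ (LinearMap.id : G →ₗ[ℂ] G) b := by
  refine tensor_mul_induction (P := fun a b => TensorProduct.map δ LinearMap.id (a * b)
      = TensorProduct.map δ LinearMap.id a * b
        + a * TensorProduct.map δ (LinearMap.id : G →ₗ[ℂ] G) b) a b ?_ ?_ ?_ ?_ ?_
  · intro a; simp only [mul_zero, map_zero, add_zero]
  · intro b; simp only [zero_mul, map_zero, add_zero]
  · intro f η g ζ
    simp only [Algebra.TensorProduct.tmul_mul_tmul, TensorProduct.map_tmul, hδ f g,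
      LinearMap.id_apply, TensorProduct.add_tmul]
  · intro a a' b h h'
    simp only [add_mul, map_add, h, h']
    abel
  · intro a b b' h h'
    simp only [mul_add, map_add, h, h']
    abel

theorem tensor_par_mul (hp : IsParity p) (a b : F ⊗[ℂ] G) : TensorProduct.map LinearMap.id p (a * b)
    = TensorProduct.map LinearMap.id p a * TensorProduct.map LinearMap.id p b := by
  refine tensor_mul_induction (P := fun a b => TensorProduct.map LinearMap.id p (a * b)
    = TensorProduct.map LinearMap.id p a * TensorProduct.map LinearMap.id p b) a b ?_ ?_ ?_ ?_ ?_
  · intro a; simp only [mul_zero, map_zero]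
  · intro b; simp only [zero_mul, map_zero]
  · intro f η g ζ
    simp only [Algebra.TensorProduct.tmul_mul_tmul, TensorProduct.map_tmul, hp.mul,
      LinearMap.id_apply]
  · intro a a' b h h'
    simp only [add_mul, map_add, h, h']
  · intro a b b' h h'
    simp only [mul_add, map_add, h, h']

theorem mul_mem_tensorIdeal {c : Set F} (hc : ∀ f g, g ∈ c → f * g ∈ c) (a : F ⊗[ℂ] G)
    {b : F ⊗[ℂ] G} (hb : b ∈ tensorIdeal G c) : a * b ∈ tensorIdeal G c := by
  induction hb using Submodule.span_induction with
  | zero => rw [mul_zero]; exact Submodule.zero_mem _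
  | add b b' _ _ h h' => rw [mul_add]; exact Submodule.add_mem _ h h'
  | smul z b _ h => rw [mul_smul_comm]; exact Submodule.smul_mem _ _ h
  | mem b h =>
    obtain ⟨g, ζ, hg, rfl⟩ := h
    induction a with
    | zero => rw [zero_mul]; exact Submodule.zero_mem _
    | add b b' h h' => rw [add_mul]; exact Submodule.add_mem _ h h'
    | tmul f η =>
      rw [Algebra.TensorProduct.tmul_mul_tmul]
      exact Submodule.subset_span ⟨_, _, hc f g hg, rfl⟩

/-- The algebra of superfields built from an algebra of functions with three commuting derivations
and from a supercommutative algebra with two odd elements `x`, `y`; the odd differential is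
`x δ₁ + y δ₂`. -/
def tensorSuperDiff (hp : IsParity p) {x y : G} (hx : p x = -x) (hy : p y = -y) {δ δ₁ δ₂ : F →ₗ[ℂ] F}
    (hδ : IsLeibniz δ) (hδ₁ : IsLeibniz δ₁) (hδ₂ : IsLeibniz δ₂) (h₁ : ∀ f, δ₁ (δ f) = δ (δ₁ f))
    (h₂ : ∀ f, δ₂ (δ f) = δ (δ₂ f)) (h₁₂ : ∀ f, δ₁ (δ₂ f) = δ₂ (δ₁ f)) {c : Set F}
    (hc : ∀ f g, g ∈ c → f * g ∈ c) : SuperDiff (F ⊗[ℂ] G) where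
  par := TensorProduct.map LinearMap.id p
  d := TensorProduct.map δ₁ (LinearMap.mulLeft ℂ x) + TensorProduct.map δ₂ (LinearMap.mulLeft ℂ y)
  del := TensorProduct.map δ LinearMap.id
  cpt := tensorIdeal G c
  par_one := by
    rw [Algebra.TensorProduct.one_def, TensorProduct.map_tmul, hp.one, LinearMap.id_apply]
  par_mul := tensor_par_mul hp
  par_par a := by
    induction a with
    | zero => simp only [map_zero]
    | add a b h h' => simp only [map_add, h, h']
    | tmul f η => simp only [TensorProduct.map_tmul, LinearMap.id_apply, hp.par_par]
  even_comm := tensor_even_comm hp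
  odd_anticomm := tensor_odd_anticomm hp
  d_mul a b := by
    simp only [LinearMap.add_apply, tensor_leibniz hp hδ₁ hx, tensor_leibniz hp hδ₂ hy, add_mul,
      mul_add]
    abel
  del_mul := tensor_map_leibniz hδ
  par_d a := by
    induction a with
    | zero => simp only [map_zero, neg_zero]
    | add a b h h' => rw [map_add, map_add, h, h', map_add, map_add, neg_add]
    | tmul f η =>
      simp only [TensorProduct.map_tmul, LinearMap.add_apply, map_add, LinearMap.id_apply,
        LinearMap.mulLeft_apply, hp.mul, hx, hy, neg_mul, TensorProduct.tmul_neg, neg_add]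
  par_del a := by
    induction a with
    | zero => simp only [map_zero]
    | add a b h h' => simp only [map_add, h, h']
    | tmul f η => simp only [TensorProduct.map_tmul, LinearMap.id_apply]
  d_d a := by
    have sq : ∀ {x : G}, p x = -x → x * x = 0 := fun {x} hx => by
      have h := hp.odd_mul x x hx
      rw [hx, neg_mul] at h
      have h2 : (2 : ℂ) • (x * x) = 0 := by rw [two_smul]; nth_rewrite 1 [h]; exact neg_add_cancel _
      exact (smul_eq_zero.mp h2).resolve_left two_ne_zero
    induction a with
    | zero => simp only [map_zero]
    | add a b h h' => rw [map_add, map_add, h, h', add_zero]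
    | tmul f η =>
      simp only [TensorProduct.map_tmul, LinearMap.add_apply, map_add, LinearMap.mulLeft_apply,
        ← mul_assoc, sq hx, sq hy, zero_mul, TensorProduct.tmul_zero, h₁₂, hp.odd_mul x y hx, hy,
        neg_mul, TensorProduct.tmul_neg]
      abel
  d_del a := by
    induction a with
    | zero => simp only [map_zero]
    | add a b h h' => rw [map_add, map_add, h, h', map_add, map_add]
    | tmul f η =>
      simp only [TensorProduct.map_tmul, LinearMap.add_apply, map_add, LinearMap.id_apply, h₁, h₂]
  cpt_mul_left a b hb := mul_mem_tensorIdeal hc a hb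

end TensorModel

section Superfields

/-- A generator of the Grassmann algebra commutes past any element up to the parity involution. -/
theorem ι_mul_grass {N : ℕ} (v : Fin 2 ⊕ Fin N → ℂ) (a : Grass N) :
    ExteriorAlgebra.ι ℂ v * a = CliffordAlgebra.involute a * ExteriorAlgebra.ι ℂ v := by
  induction a using ExteriorAlgebra.induction with
  | algebraMap r => rw [AlgHom.commutes]; exact (Algebra.commutes r _).symm
  | ι w =>
    have : CliffordAlgebra.involute (ExteriorAlgebra.ι ℂ w) = -ExteriorAlgebra.ι ℂ w :=
      CliffordAlgebra.involute_ι _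
    rw [this, neg_mul, eq_neg_iff_add_eq_zero, ExteriorAlgebra.ι_add_mul_swap]
  | mul a b ha hb => rw [← mul_assoc, ha, mul_assoc, hb, map_mul, mul_assoc]
  | add a b ha hb => rw [mul_add, ha, hb, map_add, add_mul]

/-- The grading of the Grassmann algebra is supercommutative. -/
theorem isParity_involute (N : ℕ) : IsParity (CliffordAlgebra.involute
    (Q := (0 : QuadraticForm ℂ (Fin 2 ⊕ Fin N → ℂ)))).toLinearMap where
  one := map_one CliffordAlgebra.involute
  mul := map_mul CliffordAlgebra.involute
  par_par := CliffordAlgebra.involute_involute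
  even_comm a b ha := by
    change CliffordAlgebra.involute a = a at ha
    induction b using ExteriorAlgebra.induction with
    | algebraMap r => exact (Algebra.commutes r a).symm
    | ι v => exact ((ι_mul_grass v a).trans (by rw [ha])).symm
    | mul b c hb hc => rw [← mul_assoc, hb, mul_assoc, hc, mul_assoc]
    | add b c hb hc => rw [mul_add, add_mul, hb, hc]
  odd_mul a b ha := by
    change CliffordAlgebra.involute a = -a at ha
    change _ = CliffordAlgebra.involute b * a
    induction b using ExteriorAlgebra.induction with
    | algebraMap r => rw [AlgHom.commutes]; exact (Algebra.commutes r a).symm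
    | ι v =>
      have h : CliffordAlgebra.involute (ExteriorAlgebra.ι ℂ v) = -ExteriorAlgebra.ι ℂ v :=
        CliffordAlgebra.involute_ι _
      rw [h, neg_mul, ι_mul_grass, ha, neg_mul, neg_neg]
    | mul b c hb hc => rw [← mul_assoc, hb, mul_assoc, hc, map_mul, mul_assoc]
    | add b c hb hc => rw [mul_add, map_add, add_mul, hb, hc]

theorem isLeibniz_dirD (v : ℂ × ℝ) : IsLeibniz (dirD v) := fun f g => Subtype.ext (funext fun p => by
  change fderiv ℝ ((f : ℂ × ℝ → ℂ) * (g : ℂ × ℝ → ℂ)) p v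
    = fderiv ℝ (f : ℂ × ℝ → ℂ) p v * (g : ℂ × ℝ → ℂ) p
      + (f : ℂ × ℝ → ℂ) p * fderiv ℝ (g : ℂ × ℝ → ℂ) p v
  rw [fderiv_mul (smoothFun_differentiableAt f p) (smoothFun_differentiableAt g p)]
  simp only [_root_.add_apply, _root_.smul_apply, smul_eq_mul]
  ring)

theorem dirD_comm (v w : ℂ × ℝ) (f : SmoothFun) : dirD v (dirD w f) = dirD w (dirD v f) :=
  Subtype.ext (funext fun p => by
    have hf := smoothFun_contDiff f
    have hd : DifferentiableAt ℝ (fderiv ℝ (f : ℂ × ℝ → ℂ)) p :=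
      ((hf.fderiv_right (m := 1) (by norm_cast)).differentiable (by simp)) p
    have h : ∀ v w, fderiv ℝ (fun q => fderiv ℝ (f : ℂ × ℝ → ℂ) q w) p v
        = fderiv ℝ (fderiv ℝ (f : ℂ × ℝ → ℂ)) p v w := fun v w => by
      rw [fderiv_clm_apply hd (differentiableAt_const _)]
      simp
    change fderiv ℝ (fun q => fderiv ℝ (f : ℂ × ℝ → ℂ) q w) p v
      = fderiv ℝ (fun q => fderiv ℝ (f : ℂ × ℝ → ℂ) q v) p w
    rw [h, h]
    exact (hf.contDiffAt.isSymmSndFDerivAt (by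
      rw [minSmoothness_of_isRCLikeNormedField]; exact WithTop.coe_le_coe.mpr le_top)) v w)

theorem isLeibniz_derZ : IsLeibniz derZ :=
  ((isLeibniz_dirD _).sub ((isLeibniz_dirD _).smul _)).smul _

theorem isLeibniz_derZbar : IsLeibniz derZbar :=
  ((isLeibniz_dirD _).add ((isLeibniz_dirD _).smul _)).smul _

theorem derT_derZ (f : SmoothFun) : derT (derZ f) = derZ (derT f) := by
  simp only [derT, derZ, LinearMap.smul_apply, LinearMap.sub_apply, LinearMap.map_smul, map_sub,
    dirD_comm (0, 1)]

theorem derT_derZbar (f : SmoothFun) : derT (derZbar f) = derZbar (derT f) := by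
  simp only [derT, derZbar, LinearMap.smul_apply, LinearMap.add_apply, LinearMap.map_smul, map_add,
    dirD_comm (0, 1)]

theorem derZbar_derZ (f : SmoothFun) : derZbar (derZ f) = derZ (derZbar f) := by
  simp only [derZ, derZbar, LinearMap.smul_apply, LinearMap.add_apply, LinearMap.sub_apply,
    LinearMap.map_smul, map_add, map_sub, dirD_comm (1, 0) (Complex.I, 0)]
  module

/-- The algebra of superfields on `ℂ × ℝ`. -/
def supDiff (N : ℕ) : SuperDiff (Sup N) :=
  tensorSuperDiff (isParity_involute N) (x := dt N) (y := dzbar N)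
    (CliffordAlgebra.involute_ι _) (CliffordAlgebra.involute_ι _)
    isLeibniz_derZ (isLeibniz_dirD _ : IsLeibniz derT) isLeibniz_derZbar derT_derZ derZbar_derZ
    derT_derZbar (c := {f | HasCompactSupport (f : ℂ × ℝ → ℂ)}) fun _ _ hg => HasCompactSupport.mul_left hg

end Superfields

/-! ### Comparison in coordinates -/

/-- Parameters of an infinitesimal symmetry, with values in an algebra. -/
structure GParams (A : Type*) where
  /-- vector field -/
  V : A
  /-- `𝔰𝔩(2)₊` -/
  S : M2 A
  /-- `𝔰𝔩(2)₋` -/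
  St : M2 A
  /-- `𝔤𝔩(1)` -/
  U : A
  /-- `K^{-1/2}` -/
  G : M2 A
  /-- `K^{1/2}` -/
  Sg : M2 A

namespace SuperDiff

section Coordinates

variable {A : Type*} [Ring A] [Algebra ℂ A] (S : SuperDiff A) {ι m : Type*}
  [Fintype ι] [DecidableEq ι] [Fintype m] (T : GaugeData ι m)

/-- The action of `𝔤` on `R^*`, in coordinates. -/
def cdact (c : ι → A) (w : m → A) : m → A := fun s => -∑ a, ∑ t, T.ρ a t s • (c a * w t)

/-- The moment map `μ`, in coordinates. -/
def cmu (φ : FieldIdx ι m → A) : ι → A :=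
  fun a => ∑ α, ∑ s, ∑ t, T.ρ a s t •
    (φ (.PX α s) * φ (.X α t) - φ (.Y α s) * φ (.PY α t))

/-- `∂_𝐁` on `R`-valued superfields, in coordinates. -/
def cdelB (φ : FieldIdx ι m → A) (v : m → A) (s : m) : A :=
  S.del (v s) - kappa T • gact T (graise T fun a => φ (.B a)) v s

/-- `∂_𝐁` on `R^*`-valued superfields, in coordinates. -/
def cdelBd (φ : FieldIdx ι m → A) (w : m → A) (s : m) : A :=
  S.del (w s) - kappa T • cdact T (graise T fun a => φ (.B a)) w s

/-- `d'_𝐀` on `R`-valued superfields, in coordinates. -/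
def cdA (φ : FieldIdx ι m → A) (v : m → A) (s : m) : A :=
  S.d (v s) + gact T (fun a => φ (.A a)) v s

/-- `d'_𝐀` on `R^*`-valued superfields, in coordinates. -/
def cdAd (φ : FieldIdx ι m → A) (w : m → A) (s : m) : A :=
  S.d (w s) + cdact T (fun a => φ (.A a)) w s

/-- The curvature, in coordinates. -/
def ccurv (φ : FieldIdx ι m → A) (a : ι) : A :=
  S.d (φ (.A a)) + (2⁻¹ : ℂ) • ∑ b, ∑ c, T.f b c a • (φ (.A b) * φ (.A c))

/-- The supercharge, in coordinates. -/
def cQ (φ : FieldIdx ι m → A) : FieldIdx ι m → A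
  | .A a => S.ccurv T φ a
  | .B a => S.d (φ (.B a)) - ∑ b, ∑ c, T.f b a c • (φ (.A b) * φ (.B c))
      - cmu T φ a + (T.k / (2 * (Real.pi : ℂ))) • ∑ b, T.K a b • S.del (φ (.A b))
  | .X α s => S.cdA T φ (fun t => φ (.X α t)) s
  | .Y α s => S.cdAd T φ (fun t => φ (.Y α t)) s
  | .PX α s => S.cdAd T φ (fun t => φ (.PX α t)) s
      - kappa T • cdact T (graise T (gnu T φ (partner α) (partner α))) (fun t => φ (.Y α t)) s
  | .PY α s => S.cdA T φ (fun t => φ (.PY α t)) s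
      + kappa T • gact T (graise T (gnu T φ (partner α) (partner α))) (fun t => φ (.X α t)) s

/-- The Lagrangian density, in coordinates. -/
def clag (φ : FieldIdx ι m → A) : A :=
  ∑ a, φ (.B a) * S.ccurv T φ a
  + (T.k / (4 * (Real.pi : ℂ))) • ∑ a, ∑ b, T.K a b • (φ (.A a) * S.del (φ (.A b)))
  + ∑ α, ∑ s, (φ (.PX α s) * S.cdA T φ (fun t => φ (.X α t)) s
      + φ (.PY α s) * S.cdAd T φ (fun t => φ (.Y α t)) s)
  + kappa T • ∑ a, gnu T φ 0 0 a * graise T (gnu T φ 1 1) a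

/-- The densities of the currents, in coordinates. -/
def ccur (p : GParams A) (φ : FieldIdx ι m → A) : A :=
  ∑ s, (
    ∑ α, (p.V * ((3 / 4 : ℂ) • (φ (.PX α s) * S.cdelB T φ (fun t => φ (.X α t)) s
            + φ (.PY α s) * S.cdelBd T φ (fun t => φ (.Y α t)) s)
          - (4⁻¹ : ℂ) • (φ (.X α s) * S.cdelBd T φ (fun t => φ (.PX α t)) s
            + φ (.Y α s) * S.cdelB T φ (fun t => φ (.PY α t)) s))
        + p.U * (φ (.PX α s) * φ (.X α s) - φ (.PY α s) * φ (.Y α s)))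
    + ∑ α, ∑ β, (p.S α β * (φ (.PX α s) * φ (.X β s))
        + p.St α β * (φ (.PY α s) * φ (.Y β s))
        + p.G α β * (φ (.PX α s) * φ (.PY β s))
        - (2⁻¹ : ℂ) • (vee p.G α β *
            (φ (.X α s) * S.cdelBd T φ (fun t => φ (.Y β t)) s
              - φ (.Y β s) * S.cdelB T φ (fun t => φ (.X α t)) s))
        + p.Sg α β * (φ (.Y β s) * φ (.X α s))))

/-- The symmetry transformations, in coordinates. -/
def ctr (p : GParams A) (φ : FieldIdx ι m → A) : FieldIdx ι m → A
  | .A a => kappa T • graise T (fun b => p.V * cmu T φ b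
      + ∑ α, ∑ β, vee p.G α β * gnu T φ α β b) a
  | .B _ => 0
  | .X α s => p.V * S.cdelB T φ (fun t => φ (.X α t)) s + (4⁻¹ : ℂ) • (S.del p.V * φ (.X α s))
      + ∑ β, p.S α β * φ (.X β s) + p.U * φ (.X α s) - ∑ β, p.G α β * φ (.PY β s)
  | .Y α s => p.V * S.cdelBd T φ (fun t => φ (.Y α t)) s + (4⁻¹ : ℂ) • (S.del p.V * φ (.Y α s))
      + ∑ β, p.St α β * φ (.Y β s) - p.U * φ (.Y α s) + ∑ β, p.G β α * φ (.PX β s)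
  | .PX α s => p.V * S.cdelBd T φ (fun t => φ (.PX α t)) s
      + (3 / 4 : ℂ) • (S.del p.V * φ (.PX α s))
      - ∑ β, p.S β α * φ (.PX β s) - p.U * φ (.PX α s)
      + ∑ β, (vee p.G α β * S.cdelBd T φ (fun t => φ (.Y β t)) s
        + (2⁻¹ : ℂ) • (S.del (vee p.G α β) * φ (.Y β s)) - p.Sg α β * φ (.Y β s))
  | .PY α s => p.V * S.cdelB T φ (fun t => φ (.PY α t)) s
      + (3 / 4 : ℂ) • (S.del p.V * φ (.PY α s))
      - ∑ β, p.St β α * φ (.PY β s) + p.U * φ (.PY α s)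
      - ∑ β, (vee p.G β α * S.cdelB T φ (fun t => φ (.X β t)) s
        + (2⁻¹ : ℂ) • (S.del (vee p.G β α) * φ (.X β s)) + p.Sg β α * φ (.X β s))

/-- The density of the BV pairing, in coordinates. -/
def cpair (ψ ξ : FieldIdx ι m → A) : A :=
  ∑ a, (ψ (.A a) * ξ (.B a) - ψ (.B a) * ξ (.A a))
  + ∑ α, ∑ s, (ψ (.PX α s) * ξ (.X α s) - ψ (.X α s) * ξ (.PX α s)
      + ψ (.PY α s) * ξ (.Y α s) - ψ (.Y α s) * ξ (.PY α s))

variable {S T}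

theorem cdact_eq (c : ι → A) (w : m → A) : cdact T c w = gdact T c w := funext fun s => by
  simp only [cdact, gdact, contract_apply, neg_smul, Finset.sum_neg_distrib]

theorem cmu_eq (φ : FieldIdx ι m → A) : cmu T φ = gmu T φ := funext fun a => by
  simp only [cmu, gmu, gmom, Finset.sum_apply, Pi.sub_apply, contract_apply, smul_sub,
    Finset.sum_sub_distrib]

theorem cdelB_eq (φ : FieldIdx ι m → A) (v : m → A) :
    S.cdelB T φ v = covR T S.del (conB T (fB φ)) v := funext fun s => by
  have e : gact T (conB T (fB φ)) v = -kappa T • gact T (graise T (fB φ)) v := by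
    rw [conB, LinearMap.map_smul]; rfl
  change _ = S.del (v s) + gact T (conB T (fB φ)) v s
  rw [e, cdelB, Pi.smul_apply, neg_smul, sub_eq_add_neg]

theorem cdelBd_eq (φ : FieldIdx ι m → A) (v : m → A) :
    S.cdelBd T φ v = covRd T S.del (conB T (fB φ)) v := funext fun s => by
  have e : gdact T (conB T (fB φ)) v = -kappa T • gdact T (graise T (fB φ)) v := by
    rw [conB, LinearMap.map_smul]; rfl
  change _ = S.del (v s) + gdact T (conB T (fB φ)) v s
  rw [e, cdelBd, cdact_eq, Pi.smul_apply, neg_smul, sub_eq_add_neg]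

theorem cdA_eq (φ : FieldIdx ι m → A) (v : m → A) : S.cdA T φ v = covR T S.d (fA φ) v := rfl

theorem cdAd_eq (φ : FieldIdx ι m → A) (v : m → A) : S.cdAd T φ v = covRd T S.d (fA φ) v :=
  funext fun s => by rw [cdAd, cdact_eq]; rfl

theorem ccurv_eq (φ : FieldIdx ι m → A) :
    S.ccurv T φ = vec S.d (fA φ) + (2⁻¹ : ℂ) • gbrk T (fA φ) (fA φ) := rfl

theorem cQ_eq (φ : FieldIdx ι m → A) : S.cQ T φ = S.gQ₀ T φ := by
  funext i
  cases i with
  | A a => rfl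
  | B a =>
    rw [cQ, cmu_eq]
    change _ = S.d (φ (.B a)) + gcoad T (fA φ) (fB φ) a - gmu T φ a + _
    rw [gcoad, contract_apply]
    simp only [neg_smul, Finset.sum_neg_distrib, ← sub_eq_add_neg]
    rfl
  | X α s => rfl
  | Y α s => exact congrFun (cdAd_eq (S := S) (T := T) φ (fY φ α)) s
  | PX α s => rw [cQ, cdAd_eq, cdact_eq]; rfl
  | PY α s => rfl

theorem clag_eq (φ : FieldIdx ι m → A) : S.clag T φ = S.glag T φ := by
  have e : ∑ a, ∑ b, T.K a b • (φ (.A a) * S.del (φ (.A b)))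
      = gdot (fA φ) (glower T (vec S.del (fA φ))) := by
    simp only [gdot_apply, glower_apply, Finset.mul_sum, mul_smul_comm]
    rfl
  rw [clag, glag, e]
  simp only [cdAd_eq, cdA_eq, ccurv_eq, Finset.sum_add_distrib, gdot_apply]

theorem cpair_eq (ψ ξ : FieldIdx ι m → A) : cpair ψ ξ = gpair ψ ξ := by
  simp only [cpair, gpair, gdot_apply, Finset.sum_add_distrib, Finset.sum_sub_distrib]


variable {E : Type*} [CommRing E] [Algebra ℂ E] [Algebra E A] [IsScalarTower ℂ E A]
  {D : Derivation ℂ E E}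

/-- The parameters `x + τ u` in the algebra `A`. -/
structure _root_.HTTwist.GParams.Represents (p : GParams A) (x : AEven E) (u : AOdd E) (τ : A) : Prop where
  V : p.V = algebraMap E A x.1
  S : ∀ α β, p.S α β = algebraMap E A ((x.2.1 : M2 E) α β)
  St : ∀ α β, p.St α β = algebraMap E A ((x.2.2.1 : M2 E) α β)
  U : p.U = algebraMap E A x.2.2.2
  G : ∀ α β, p.G α β = algebraMap E A (u.1 α β) * τ
  Sg : ∀ α β, p.Sg α β = algebraMap E A (u.2 α β) * τ

theorem _root_.HTTwist.GParams.Represents.vee {p : GParams A} {x : AEven E} {u : AOdd E} {τ : A}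
    (h : p.Represents x u τ) (α β : Fin 2) :
    vee p.G α β = algebraMap E A (HTTwist.vee u.1 α β) * τ := by
  have hG : p.G = u.1.map fun e => algebraMap E A e * τ := Matrix.ext fun α β => h.G α β
  obtain ⟨g₁, g₂, g₃, g₄, s₁, s₂, s₃, s₄, rfl⟩ := exists_aOdd u
  rw [hG]
  fin_cases α <;> fin_cases β <;> simp [HTTwist.vee]

theorem rotX_apply (x : AEven E) (α β : Fin 2) :
    rotX x α β = (x.2.1 : M2 E) α β + if α = β then x.2.2.2 else 0 := by
  rw [rotX, Matrix.add_apply, Matrix.smul_apply, Matrix.one_apply, smul_eq_mul, mul_ite, mul_one,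
    mul_zero]

theorem rotY_apply (x : AEven E) (α β : Fin 2) :
    rotY x α β = (x.2.2.1 : M2 E) α β - if α = β then x.2.2.2 else 0 := by
  rw [rotY, Matrix.sub_apply, Matrix.smul_apply, Matrix.one_apply, smul_eq_mul, mul_ite, mul_one,
    mul_zero]

/-- The transformations in coordinates agree with `ptr`, provided that the odd parameter can be moved
through the covariant derivative. -/
theorem ctr_eq_ptr {p : GParams A} {x : AEven E} {u : AOdd E} {τ : A}
    (h : p.Represents x u τ) (hE : S.Scalars D) (hτ : S.del τ = 0) (φ : FieldIdx ι m → A)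
    (hφ : CommWith τ φ) : S.ctr T p φ = ptr T D S.del x u τ φ := by
  have hv : ∀ e : E, S.del (e • τ) = D e • τ := fun e => by
    rw [Algebra.smul_def, S.del_mul, hτ, mul_zero, add_zero, hE.del, Algebra.smul_def]
  have hc : ∀ (t : m → ι → m → ℂ) v, cov t S.del (conB T (fB φ)) (τ • v)
      = τ • cov t S.del (conB T (fB φ)) v := fun t v => cov_mul hE.isDer t hτ (CommWith.conB T hφ) v
  funext i
  cases i with
  | A a =>
    refine congrFun (congrArg (fun w => kappa T • graise T w) (funext fun b => ?_)) a
    simp only [h.V, h.vee, ← Algebra.smul_def, smul_mul_assoc, cmu_eq, atr, Pi.add_apply,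
      Pi.smul_apply, Finset.sum_apply, smul_eq_mul]
  | B a => rfl
  | X α s =>
    change _ = (wtr D (covR T S.del (conB T (fB φ))) 4⁻¹ x.1 (rotX x) (fX φ) α
      - ∑ β, u.1 α β • (τ • fPY φ β)) s
    simp only [ctr, h.V, h.S, h.U, h.G, hE.del, ← Algebra.smul_def, smul_mul_assoc, cdelB_eq, wtr,
      Pi.add_apply, Pi.sub_apply, Pi.smul_apply, Finset.sum_apply, smul_eq_mul, rotX_apply,
      add_smul, Finset.sum_add_distrib, ite_smul, zero_smul, Finset.sum_ite_eq, Finset.mem_univ,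
      if_true, add_assoc]
  | Y α s =>
    change _ = (wtr D (covRd T S.del (conB T (fB φ))) 4⁻¹ x.1 (rotY x) (fY φ) α
      + ∑ β, u.1.transpose α β • (τ • fPX φ β)) s
    simp only [ctr, h.V, h.St, h.U, h.G, hE.del, ← Algebra.smul_def, smul_mul_assoc, cdelBd_eq, wtr,
      Pi.add_apply, Pi.sub_apply, Pi.smul_apply, Finset.sum_apply, smul_eq_mul, rotY_apply,
      sub_smul, Finset.sum_sub_distrib, ite_smul, zero_smul, Finset.sum_ite_eq, Finset.mem_univ,
      if_true, Matrix.transpose_apply, add_sub_assoc]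
  | PX α s =>
    change _ = (wtr D (covRd T S.del (conB T (fB φ))) (3 / 4) x.1 (-(rotX x).transpose) (fPX φ) α
      + xtr D (covRd T S.del (conB T (fB φ))) (HTTwist.vee u.1) u.2 (fun β => τ • fY φ β) α) s
    simp only [ctr, h.V, h.S, h.U, h.vee, h.Sg, hE.del, hv, hc, ← Algebra.smul_def, smul_mul_assoc,
      cdelBd_eq, wtr, xtr,
      Pi.add_apply, Pi.sub_apply, Pi.smul_apply, Finset.sum_apply, smul_eq_mul, rotX_apply,
      Pi.neg_apply, Matrix.neg_apply, neg_smul, add_smul, Finset.sum_add_distrib, Finset.sum_neg_distrib,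
      ite_smul, zero_smul, Finset.sum_ite_eq', Finset.mem_univ, if_true, Matrix.transpose_apply]
    abel
  | PY α s =>
    change _ = (wtr D (covR T S.del (conB T (fB φ))) (3 / 4) x.1 (-(rotY x).transpose) (fPY φ) α
      - xtr D (covR T S.del (conB T (fB φ))) (HTTwist.vee u.1).transpose (-u.2.transpose)
        (fun β => τ • fX φ β) α) s
    simp only [ctr, h.V, h.St, h.U, h.vee, h.Sg, hE.del, hv, hc, ← Algebra.smul_def, smul_mul_assoc,
      cdelB_eq, wtr, xtr,
      Pi.add_apply, Pi.sub_apply, Pi.smul_apply, Finset.sum_apply, smul_eq_mul, rotY_apply,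
      Matrix.neg_apply, neg_smul, sub_smul, Finset.sum_sub_distrib, Finset.sum_add_distrib, sub_neg_eq_add, neg_sub,
      ite_smul, zero_smul, Finset.sum_ite_eq', Finset.mem_univ, if_true, Matrix.transpose_apply]
    abel

theorem ccur_eq {p : GParams A} {x : AEven E} {u : AOdd E} {τ : A}
    (h : p.Represents x u τ) (φ : FieldIdx ι m → A) :
    S.ccur T p φ = S.ecur T x φ + τ * S.ocur T u φ := by
  simp only [ccur, ecur, ocur, h.V, h.S, h.St, h.U, h.G, h.Sg, h.vee, gdot_apply, fX, fY, fPX, fPY,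
    rotX_apply, rotY_apply, cdelB_eq, cdelBd_eq, ← Algebra.smul_def, smul_mul_assoc,
    mul_smul_comm, mul_add, mul_sub, smul_add, smul_sub, add_smul, sub_smul, ite_smul, zero_smul,
    Finset.sum_ite_eq, Finset.mem_univ, if_true, Fin.sum_univ_two,
    Finset.sum_add_distrib, Finset.sum_sub_distrib, ← Finset.smul_sum, ← Finset.mul_sum,
    Fin.isValue]
  match_scalars <;> algebra

end Coordinates
end SuperDiff

section Sup

variable {ι m : Type*} [Fintype ι] [DecidableEq ι] [Fintype m] {N : ℕ} (T : GaugeData ι m)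

/-- Parameters with values in superfields, as parameters with values in an algebra. -/
def Params.toG (p : Params N) : GParams (Sup N) := ⟨p.V, p.S, p.St, p.U, p.G, p.Sg⟩

theorem Q_eq (φ : Fields ι m N) : Q T φ = (supDiff N).cQ T φ := by
  funext i; cases i <;> rfl

theorem lagrangian_eq (φ : Fields ι m N) : lagrangian T φ = (supDiff N).clag T φ := rfl

theorem transf_eq (p : Params N) (φ : Fields ι m N) :
    transf T p φ = (supDiff N).ctr T p.toG φ := by
  funext i; cases i <;> rfl

theorem current_eq (p : Params N) (φ : Fields ι m N) :
    current T p φ = (supDiff N).ccur T p.toG φ := rfl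

theorem pairing_eq (ψ ξ : Fields ι m N) : pairing ψ ξ = SuperDiff.cpair ψ ξ := rfl

end Sup

/-! ### Holomorphic parameters -/

section Naturality

variable {O E : Type*} [CommRing O] [Algebra ℂ O] [CommRing E] [Algebra ℂ E] (j : O →ₐ[ℂ] E)
  {D : Derivation ℂ O O} {D' : Derivation ℂ E E}

/-- Extension of scalars of traceless matrices. -/
def sl2Map (S : SL2 O) : SL2 E :=
  ⟨(S : M2 O).map j, by
    have h := S.2
    rw [LinearMap.mem_ker, Matrix.traceLinearMap_apply] at h ⊢
    rw [← AddMonoidHom.map_trace, h, map_zero]⟩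

/-- Extension of scalars of the even part. -/
def evenMap (x : AEven O) : AEven E := (j x.1, sl2Map j x.2.1, sl2Map j x.2.2.1, j x.2.2.2)

/-- Extension of scalars of the odd part. -/
def oddMap (u : AOdd O) : AOdd E := (u.1.map j, u.2.map j)

theorem map_algHom_of (a b c d : O) : (!![a, b; c, d] : M2 O).map j = !![j a, j b; j c, j d] := by
  ext i k; fin_cases i <;> fin_cases k <;> rfl

theorem sl2Map_sl2mk (a b c : O) : sl2Map j (sl2mk a b c) = sl2mk (j a) (j b) (j c) := by
  refine Subtype.ext ?_
  change (!![a, b; c, -a]).map j = !![j a, j b; j c, -j a]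
  rw [map_algHom_of, map_neg]

theorem escale_sl2mk (e V a b c a₂ b₂ c₂ U : E) :
    escale e (V, sl2mk a b c, sl2mk a₂ b₂ c₂, U)
      = (e * V, sl2mk (e * a) (e * b) (e * c), sl2mk (e * a₂) (e * b₂) (e * c₂), e * U) := by
  have h : ∀ a b c : E, e • (!![a, b; c, -a] : M2 E) = !![e * a, e * b; e * c, -(e * a)] :=
    fun a b c => by rw [m2_smul, smul_neg]; rfl
  refine Prod.ext rfl (Prod.ext (Subtype.ext (h a b c)) (Prod.ext (Subtype.ext (h a₂ b₂ c₂)) rfl))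

variable {j}

theorem aN6_ee_escale_evenMap (hj : ∀ f, D' (j f) = j (D f)) {e e' : E}
    (he : D' e = 0) (he' : D' e' = 0) (x y : AEven O) :
    (aN6 D').ee (escale e (evenMap j x)) (escale e' (evenMap j y))
      = escale (e * e') (evenMap j ((aN6 D).ee x y)) := by
  obtain ⟨V, a, b, c, a₂, b₂, c₂, U, rfl⟩ := exists_aEven x
  obtain ⟨V', a', b', c', a₂', b₂', c₂', U', rfl⟩ := exists_aEven y
  simp only [evenMap, sl2Map_sl2mk, escale_sl2mk, aN6_ee_eq, Derivation.leibniz, he, he', hj,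
    map_add, map_sub, map_mul, map_ofNat, smul_eq_mul, mul_zero, add_zero, Prod.mk.injEq, sl2mk_inj]
  refine ⟨?_, ⟨?_, ?_, ?_⟩, ⟨?_, ?_, ?_⟩, ?_⟩ <;> ring

theorem aN6_eo_escale_evenMap (hj : ∀ f, D' (j f) = j (D f)) {e : E} (he : D' e = 0)
    (x : AEven O) (u : AOdd O) :
    (aN6 D').eo (escale e (evenMap j x)) (oddMap j u)
      = (e • (oddMap j ((aN6 D).eo x u)).1, e • (oddMap j ((aN6 D).eo x u)).2) := by
  obtain ⟨V, a, b, c, a₂, b₂, c₂, U, rfl⟩ := exists_aEven x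
  obtain ⟨g₁, g₂, g₃, g₄, s₁, s₂, s₃, s₄, rfl⟩ := exists_aOdd u
  simp only [evenMap, oddMap, sl2Map_sl2mk, escale_sl2mk, aN6_eo_eq, Derivation.leibniz, he, hj,
    map_add, map_sub, map_mul, map_smul, map_algHom_of, m2_smul, smul_eq_mul, mul_zero, add_zero,
    Prod.mk.injEq, m2_inj]
  refine ⟨⟨?_, ?_, ?_, ?_⟩, ?_, ?_, ?_, ?_⟩ <;> algebra

theorem aN6_oo_oddMap (hj : ∀ f, D' (j f) = j (D f)) (u v : AOdd O) :
    (aN6 D').oo (oddMap j u) (oddMap j v) = evenMap j ((aN6 D).oo u v) := by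
  obtain ⟨g₁, g₂, g₃, g₄, s₁, s₂, s₃, s₄, rfl⟩ := exists_aOdd u
  obtain ⟨h₁, h₂, h₃, h₄, t₁, t₂, t₃, t₄, rfl⟩ := exists_aOdd v
  simp only [evenMap, oddMap, sl2Map_sl2mk, aN6_oo_eq, hj, map_add, map_sub, map_mul, map_smul,
    map_algHom_of]

end Naturality

section ScalarAlgebra

variable {A : Type*} [Ring A] [Algebra ℂ A] (S : SuperDiff A)

/-- The even elements annihilated by `d`. -/
def SuperDiff.scalars : Subalgebra ℂ A where
  carrier := {a | S.par a = a ∧ S.d a = 0}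
  mul_mem' {a b} ha hb := ⟨by rw [S.par_mul, ha.1, hb.1], by
    rw [S.d_mul, ha.2, hb.2, zero_mul, mul_zero, add_zero]⟩
  add_mem' {a b} ha hb := ⟨by rw [map_add, ha.1, hb.1], by rw [map_add, ha.2, hb.2, add_zero]⟩
  algebraMap_mem' c := by
    have h : S.d 1 = 0 := by
      have := S.d_mul 1 1
      rwa [mul_one, S.par_one, mul_one, one_mul, left_eq_add] at this
    rw [Algebra.algebraMap_eq_smul_one]
    exact ⟨by rw [map_smul, S.par_one], by rw [map_smul, h, smul_zero]⟩

/-- The commutative algebra of even elements annihilated by `d`. -/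
def SuperDiff.Scal : Type _ := S.scalars

instance : CommRing S.Scal :=
  { (inferInstance : Ring S.scalars) with
    mul_comm := fun a b => Subtype.ext (S.even_comm a.1 b.1 a.2.1) }

instance : Algebra ℂ S.Scal := (inferInstance : Algebra ℂ S.scalars)

/-- The inclusion of the scalars. -/
def SuperDiff.scalVal : S.Scal →ₐ[ℂ] A := S.scalars.val

instance : Algebra S.Scal A :=
  RingHom.toAlgebra' (S.scalVal : S.Scal →+* A) fun a b => S.even_comm _ b a.2.1

instance : IsScalarTower ℂ S.Scal A := .of_algebraMap_eq fun r => (S.scalVal.commutes r).symm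

/-- The restriction of `del` to the scalars. -/
def SuperDiff.scalDer : Derivation ℂ S.Scal S.Scal where
  toFun a := ⟨S.del a.1, by rw [S.par_del, a.2.1], by rw [S.d_del, a.2.2, map_zero]⟩
  map_add' a b := Subtype.ext (map_add S.del a.1 b.1)
  map_smul' c a := Subtype.ext (map_smul S.del c a.1)
  map_one_eq_zero' := Subtype.ext (by
    have := S.del_mul 1 1
    rwa [mul_one, mul_one, one_mul, left_eq_add] at this)
  leibniz' a b := Subtype.ext (by
    change S.del (a.1 * b.1) = a.1 * S.del b.1 + b.1 * S.del a.1
    rw [S.del_mul, add_comm, S.even_comm b.1 _ b.2.1])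

theorem SuperDiff.scalars_scalDer : S.Scalars S.scalDer :=
  ⟨fun e => e.2.1, fun e => e.2.2, fun _ => rfl⟩

end ScalarAlgebra

section Pullback

/-- A pulled back holomorphic function is complex differentiable in `z` and independent of `t`. -/
theorem dirD_pull (v : ℂ × ℝ) (f : Hol) : dirD v (pull f) = v.1 • pull (holDer f) := by
  refine Subtype.ext (funext fun p => ?_)
  have h : HasFDerivAt (fun q : ℂ × ℝ => (f : ℂ → ℂ) q.1) _ p :=
    ((f.2 p.1).hasDerivAt.hasFDerivAt.restrictScalars ℝ).comp p hasFDerivAt_fst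
  change fderiv ℝ (fun q : ℂ × ℝ => (f : ℂ → ℂ) q.1) p v = v.1 * deriv (f : ℂ → ℂ) p.1
  rw [h.fderiv]
  simp

theorem derT_pull (f : Hol) : derT (pull f) = 0 := by
  rw [derT, dirD_pull, zero_smul]

theorem derZ_pull (f : Hol) : derZ (pull f) = pull (holDer f) := by
  rw [derZ, LinearMap.smul_apply, LinearMap.sub_apply, LinearMap.smul_apply, dirD_pull, dirD_pull,
    smul_smul, Complex.I_mul_I, ← sub_smul, smul_smul]
  norm_num

theorem derZbar_pull (f : Hol) : derZbar (pull f) = 0 := by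
  rw [derZbar, LinearMap.smul_apply, LinearMap.add_apply, LinearMap.smul_apply, dirD_pull,
    dirD_pull, smul_smul, Complex.I_mul_I, ← add_smul, add_neg_cancel, zero_smul, smul_zero]

variable {N : ℕ}

theorem dprime_pull_tmul (f : Hol) (η : Grass N) : dprime N (pull f ⊗ₜ η) = 0 := by
  rw [dprime, LinearMap.add_apply, TensorProduct.map_tmul, TensorProduct.map_tmul, derT_pull,
    derZbar_pull, TensorProduct.zero_tmul, TensorProduct.zero_tmul, add_zero]

theorem del_pull_tmul (f : Hol) (η : Grass N) : del N (pull f ⊗ₜ η) = pull (holDer f) ⊗ₜ η := by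
  rw [del, TensorProduct.map_tmul, derZ_pull, LinearMap.id_apply]

theorem parityInv_pull_tmul {f : Hol} {η : Grass N} (h : GEven η) :
    parityInv (pull f ⊗ₜ η) = pull f ⊗ₜ η := congrArg (pull f ⊗ₜ[ℂ] ·) h

theorem pull_one : pull 1 = 1 := rfl

/-- Holomorphic functions with coefficients in even constants, as scalars. -/
def holScal (f : Hol) (η : Grass N) (h : GEven η) : (supDiff N).Scal :=
  ⟨pull f ⊗ₜ η, parityInv_pull_tmul h, dprime_pull_tmul f η⟩

theorem gEven_one : GEven (1 : Grass N) := map_one _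

variable (N) in
/-- Holomorphic functions as scalars. -/
def holHom : Hol →ₐ[ℂ] (supDiff N).Scal where
  toFun f := holScal f 1 gEven_one
  map_one' := rfl
  map_mul' f g := Subtype.ext (by
    change pull (f * g) ⊗ₜ (1 : Grass N) = pull f ⊗ₜ 1 * pull g ⊗ₜ 1
    rw [Algebra.TensorProduct.tmul_mul_tmul, one_mul]; rfl)
  map_zero' := Subtype.ext (TensorProduct.zero_tmul _ _)
  map_add' f g := Subtype.ext (TensorProduct.add_tmul (pull f) (pull g) 1)
  commutes' c := rfl

theorem scalDer_holHom (f : Hol) : (supDiff N).scalDer (holHom N f) = holHom N (holDer f) :=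
  Subtype.ext (del_pull_tmul f 1)

theorem scalDer_const (η : Grass N) (h : GEven η) : (supDiff N).scalDer (holScal 1 η h) = 0 :=
  Subtype.ext (by
    change del N (pull 1 ⊗ₜ η) = 0
    rw [del_pull_tmul, Derivation.map_one_eq_zero]
    exact TensorProduct.zero_tmul _ _)

theorem holScal_mul_holHom (f : Hol) (η : Grass N) (h : GEven η) :
    holScal 1 η h * holHom N f = holScal f η h := Subtype.ext (by
  change pull 1 ⊗ₜ η * pull f ⊗ₜ 1 = pull f ⊗ₜ η
  rw [Algebra.TensorProduct.tmul_mul_tmul, pull_one, one_mul, mul_one])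

theorem GEven.mul {η η' : Grass N} (h : GEven η) (h' : GEven η') : GEven (η * η') := by
  rw [GEven, map_mul, h, h']

theorem GOdd.mul {θ θ' : Grass N} (h : GOdd θ) (h' : GOdd θ') : GEven (θ * θ') := by
  rw [GEven, map_mul, h, h', neg_mul_neg]

theorem GEven.neg {η : Grass N} (h : GEven η) : GEven (-η) := by rw [GEven, map_neg, h]

theorem oddConst_const {θ : Grass N} (h : GOdd θ) : (supDiff N).OddConst (const θ) where
  odd := (congrArg ((1 : SmoothFun) ⊗ₜ[ℂ] ·) h).trans (TensorProduct.tmul_neg _ _)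
  d := dprime_pull_tmul 1 θ
  del := (del_pull_tmul 1 θ).trans (by
    rw [Derivation.map_one_eq_zero]; exact TensorProduct.zero_tmul _ _)

theorem evenParams_represents (η : Grass N) (h : GEven η) (x : AEven Hol) (τ : Sup N) :
    (evenParams η x).toG.Represents (escale (holScal 1 η h) (evenMap (holHom N) x)) 0 τ where
  V := congrArg Subtype.val (holScal_mul_holHom x.1 η h).symm
  S α β := congrArg Subtype.val (holScal_mul_holHom ((x.2.1 : M2 Hol) α β) η h).symm
  St α β := congrArg Subtype.val (holScal_mul_holHom ((x.2.2.1 : M2 Hol) α β) η h).symm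
  U := congrArg Subtype.val (holScal_mul_holHom x.2.2.2 η h).symm
  G _ _ := (zero_mul τ).symm
  Sg _ _ := (zero_mul τ).symm

theorem pull_tmul_eq (f : Hol) (θ : Grass N) :
    (pull f ⊗ₜ[ℂ] (Complex.I • θ) : Sup N)
      = algebraMap (supDiff N).Scal (Sup N) (holHom N f) * const (Complex.I • θ) := by
  change _ = (pull f ⊗ₜ[ℂ] 1 * 1 ⊗ₜ[ℂ] (Complex.I • θ) : Sup N)
  rw [Algebra.TensorProduct.tmul_mul_tmul, one_mul, mul_one]

theorem oddParams_represents (θ : Grass N) (u : AOdd Hol) :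
    (oddParams θ u).toG.Represents 0 (oddMap (holHom N) u) (const (Complex.I • θ)) :=
  ⟨rfl, fun _ _ => rfl, fun _ _ => rfl, rfl, fun _ _ => pull_tmul_eq _ θ,
    fun _ _ => pull_tmul_eq _ θ⟩

theorem pull_mul_tmul_eq (f : Hol) (η θ : Grass N) (h : GEven η) :
    (pull f ⊗ₜ[ℂ] (Complex.I • (η * θ)) : Sup N)
      = algebraMap (supDiff N).Scal (Sup N) (holScal 1 η h * holHom N f)
        * const (Complex.I • θ) := by
  rw [holScal_mul_holHom]
  change _ = (pull f ⊗ₜ[ℂ] η * 1 ⊗ₜ[ℂ] (Complex.I • θ) : Sup N)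
  rw [Algebra.TensorProduct.tmul_mul_tmul, mul_one, mul_smul_comm]

/-- An even parameter may be moved into the coefficients. -/
theorem oddParams_mul_represents (η θ : Grass N) (h : GEven η) (u : AOdd Hol) :
    (oddParams (η * θ) u).toG.Represents 0 (holScal 1 η h • (oddMap (holHom N) u).1,
      holScal 1 η h • (oddMap (holHom N) u).2) (const (Complex.I • θ)) :=
  ⟨rfl, fun _ _ => rfl, fun _ _ => rfl, rfl, fun _ _ => pull_mul_tmul_eq _ η θ h,
    fun _ _ => pull_mul_tmul_eq _ η θ h⟩

end Pullback

/-! ### The theory and its symmetries -/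

/-- A commutator depends only on the values of the transformations on a class of configurations
which contains the line spanned by any two of its members. -/
theorem IsComm.congr {B : Type*} [AddCommGroup B] [Module ℂ B] {F F' G G' : B → B} {φ ξ : B}
    {P : B → Prop} (hP : ∀ (φ ψ : B) (s : ℂ), P φ → P ψ → P (φ + s • ψ))
    (hF : ∀ φ, P φ → F' φ = F φ) (hG : ∀ φ, P φ → G' φ = G φ) (hφ : P φ) (hFφ : P (F φ))
    (hGφ : P (G φ)) (h : IsComm F G φ ξ) : IsComm F' G' φ ξ := by
  obtain ⟨a, b, ⟨c, hc, hca⟩, ⟨c', hc', hcb⟩, e⟩ := h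
  exact ⟨a, b, ⟨c, fun s => by rw [hG φ hφ, hF _ (hP _ _ s hφ hGφ), hc], hca⟩,
    ⟨c', fun s => by rw [hF φ hφ, hG _ (hP _ _ s hφ hFφ), hc'], hcb⟩, e⟩

theorem HasDirDeriv.const_mul {B A : Type*} [AddCommGroup B] [Module ℂ B] [Ring A] [Algebra ℂ A]
    {F : B → A} {φ ψ : B} {d : A} (h : HasDirDeriv F φ ψ d) (a : A) :
    HasDirDeriv (fun f => a * F f) φ ψ (a * d) := h.linear_comp (LinearMap.mulLeft ℂ a)

section

variable {A : Type*} [Ring A] [Algebra ℂ A] {S : SuperDiff A} {ι m : Type*}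
  [Fintype ι] [DecidableEq ι] [Fintype m] {T : GaugeData ι m}
  {E : Type*} [CommRing E] [Algebra ℂ E] [Algebra E A] [IsScalarTower ℂ E A]
  {φ ψ : FieldIdx ι m → A}

theorem SuperDiff.IsField.add_smul (h : S.IsField φ) (h' : S.IsField ψ) (s : ℂ) :
    S.IsField (φ + s • ψ) := by
  have e : ∀ i, S.par (φ i) = φ i → S.par (ψ i) = ψ i → S.par ((φ + s • ψ) i) = (φ + s • ψ) i :=
    fun i h h' => by
      rw [Pi.add_apply, Pi.smul_apply, map_add, LinearMap.map_smul, h, h']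
  have o : ∀ i, S.par (φ i) = -φ i → S.par (ψ i) = -ψ i →
      S.par ((φ + s • ψ) i) = -(φ + s • ψ) i := fun i h h' => by
    rw [Pi.add_apply, Pi.smul_apply, map_add, LinearMap.map_smul, h, h', smul_neg, neg_add]
  exact ⟨fun a => o _ (h.1 a) (h'.1 a), fun a => e _ (h.2.1 a) (h'.2.1 a),
    fun α s => e _ (h.2.2.1 α s) (h'.2.2.1 α s), fun α s => e _ (h.2.2.2.1 α s) (h'.2.2.2.1 α s),
    fun α s => o _ (h.2.2.2.2.1 α s) (h'.2.2.2.2.1 α s),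
    fun α s => o _ (h.2.2.2.2.2 α s) (h'.2.2.2.2.2 α s)⟩

theorem SuperDiff.ebdry_mem_cpt (hψ : ∀ i, ψ i ∈ S.cpt) (x : AEven E) :
    ebdry x φ ψ ∈ S.cpt :=
  smul_mem_cpt _ (Submodule.sum_mem _ fun _ _ => Submodule.sub_mem _
    (Submodule.smul_mem _ _ (Submodule.add_mem _ (gdot_mem_cpt _ fun _ => hψ _)
      (gdot_mem_cpt _ fun _ => hψ _)))
    (Submodule.smul_mem _ _ (Submodule.add_mem _ (gdot_mem_cpt _ fun _ => hψ _)
      (gdot_mem_cpt _ fun _ => hψ _))))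

theorem SuperDiff.obdry_mem_cpt (hψ : ∀ i, ψ i ∈ S.cpt) (u : AOdd E) :
    obdry u φ ψ ∈ S.cpt :=
  Submodule.smul_mem _ _ (Submodule.sum_mem _ fun _ _ => Submodule.sum_mem _ fun _ _ =>
    smul_mem_cpt _ (Submodule.sub_mem _ (gdot_mem_cpt _ fun _ => hψ _)
      (gdot_mem_cpt _ fun _ => hψ _)))

theorem SuperDiff.ecur_zero : S.ecur T (0 : AEven E) φ = 0 := by
  simp [ecur, rotX, rotY]

theorem SuperDiff.oddConst_zero : S.OddConst 0 := ⟨by simp, map_zero _, map_zero _⟩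

end

section Sup

open SuperDiff

variable {ι m : Type*} [Fintype ι] [DecidableEq ι] [Fintype m] {N : ℕ} {T : GaugeData ι m}

theorem thetaQ_eq (θ : Grass N) : (thetaQ T θ : Fields ι m N → _) = (supDiff N).gQ T (const θ) :=
  funext fun φ => by
    rw [gQ_eq_smul, ← cQ_eq, ← Q_eq]; rfl

theorem IsField.add_smul (φ ψ : Fields ι m N) (s : ℂ) (h : IsField φ) (h' : IsField ψ) :
    IsField (φ + s • ψ) :=
  SuperDiff.IsField.add_smul (S := supDiff N) h h' s

theorem isBVTheory (hT : IsGWData T) : IsBVTheory N T where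
  Q_sq θ θ' φ hθ hθ' h := by
    rw [thetaQ_eq, thetaQ_eq]
    exact isComm_gQ_gQ hT (supDiff N).scalars_scalDer (oddConst_const hθ) (oddConst_const hθ') h
  Q_maps θ φ hθ h := by
    rw [thetaQ_eq]
    exact SuperDiff.IsField.gQ (S := supDiff N) h (oddConst_const hθ)
  Q_hamiltonian θ hθ φ ψ h hψ hc := by
    have hL : (fun φ : Fields ι m N => -(const θ * lagrangian T φ))
        = fun φ => -(const θ * (supDiff N).glag T φ) := funext fun φ => by
      rw [lagrangian_eq, clag_eq]
    rw [hL]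
    refine ⟨_, ((hasDirDeriv_glag _ T φ ψ).const_mul (const θ)).neg, ?_⟩
    · rw [thetaQ_eq, pairing_eq, cpair_eq]
      exact glag'_sub_gpair (S := supDiff N) hT h hψ (oddConst_const hθ) hc

variable {p p' : Params N} {x y : AEven (supDiff N).Scal} {u v : AOdd (supDiff N).Scal}
  {τ τ' : Sup N}

theorem transf_eq_ptr (hp : p.toG.Represents x u τ) (hτ : (supDiff N).OddConst τ)
    {φ : Fields ι m N} (h : IsField φ) :
    transf T p φ = ptr T (supDiff N).scalDer (supDiff N).del x u τ φ :=
  (transf_eq T p φ).trans (ctr_eq_ptr hp (supDiff N).scalars_scalDer hτ.del φ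
    (SuperDiff.IsField.commWith (S := supDiff N) h hτ))

theorem isField_transf (hp : p.toG.Represents x u τ) (hτ : (supDiff N).OddConst τ)
    {φ : Fields ι m N} (h : IsField φ) : IsField (transf T p φ) := by
  rw [transf_eq_ptr hp hτ h]
  exact SuperDiff.IsField.ptr (S := supDiff N) T (supDiff N).scalars_scalDer h hτ x u

theorem isComm_transf (hp : p.toG.Represents x u τ) (hτ : (supDiff N).OddConst τ)
    (hp' : p'.toG.Represents y v τ') (hτ' : (supDiff N).OddConst τ')
    {φ ξ : Fields ι m N} (h : IsField φ)
    (hc : IsComm (ptr T (supDiff N).scalDer (supDiff N).del x u τ)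
      (ptr T (supDiff N).scalDer (supDiff N).del y v τ') φ ξ) :
    IsComm (transf T p) (transf T p') φ ξ :=
  hc.congr IsField.add_smul (fun _ => transf_eq_ptr hp hτ) (fun _ => transf_eq_ptr hp' hτ') h
    (transf_eq_ptr (T := T) hp hτ h ▸ isField_transf hp hτ h)
    (transf_eq_ptr (T := T) hp' hτ' h ▸ isField_transf hp' hτ' h)

theorem isComm_thetaQ_transf (hp : p.toG.Represents x u τ) (hτ : (supDiff N).OddConst τ)
    {θ : Grass N} (hθ : GOdd θ) {φ ξ : Fields ι m N} (h : IsField φ)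
    (hc : IsComm ((supDiff N).gQ T (const θ))
      (ptr T (supDiff N).scalDer (supDiff N).del x u τ) φ ξ) :
    IsComm (thetaQ T θ) (transf T p) φ ξ :=
  hc.congr IsField.add_smul (fun _ _ => by rw [thetaQ_eq]) (fun _ => transf_eq_ptr hp hτ) h
    (SuperDiff.IsField.gQ (S := supDiff N) h (oddConst_const hθ))
    (transf_eq_ptr (T := T) hp hτ h ▸ isField_transf hp hτ h)

theorem isSymmetry_even (hT : IsGWData T) (hp : p.toG.Represents x 0 0) :
    IsSymmetry T (current T p) (transf T p) := by
  have hJ : current T p = (supDiff N).ecur T x := funext fun φ => by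
    rw [current_eq, ccur_eq hp, zero_mul, add_zero]
  have h0 : (supDiff N).OddConst 0 := oddConst_zero
  have hE := (supDiff N).scalars_scalDer
  refine ⟨fun φ => isField_transf hp h0, fun θ φ hθ h => isComm_thetaQ_transf hp h0 hθ h
    (isComm_gQ_even hT hE (oddConst_const hθ) h0 h x), fun φ ψ h hψ hc => ?_, fun θ φ hθ h => ?_⟩
  · rw [hJ, transf_eq_ptr hp h0 h, pairing_eq, cpair_eq]
    refine ⟨_, hasDirDeriv_ecur _ T x φ ψ, ?_⟩
    rw [ecur'_sub_gpair hT hE h hψ x 0]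
    exact del_mem_totalDer (S := supDiff N) (ebdry_mem_cpt hc x)
  · rw [hJ, thetaQ_eq]
    exact (hasDirDeriv_ecur _ T x φ _).congr_deriv (ecur'_gQ hT hE (oddConst_const hθ) h x)

theorem isSymmetry_odd (hT : IsGWData T) (hp : p.toG.Represents 0 u τ)
    (hτ : (supDiff N).OddConst τ) : IsSymmetry T (current T p) (transf T p) := by
  have hJ : (current T p : Fields ι m N → _) = fun φ => τ * (supDiff N).ocur T u φ :=
    funext fun φ => by
      rw [current_eq, ccur_eq hp]
      rw [ecur_zero, zero_add]
  have hE := (supDiff N).scalars_scalDer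
  refine ⟨fun φ => isField_transf hp hτ, fun θ φ hθ h => isComm_thetaQ_transf hp hτ hθ h
    (isComm_gQ_odd hT hE (oddConst_const hθ) hτ h u), fun φ ψ h hψ hc => ?_, fun θ φ hθ h => ?_⟩
  · rw [hJ, transf_eq_ptr hp hτ h, pairing_eq, cpair_eq]
    refine ⟨_, (hasDirDeriv_ocur _ T u φ ψ).const_mul τ, ?_⟩
    rw [ocur'_sub_gpair hT hE h hψ u hτ]
    exact del_mem_totalDer (S := supDiff N) ((supDiff N).cpt_mul_left _ _ (obdry_mem_cpt hc u))
  · rw [hJ, thetaQ_eq]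
    refine ((hasDirDeriv_ocur _ T u φ _).const_mul τ).congr_deriv ?_
    rw [ocur'_gQ hT hE (oddConst_const hθ) h u]
    have e := (oddConst_const hθ).thd_mul τ ((supDiff N).ocur T u φ)
    rw [hτ.thd_odd, zero_mul, zero_add] at e
    exact e.symm

theorem homotopy_eq (V : Hol) (θ : Grass N) :
    (homotopy T (pull V ⊗ₜ θ) : Fields ι m N → _)
      = ghom T (holHom N V) (const θ) := by
  have e : (pull V ⊗ₜ[ℂ] θ : Sup N) = (holHom N V).1 * const θ := by
    change _ = (pull V ⊗ₜ[ℂ] 1 * 1 ⊗ₜ[ℂ] θ : Sup N)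
    rw [Algebra.TensorProduct.tmul_mul_tmul, one_mul, mul_one]
  funext φ i
  cases i with
  | A a =>
    change kappa T • (pull V ⊗ₜ[ℂ] θ * _) = kappa T • ((holHom N V).1 * (const θ * _))
    rw [e, mul_assoc]
    rfl
  | _ => rfl

theorem geometric_eq (V : Hol) (η : Grass N) (h : GEven η) (φ : Fields ι m N) :
    geometric (pull V ⊗ₜ η) φ
      = ggeo (supDiff N) (supDiff N).scalDer (holScal 1 η h * holHom N V) φ := by
  rw [holScal_mul_holHom]
  funext i
  cases i <;> rfl

theorem vect_represents (V : Hol) (η : Grass N) (h : GEven η) (τ : Sup N) :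
    (evenParams η (V, 0, 0, 0)).toG.Represents
      (holScal 1 η h * holHom N V, 0, 0, 0) 0 τ where
  V := congrArg Subtype.val (holScal_mul_holHom V η h).symm
  S _ _ := TensorProduct.zero_tmul _ _
  St _ _ := TensorProduct.zero_tmul _ _
  U := TensorProduct.zero_tmul _ _
  G _ _ := (zero_mul τ).symm
  Sg _ _ := (zero_mul τ).symm

theorem const_mul_const (θ θ' : Grass N) (h : GEven (θ * θ')) :
    const θ * const θ' = algebraMap (supDiff N).Scal (Sup N) (holScal 1 (θ * θ') h) := by
  change (1 ⊗ₜ[ℂ] θ * 1 ⊗ₜ[ℂ] θ' : Sup N) = 1 ⊗ₜ[ℂ] (θ * θ')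
  rw [Algebra.TensorProduct.tmul_mul_tmul, one_mul]

theorem const_smul (c : ℂ) (θ : Grass N) : const (c • θ) = c • const θ :=
  TensorProduct.tmul_smul c 1 θ

theorem carriesActionOfAN6 (hT : IsGWData T) : CarriesActionOfAN6 N T where
  even_sym η x hη := isSymmetry_even hT (evenParams_represents η hη x 0)
  odd_sym θ u hθ := isSymmetry_odd hT (oddParams_represents θ u)
    (const_smul Complex.I θ ▸ (oddConst_const hθ).smul Complex.I)
  even_even η η' x y φ hη hη' h := by
    have h0 : (supDiff N).OddConst 0 := oddConst_zero
    have hp := evenParams_represents (η * η') (hη.mul hη') ((aN6 holDer).ee x y) 0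
    rw [evenSym, evenSym, evenSym, transf_eq_ptr hp h0 h]
    refine isComm_transf (evenParams_represents η hη x 0) h0 (evenParams_represents η' hη' y 0) h0 h ?_
    have e : holScal 1 (η * η') (hη.mul hη') = holScal 1 η hη * holScal 1 η' hη' :=
      Subtype.ext (by
        change (1 ⊗ₜ[ℂ] (η * η') : Sup N) = 1 ⊗ₜ[ℂ] η * 1 ⊗ₜ[ℂ] η'
        rw [Algebra.TensorProduct.tmul_mul_tmul, one_mul])
    rw [e, ← aN6_ee_escale_evenMap scalDer_holHom (scalDer_const η hη) (scalDer_const η' hη')]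
    exact isComm_even_even T (supDiff N).scalars_scalDer.isDer _ _ 0 φ
  even_odd η θ x u φ hη hθ h := by
    have hτ : (supDiff N).OddConst (const (Complex.I • θ)) :=
      const_smul Complex.I θ ▸ (oddConst_const hθ).smul Complex.I
    rw [evenSym, oddSym, oddSym, transf_eq_ptr (oddParams_mul_represents η θ hη _) hτ h]
    refine isComm_transf (evenParams_represents η hη x (const (Complex.I • θ))) hτ
      (oddParams_represents θ u) hτ h ?_
    rw [← aN6_eo_escale_evenMap scalDer_holHom (scalDer_const η hη)]
    exact isComm_even_odd T (supDiff N).scalars_scalDer.isDer _ _ hτ.del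
      (SuperDiff.IsField.commWith (S := supDiff N) h hτ)
  odd_odd θ θ' u v φ hθ hθ' h := by
    have hτ := (oddConst_const hθ).smul Complex.I
    have hτ' := (oddConst_const hθ').smul Complex.I
    rw [← const_smul] at hτ hτ'
    have hη : GEven (-(θ * θ')) := (hθ.mul hθ').neg
    rw [evenSym, oddSym, oddSym, transf_eq_ptr (evenParams_represents _ hη _ _) hτ h]
    refine isComm_transf (oddParams_represents θ u) hτ (oddParams_represents θ' v) hτ' h ?_
    rw [← aN6_oo_oddMap scalDer_holHom]
    -- the factors `i` in the odd generators give the sign of `-θθ'`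
    have e : const (Complex.I • θ) * const (Complex.I • θ')
        = algebraMap (supDiff N).Scal (Sup N) (holScal 1 (-(θ * θ')) hη) := by
      rw [const_smul, const_smul, smul_mul_smul_comm, Complex.I_mul_I,
        const_mul_const θ θ' (hθ.mul hθ')]
      refine (neg_one_smul ℂ (M := Sup N) _).trans ?_
      exact (TensorProduct.tmul_neg _ _).symm
    exact isComm_odd_odd T (supDiff N).scalars_scalDer.isDer _ _ hτ.del hτ'.del
      (SuperDiff.IsField.commWith (S := supDiff N) h hτ)
      (SuperDiff.IsField.commWith (S := supDiff N) h hτ') (scalDer_const _ hη) e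
      (by rw [hτ'.mul hτ, e])
  vect_homotopic θ θ' V φ hθ hθ' h := by
    have hη := hθ.mul hθ'
    rw [evenSym, transf_eq_ptr (vect_represents V _ hη (const θ)) (oddConst_const hθ) h,
      geometric_eq V _ hη, homotopy_eq, thetaQ_eq]
    exact isComm_gQ_ghom hT (supDiff N).scalars_scalDer (oddConst_const hθ) (oddConst_const hθ') h
      (holHom N V) (scalDer_const _ hη) (const_mul_const θ θ' hη)

end Sup

/-! ### Coordinates of a metric Lie algebra -/

section GaugeData

variable {𝔤 R ι m : Type*} [LieRing 𝔤] [LieAlgebra ℂ 𝔤] [AddCommGroup R] [Module ℂ R]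
  [LieRingModule 𝔤 R] [LieModule ℂ 𝔤 R] [Fintype ι] [DecidableEq ι] [Fintype m] [DecidableEq m]
  (e : Module.Basis ι ℂ 𝔤) (r : Module.Basis m ℂ R) (Tr : LinearMap.BilinForm ℂ 𝔤)

theorem sum_repr_mul (x : 𝔤) (L : 𝔤 →ₗ[ℂ] ℂ) : ∑ a, e.repr x a * L (e a) = L x := by
  conv_rhs => rw [← e.sum_repr x]
  simp only [map_sum, map_smul, smul_eq_mul]

theorem isGWData_gaugeData (hsymm : Tr.IsSymm) (hnondeg : Tr.Nondegenerate)
    (hinv : ∀ x y z : 𝔤, Tr ⁅x, y⁆ z = Tr x ⁅y, z⁆) {k : ℂ} (hk : k ≠ 0)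
    (hfund : FundamentalIdentity (gaugeData e r Tr k)) : IsGWData (gaugeData e r Tr k) := by
  have hK : (gaugeData e r Tr k).K = LinearMap.BilinForm.toMatrix e Tr :=
    Matrix.ext fun a b => (LinearMap.BilinForm.toMatrix_apply e Tr a b).symm
  have hdet : IsUnit (gaugeData e r Tr k).K.det := by
    rw [hK]
    exact isUnit_iff_ne_zero.2 ((LinearMap.BilinForm.nondegenerate_iff_det_ne_zero e).1 hnondeg)
  have hs : (gaugeData e r Tr k).K.transpose = (gaugeData e r Tr k).K :=
    Matrix.ext fun a b => hsymm.eq (e b) (e a)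
  refine ⟨fun b c s u => ?_, fun b c a => ?_, fun a b c d => ?_, fun a b => hsymm.eq (e a) (e b),
    fun a b => ?_, Matrix.mul_nonsing_inv _ hdet, Matrix.nonsing_inv_mul _ hdet,
    fun a b c => ?_, hk, hfund⟩
  · have h := sum_repr_mul e ⁅e b, e c⁆
      (LinearMap.proj u ∘ₗ LinearMap.proj s ∘ₗ (LinearMap.toMatrix r r).toLinearMap
        ∘ₗ (LieModule.toEnd ℂ 𝔤 R : 𝔤 →ₗ[ℂ] Module.End ℂ R))
    refine Eq.trans ?_ h.symm
    change _ = LinearMap.toMatrix r r (LieModule.toEnd ℂ 𝔤 R ⁅e b, e c⁆) s u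
    have hl : LieModule.toEnd ℂ 𝔤 R ⁅e b, e c⁆
        = LieModule.toEnd ℂ 𝔤 R (e b) * LieModule.toEnd ℂ 𝔤 R (e c)
          - LieModule.toEnd ℂ 𝔤 R (e c) * LieModule.toEnd ℂ 𝔤 R (e b) :=
      LinearMap.ext fun v => lie_lie (e b) (e c) v
    rw [hl, map_sub, LinearMap.toMatrix_mul,
      LinearMap.toMatrix_mul, Matrix.sub_apply, Matrix.mul_apply, Matrix.mul_apply,
      ← Finset.sum_sub_distrib]
    rfl
  · change e.repr ⁅e b, e c⁆ a = -e.repr ⁅e c, e b⁆ a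
    rw [← lie_skew, map_neg, Finsupp.neg_apply]
  · have h := fun x y : 𝔤 => sum_repr_mul e y (e.coord d ∘ₗ (LieAlgebra.ad ℂ 𝔤 x : 𝔤 →ₗ[ℂ] 𝔤))
    rw [Finset.sum_add_distrib, Finset.sum_add_distrib]
    refine (congrArg₂ (· + ·) (congrArg₂ (· + ·) (h (e a) ⁅e b, e c⁆) (h (e b) ⁅e c, e a⁆))
      (h (e c) ⁅e a, e b⁆)).trans ?_
    change e.coord d ⁅e a, ⁅e b, e c⁆⁆ + e.coord d ⁅e b, ⁅e c, e a⁆⁆ + e.coord d ⁅e c, ⁅e a, e b⁆⁆ = 0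
    rw [← map_add, ← map_add, lie_jacobi, map_zero]
  · have h := Matrix.transpose_nonsing_inv (gaugeData e r Tr k).K
    rw [hs] at h
    exact congrFun (congrFun h.symm a) b
  · refine (sum_repr_mul e ⁅e a, e b⁆ (Tr.flip (e c))).trans ?_
    exact (hinv _ _ _).trans (sum_repr_mul e ⁅e b, e c⁆ (Tr (e a))).symm

end GaugeData

end HTTwist

end

open HTTwist
theorem mainTheorem4 {𝔤 R ι m : Type*} [LieRing 𝔤] [LieAlgebra ℂ 𝔤] [AddCommGroup R] [Module ℂ R]
    [LieRingModule 𝔤 R] [LieModule ℂ 𝔤 R] [Fintype ι] [DecidableEq ι] [Fintype m] [DecidableEq m]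
    (e : Module.Basis ι ℂ 𝔤) (r : Module.Basis m ℂ R)
    (Tr : LinearMap.BilinForm ℂ 𝔤) (hsymm : Tr.IsSymm) (hnondeg : Tr.Nondegenerate)
    (hinv : ∀ x y z : 𝔤, Tr ⁅x, y⁆ z = Tr x ⁅y, z⁆)
    (k : ℂ) (hk : k ≠ 0)
    (hfund : FundamentalIdentity (gaugeData e r Tr k)) :
    -- `𝔞_{𝒩=6}` is a Lie superalgebra with the stated even and odd parts
    IsLieSuperalgebra (aN6 holDer) ∧ EvenPartIsVectSO4GL1 holDer ∧ OddPartIsExtension holDer ∧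
    -- it acts on the `HT` twist
    (∀ N : ℕ, IsBVTheory N (gaugeData e r Tr k) ∧ CarriesActionOfAN6 N (gaugeData e r Tr k)) ∧
    -- it is the positive part of `K'₄`: over holomorphic functions, and in terms of Fourier modes
    IsModeAlgebraK4' holDer (aN6 holDer) ∧
    IsModeAlgebraK4' Polynomial.derivative' (aN6 (Polynomial.derivative' (R := ℂ))) := by
  refine ⟨isLieSuperalgebra_aN6 holDer, evenPartIsVectSO4GL1 holDer, oddPartIsExtension_aN6 holDer,
    fun N => ?_, isModeAlgebraK4'_aN6 holDer, isModeAlgebraK4'_aN6 _⟩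
  have hT := isGWData_gaugeData e r Tr hsymm hnondeg hinv hk hfund
  exact ⟨isBVTheory hT, carriesActionOfAN6 hT⟩
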